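/- **Setting.** Let $M$ be an $n$-dimensional complex manifold (Hausdorff, second countable), $r\in C^\infty(M,\mathbb R)$, and $D=\{r<0\}\subset\subset M$, where $r$ is strictly plurisubharmonic near $\partial D$ and all critical points of $r$ in $\overline D$ are non-degenerate ($dr$ may vanish on $\partial D$). Equip $M$ with a Hermitian metric that equals $\sum \frac{\partial^2 r}{\partial\zeta_j\partial\bar\zeta_k}d\zeta_j\,d\bar\zeta_k$ near $\partial D$; let $dV$ be its volume, $\gamma=|\partial r|$, and $D'=\{\zeta\in D:\gamma(\zeta)\neq 0\}$ ($D\setminus D'$ is finite). Let $\rho$ be a symmetric function on $M\times M$ with $\rho^2$ smooth, equal to the geodesic distance near the diagonal and positive off the diagonal. For a function $h$ of one point, $h^*$ means $h(z)$ and $h$ means $h(\zeta)$; $X^\zeta,X^z$ denote $X$ acting in $\zeta$, $z$. **Tangential fields.** For $S\subset D'$ open, a smooth function $\xi$ on $S$ is of class $\xi_0$ if for all smooth vector fields $Z_1,\dots,Z_\alpha$ on $M$ there is $C$ with $\gamma^{\alpha}|Z_1\cdots Z_\alpha\xi|\le C$ on $S$. A complex vector field $X$, smooth on $D$, is a *smooth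 tangential vector field* if each $p\in\partial D$ has an open neighbourhood $U$ such that on $U\cap D'$ there is a frame $L_1,\dots,L_n$ of $(1,0)$-fields, with coefficients of class $\xi_0$, dual to an orthogonal frame $\omega^1,\dots,\omega^n$ of $(1,0)$-forms with $\partial r=\gamma\omega^n$, such that $X$ is on $U\cap D'$ a combination of $L_1,\dots,L_{n-1}$, $\bar L_1,\dots,\bar L_{n-1}$, $L_n-\bar L_n$ and $r(L_n+\bar L_n)$ with coefficients in $C^\infty(U)$. Its adjoint is $\tilde Xu=-Xu-(\operatorname{div}X)u$ (so $\int (Xu)w\,dV=\int u\,\tilde Xw\,dV$ for test functions). **Isotropic operators.** Let $V,W$ be finite-dimensional complex vector spaces (the coefficient spaces of forms; vector fields act on coefficients). For an integer $m\ge0$, $\mathscr E_{m,0}$ denotes a kernel $\mathscr E(\zeta,z)\in\operatorname{Hom}(V,W)$, smooth on $D'\times D'$, such that every composition $P$ (in any order) of $a$ derivatives of the form $Z^\zeta$, $b$ of the form $Z^z$ and $c$ of the form $Z^\zeta+Z^z$, with $Z$ smooth vector fields on $M$, satisfies on $D'\times D'$, for a constant $C$ depending on $P$, $$\min(\rho,\gamma)^a\,\min(\rho,\gamma^*)^b\,\min(\gamma,\gamma^*)^c\,|P\mathscr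 E(\zeta,z)|\le C\rho(\zeta,z)^m .$$ An *isotropic operator* $E_{1-2n}$ is an operator $Ef(z)=\int_D \mathscr E^i(\zeta,z)f(\zeta)\,dV(\zeta)$ whose kernel has, for $\zeta\ne z$ in $D'$, the form $\mathscr E^i=\mathscr E_{m,0}/\rho^{2k}$ with integers $m,k\ge0$ and $m-2k\ge 1-2n$. **Theorem.** Let $X$ be a smooth tangential vector field and $E_{1-2n}$ an isotropic operator. Then there are $l\ge0$ and isotropic operators $E^{(0)}_{1-2n},\dots,E^{(l)}_{1-2n}$ such that $$\gamma^*X^zE_{1-2n}=-E_{1-2n}\tilde X^\zeta\gamma+E^{(0)}_{1-2n}+\sum_{\nu=1}^lE^{(\nu)}_{1-2n},$$ that is: for every $f\in C^1(D,V)$ that is bounded together with its differential and every $z\in D'$, all integrals involved converge absolutely, $E_{1-2n}f$ is differentiable at $z$, and $$\gamma(z)\,X(E_{1-2n}f)(z)=-E_{1-2n}(\tilde X(\gamma f))(z)+E^{(0)}_{1-2n}f(z)+\sum_{\nu=1}^lE^{(\nu)}_{1-2n}f(z).$$ -/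

import Mathlib

open Set MeasureTheory
open scoped Manifold ContDiff Topology ENNReal

noncomputable section

namespace HL

/-! ### Complex manifolds as real manifolds -/

/-- The model space `ℂⁿ`. -/
abbrev Cn (n : ℕ) : Type := EuclideanSpace ℂ (Fin n)

/-- A complex manifold is also a (real analytic, hence smooth) real manifold. -/
instance realManifold (n : ℕ) (M : Type*) [TopologicalSpace M] [ChartedSpace (Cn n) M]
    [IsManifold 𝓘(ℂ, Cn n) ω M] : IsManifold 𝓘(ℝ, Cn n) ω M := by
  apply isManifold_of_contDiffOn
  intro e e' he he'
  have h := ((contDiffGroupoid ω 𝓘(ℂ, Cn n)).compatible he he').1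
  exact ContDiffOn.restrict_scalars ℝ h

/-- The real tangent space at `x`. Mathlib identifies it with `ℂⁿ` through the preferred
(holomorphic) chart at `x`. -/
abbrev Tan (n : ℕ) {M : Type*} [TopologicalSpace M] [ChartedSpace (Cn n) M] (x : M) : Type :=
  TangentSpace 𝓘(ℝ, Cn n) x

/-- Multiplication by `i` on the tangent space (the complex structure). -/
def mulI {n : ℕ} {M : Type*} [TopologicalSpace M] [ChartedSpace (Cn n) M] {x : M}
    (v : Tan n x) : Tan n x :=
  (Complex.I • (show Cn n from v) : Cn n)

/-- The derivative `du(v)` of a vector valued function `u` at `x` along the real tangent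
vector `v`. -/
def dirDeriv {n : ℕ} {M : Type*} [TopologicalSpace M] [ChartedSpace (Cn n) M]
    {F : Type*} [NormedAddCommGroup F] [NormedSpace ℝ F] (u : M → F) (x : M) (v : Tan n x) : F :=
  (mfderiv 𝓘(ℝ, Cn n) 𝓘(ℝ, F) u x v : F)

/-- For a tangent vector `v = ∑ vⱼ ∂/∂zⱼ + conj`, the derivative of `u` along the `(1,0)`-vector
`L_v = ∑ vⱼ ∂/∂zⱼ = (v - i Jv) / 2`. -/
def holDeriv {n : ℕ} {M : Type*} [TopologicalSpace M] [ChartedSpace (Cn n) M]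
    {F : Type*} [NormedAddCommGroup F] [NormedSpace ℂ F] (u : M → F) (x : M) (v : Tan n x) : F :=
  (1 / 2 : ℂ) • (dirDeriv u x v - Complex.I • dirDeriv u x (mulI v))

/-- The derivative of `u` along the `(0,1)`-vector `conj L_v = (v + i Jv) / 2`. -/
def antiholDeriv {n : ℕ} {M : Type*} [TopologicalSpace M] [ChartedSpace (Cn n) M]
    {F : Type*} [NormedAddCommGroup F] [NormedSpace ℂ F] (u : M → F) (x : M) (v : Tan n x) : F :=
  (1 / 2 : ℂ) • (dirDeriv u x v + Complex.I • dirDeriv u x (mulI v))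

/-- Smooth real vector fields on `M`. -/
abbrev SmoothField (n : ℕ) (M : Type*) [TopologicalSpace M] [ChartedSpace (Cn n) M]
    [IsManifold 𝓘(ℂ, Cn n) ω M] : Type _ :=
  ContMDiffSection 𝓘(ℝ, Cn n) (Cn n) ∞ (fun x : M => TangentSpace 𝓘(ℝ, Cn n) x)

/-- Complex vector fields `X = re + i im`, i.e. sections of the complexified tangent bundle. -/
structure ComplexField (n : ℕ) (M : Type*) [TopologicalSpace M] [ChartedSpace (Cn n) M] where
  re : ∀ x : M, Tan n x
  im : ∀ x : M, Tan n x

/-- The derivative `X u` of a (vector valued) function. -/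
def ComplexField.apply {n : ℕ} {M : Type*} [TopologicalSpace M] [ChartedSpace (Cn n) M]
    {F : Type*} [NormedAddCommGroup F] [NormedSpace ℂ F]
    (X : ComplexField n M) (u : M → F) (x : M) : F :=
  dirDeriv u x (X.re x) + Complex.I • dirDeriv u x (X.im x)

/-- The second derivative of `r` at `x`, computed in the preferred chart at `x`. -/
def chartHessian {n : ℕ} {M : Type*} [TopologicalSpace M] [ChartedSpace (Cn n) M]
    (r : M → ℝ) (x : M) (v w : Tan n x) : ℝ :=
  fderiv ℝ (fderiv ℝ (r ∘ (chartAt (Cn n) x).symm)) (chartAt (Cn n) x x) (v : Cn n) (w : Cn n)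

/-- The Levi form `∑ (∂²r/∂ζⱼ∂ζ̄ₖ) vⱼ v̄ₖ` of `r` at `x`. -/
def leviForm {n : ℕ} {M : Type*} [TopologicalSpace M] [ChartedSpace (Cn n) M]
    (r : M → ℝ) (x : M) (v : Tan n x) : ℝ :=
  (chartHessian r x v v + chartHessian r x (mulI v) (mulI v)) / 4

/-! ### Henkin-Leiterer domains -/

/-- A relatively compact strictly pseudoconvex domain `{r < 0}` in a complex manifold `M`, whose
defining function `r` is a Morse function (`dr` may vanish on the boundary), together with a
Hermitian metric on `M` that is a Levi metric `∑ (∂²r/∂ζⱼ∂ζ̄ₖ) dζⱼ dζ̄ₖ` near the boundary.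
The Hermitian metric is recorded by its real part `inner`, normalised by
`inner v v = ∑ hⱼₖ vⱼ v̄ₖ`. -/
structure LeviDomain (n : ℕ) (M : Type*) [TopologicalSpace M] [ChartedSpace (Cn n) M]
    [IsManifold 𝓘(ℂ, Cn n) ω M] where
  /-- the defining function -/
  r : M → ℝ
  /-- the Hermitian metric -/
  metric : Bundle.ContMDiffRiemannianMetric 𝓘(ℝ, Cn n) ∞ (Cn n)
    (fun x : M => TangentSpace 𝓘(ℝ, Cn n) x)
  smooth_r : ContMDiff 𝓘(ℝ, Cn n) 𝓘(ℝ, ℝ) ∞ r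
  relativelyCompact : IsCompact (closure {x | r x < 0})
  strictlyPseudoconvex : ∃ U : Set M, IsOpen U ∧ frontier {x | r x < 0} ⊆ U ∧
    ∀ x ∈ U, ∀ v : Tan n x, v ≠ 0 → 0 < leviForm r x v
  morse : ∀ x ∈ closure {x | r x < 0}, (∀ v : Tan n x, dirDeriv r x v = 0) →
    ∀ v : Tan n x, v ≠ 0 → ∃ w : Tan n x, chartHessian r x v w ≠ 0
  hermitian : ∀ (x : M) (v w : Tan n x),
    metric.inner x (mulI v) (mulI w) = metric.inner x v w
  levi : ∃ U : Set M, IsOpen U ∧ frontier {x | r x < 0} ⊆ U ∧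
    ∀ x ∈ U, ∀ v : Tan n x, metric.inner x v v = leviForm r x v

namespace LeviDomain

variable {n : ℕ} {M : Type*} [TopologicalSpace M] [ChartedSpace (Cn n) M]
  [IsManifold 𝓘(ℂ, Cn n) ω M]

/-- The domain `D = {r < 0}`. -/
def carrier (D : LeviDomain n M) : Set M := {x | D.r x < 0}

/-- `∂r (v) = ∑ (∂r/∂ζⱼ) vⱼ`. -/
def delR (D : LeviDomain n M) (x : M) (v : Tan n x) : ℂ :=
  holDeriv (fun y => (D.r y : ℂ)) x v

/-- `γ = |∂r|`, the length of `∂r` in the Hermitian metric. -/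
def gamma (D : LeviDomain n M) (x : M) : ℝ :=
  sSup {t : ℝ | ∃ v : Tan n x, D.metric.inner x v v ≤ 1 ∧ t = ‖D.delR x v‖}

/-- The points of `D` at which `γ ≠ 0`, i.e. `D` without the critical points of `r`. -/
def reg (D : LeviDomain n M) : Set M := {x | x ∈ D.carrier ∧ D.gamma x ≠ 0}

/-- The geodesic distance: the infimum of the lengths of `C¹` paths. -/
def geodesicDist (D : LeviDomain n M) (x y : M) : ℝ≥0∞ :=
  letI : ∀ x : M, ENorm (TangentSpace 𝓘(ℝ, Cn n) x) :=
    fun x => ⟨fun v => ENNReal.ofReal (√(D.metric.inner x v v))⟩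
  Manifold.riemannianEDist 𝓘(ℝ, Cn n) x y

/-- `ρ` is a symmetric function on `M × M`, smooth in the sense that `ρ²` is smooth, which
coincides with the geodesic distance in a neighbourhood of the diagonal and is positive outside
the diagonal. -/
structure IsDistanceFunction (D : LeviDomain n M) (ρ : M → M → ℝ) : Prop where
  symm : ∀ x y, ρ x y = ρ y x
  smooth : ContMDiff (𝓘(ℝ, Cn n).prod 𝓘(ℝ, Cn n)) 𝓘(ℝ, ℝ) ∞ (fun p : M × M => ρ p.1 p.2 ^ 2)
  eq_geodesicDist : ∃ O : Set (M × M), IsOpen O ∧ (∀ x, (x, x) ∈ O) ∧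
    ∀ x y, (x, y) ∈ O → ρ x y = (D.geodesicDist x y).toReal
  pos : ∀ x y, x ≠ y → 0 < ρ x y

/-! ### Riemannian volume, divergence, adjoint -/

/-- The density `√det(g)` of the Riemannian volume in the chart at `p`. -/
def density (D : LeviDomain n M) (p : M) (y : Cn n) : ℝ :=
  √(Matrix.det (Matrix.of fun i j =>
    D.metric.inner ((chartAt (Cn n) p).symm y)
      (mfderiv 𝓘(ℝ, Cn n) 𝓘(ℝ, Cn n) (chartAt (Cn n) p).symm y
        (stdOrthonormalBasis ℝ (Cn n) i : Cn n))
      (mfderiv 𝓘(ℝ, Cn n) 𝓘(ℝ, Cn n) (chartAt (Cn n) p).symm y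
        (stdOrthonormalBasis ℝ (Cn n) j : Cn n))))

/-- The Riemannian volume of the domain of the chart at `p`. -/
def chartVolume [MeasurableSpace M] (D : LeviDomain n M) (p : M) : Measure M :=
  ((volume.withDensity fun y => ENNReal.ofReal (D.density p y)).restrict
    (chartAt (Cn n) p).target).map (chartAt (Cn n) p).symm

theorem _root_.HL.exists_chart_cover (n : ℕ) (M : Type*) [TopologicalSpace M]
    [ChartedSpace (Cn n) M] [SecondCountableTopology M] [Nonempty M] :
    ∃ c : ℕ → M, ⋃ i, (chartAt (Cn n) (c i)).source = univ := by
  obtain ⟨s, hs, hU⟩ := TopologicalSpace.countable_cover_nhds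
    (fun x : M => chart_source_mem_nhds (Cn n) x)
  have hne : s.Nonempty := by
    by_contra h
    rw [not_nonempty_iff_eq_empty] at h
    simp [h] at hU
    exact (not_isEmpty_of_nonempty M) (univ_eq_empty_iff.1 hU.symm)
  obtain ⟨c, rfl⟩ := hs.exists_eq_range hne
  exact ⟨c, by simpa using hU⟩

open Classical in
/-- The Riemannian volume of the metric: the chart volumes patched along a countable cover of `M`
by chart domains (made disjoint). -/
def vol [MeasurableSpace M] [SecondCountableTopology M] (D : LeviDomain n M) : Measure M :=
  if _ : Nonempty M then
    let c := (HL.exists_chart_cover n M).choose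
    Measure.sum fun i => (D.chartVolume (c i)).restrict
      (disjointed (fun j => (chartAt (Cn n) (c j)).source) i)
  else 0

/-- The Riemannian divergence `g^{-1/2} ∑ ∂ᵢ (g^{1/2} Zⁱ)` of a real vector field at `x`, computed
in the chart at `x`. -/
def divergence (D : LeviDomain n M) (Z : ∀ x : M, Tan n x) (x : M) : ℝ :=
  LinearMap.trace ℝ (Cn n)
    (fderiv ℝ (fun y : Cn n => D.density x y •
      (mfderiv 𝓘(ℝ, Cn n) 𝓘(ℝ, Cn n) (chartAt (Cn n) x) ((chartAt (Cn n) x).symm y)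
        (Z ((chartAt (Cn n) x).symm y)) : Cn n)) (chartAt (Cn n) x x) : Cn n →L[ℝ] Cn n) /
    D.density x (chartAt (Cn n) x x)

/-- The formal adjoint `X̃ u = -X u - (div X) u` of the complex vector field `X`, characterised by
`∫ (X u) w dV = ∫ u (X̃ w) dV` for test functions. -/
def adjoint {F : Type*} [NormedAddCommGroup F] [NormedSpace ℂ F]
    (D : LeviDomain n M) (X : ComplexField n M) (u : M → F) (x : M) : F :=
  -X.apply u x - ((D.divergence X.re x : ℂ) + Complex.I * (D.divergence X.im x : ℂ)) • u x

/-! ### Weighted symbol classes and smooth tangential vector fields -/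

/-- The iterated derivative `Z₁ Z₂ ⋯ Zₗ u` along smooth vector fields of `M`. -/
def iterDeriv {F : Type*} [NormedAddCommGroup F] [NormedSpace ℝ F]
    (Zs : List (SmoothField n M)) (u : M → F) : M → F :=
  Zs.foldr (fun Z w x => dirDeriv w x (Z x)) u

/-- The functions `ξₖ` on an open set `S` on which `γ ≠ 0`: smooth functions with
`|γ^α D_α ξₖ| ≲ γᵏ` for all differential operators `D_α` of order `α`. -/
def IsXi (D : LeviDomain n M) (S : Set M) (k : ℤ) {F : Type*} [NormedAddCommGroup F]
    [NormedSpace ℝ F] (u : M → F) : Prop :=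
  ContMDiffOn 𝓘(ℝ, Cn n) 𝓘(ℝ, F) ∞ u S ∧
  ∀ Zs : List (SmoothField n M), ∃ C : ℝ, ∀ x ∈ S,
    D.gamma x ^ Zs.length * ‖iterDeriv Zs u x‖ ≤ C * D.gamma x ^ k

/-- `L₁, …, Lₙ` (given by the tangent vectors `vᵢ`, `Lᵢ = (vᵢ - i Jvᵢ) / 2`) is, on the open set
`S`, the frame dual to an orthogonal frame `ω¹, …, ωⁿ` of `(1,0)`-forms with `∂r = γ ω^{i₀}`;
its coefficients are functions `ξ₀`, i.e. their derivatives of order `α` are `O(γ^{-α})`. -/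
structure IsFrame (D : LeviDomain n M) (S : Set M) (i₀ : Fin n)
    (v : Fin n → ∀ x : M, Tan n x) : Prop where
  ne_zero : ∀ x ∈ S, ∀ i, v i x ≠ 0
  orthogonal : ∀ x ∈ S, ∀ i j, i ≠ j →
    D.metric.inner x (v i x) (v j x) = 0 ∧ D.metric.inner x (v i x) (mulI (v j x)) = 0
  delR_eq : ∀ x ∈ S, ∀ i, D.delR x (v i x) = if i = i₀ then (D.gamma x : ℂ) else 0
  coeff : ∀ (i : Fin n) (φ : M → ℝ), ContMDiff 𝓘(ℝ, Cn n) 𝓘(ℝ, ℝ) ∞ φ →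
    D.IsXi S 0 (fun x => dirDeriv φ x (v i x))

/-- `X` is a smooth tangential vector field: it is smooth in `D`, and near each boundary point it
is a combination of `Lᵢ`, `L̄ᵢ` (`i ≠ i₀`), `Y = L_{i₀} - L̄_{i₀}` and `rN`,
`N = L_{i₀} + L̄_{i₀}`, with coefficients that are smooth up to the boundary. -/
def IsSmoothTangential (D : LeviDomain n M) (X : ComplexField n M) : Prop :=
  ContMDiffOn 𝓘(ℝ, Cn n) 𝓘(ℝ, Cn n).tangent ∞
    (fun x => (⟨x, X.re x⟩ : TangentBundle 𝓘(ℝ, Cn n) M)) D.carrier ∧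
  ContMDiffOn 𝓘(ℝ, Cn n) 𝓘(ℝ, Cn n).tangent ∞
    (fun x => (⟨x, X.im x⟩ : TangentBundle 𝓘(ℝ, Cn n) M)) D.carrier ∧
  ∀ p ∈ frontier D.carrier, ∃ (U : Set M) (i₀ : Fin n) (v : Fin n → ∀ x : M, Tan n x)
    (a b : Fin n → M → ℂ) (c d : M → ℂ),
    IsOpen U ∧ p ∈ U ∧ D.IsFrame (U ∩ D.reg) i₀ v ∧
    (∀ i, ContMDiffOn 𝓘(ℝ, Cn n) 𝓘(ℝ, ℂ) ∞ (a i) U) ∧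
    (∀ i, ContMDiffOn 𝓘(ℝ, Cn n) 𝓘(ℝ, ℂ) ∞ (b i) U) ∧
    ContMDiffOn 𝓘(ℝ, Cn n) 𝓘(ℝ, ℂ) ∞ c U ∧ ContMDiffOn 𝓘(ℝ, Cn n) 𝓘(ℝ, ℂ) ∞ d U ∧
    ∀ φ : M → ℂ, ContMDiff 𝓘(ℝ, Cn n) 𝓘(ℝ, ℂ) ∞ φ → ∀ x ∈ U ∩ D.reg,
      X.apply φ x =
        ∑ i ∈ Finset.univ.erase i₀,
          (a i x * holDeriv φ x (v i x) + b i x * antiholDeriv φ x (v i x)) +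
        c x * (holDeriv φ x (v i₀ x) - antiholDeriv φ x (v i₀ x)) +
        d x * ((D.r x : ℂ) * (holDeriv φ x (v i₀ x) + antiholDeriv φ x (v i₀ x)))

/-! ### Isotropic kernels and operators -/

/-- The three ways in which a vector field `Z` of `M` differentiates a kernel `F(ζ, z)`:
`Z^ζ`, `Z^z` and `Z^ζ + Z^z`. -/
inductive Slot
  | fst
  | snd
  | both

/-- `Z^ζ F`, `Z^z F` or `Z^ζ F + Z^z F`. -/
def kernelDeriv {F : Type*} [NormedAddCommGroup F] [NormedSpace ℝ F]
    (s : Slot) (Z : SmoothField n M) (A : M → M → F) (ζ z : M) : F :=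
  match s with
  | .fst => dirDeriv (fun x => A x z) ζ (Z ζ)
  | .snd => dirDeriv (fun y => A ζ y) z (Z z)
  | .both => dirDeriv (fun x => A x z) ζ (Z ζ) + dirDeriv (fun y => A ζ y) z (Z z)

/-- The length scale of each of the three kinds of derivatives. -/
def scale (D : LeviDomain n M) (ρ : M → M → ℝ) (s : Slot) (ζ z : M) : ℝ :=
  match s with
  | .fst => min (ρ ζ z) (D.gamma ζ)
  | .snd => min (ρ ζ z) (D.gamma z)
  | .both => min (D.gamma ζ) (D.gamma z)

/-- The kernels `𝓔_{j,k}`: smooth, with `|𝓔_{j,k}| ≲ γ(ζ)ᵏ ρ(ζ,z)ʲ`, where, as for a product of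
a function `ξₖ(ζ)` and a smooth function vanishing to order `j` on the diagonal, a derivative
`Z^ζ` costs a factor `min(ρ, γ(ζ))⁻¹`, a derivative `Z^z` a factor `min(ρ, γ(z))⁻¹`, and a
derivative `Z^ζ + Z^z` (tangent to the diagonal) a factor `min(γ(ζ), γ(z))⁻¹`. -/
def IsE (D : LeviDomain n M) (ρ : M → M → ℝ) (j : ℕ) (k : ℤ) {F : Type*} [NormedAddCommGroup F]
    [NormedSpace ℝ F] (A : M → M → F) : Prop :=
  ContMDiffOn (𝓘(ℝ, Cn n).prod 𝓘(ℝ, Cn n)) 𝓘(ℝ, F) ∞ (fun p : M × M => A p.1 p.2)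
    (D.reg ×ˢ D.reg) ∧
  ∀ ops : List (Slot × SmoothField n M), ∃ C : ℝ, ∀ ζ ∈ D.reg, ∀ z ∈ D.reg,
    (ops.map fun o => D.scale ρ o.1 ζ z).prod *
      ‖ops.foldr (fun o B => kernelDeriv o.1 o.2 B) A ζ z‖ ≤
    C * D.gamma ζ ^ k * ρ ζ z ^ j

/-- `K = 𝓔^i_{j-2n}` is an isotropic kernel: `K = 𝓔_{m,0} / ρ^{2k}` off the diagonal, with
`m - 2k ≥ j - 2n`. -/
def IsIsotropicKernel (D : LeviDomain n M) (ρ : M → M → ℝ) (j : ℕ) {F : Type*}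
    [NormedAddCommGroup F] [NormedSpace ℝ F] (K : M → M → F) : Prop :=
  ∃ (m k : ℕ) (A : M → M → F), (j : ℤ) - 2 * n ≤ (m : ℤ) - 2 * k ∧ D.IsE ρ m 0 A ∧
    ∀ ζ ∈ D.reg, ∀ z ∈ D.reg, ζ ≠ z → K ζ z = (ρ ζ z ^ (2 * k))⁻¹ • A ζ z

/-- The operator `f ↦ ∫_D K(ζ, z) f(ζ) dV(ζ)` with kernel `K`. -/
def op [MeasurableSpace M] [SecondCountableTopology M] (D : LeviDomain n M)
    {V W : Type*} [NormedAddCommGroup V] [NormedSpace ℂ V]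
    [NormedAddCommGroup W] [NormedSpace ℂ W] (K : M → M → V →L[ℂ] W) (f : M → V) (z : M) : W :=
  ∫ ζ in D.carrier, K ζ z (f ζ) ∂D.vol

/-- The integral defining `op` at `z` converges absolutely. -/
def OpConverges [MeasurableSpace M] [SecondCountableTopology M] (D : LeviDomain n M)
    {V W : Type*} [NormedAddCommGroup V] [NormedSpace ℂ V]
    [NormedAddCommGroup W] [NormedSpace ℂ W] (K : M → M → V →L[ℂ] W) (f : M → V) (z : M) : Prop :=
  IntegrableOn (fun ζ => K ζ z (f ζ)) D.carrier D.vol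

/-- `f` is of class `C¹` in `D` and bounded together with its differential. -/
def IsBoundedC1 (D : LeviDomain n M) {V : Type*} [NormedAddCommGroup V] [NormedSpace ℂ V]
    (f : M → V) : Prop :=
  ContMDiffOn 𝓘(ℝ, Cn n) 𝓘(ℝ, V) 1 f D.carrier ∧
  ∃ C : ℝ, ∀ x ∈ D.carrier, ‖f x‖ ≤ C ∧
    ∀ v : Tan n x, ‖dirDeriv f x v‖ ≤ C * √(D.metric.inner x v v)

end LeviDomain

end HL

end

noncomputable section

set_option linter.unusedSectionVars false

namespace HL

/-! ### Iterated derivatives along vector fields and weighted symbol classes -/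

section Symbols

variable {E : Type*} [NormedAddCommGroup E] [NormedSpace ℝ E] {H : Type*} [TopologicalSpace H]
  {I : ModelWithCorners ℝ E H} {N : Type*} [TopologicalSpace N] [ChartedSpace H N]
  [IsManifold I ∞ N]
  {F : Type*} [NormedAddCommGroup F] [NormedSpace ℝ F]
  {G : Type*} [NormedAddCommGroup G] [NormedSpace ℝ G]
  {G' : Type*} [NormedAddCommGroup G'] [NormedSpace ℝ G']

/-! Write the kernel as `K = A / ρ^{2k}` with `A` of class `𝓔_{m,0}` and put `T = γ X^ζ + γ* X^z`.
Formally `γ* X^z ∫ K f = ∫ (T K) f - ∫ (γ X^ζ K) f`, and partial integration turns the last integral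
into `∫ K X̃(γ f)`. So three facts are needed: `T K` is again an isotropic kernel of the same order,
the partial integration leaves no boundary term, and one may differentiate under the singular
integral. The whole of `T K` becomes the kernel of `E^{(0)}`, so `l = 0` suffices.

The kernel `T K`. By the quotient rule its numerator over `ρ^{2k+2}` is `ρ² T A - k T(ρ²) A`, so it
is enough that `T` preserves the symbol class of weight `ρ^m` (`symb_tangDeriv`). In a finite
overcomplete frame of global fields (`exists_frame`), `T = ∑ (gⱼ Zⱼ^ζ + gⱼ* Zⱼ^z)` with `gⱼ` of
class `ξ₁`, being `γ` times a function of class `ξ₀`. Where `γ ≲ ρ`, each term is harmless, since `γ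
/ min(ρ, γ)` is bounded, and likewise for `γ*`. Where `ρ ≲ γ`, the two values of `γ` are comparable,
and `T = ∑ gⱼ (Zⱼ^ζ + Zⱼ^z) + (gⱼ* - gⱼ) Zⱼ^z`: the first derivative costs only `1/γ`, and the
difference is of size `ρ` together with its weighted derivatives (`symb_sub`). This last estimate
rests on `xi_sub_le`: two points of `D'` that are close relative to `γ` are joined inside `D` by a
path bent towards decreasing `r`, on which `γ` does not drop much; a straight segment could leave
`D`. That `ρ²` is a symbol (`symb_rhoSq`) follows from its vanishing to second order on the
diagonal, an order that derivatives `Z^ζ + Z^z` do not lower.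

No boundary term. A tangential field satisfies `X r = O(r)`, and `γ X γ² = O(γ²)`; hence `γ X` maps
`-r γ²` to a function bounded by a multiple of it. Together with `T ρ² = O(ρ²)` this gives `T u =
O(u)` for `u = -r γ² ρ²`. Cutoffs of the form `χ(j u - 1)` therefore have `T`-derivatives bounded
uniformly in `j` and zero where `j u ≥ 2`. The cut kernels are smooth and compactly supported in `ζ`
inside `D'`, so for them the identity is exact (`gamma_apply_regular`). The error made by cutting is
an integral of `ρ^{1-2n}` over `{j u < 2}`, which tends to zero uniformly for `z` near a given point
(`eventually_lintegral_bad_le`), because `D ∖ D'` is a null set: non-degenerate critical points are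
isolated.

Differentiability. The same convergence, applied to the fields `γ⁻¹ ∂ᵢ` cut off near a point of
`D'`, shows that all first derivatives of the cut operators converge uniformly near that point, so
the limit is differentiable there. For this reason the argument is carried out for the fields of
`IsAdmissible`, which include these auxiliary fields as well as the tangential ones. -/

/-- The derivative of `u` along the vector field `Y`. -/
def lieD (Y : ∀ x : N, TangentSpace I x) (u : N → F) (x : N) : F :=
  (mfderiv I 𝓘(ℝ, F) u x (Y x) : F)

/-- Smoothness of a vector field on a set. -/
def FieldOn (k : ℕ∞ω) (Y : ∀ x : N, TangentSpace I x) (S : Set N) : Prop :=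
  ContMDiffOn I I.tangent k (fun x => (⟨x, Y x⟩ : TangentBundle I N)) S

theorem lieD_contMDiffOn {k m : ℕ∞ω} {Y : ∀ x : N, TangentSpace I x}
    {S : Set N} (hS : IsOpen S) {u : N → F} (hY : FieldOn m Y S)
    (hu : ContMDiffOn I 𝓘(ℝ, F) k u S) (hk : m + 1 ≤ k) :
    ContMDiffOn I 𝓘(ℝ, F) m (lieD Y u) S := by
  have h1 := hu.contMDiffOn_tangentMapWithin hk hS.uniqueMDiffOn
  have h2 := (contMDiff_snd_tangentBundle_modelSpace (𝕜 := ℝ) (n := m) F 𝓘(ℝ, F)).comp_contMDiffOn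
    (h1.comp hY (fun x hx => hx))
  refine h2.congr fun x hx => ?_
  simp only [lieD, Function.comp, tangentMapWithin]
  rw [mfderivWithin_of_isOpen hS hx]

theorem lieD_congr {Y : ∀ x : N, TangentSpace I x} {S : Set N} (hS : IsOpen S) {u v : N → F}
    (h : EqOn u v S) : EqOn (lieD Y u) (lieD Y v) S := by
  intro x hx
  have : u =ᶠ[𝓝 x] v := Filter.eventuallyEq_of_mem (hS.mem_nhds hx) h
  simp only [lieD]
  rw [this.mfderiv_eq]
  rfl

/-- The Leibniz rule is kept for a general real bilinear map, so that it serves real and complex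
products, scalar multiplication and the evaluation of linear maps alike. -/
theorem lieD_bilin (B : F →L[ℝ] G →L[ℝ] G') {Y : ∀ x : N, TangentSpace I x} {u : N → F}
    {v : N → G} {x : N} (hu : MDifferentiableAt I 𝓘(ℝ, F) u x)
    (hv : MDifferentiableAt I 𝓘(ℝ, G) v x) :
    lieD Y (fun y => B (u y) (v y)) x = B (lieD Y u x) (v x) + B (u x) (lieD Y v x) := by
  have h1 := B.isBoundedBilinearMap.hasFDerivAt (u x, v x)
  have hp : HasMFDerivAt I 𝓘(ℝ, F × G) (fun x => (u x, v x)) x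
      (ContinuousLinearMap.prod (mfderiv I 𝓘(ℝ, F) u x : TangentSpace I x →L[ℝ] F)
        (mfderiv I 𝓘(ℝ, G) v x : TangentSpace I x →L[ℝ] G)) :=
    ⟨ContinuousAt.prodMk hu.hasMFDerivAt.1 hv.hasMFDerivAt.1,
      HasFDerivWithinAt.prodMk hu.hasMFDerivAt.2 hv.hasMFDerivAt.2⟩
  have h2 := HasMFDerivAt.comp (f := fun x => (u x, v x)) x h1.hasMFDerivAt hp
  have h3 := h2.mfderiv
  simp only [lieD]
  have : ((fun p : F × G => (B p.1) p.2) ∘ fun x => (u x, v x)) = fun y => B (u y) (v y) := rfl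
  rw [this] at h3
  rw [h3]
  erw [ContinuousLinearMap.comp_apply]
  change B (u x) _ + B _ (v x) = _
  rw [add_comm]
  rfl

theorem lieD_clm (L : F →L[ℝ] G) {Y : ∀ x : N, TangentSpace I x} {u : N → F} {x : N}
    (hu : MDifferentiableAt I 𝓘(ℝ, F) u x) :
    lieD Y (fun y => L (u y)) x = L (lieD Y u x) := by
  have h2 := (L.hasFDerivAt (x := u x)).hasMFDerivAt.comp x hu.hasMFDerivAt
  have h3 := h2.mfderiv
  simp only [lieD]
  have : (L ∘ u) = fun y => L (u y) := rfl
  rw [this] at h3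
  rw [h3]
  rfl

theorem lieD_add {Y : ∀ x : N, TangentSpace I x} {u v : N → F} {x : N}
    (hu : MDifferentiableAt I 𝓘(ℝ, F) u x) (hv : MDifferentiableAt I 𝓘(ℝ, F) v x) :
    lieD Y (fun y => u y + v y) x = lieD Y u x + lieD Y v x := by
  have h3 := (hu.hasMFDerivAt.add hv.hasMFDerivAt).mfderiv
  have : u + v = fun y => u y + v y := rfl
  rw [this] at h3
  simp only [lieD]
  rw [h3]
  rfl

theorem lieD_const (Y : ∀ x : N, TangentSpace I x) (c : F) (x : N) :
    lieD Y (fun _ => c) x = 0 := by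
  simp only [lieD]
  rw [mfderiv_const]
  rfl

variable {ι : Type*}

/-- The iterated derivative of `u` along the fields `Y i`, `i ∈ l`, the first one outermost. -/
def iterD (Y : ι → ∀ x : N, TangentSpace I x) (l : List ι) (u : N → F) : N → F :=
  l.foldr (fun i w => lieD (Y i) w) u

@[simp] theorem iterD_nil (Y : ι → ∀ x : N, TangentSpace I x) (u : N → F) :
    iterD Y [] u = u := rfl

@[simp] theorem iterD_cons (Y : ι → ∀ x : N, TangentSpace I x) (i : ι) (l : List ι) (u : N → F) :
    iterD Y (i :: l) u = lieD (Y i) (iterD Y l u) := rfl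

theorem iterD_append (Y : ι → ∀ x : N, TangentSpace I x) (l l' : List ι) (u : N → F) :
    iterD Y (l ++ l') u = iterD Y l (iterD Y l' u) := by
  simp [iterD, List.foldr_append]

variable {Y : ι → ∀ x : N, TangentSpace I x} {S : Set N} {s : ι → N → ℝ}

theorem iterD_congr (hS : IsOpen S) {u v : N → F} (h : EqOn u v S) (l : List ι) :
    EqOn (iterD Y l u) (iterD Y l v) S := by
  induction l with
  | nil => exact h
  | cons i l ih => exact lieD_congr hS ih

theorem lieD_smooth {Z : ∀ x : N, TangentSpace I x} (hS : IsOpen S) {u : N → F}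
    (hY : FieldOn ∞ Z S) (hu : ContMDiffOn I 𝓘(ℝ, F) ∞ u S) :
    ContMDiffOn I 𝓘(ℝ, F) ∞ (lieD Z u) S :=
  lieD_contMDiffOn hS hY hu (by simp)

theorem _root_.ContMDiffOn.mdiffAt' {u : N → F} (hS : IsOpen S) (hu : ContMDiffOn I 𝓘(ℝ, F) ∞ u S) {x : N}
    (hx : x ∈ S) : MDifferentiableAt I 𝓘(ℝ, F) u x :=
  (hu.contMDiffAt (hS.mem_nhds hx)).mdifferentiableAt (by simp)

theorem iterD_smooth (hS : IsOpen S) {u : N → F} (hY : ∀ i, FieldOn ∞ (Y i) S)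
    (hu : ContMDiffOn I 𝓘(ℝ, F) ∞ u S) (l : List ι) :
    ContMDiffOn I 𝓘(ℝ, F) ∞ (iterD Y l u) S := by
  induction l with
  | nil => exact hu
  | cons i l ih => exact lieD_smooth hS (hY i) ih

theorem iterD_add (hS : IsOpen S) {u v : N → F} (hY : ∀ i, FieldOn ∞ (Y i) S)
    (hu : ContMDiffOn I 𝓘(ℝ, F) ∞ u S) (hv : ContMDiffOn I 𝓘(ℝ, F) ∞ v S) (l : List ι) :
    EqOn (iterD Y l (fun y => u y + v y)) (fun y => iterD Y l u y + iterD Y l v y) S := by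
  induction l with
  | nil => exact fun _ _ => rfl
  | cons i l ih =>
    intro x hx
    rw [iterD_cons, lieD_congr hS ih hx]
    exact lieD_add (ContMDiffOn.mdiffAt' hS (iterD_smooth hS hY hu l) hx)
      (ContMDiffOn.mdiffAt' hS (iterD_smooth hS hY hv l) hx)

theorem iterD_clm (L : F →L[ℝ] G) (hS : IsOpen S) {u : N → F} (hY : ∀ i, FieldOn ∞ (Y i) S)
    (hu : ContMDiffOn I 𝓘(ℝ, F) ∞ u S) (l : List ι) :
    EqOn (iterD Y l (fun y => L (u y))) (fun y => L (iterD Y l u y)) S := by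
  induction l with
  | nil => exact fun _ _ => rfl
  | cons i l ih =>
    intro x hx
    rw [iterD_cons, lieD_congr hS ih hx]
    exact lieD_clm L (ContMDiffOn.mdiffAt' hS (iterD_smooth hS hY hu l) hx)

/-- The weighted symbol class: `u` is smooth on `S` and each derivative along `Y i` costs a factor
`(s i)⁻¹` with respect to the weight `φ`. -/
def Symb (S : Set N) (Y : ι → ∀ x : N, TangentSpace I x) (s : ι → N → ℝ) (φ : N → ℝ)
    (u : N → F) : Prop :=
  ContMDiffOn I 𝓘(ℝ, F) ∞ u S ∧ ∀ l : List ι, ∃ C : ℝ, ∀ x ∈ S,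
    (l.map fun i => s i x).prod * ‖iterD Y l u x‖ ≤ C * φ x

theorem prod_nonneg_of_scale {x : N} (hs : ∀ i, 0 ≤ s i x) (l : List ι) :
    0 ≤ (l.map fun i => s i x).prod :=
  List.prod_nonneg (by simp only [List.mem_map]; rintro _ ⟨i, -, rfl⟩; exact hs i)

theorem Symb.mono {φ ψ : N → ℝ} {u : N → F} (h : Symb S Y s φ u) (C : ℝ)
    (hφ : ∀ x ∈ S, 0 ≤ φ x) (hφψ : ∀ x ∈ S, φ x ≤ C * ψ x) : Symb S Y s ψ u := by
  refine ⟨h.1, fun l => ?_⟩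
  obtain ⟨C', hC'⟩ := h.2 l
  refine ⟨|C'| * C, fun x hx => (hC' x hx).trans ?_⟩
  calc C' * φ x ≤ |C'| * φ x := mul_le_mul_of_nonneg_right (le_abs_self _) (hφ x hx)
    _ ≤ |C'| * (C * ψ x) := mul_le_mul_of_nonneg_left (hφψ x hx) (abs_nonneg _)
    _ = _ := by ring

/-- This allows two decompositions of the same function, each good in its own region, to be used
together: at each point the better bound counts, and no localisation of the function is needed. -/
theorem Symb.min {φ ψ : N → ℝ} {u : N → F} (h : Symb S Y s φ u) (h' : Symb S Y s ψ u)
    (hφ : ∀ x ∈ S, 0 ≤ φ x) (hψ : ∀ x ∈ S, 0 ≤ ψ x) :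
    Symb S Y s (fun x => min (φ x) (ψ x)) u := by
  refine ⟨h.1, fun l => ?_⟩
  obtain ⟨C, hC⟩ := h.2 l
  obtain ⟨C', hC'⟩ := h'.2 l
  refine ⟨max |C| |C'|, fun x hx => ?_⟩
  dsimp only
  rcases le_total (φ x) (ψ x) with hle | hle
  · rw [min_eq_left hle]
    exact (hC x hx).trans (mul_le_mul_of_nonneg_right ((le_abs_self _).trans (le_max_left _ _))
      (hφ x hx))
  · rw [min_eq_right hle]
    exact (hC' x hx).trans (mul_le_mul_of_nonneg_right ((le_abs_self _).trans (le_max_right _ _))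
      (hψ x hx))

theorem Symb.congr {φ : N → ℝ} {u v : N → F} (hS : IsOpen S) (h : Symb S Y s φ u)
    (huv : EqOn v u S) : Symb S Y s φ v := by
  refine ⟨h.1.congr huv, fun l => ?_⟩
  obtain ⟨C, hC⟩ := h.2 l
  exact ⟨C, fun x hx => by rw [iterD_congr hS huv l hx]; exact hC x hx⟩

theorem Symb.mono_set {φ : N → ℝ} {u : N → F} {S' : Set N} (h : Symb S Y s φ u) (hS : S' ⊆ S) :
    Symb S' Y s φ u :=
  ⟨h.1.mono hS, fun l => (h.2 l).imp fun _ hC x hx => hC x (hS hx)⟩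

theorem Symb.add {φ ψ : N → ℝ} {u v : N → F} (hS : IsOpen S) (hY : ∀ i, FieldOn ∞ (Y i) S)
    (hs : ∀ i, ∀ x ∈ S, 0 < s i x) (hφ : ∀ x ∈ S, 0 ≤ φ x) (hψ : ∀ x ∈ S, 0 ≤ ψ x)
    (hu : Symb S Y s φ u) (hv : Symb S Y s ψ v) :
    Symb S Y s (fun x => φ x + ψ x) (fun x => u x + v x) := by
  refine ⟨hu.1.add hv.1, fun l => ?_⟩
  obtain ⟨C, hC⟩ := hu.2 l
  obtain ⟨C', hC'⟩ := hv.2 l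
  refine ⟨max |C| |C'|, fun x hx => ?_⟩
  rw [iterD_add hS hY hu.1 hv.1 l hx]
  have h1 := (hC x hx).trans (mul_le_mul_of_nonneg_right ((le_abs_self _).trans
    (le_max_left _ |C'|)) (hφ x hx))
  have h2 := (hC' x hx).trans (mul_le_mul_of_nonneg_right ((le_abs_self _).trans
    (le_max_right |C| _)) (hψ x hx))
  have h3 := mul_le_mul_of_nonneg_left (norm_add_le (iterD Y l u x) (iterD Y l v x))
    (prod_nonneg_of_scale (fun i => (hs i x hx).le) l)
  linarith

theorem Symb.clm {φ : N → ℝ} {u : N → F} (L : F →L[ℝ] G) (hS : IsOpen S)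
    (hY : ∀ i, FieldOn ∞ (Y i) S) (hs : ∀ i, ∀ x ∈ S, 0 < s i x) (hu : Symb S Y s φ u) :
    Symb S Y s φ (fun x => L (u x)) := by
  refine ⟨L.contMDiff.comp_contMDiffOn hu.1, fun l => ?_⟩
  obtain ⟨C, hC⟩ := hu.2 l
  refine ⟨‖L‖ * C, fun x hx => ?_⟩
  rw [iterD_clm L hS hY hu.1 l hx]
  have h3 := mul_le_mul_of_nonneg_left (L.le_opNorm (iterD Y l u x))
    (prod_nonneg_of_scale (fun i => (hs i x hx).le) l)
  have h4 := mul_le_mul_of_nonneg_left (hC x hx) (norm_nonneg L)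
  linarith

theorem Symb.sum {κ : Type*} {t : Finset κ} {φ : N → ℝ} {u : κ → N → F} (hS : IsOpen S)
    (hY : ∀ i, FieldOn ∞ (Y i) S)
    (hs : ∀ i, ∀ x ∈ S, 0 < s i x) (hφ : ∀ x ∈ S, 0 ≤ φ x)
    (hu : ∀ j ∈ t, Symb S Y s φ (u j)) :
    Symb S Y s φ (fun x => ∑ j ∈ t, u j x) := by
  classical
  induction t using Finset.induction_on with
  | empty =>
    refine ⟨by simpa using contMDiffOn_const, fun l => ⟨0, fun x hx => ?_⟩⟩
    have : iterD Y l (fun _ : N => (0 : F)) = fun _ => 0 := by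
      induction l with
      | nil => rfl
      | cons i l ih => rw [iterD_cons, ih]; ext x; exact lieD_const _ _ _
    simp [this]
  | insert a t ha ih =>
    simp only [Finset.sum_insert ha]
    refine (Symb.add hS hY hs hφ hφ (hu a (by simp)) (ih fun j hj => hu j (by simp [hj]))).mono 2
      (fun x hx => add_nonneg (hφ x hx) (hφ x hx)) fun x _ => (two_mul (φ x)).ge

/-- The symbol estimates for at most `k` derivatives. -/
def SymbLe (k : ℕ) (S : Set N) (Y : ι → ∀ x : N, TangentSpace I x) (s : ι → N → ℝ) (φ : N → ℝ)
    (u : N → F) : Prop :=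
  ContMDiffOn I 𝓘(ℝ, F) ∞ u S ∧ ∀ l : List ι, l.length ≤ k → ∃ C : ℝ, ∀ x ∈ S,
    (l.map fun i => s i x).prod * ‖iterD Y l u x‖ ≤ C * φ x

theorem Symb.symbLe {φ : N → ℝ} {u : N → F} (h : Symb S Y s φ u) (k : ℕ) :
    SymbLe k S Y s φ u :=
  ⟨h.1, fun l _ => h.2 l⟩

theorem SymbLe.mono_order {φ : N → ℝ} {u : N → F} {k m : ℕ} (h : SymbLe k S Y s φ u)
    (hm : m ≤ k) : SymbLe m S Y s φ u :=
  ⟨h.1, fun l hl => h.2 l (hl.trans hm)⟩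

theorem SymbLe.congr_weight {φ ψ : N → ℝ} {u : N → F} {k : ℕ} (h : SymbLe k S Y s φ u)
    (hφ : EqOn φ ψ S) : SymbLe k S Y s ψ u :=
  ⟨h.1, fun l hl => (h.2 l hl).imp fun C hC x hx => by rw [← hφ hx]; exact hC x hx⟩

/-- The inductive step of all symbol estimates: the innermost derivative is split off a word of
derivatives, and its scale is moved into the weight. -/
theorem symbLe_of_lieD {φ : N → ℝ} {u : N → F} {k : ℕ} (hu : ContMDiffOn I 𝓘(ℝ, F) ∞ u S)
    (hs : ∀ i, ∀ x ∈ S, 0 < s i x)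
    (h0 : ∃ C : ℝ, ∀ x ∈ S, ‖u x‖ ≤ C * φ x)
    (h : ∀ i, SymbLe k S Y s (fun x => φ x / s i x) (lieD (Y i) u)) :
    SymbLe (k + 1) S Y s φ u := by
  refine ⟨hu, fun l hl => ?_⟩
  rcases List.eq_nil_or_concat l with rfl | ⟨l', i, rfl⟩
  · simpa using h0
  · rw [List.concat_eq_append] at hl ⊢
    obtain ⟨C, hC⟩ := (h i).2 l' (by simpa using hl)
    refine ⟨C, fun x hx => ?_⟩
    have := hC x hx
    rw [mul_div_assoc', le_div_iff₀ (hs i x hx)] at this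
    rw [iterD_append, List.map_append, List.prod_append]
    simp only [List.map_cons, List.map_nil, List.prod_cons, List.prod_nil, mul_one, iterD_cons,
      iterD_nil]
    linarith

theorem SymbLe.lieD {φ : N → ℝ} {u : N → F} {k : ℕ} (hS : IsOpen S)
    (hY : ∀ i, FieldOn ∞ (Y i) S)
    (hs : ∀ i, ∀ x ∈ S, 0 < s i x) (h : SymbLe (k + 1) S Y s φ u) (i : ι) :
    SymbLe k S Y s (fun x => φ x / s i x) (lieD (Y i) u) := by
  refine ⟨lieD_smooth hS (hY i) h.1, fun l hl => ?_⟩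
  obtain ⟨C, hC⟩ := h.2 (l ++ [i]) (by simpa using hl)
  refine ⟨C, fun x hx => ?_⟩
  have := hC x hx
  rw [iterD_append, List.map_append, List.prod_append] at this
  simp only [List.map_cons, List.map_nil, List.prod_cons, List.prod_nil, mul_one, iterD_cons,
    iterD_nil] at this
  rw [mul_div_assoc', le_div_iff₀ (hs i x hx)]
  linarith

theorem Symb.lieD {φ : N → ℝ} {u : N → F} (hS : IsOpen S) (hY : ∀ i, FieldOn ∞ (Y i) S)
    (hs : ∀ i, ∀ x ∈ S, 0 < s i x) (h : Symb S Y s φ u) (i : ι) :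
    Symb S Y s (fun x => φ x / s i x) (lieD (Y i) u) :=
  ⟨lieD_smooth hS (hY i) h.1, fun l =>
    (SymbLe.lieD hS hY hs (h.symbLe (l.length + 1)) i).2 l le_rfl⟩

/-- Induction on the order replaces an iterated Leibniz formula: one derivative of `B(u, v)` is a
sum of two terms of the same kind, with one of the two weights divided by the scale. -/
theorem SymbLe.bilin (B : F →L[ℝ] G →L[ℝ] G') (hS : IsOpen S)
    (hY : ∀ i, FieldOn ∞ (Y i) S) (hs : ∀ i, ∀ x ∈ S, 0 < s i x) {k : ℕ}
    {φ ψ : N → ℝ} {u : N → F} {v : N → G} (hφ : ∀ x ∈ S, 0 ≤ φ x) (hψ : ∀ x ∈ S, 0 ≤ ψ x)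
    (hu : SymbLe k S Y s φ u) (hv : SymbLe k S Y s ψ v) :
    SymbLe k S Y s (fun x => φ x * ψ x) (fun x => B (u x) (v x)) := by
  have hsm : ContMDiffOn I 𝓘(ℝ, G') ∞ (fun x => B (u x) (v x)) S :=
    B.isBoundedBilinearMap.contDiff.contMDiff.comp_contMDiffOn (hu.1.prodMk_space hv.1)
  have h0 : ∃ C : ℝ, ∀ x ∈ S, ‖B (u x) (v x)‖ ≤ C * (φ x * ψ x) := by
    obtain ⟨C, hC⟩ := hu.2 [] (by simp)
    obtain ⟨C', hC'⟩ := hv.2 [] (by simp)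
    refine ⟨‖B‖ * |C| * |C'|, fun x hx => ?_⟩
    have h1 := hC x hx
    have h2 := hC' x hx
    simp only [List.map_nil, List.prod_nil, one_mul, iterD_nil] at h1 h2 ⊢
    have h1' := h1.trans (mul_le_mul_of_nonneg_right (le_abs_self C) (hφ x hx))
    have h2' := h2.trans (mul_le_mul_of_nonneg_right (le_abs_self C') (hψ x hx))
    calc ‖B (u x) (v x)‖ ≤ ‖B‖ * ‖u x‖ * ‖v x‖ := B.le_opNorm₂ _ _
      _ ≤ ‖B‖ * (|C| * φ x) * (|C'| * ψ x) := by
          have := mul_nonneg (abs_nonneg C) (hφ x hx)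
          gcongr
      _ = _ := by ring
  induction k generalizing φ ψ u v with
  | zero =>
    refine ⟨hsm, fun l hl => ?_⟩
    obtain rfl : l = [] := List.length_eq_zero_iff.1 (by simpa using hl)
    simpa using h0
  | succ k ih =>
    refine symbLe_of_lieD hsm hs h0 fun i => ?_
    have hp : ∀ x ∈ S, 0 ≤ φ x / s i x := fun x hx => div_nonneg (hφ x hx) (hs i x hx).le
    have hq : ∀ x ∈ S, 0 ≤ ψ x / s i x := fun x hx => div_nonneg (hψ x hx) (hs i x hx).le
    have hdu := SymbLe.lieD hS hY hs hu i
    have hdv := SymbLe.lieD hS hY hs hv i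
    have sm1 : ContMDiffOn I 𝓘(ℝ, G') ∞ (fun y => B (HL.lieD (Y i) u y) (v y)) S :=
      B.isBoundedBilinearMap.contDiff.contMDiff.comp_contMDiffOn (hdu.1.prodMk_space hv.1)
    have sm2 : ContMDiffOn I 𝓘(ℝ, G') ∞ (fun y => B (u y) (HL.lieD (Y i) v y)) S :=
      B.isBoundedBilinearMap.contDiff.contMDiff.comp_contMDiffOn (hu.1.prodMk_space hdv.1)
    -- The smoothness and the order zero bound were obtained before the induction started, so the
    -- induction hypothesis asks for both; they are supplied here for the two new pairs of factors.
    have bd {a : N → F} {b : N → G} {α β : N → ℝ} (ha : SymbLe k S Y s α a)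
        (hb : SymbLe k S Y s β b) (hα : ∀ x ∈ S, 0 ≤ α x) (hβ : ∀ x ∈ S, 0 ≤ β x) :
        ∃ C : ℝ, ∀ x ∈ S, ‖B (a x) (b x)‖ ≤ C * (α x * β x) := by
      obtain ⟨C, hC⟩ := ha.2 [] (by simp)
      obtain ⟨C', hC'⟩ := hb.2 [] (by simp)
      refine ⟨‖B‖ * |C| * |C'|, fun x hx => ?_⟩
      have h1 := hC x hx
      have h2 := hC' x hx
      simp only [List.map_nil, List.prod_nil, one_mul, iterD_nil] at h1 h2 ⊢
      have h1' := h1.trans (mul_le_mul_of_nonneg_right (le_abs_self C) (hα x hx))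
      have h2' := h2.trans (mul_le_mul_of_nonneg_right (le_abs_self C') (hβ x hx))
      calc ‖B (a x) (b x)‖ ≤ ‖B‖ * ‖a x‖ * ‖b x‖ := B.le_opNorm₂ _ _
        _ ≤ ‖B‖ * (|C| * α x) * (|C'| * β x) := by
            have := mul_nonneg (abs_nonneg C) (hα x hx)
            gcongr
        _ = _ := by ring
    have hu' := hu.mono_order (Nat.le_succ k)
    have hv' := hv.mono_order (Nat.le_succ k)
    have h1 := ih hp hψ hdu hv' sm1 (bd hdu hv' hp hψ)
    have h2 := ih hφ hq hu' hdv sm2 (bd hu' hdv hφ hq)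
    have key : EqOn (HL.lieD (Y i) fun y => B (u y) (v y))
        (fun y => B (HL.lieD (Y i) u y) (v y) + B (u y) (HL.lieD (Y i) v y)) S := fun y hy =>
      lieD_bilin B (hu.1.mdiffAt' hS hy) (hv.1.mdiffAt' hS hy)
    refine ⟨(sm1.add sm2).congr key, fun l hl => ?_⟩
    obtain ⟨C, hC⟩ := h1.2 l hl
    obtain ⟨C', hC'⟩ := h2.2 l hl
    refine ⟨C + C', fun x hx => ?_⟩
    have h1 := hC x hx
    have h2 := hC' x hx
    have h0 := hs i x hx
    rw [iterD_congr hS key l hx, iterD_add hS hY sm1 sm2 l hx]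
    have h3 := prod_nonneg_of_scale (fun i => (hs i x hx).le) l
    have h4 := mul_le_mul_of_nonneg_left (norm_add_le
      (iterD Y l (fun y => B (HL.lieD (Y i) u y) (v y)) x)
      (iterD Y l (fun y => B (u y) (HL.lieD (Y i) v y)) x)) h3
    have e1 : C * (φ x / s i x * ψ x) = C * (φ x * ψ x / s i x) := by ring
    have e2 : C' * (φ x * (ψ x / s i x)) = C' * (φ x * ψ x / s i x) := by ring
    rw [e1] at h1
    rw [e2] at h2
    linarith

theorem Symb.bilin (B : F →L[ℝ] G →L[ℝ] G') (hS : IsOpen S)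
    (hY : ∀ i, FieldOn ∞ (Y i) S) (hs : ∀ i, ∀ x ∈ S, 0 < s i x)
    {φ ψ : N → ℝ} {u : N → F} {v : N → G} (hφ : ∀ x ∈ S, 0 ≤ φ x) (hψ : ∀ x ∈ S, 0 ≤ ψ x)
    (hu : Symb S Y s φ u) (hv : Symb S Y s ψ v) :
    Symb S Y s (fun x => φ x * ψ x) (fun x => B (u x) (v x)) :=
  ⟨B.isBoundedBilinearMap.contDiff.contMDiff.comp_contMDiffOn (hu.1.prodMk_space hv.1), fun l =>
    (SymbLe.bilin B hS hY hs hφ hψ (hu.symbLe l.length) (hv.symbLe l.length)).2 l le_rfl⟩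

end Symbols


/-! ### Charts, cutoff functions and global frames -/

section Frames

variable {n : ℕ} {M : Type*} [TopologicalSpace M] [ChartedSpace (Cn n) M]
  [IsManifold 𝓘(ℂ, Cn n) ω M]
  {F : Type*} [NormedAddCommGroup F] [NormedSpace ℝ F]

theorem dirDeriv_clm {G : Type*} [NormedAddCommGroup G] [NormedSpace ℝ G] (L : F →L[ℝ] G)
    {u : M → F} {x : M} (hu : MDifferentiableAt 𝓘(ℝ, Cn n) 𝓘(ℝ, F) u x) (v : Tan n x) :
    dirDeriv (fun y => L (u y)) x v = L (dirDeriv u x v) :=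
  lieD_clm L (Y := fun _ : M => (v : Cn n)) hu

theorem dirDeriv_bilin {G G' : Type*} [NormedAddCommGroup G] [NormedSpace ℝ G]
    [NormedAddCommGroup G'] [NormedSpace ℝ G'] (B : F →L[ℝ] G →L[ℝ] G')
    {u : M → F} {w : M → G} {x : M} (hu : MDifferentiableAt 𝓘(ℝ, Cn n) 𝓘(ℝ, F) u x)
    (hw : MDifferentiableAt 𝓘(ℝ, Cn n) 𝓘(ℝ, G) w x) (v : Tan n x) :
    dirDeriv (fun y => B (u y) (w y)) x v = B (dirDeriv u x v) (w x) + B (u x) (dirDeriv w x v) :=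
  lieD_bilin B (Y := fun _ : M => (v : Cn n)) hu hw

theorem chart_mdiff (p : M) :
    (chartAt (Cn n) p).MDifferentiable 𝓘(ℝ, Cn n) 𝓘(ℝ, Cn n) :=
  mdifferentiable_chart p

/-- The differential of the chart at `p`. -/
def chartD (p x : M) : Tan n x →L[ℝ] Cn n :=
  mfderiv 𝓘(ℝ, Cn n) 𝓘(ℝ, Cn n) (chartAt (Cn n) p) x

/-- The differential of the inverse of the chart at `p`, at the image of `x`. -/
def chartDinv (p x : M) : Cn n →L[ℝ] Tan n x :=
  (mfderiv 𝓘(ℝ, Cn n) 𝓘(ℝ, Cn n) (chartAt (Cn n) p).symm (chartAt (Cn n) p x) : Cn n →L[ℝ] Cn n)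

theorem chartD_chartDinv {p x : M} (hx : x ∈ (chartAt (Cn n) p).source) (w : Cn n) :
    chartD p x (chartDinv p x w) = w := by
  have h := (chart_mdiff p).comp_symm_deriv ((chartAt (Cn n) p).map_source hx)
  have h' := congr($h w)
  have e : (chartAt (Cn n) p).symm (chartAt (Cn n) p x) = x := (chartAt (Cn n) p).left_inv hx
  rw [e] at h'
  exact h'

theorem chartDinv_chartD {p x : M} (hx : x ∈ (chartAt (Cn n) p).source) (v : Tan n x) :
    chartDinv p x (chartD p x v) = v := by
  have h := (chart_mdiff p).symm_comp_deriv hx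
  exact congr($h v)

theorem dirDeriv_chartDinv {p x : M} (hx : x ∈ (chartAt (Cn n) p).source) {u : M → F}
    (hu : MDifferentiableAt 𝓘(ℝ, Cn n) 𝓘(ℝ, F) u x) (w : Cn n) :
    dirDeriv u x (chartDinv p x w) =
      fderiv ℝ (u ∘ (chartAt (Cn n) p).symm) (chartAt (Cn n) p x) w := by
  have e : (chartAt (Cn n) p).symm (chartAt (Cn n) p x) = x := (chartAt (Cn n) p).left_inv hx
  have h := mfderiv_comp (I := 𝓘(ℝ, Cn n)) (I' := 𝓘(ℝ, Cn n)) (I'' := 𝓘(ℝ, F))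
    (g := u) (f := (chartAt (Cn n) p).symm) (chartAt (Cn n) p x) (by rwa [e])
    ((chart_mdiff p).mdifferentiableAt_symm ((chartAt (Cn n) p).map_source hx))
  rw [mfderiv_eq_fderiv] at h
  have h' := congr($h w)
  rw [e] at h'
  exact h'.symm

theorem dirDeriv_eq_fderiv {p x : M} (hx : x ∈ (chartAt (Cn n) p).source) {u : M → F}
    (hu : MDifferentiableAt 𝓘(ℝ, Cn n) 𝓘(ℝ, F) u x) (v : Tan n x) :
    dirDeriv u x v =
      fderiv ℝ (u ∘ (chartAt (Cn n) p).symm) (chartAt (Cn n) p x) (chartD p x v) := by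
  rw [← dirDeriv_chartDinv hx hu, chartDinv_chartD hx]

theorem comp_chart_symm_contDiffOn {p : M} {S : Set M} {k : ℕ∞ω} {u : M → F}
    (hu : ContMDiffOn 𝓘(ℝ, Cn n) 𝓘(ℝ, F) k u S) :
    ContDiffOn ℝ k (u ∘ (chartAt (Cn n) p).symm)
      ((chartAt (Cn n) p).target ∩ (chartAt (Cn n) p).symm ⁻¹' S) := by
  rw [← contMDiffOn_iff_contDiffOn]
  refine hu.comp ((contMDiffOn_chart_symm (I := 𝓘(ℝ, Cn n))).mono inter_subset_left)
    inter_subset_right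

/-- The field is the image of a section over the model space under the tangent map of the inverse
chart. Passing to the tangent map loses one derivative, whence `k + 1 ≤ ω`. -/
theorem fieldOn_chartDinv {p : M} {S : Set M} {k : ℕ∞ω} {w : M → Cn n}
    (hS : S ⊆ (chartAt (Cn n) p).source)
    (hw : ContMDiffOn 𝓘(ℝ, Cn n) 𝓘(ℝ, Cn n) k w S) (hk : k + 1 ≤ ω) :
    FieldOn (I := 𝓘(ℝ, Cn n)) k (fun x : M => (chartDinv p x (w x) : Tan n x)) S := by
  have h1 := (contMDiffOn_chart_symm (I := 𝓘(ℝ, Cn n)) (x := p) (n := ω)).contMDiffOn_tangentMapWithin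
    hk (chartAt (Cn n) p).open_target.uniqueMDiffOn
  have h2 : ContMDiffOn 𝓘(ℝ, Cn n) (𝓘(ℝ, Cn n)).tangent k
      (fun x : M => (⟨chartAt (Cn n) p x, w x⟩ : TangentBundle 𝓘(ℝ, Cn n) (Cn n))) S := by
    intro x hx
    rw [Bundle.contMDiffWithinAt_totalSpace]
    refine ⟨((contMDiffOn_chart (I := 𝓘(ℝ, Cn n)) (x := p) (n := k)) x (hS hx)).mono hS, ?_⟩
    simpa using! hw x hx
  refine (h1.comp h2 fun x hx => (chartAt (Cn n) p).map_source (hS hx)).congr fun x hx => ?_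
  -- The composition lives over `φ⁻¹(φ(x))`, which is only provably equal to `x`; all fibres being
  -- the same space `ℂⁿ`, equality of the base points is enough.
  have key : ∀ a b : M, a = b → ∀ v : Cn n, (⟨a, v⟩ : TangentBundle 𝓘(ℝ, Cn n) M) = ⟨b, v⟩ := by
    rintro _ _ rfl _; rfl
  simp only [Function.comp, tangentMapWithin]
  rw [mfderivWithin_of_isOpen (chartAt (Cn n) p).open_target
    ((chartAt (Cn n) p).map_source (hS hx))]
  exact (key _ _ ((chartAt (Cn n) p).left_inv (hS hx)) _).symm

theorem fieldOn_chartD {p : M} {S : Set M} (hSo : IsOpen S) {k : ℕ∞ω}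
    {Z : ∀ x : M, Tan n x} (hS : S ⊆ (chartAt (Cn n) p).source)
    (hZ : FieldOn (I := 𝓘(ℝ, Cn n)) k Z S) (hk : k + 1 ≤ ω) :
    ContMDiffOn 𝓘(ℝ, Cn n) 𝓘(ℝ, Cn n) k (fun x => chartD p x (Z x)) S :=
  lieD_contMDiffOn hSo hZ ((contMDiffOn_chart (x := p) (n := ω)).mono hS) hk

theorem fieldOn_smul_section {S : Set M} {k : ℕ∞ω} {Z : ∀ x : M, Tan n x} {ψ : M → ℝ}
    (hk : k + 1 ≤ ω) (hZ : FieldOn (I := 𝓘(ℝ, Cn n)) k Z S)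
    (hψ : ContMDiffOn 𝓘(ℝ, Cn n) 𝓘(ℝ, ℝ) k ψ S) :
    FieldOn (I := 𝓘(ℝ, Cn n)) k (fun x => ψ x • Z x) S := by
  have : IsManifold 𝓘(ℝ, Cn n) (k + 1) M := IsManifold.of_le hk
  exact hψ.smul_section hZ

theorem fieldOn_smul_of_tsupport {S : Set M} {Z : ∀ x : M, Tan n x} {ψ : M → ℝ}
    (hS : IsOpen S) (hZ : FieldOn (I := 𝓘(ℝ, Cn n)) ∞ Z S)
    (hψ : ContMDiff 𝓘(ℝ, Cn n) 𝓘(ℝ, ℝ) ∞ ψ) (ht : tsupport ψ ⊆ S) :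
    FieldOn (I := 𝓘(ℝ, Cn n)) ∞ (fun x => ψ x • Z x) univ :=
  (ContMDiffOn.smul_section_of_tsupport (V := fun x : M => TangentSpace 𝓘(ℝ, Cn n) x)
    hψ.contMDiffOn hS ht hZ).contMDiffOn

theorem smul_contMDiff_of_tsupport {S : Set M} {u : M → F} {ψ : M → ℝ}
    (hS : IsOpen S) (hu : ContMDiffOn 𝓘(ℝ, Cn n) 𝓘(ℝ, F) ∞ u S)
    (hψ : ContMDiff 𝓘(ℝ, Cn n) 𝓘(ℝ, ℝ) ∞ ψ) (ht : tsupport ψ ⊆ S) :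
    ContMDiff 𝓘(ℝ, Cn n) 𝓘(ℝ, F) ∞ (fun x => ψ x • u x) := by
  refine contMDiff_of_tsupport fun x hx => ?_
  have hx' : x ∈ S := ht (tsupport_smul_subset_left ψ u hx)
  exact (hψ x).smul (hu.contMDiffAt (hS.mem_nhds hx'))

variable [T2Space M] [SecondCountableTopology M]

theorem locallyCompact (n : ℕ) (M : Type*) [TopologicalSpace M] [ChartedSpace (Cn n) M] :
    LocallyCompactSpace M :=
  ChartedSpace.locallyCompactSpace (Cn n) M

theorem sigmaCompact (n : ℕ) (M : Type*) [TopologicalSpace M] [ChartedSpace (Cn n) M]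
    [SecondCountableTopology M] : SigmaCompactSpace M :=
  have := locallyCompact n M
  inferInstance

theorem exists_cutoff {K O : Set M} (hK : IsCompact K) (hO : IsOpen O) (hKO : K ⊆ O) :
    ∃ b : M → ℝ, ContMDiff 𝓘(ℝ, Cn n) 𝓘(ℝ, ℝ) ∞ b ∧ HasCompactSupport b ∧ tsupport b ⊆ O ∧
      (∀ᶠ x in 𝓝ˢ K, b x = 1) ∧ ∀ x, b x ∈ Icc 0 1 := by
  have := locallyCompact n M
  have := sigmaCompact n M
  obtain ⟨K', hK', h1, h2⟩ := exists_compact_between hK hO hKO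
  obtain ⟨f, hf1, hf0, hf⟩ := exists_contMDiffMap_one_nhds_of_subset_interior (n := (⊤ : ℕ∞))
    𝓘(ℝ, Cn n) hK.isClosed h1
  have hs : tsupport f ⊆ K' := closure_minimal (fun x hx => by
    by_contra h; exact hx (hf0 x h)) hK'.isClosed
  exact ⟨f, f.contMDiff, hK'.of_isClosed_subset (isClosed_tsupport _) hs, hs.trans h2, hf1, hf⟩

theorem exists_finite_partition {K O : Set M} (hK : IsCompact K) (hO : IsOpen O) (hKO : K ⊆ O) :
    ∃ (t : Finset M) (ψ : M → M → ℝ), (∀ p, ContMDiff 𝓘(ℝ, Cn n) 𝓘(ℝ, ℝ) ∞ (ψ p)) ∧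
      (∀ p, HasCompactSupport (ψ p)) ∧
      (∀ p, tsupport (ψ p) ⊆ (chartAt (Cn n) p).source ∩ O) ∧ ∀ x ∈ K, ∑ p ∈ t, ψ p x = 1 := by
  have := locallyCompact n M
  have := sigmaCompact n M
  obtain ⟨K', hK', h1, h2⟩ := exists_compact_between hK hO hKO
  obtain ⟨f, hf⟩ := SmoothPartitionOfUnity.exists_isSubordinate 𝓘(ℝ, Cn n) hK.isClosed
    (fun p : M => (chartAt (Cn n) p).source ∩ interior K')
    (fun p => (chartAt (Cn n) p).open_source.inter isOpen_interior)
    (fun x hx => mem_iUnion.2 ⟨x, mem_chart_source _ x, h1 hx⟩)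
  have hfin := f.locallyFinite.finite_nonempty_inter_compact hK
  refine ⟨hfin.toFinset, fun p => f p, fun p => (f p).contMDiff, fun p => ?_, fun p => ?_,
    fun x hx => ?_⟩
  · exact hK'.of_isClosed_subset (isClosed_tsupport _)
      ((hf p).trans (inter_subset_right.trans interior_subset))
  · exact (hf p).trans (inter_subset_inter_right _ (interior_subset.trans h2))
  · apply f.sum_finsupport' x hx
    intro p hp
    rw [f.mem_finsupport] at hp
    simp only [Finite.mem_toFinset, mem_ofPred_eq]
    exact ⟨x, hp, hx⟩

/-- Finitely many smooth functions `φ j` and fields `Z j` with `v = ∑ dφⱼ(v) Zⱼ` for all tangent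
vectors at points of `K`. -/
structure IsFrameOn {N : ℕ} (K : Set M) (φ : Fin N → M → ℝ) (Z : Fin N → SmoothField n M) :
    Prop where
  smooth : ∀ j, ContMDiff 𝓘(ℝ, Cn n) 𝓘(ℝ, ℝ) ∞ (φ j)
  eq_sum : ∀ x ∈ K, ∀ v : Tan n x, v = ∑ j, dirDeriv (φ j) x v • Z j x

/-- The `φ j` are real coordinates of finitely many charts, each multiplied by a cutoff equal to one
near the support of a partition function; the `Z j` are the corresponding coordinate fields times
the partition functions. The family is overcomplete, but it reduces any vector field to global
smooth ones with scalar coefficients, and it makes constants uniform over `K`. -/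
theorem exists_frame {K : Set M} (hK : IsCompact K) :
    ∃ (N : ℕ) (φ : Fin N → M → ℝ) (Z : Fin N → SmoothField n M), IsFrameOn K φ Z := by
  obtain ⟨t, ψ, hψ, hψc, hψs, hψ1⟩ := exists_finite_partition (n := n) hK isOpen_univ
    (subset_univ _)
  have hψs' : ∀ p, tsupport (ψ p) ⊆ (chartAt (Cn n) p).source := fun p =>
    (hψs p).trans inter_subset_left
  choose b hb hbc hbs hb1 _ using fun p => exists_cutoff (n := n) (hψc p)
    (chartAt (Cn n) p).open_source (hψs' p)
  let e := stdOrthonormalBasis ℝ (Cn n)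
  let φ' : t × Fin (Module.finrank ℝ (Cn n)) → M → ℝ := fun q x =>
    b q.1 x • (innerSL ℝ (e q.2) (chartAt (Cn n) (q.1 : M) x))
  let Z' : t × Fin (Module.finrank ℝ (Cn n)) → SmoothField n M := fun q =>
    ⟨fun x => ψ q.1 x • chartDinv (q.1 : M) x (e q.2), by
      rw [← contMDiffOn_univ]
      exact fieldOn_smul_of_tsupport (chartAt (Cn n) (q.1 : M)).open_source
        (fieldOn_chartDinv (w := fun _ => e q.2) subset_rfl contMDiffOn_const (by simp)) (hψ _)
        (hψs' _)⟩
  let g := (Fintype.equivFin (t × Fin (Module.finrank ℝ (Cn n)))).symm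
  refine ⟨_, fun j => φ' (g j), fun j => Z' (g j), fun j => ?_, fun x hx v => ?_⟩
  · refine smul_contMDiff_of_tsupport (chartAt (Cn n) ((g j).1 : M)).open_source ?_ (hb _) (hbs _)
    exact (innerSL ℝ (e (g j).2)).contMDiff.comp_contMDiffOn contMDiffOn_chart
  · rw [g.sum_comp (fun q => dirDeriv (φ' q) x v • Z' q x), Fintype.sum_prod_type]
    refine Eq.trans ?_ (Finset.sum_coe_sort t (fun p : M => ∑ i, dirDeriv (fun x => b p x •
        (innerSL ℝ (e i) (chartAt (Cn n) p x))) x v • (ψ p x • chartDinv p x (e i)))).symm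
    have key : ∀ p ∈ t, ∑ i, dirDeriv (fun x => b p x •
        (innerSL ℝ (e i) (chartAt (Cn n) p x))) x v • (ψ p x • chartDinv p x (e i)) =
        ψ p x • v := by
      intro p _
      by_cases h0 : ψ p x = 0
      · simp [h0]
      have hxs : x ∈ tsupport (ψ p) := subset_tsupport _ h0
      have hb1' : ∀ᶠ y in 𝓝 x, b p y = 1 :=
        (Filter.eventually_iff.1 ((hb1 p).filter_mono (nhds_le_nhdsSet hxs)))
      have hxc := hψs' p hxs
      have hd : ∀ i, dirDeriv (fun x => b p x • (innerSL ℝ (e i) (chartAt (Cn n) p x))) x v =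
          innerSL ℝ (e i) (chartD p x v) := by
        intro i
        have he : (fun x => b p x • (innerSL ℝ (e i) (chartAt (Cn n) p x))) =ᶠ[𝓝 x]
            fun x => innerSL ℝ (e i) (chartAt (Cn n) p x) := by
          filter_upwards [hb1'] with y hy
          rw [hy, one_smul]
        rw [dirDeriv, he.mfderiv_eq]
        exact dirDeriv_clm (innerSL ℝ (e i)) ((chart_mdiff p).mdifferentiableAt hxc) v
      simp only [hd]
      have : ∑ i, (innerSL ℝ (e i) (chartD p x v)) • (ψ p x • chartDinv p x (e i)) =
          ψ p x • chartDinv p x (∑ i, inner ℝ (e i) (chartD p x v) • e i) := by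
        rw [map_sum, Finset.smul_sum]
        refine Finset.sum_congr rfl fun i _ => ?_
        rw [map_smul, smul_comm]
        rfl
      rw [this, e.sum_repr' (chartD p x v), chartDinv_chartD hxc]
    rw [Finset.sum_congr rfl key, ← Finset.sum_smul, hψ1 x hx, one_smul]

end Frames


/-! ### The metric, gradients and the function `γ` -/

section Metric

variable {n : ℕ} {M : Type*} [TopologicalSpace M] [ChartedSpace (Cn n) M]
  [IsManifold 𝓘(ℂ, Cn n) ω M] (D : LeviDomain n M)

theorem LeviDomain.metric_contMDiffOn {k : ℕ∞ω} (hk : k ≤ (∞ : ℕ∞ω)) {S : Set M} {Z W : ∀ x : M, Tan n x}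
    (hZ : FieldOn (I := 𝓘(ℝ, Cn n)) k Z S) (hW : FieldOn (I := 𝓘(ℝ, Cn n)) k W S) :
    ContMDiffOn 𝓘(ℝ, Cn n) 𝓘(ℝ, ℝ) k (fun x => D.metric.inner x (Z x) (W x)) S := by
  intro x hx
  have hg := (D.metric.contMDiff.of_le hk).contMDiffAt.contMDiffWithinAt (x := x) (s := S)
  have : ContMDiffWithinAt 𝓘(ℝ, Cn n) (𝓘(ℝ, Cn n).prod 𝓘(ℝ)) k
      (fun m ↦ Bundle.TotalSpace.mk' ℝ (E := Bundle.Trivial M ℝ) m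
        (D.metric.inner m (Z m) (W m))) S x :=
    ContMDiffWithinAt.clm_bundle_apply₂ (F₁ := Cn n) (F₂ := Cn n) hg (hZ x hx) (hW x hx)
  simp only [Bundle.contMDiffWithinAt_totalSpace] at this
  exact this.2

theorem mulI_mulI {x : M} (v : Tan n x) : mulI (mulI v) = -v := by
  change Complex.I • Complex.I • (show Cn n from v) = -(show Cn n from v)
  rw [smul_smul, Complex.I_mul_I, neg_one_smul]

/-- Since `J` is an isometry with `J² = -1`, it is skew for the real metric. -/
theorem LeviDomain.inner_mulI_self (x : M) (v : Tan n x) : D.metric.inner x v (mulI v) = 0 := by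
  have h := D.hermitian x v (mulI v)
  rw [mulI_mulI, map_neg, D.metric.symm x (mulI v) v] at h
  linarith

theorem LeviDomain.inner_nonneg (x : M) (v : Tan n x) : 0 ≤ D.metric.inner x v v := by
  by_cases h : v = 0
  · simp [h]
  · exact (D.metric.pos x v h).le

theorem LeviDomain.inner_cauchy (x : M) (v w : Tan n x) :
    (D.metric.inner x v w) ^ 2 ≤ D.metric.inner x v v * D.metric.inner x w w := by
  by_cases hv : v = 0
  · simp [hv]
  have h0 := D.metric.pos x v hv
  have h := D.inner_nonneg x (D.metric.inner x v v • w - D.metric.inner x v w • v)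
  simp only [map_sub, map_smul, _root_.sub_apply, _root_.smul_apply,
    smul_eq_mul, D.metric.symm x w v] at h
  nlinarith

theorem LeviDomain.exists_gradient (x : M) (L : Tan n x →L[ℝ] ℝ) :
    ∃ w : Tan n x, ∀ v, D.metric.inner x w v = L v := by
  let T : Cn n →ₗ[ℝ] Module.Dual ℝ (Cn n) :=
    { toFun := fun v => ((D.metric.inner x v : Tan n x →L[ℝ] ℝ) : Tan n x →ₗ[ℝ] ℝ)
      map_add' := fun v w => by ext u; exact congr($(map_add (D.metric.inner x) v w) u)
      map_smul' := fun c v => by ext u; exact congr($(map_smul (D.metric.inner x) c v) u) }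
  have hinj : Function.Injective T := by
    rw [← LinearMap.ker_eq_bot, LinearMap.ker_eq_bot']
    intro v hv
    by_contra h
    have h1 := D.metric.pos x v h
    have h2 : D.metric.inner x v v = 0 := LinearMap.congr_fun hv v
    exact h1.ne' h2
  have hsurj := (LinearMap.injective_iff_surjective_of_finrank_eq_finrank
    (Subspace.dual_finrank_eq (K := ℝ) (V := Cn n)).symm).1 hinj
  obtain ⟨w, hw⟩ := hsurj (L : Tan n x →ₗ[ℝ] ℝ)
  exact ⟨w, fun v => LinearMap.congr_fun hw v⟩

/-- The gradient of a function. -/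
def LeviDomain.grad (φ : M → ℝ) (x : M) : Tan n x :=
  (D.exists_gradient x (mfderiv 𝓘(ℝ, Cn n) 𝓘(ℝ, ℝ) φ x)).choose

theorem LeviDomain.inner_grad (φ : M → ℝ) (x : M) (v : Tan n x) :
    D.metric.inner x (D.grad φ x) v = dirDeriv φ x v :=
  (D.exists_gradient x (mfderiv 𝓘(ℝ, Cn n) 𝓘(ℝ, ℝ) φ x)).choose_spec v

theorem LeviDomain.grad_unique {φ : M → ℝ} {x : M} {w : Tan n x}
    (h : ∀ v, D.metric.inner x w v = dirDeriv φ x v) : w = D.grad φ x := by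
  by_contra hne
  have h1 := D.metric.pos x (w - D.grad φ x) (sub_ne_zero.2 hne)
  have h2 : D.metric.inner x (w - D.grad φ x) = D.metric.inner x w - D.metric.inner x (D.grad φ x) :=
    map_sub _ _ _
  rw [h2] at h1
  change 0 < D.metric.inner x w _ - D.metric.inner x (D.grad φ x) _ at h1
  rw [h, D.inner_grad, sub_self] at h1
  exact lt_irrefl _ h1

/-- The Gram operator of the metric in the chart at `p`. -/
def LeviDomain.gramOp (p x : M) : Cn n →L[ℝ] Cn n :=
  ∑ i, ∑ j, (D.metric.inner x (chartDinv p x (stdOrthonormalBasis ℝ (Cn n) i))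
    (chartDinv p x (stdOrthonormalBasis ℝ (Cn n) j))) •
    (innerSL ℝ (stdOrthonormalBasis ℝ (Cn n) j)).smulRight (stdOrthonormalBasis ℝ (Cn n) i)

theorem LeviDomain.inner_gramOp (p x : M) (w w' : Cn n) :
    inner ℝ (D.gramOp p x w) w' =
      D.metric.inner x (chartDinv p x w) (chartDinv p x w') := by
  set e := stdOrthonormalBasis ℝ (Cn n) with he
  conv_rhs => rw [← e.sum_repr' w, ← e.sum_repr' w']
  simp only [LeviDomain.gramOp, ← he, _root_.sum_apply,
    _root_.smul_apply, ContinuousLinearMap.smulRight_apply, innerSL_apply_apply,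
    sum_inner, map_sum, map_smul, inner_smul_left, smul_eq_mul, RCLike.conj_to_real]
  refine Finset.sum_congr rfl fun j _ => ?_
  simp only [real_inner_comm]
  rw [Finset.mul_sum]
  refine Finset.sum_congr rfl fun i _ => ?_
  rw [D.metric.symm x (chartDinv p x (e j)) (chartDinv p x (e i))]
  ring

theorem LeviDomain.isUnit_gramOp {p x : M} (hx : x ∈ (chartAt (Cn n) p).source) :
    IsUnit (D.gramOp p x) := by
  have hinj : Function.Injective (D.gramOp p x) := by
    rw [injective_iff_map_eq_zero]
    intro w hw
    have h1 := D.inner_gramOp p x w w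
    rw [hw, inner_zero_left] at h1
    have h2 : chartDinv p x w = 0 := by
      by_contra h
      exact (D.metric.pos x _ h).ne h1
    rw [← chartD_chartDinv hx w, h2, map_zero]
  have hb : Function.Bijective (D.gramOp p x) :=
    ⟨hinj, LinearMap.surjective_of_injective (f := (D.gramOp p x).toLinearMap) hinj⟩
  let e := (LinearEquiv.ofBijective (D.gramOp p x).toLinearMap hb).toContinuousLinearEquiv
  have : D.gramOp p x = (e : Cn n →L[ℝ] Cn n) := by ext1 w; rfl
  rw [this]
  exact ⟨(ContinuousLinearEquiv.unitsEquiv ℝ (Cn n)).symm e, rfl⟩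

theorem LeviDomain.gramOp_contMDiffOn (p : M) :
    ContMDiffOn 𝓘(ℝ, Cn n) 𝓘(ℝ, Cn n →L[ℝ] Cn n) ∞ (D.gramOp p) (chartAt (Cn n) p).source := by
  have : D.gramOp p = fun x => ∑ i, ∑ j,
    (D.metric.inner x (chartDinv p x (stdOrthonormalBasis ℝ (Cn n) i))
    (chartDinv p x (stdOrthonormalBasis ℝ (Cn n) j))) •
    (innerSL ℝ (stdOrthonormalBasis ℝ (Cn n) j)).smulRight (stdOrthonormalBasis ℝ (Cn n) i) := rfl
  rw [this]
  refine contMDiffOn_finsetSum fun i _ => contMDiffOn_finsetSum fun j _ => ?_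
  have h := D.metric_contMDiffOn le_rfl
    (fieldOn_chartDinv (p := p) (w := fun _ => stdOrthonormalBasis ℝ (Cn n) i) subset_rfl
      contMDiffOn_const (by simp))
    (fieldOn_chartDinv (p := p) (w := fun _ => stdOrthonormalBasis ℝ (Cn n) j) subset_rfl
      contMDiffOn_const (by simp))
  exact h.smul contMDiffOn_const

/-- In a chart the gradient is `G⁻¹ β`, where `G` is the Gram operator and `β` collects the partial
derivatives of `φ`; inversion is smooth at invertible operators. The gradient was chosen pointwise,
so its uniqueness is what identifies the two. -/
theorem LeviDomain.grad_smooth {φ : M → ℝ} (hφ : ContMDiff 𝓘(ℝ, Cn n) 𝓘(ℝ, ℝ) ∞ φ) :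
    FieldOn (I := 𝓘(ℝ, Cn n)) ∞ (D.grad φ) univ := by
  rw [FieldOn, contMDiffOn_univ]
  intro p
  set e := stdOrthonormalBasis ℝ (Cn n) with he
  let β : M → Cn n := fun x => ∑ i, dirDeriv φ x (chartDinv p x (e i)) • e i
  have hβ : ContMDiffOn 𝓘(ℝ, Cn n) 𝓘(ℝ, Cn n) ∞ β (chartAt (Cn n) p).source := by
    refine contMDiffOn_finsetSum fun i _ => ?_
    have h := lieD_smooth (Z := fun x => chartDinv p x (e i)) (chartAt (Cn n) p).open_source
      (fieldOn_chartDinv (w := fun _ => e i) subset_rfl contMDiffOn_const (by simp))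
      hφ.contMDiffOn
    exact h.smul contMDiffOn_const
  have hinv : ContMDiffOn 𝓘(ℝ, Cn n) 𝓘(ℝ, Cn n →L[ℝ] Cn n) ∞
      (fun x => Ring.inverse (D.gramOp p x)) (chartAt (Cn n) p).source := by
    intro x hx
    obtain ⟨U, hU⟩ := D.isUnit_gramOp hx
    have h := contDiffAt_ringInverse ℝ (n := ∞) U
    rw [hU] at h
    exact h.contMDiffAt.comp_contMDiffWithinAt x (D.gramOp_contMDiffOn p x hx)
  have hw : ContMDiffOn 𝓘(ℝ, Cn n) 𝓘(ℝ, Cn n) ∞ (fun x => Ring.inverse (D.gramOp p x) (β x))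
      (chartAt (Cn n) p).source := hinv.clm_apply hβ
  have hF := fieldOn_chartDinv (p := p) subset_rfl hw (by simp)
  have : FieldOn (I := 𝓘(ℝ, Cn n)) ∞ (D.grad φ) (chartAt (Cn n) p).source := by
    refine hF.congr fun x hx => ?_
    congr 1
    symm
    apply D.grad_unique
    intro v
    rw [← chartDinv_chartD hx v, ← D.inner_gramOp]
    have h1 : D.gramOp p x (Ring.inverse (D.gramOp p x) (β x)) = β x := by
      have := Ring.mul_inverse_cancel _ (D.isUnit_gramOp hx)
      exact congr($this (β x))
    rw [h1]
    conv_rhs => rw [← e.sum_repr' (chartD p x v)]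
    have h2 : dirDeriv φ x (chartDinv p x (∑ i, inner ℝ (e i) (chartD p x v) • e i)) =
        ∑ i, inner ℝ (e i) (chartD p x v) * dirDeriv φ x (chartDinv p x (e i)) := by
      simp only [dirDeriv, map_sum, map_smul]
      rfl
    rw [h2]
    simp only [β, sum_inner, inner_smul_left, RCLike.conj_to_real]
    exact Finset.sum_congr rfl fun i _ => mul_comm _ _
  exact this.contMDiffAt ((chartAt (Cn n) p).open_source.mem_nhds (mem_chart_source _ p))

/-- The gradient of a smooth function as a smooth field. -/
def LeviDomain.gradField {φ : M → ℝ} (hφ : ContMDiff 𝓘(ℝ, Cn n) 𝓘(ℝ, ℝ) ∞ φ) : SmoothField n M :=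
  ⟨D.grad φ, contMDiffOn_univ.1 (D.grad_smooth hφ)⟩

theorem LeviDomain.r_mdiff (x : M) : MDifferentiableAt 𝓘(ℝ, Cn n) 𝓘(ℝ, ℝ) D.r x :=
  D.smooth_r.mdifferentiableAt (by simp)

theorem dirDeriv_ofReal {u : M → ℝ} {x : M} (hu : MDifferentiableAt 𝓘(ℝ, Cn n) 𝓘(ℝ, ℝ) u x)
    (v : Tan n x) : dirDeriv (fun y => (u y : ℂ)) x v = ((dirDeriv u x v : ℝ) : ℂ) :=
  dirDeriv_clm Complex.ofRealCLM hu v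

theorem holDeriv_ofReal {u : M → ℝ} {x : M} (hu : MDifferentiableAt 𝓘(ℝ, Cn n) 𝓘(ℝ, ℝ) u x)
    (v : Tan n x) : holDeriv (fun y => (u y : ℂ)) x v =
      (1 / 2 : ℂ) * (((dirDeriv u x v : ℝ) : ℂ) - Complex.I * ((dirDeriv u x (mulI v) : ℝ) : ℂ)) := by
  rw [holDeriv, dirDeriv_ofReal hu, dirDeriv_ofReal hu]
  rfl

theorem antiholDeriv_ofReal {u : M → ℝ} {x : M} (hu : MDifferentiableAt 𝓘(ℝ, Cn n) 𝓘(ℝ, ℝ) u x)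
    (v : Tan n x) : antiholDeriv (fun y => (u y : ℂ)) x v =
      (1 / 2 : ℂ) * (((dirDeriv u x v : ℝ) : ℂ) + Complex.I * ((dirDeriv u x (mulI v) : ℝ) : ℂ)) := by
  rw [antiholDeriv, dirDeriv_ofReal hu, dirDeriv_ofReal hu]
  rfl

theorem LeviDomain.norm_delR_sq (x : M) (v : Tan n x) :
    ‖D.delR x v‖ ^ 2 = ((dirDeriv D.r x v) ^ 2 + (dirDeriv D.r x (mulI v)) ^ 2) / 4 := by
  rw [LeviDomain.delR, holDeriv_ofReal (D.r_mdiff x), ← Complex.normSq_eq_norm_sq, map_mul,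
    Complex.normSq_apply, Complex.normSq_apply]
  simp
  ring

/-- `γ²` as a smooth function. -/
def LeviDomain.gammaSq (x : M) : ℝ := dirDeriv D.r x (D.grad D.r x) / 4

theorem LeviDomain.gammaSq_nonneg (x : M) : 0 ≤ D.gammaSq x := by
  rw [LeviDomain.gammaSq, ← D.inner_grad]
  have := D.inner_nonneg x (D.grad D.r x)
  positivity

/-- With `w = grad r` one has `4 |∂r(v)|² = ⟨w, v⟩² + ⟨w, Jv⟩²`, which is at most `|w|² |v|²`, with
equality for `v` parallel to `w`. This replaces the supremum in the definition of `γ` by the square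
root of a smooth function. -/
theorem LeviDomain.gamma_eq (x : M) : D.gamma x = √(D.gammaSq x) := by
  set w := D.grad D.r x with hw
  have hww : D.metric.inner x w w = 4 * D.gammaSq x := by
    rw [LeviDomain.gammaSq, ← D.inner_grad]; ring
  have hupper : ∀ v : Tan n x, D.metric.inner x v v ≤ 1 → ‖D.delR x v‖ ≤ √(D.gammaSq x) := by
    intro v hv
    apply Real.le_sqrt_of_sq_le
    rw [D.norm_delR_sq, ← D.inner_grad, ← D.inner_grad, ← hw]
    set a := D.metric.inner x w v
    set b := D.metric.inner x w (mulI v)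
    -- The test vector `a v + b Jv` pairs with `w` to `a² + b²`, and its squared length is `(a² +
    -- b²)|v|²` because `v ⊥ Jv` and `J` is isometric. Cauchy–Schwarz then loses nothing.
    have h1 := D.inner_cauchy x w (a • v + b • mulI v)
    have h2 : D.metric.inner x w (a • v + b • mulI v) = a ^ 2 + b ^ 2 := by
      simp only [map_add, map_smul, smul_eq_mul]; ring
    have h3 : D.metric.inner x (a • v + b • mulI v) (a • v + b • mulI v) =
        (a ^ 2 + b ^ 2) * D.metric.inner x v v := by
      simp only [map_add, map_smul, smul_eq_mul, _root_.add_apply,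
        _root_.smul_apply, D.inner_mulI_self, D.metric.symm x (mulI v) v,
        D.hermitian]
      ring
    rw [h2, h3, hww] at h1
    rcases eq_or_lt_of_le (add_nonneg (sq_nonneg a) (sq_nonneg b)) with h0 | h0
    · rw [← h0]; simpa using D.gammaSq_nonneg x
    · have h4 : a ^ 2 + b ^ 2 ≤ 4 * D.gammaSq x * D.metric.inner x v v := by
        by_contra hcon
        push Not at hcon
        nlinarith
      have h5 := D.gammaSq_nonneg x
      nlinarith
  have hne : {t : ℝ | ∃ v : Tan n x, D.metric.inner x v v ≤ 1 ∧ t = ‖D.delR x v‖}.Nonempty :=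
    ⟨_, 0, by simp, rfl⟩
  apply le_antisymm
  · apply csSup_le hne
    rintro t ⟨v, hv, rfl⟩
    exact hupper v hv
  · rcases eq_or_lt_of_le (D.gammaSq_nonneg x) with h0 | h0
    · rw [← h0, Real.sqrt_zero]
      apply Real.sSup_nonneg
      rintro t ⟨v, -, rfl⟩
      exact norm_nonneg _
    · have hc : 0 < √(4 * D.gammaSq x) := Real.sqrt_pos.2 (by positivity)
      have hcs : √(4 * D.gammaSq x) ^ 2 = 4 * D.gammaSq x := Real.sq_sqrt (by positivity)
      set c := √(4 * D.gammaSq x)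
      have hu : D.metric.inner x (c⁻¹ • w) (c⁻¹ • w) ≤ 1 := by
        simp only [map_smul, _root_.smul_apply, smul_eq_mul, hww, ← hcs]
        apply le_of_eq
        field_simp
      have hv : √(D.gammaSq x) ≤ ‖D.delR x (c⁻¹ • w)‖ := by
        apply Real.sqrt_le_iff.2 ⟨norm_nonneg _, ?_⟩
        rw [D.norm_delR_sq, ← D.inner_grad, ← hw, map_smul, hww, smul_eq_mul]
        have : (c⁻¹ * (4 * D.gammaSq x)) ^ 2 = 4 * D.gammaSq x := by
          rw [← hcs]; field_simp
        rw [this]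
        have := sq_nonneg (dirDeriv D.r x (mulI (c⁻¹ • w)))
        linarith
      refine hv.trans (le_csSup ⟨√(D.gammaSq x), ?_⟩ ⟨_, hu, rfl⟩)
      rintro t ⟨v, hv, rfl⟩
      exact hupper v hv

theorem LeviDomain.gamma_nonneg (x : M) : 0 ≤ D.gamma x := by
  rw [D.gamma_eq]; exact Real.sqrt_nonneg _

theorem LeviDomain.gamma_sq (x : M) : D.gamma x ^ 2 = D.gammaSq x := by
  rw [D.gamma_eq, Real.sq_sqrt (D.gammaSq_nonneg x)]

theorem LeviDomain.gammaSq_smooth : ContMDiff 𝓘(ℝ, Cn n) 𝓘(ℝ, ℝ) ∞ D.gammaSq := by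
  rw [← contMDiffOn_univ]
  have h : ContMDiffOn 𝓘(ℝ, Cn n) 𝓘(ℝ, ℝ) ∞ (lieD (D.grad D.r) D.r) univ :=
    lieD_smooth isOpen_univ (D.grad_smooth D.smooth_r) D.smooth_r.contMDiffOn
  have := (contDiff_id.div_const (𝕜 := ℝ) (n := ∞) (4 : ℝ)).contMDiff.comp_contMDiffOn h
  exact this

theorem LeviDomain.gamma_continuous : Continuous D.gamma := by
  have : D.gamma = fun x => √(D.gammaSq x) := funext D.gamma_eq
  rw [this]
  exact D.gammaSq_smooth.continuous.sqrt

theorem LeviDomain.isOpen_carrier : IsOpen D.carrier :=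
  isOpen_lt D.smooth_r.continuous continuous_const

theorem LeviDomain.isOpen_reg : IsOpen D.reg :=
  D.isOpen_carrier.inter (isOpen_ne_fun D.gamma_continuous continuous_const)

theorem LeviDomain.gamma_pos {x : M} (hx : x ∈ D.reg) : 0 < D.gamma x :=
  lt_of_le_of_ne (D.gamma_nonneg x) (Ne.symm hx.2)

theorem LeviDomain.reg_subset_carrier : D.reg ⊆ D.carrier := fun _ h => h.1

theorem LeviDomain.isCompact_closure : IsCompact (closure D.carrier) := D.relativelyCompact

/-- Cauchy–Schwarz, as `|grad r| = 2γ`. -/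
theorem LeviDomain.abs_dirDeriv_r_le (x : M) (v : Tan n x) :
    |dirDeriv D.r x v| ≤ 2 * D.gamma x * √(D.metric.inner x v v) := by
  have h := D.inner_cauchy x (D.grad D.r x) v
  rw [D.inner_grad, D.inner_grad] at h
  have h2 : dirDeriv D.r x (D.grad D.r x) = 4 * D.gamma x ^ 2 := by
    rw [D.gamma_sq, LeviDomain.gammaSq]; ring
  rw [h2] at h
  have hg := D.gamma_nonneg x
  apply abs_le_of_sq_le_sq _ (by positivity)
  rw [mul_pow, Real.sq_sqrt (D.inner_nonneg x v)]
  linarith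

theorem LeviDomain.gamma_eq_zero_iff (x : M) : D.gamma x = 0 ↔ ∀ v : Tan n x, dirDeriv D.r x v = 0 := by
  constructor
  · intro h v
    have := D.abs_dirDeriv_r_le x v
    rw [h] at this
    simpa using this
  · intro h
    rw [D.gamma_eq, LeviDomain.gammaSq, h]
    simp

end Metric


/-! ### Comparison of `ρ` with the distance in charts -/

section Distance

variable {n : ℕ} {M : Type*} [TopologicalSpace M] [ChartedSpace (Cn n) M]
  [IsManifold 𝓘(ℂ, Cn n) ω M] (D : LeviDomain n M)

theorem LeviDomain.abs_dirDeriv_le (φ : M → ℝ) (x : M) (v : Tan n x) :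
    |dirDeriv φ x v| ≤
      √(D.metric.inner x (D.grad φ x) (D.grad φ x)) * √(D.metric.inner x v v) := by
  have h := D.inner_cauchy x (D.grad φ x) v
  rw [D.inner_grad φ x v] at h
  apply abs_le_of_sq_le_sq _ (by positivity)
  rw [mul_pow, Real.sq_sqrt (D.inner_nonneg x v), Real.sq_sqrt (D.inner_nonneg x _)]
  exact h

theorem LeviDomain.exists_dirDeriv_bound {φ : M → ℝ} (hφ : ContMDiff 𝓘(ℝ, Cn n) 𝓘(ℝ, ℝ) ∞ φ)
    (hc : HasCompactSupport φ) :
    ∃ C : ℝ, 0 < C ∧ ∀ (x : M) (v : Tan n x), |dirDeriv φ x v| ≤ C * √(D.metric.inner x v v) := by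
  have hcont : Continuous fun x => √(D.metric.inner x (D.grad φ x) (D.grad φ x)) := by
    refine Continuous.sqrt ?_
    exact (contMDiffOn_univ.1 (D.metric_contMDiffOn le_rfl (D.grad_smooth hφ)
      (D.grad_smooth hφ))).continuous
  obtain ⟨C, hC⟩ := hc.isCompact.exists_bound_of_continuousOn hcont.continuousOn
  refine ⟨max C 1, lt_max_of_lt_right one_pos, fun x v => ?_⟩
  by_cases hx : x ∈ tsupport φ
  · refine (D.abs_dirDeriv_le φ x v).trans (mul_le_mul_of_nonneg_right ?_ (Real.sqrt_nonneg _))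
    exact (le_abs_self _).trans ((hC x hx).trans (le_max_left _ _))
  · have h0 : φ =ᶠ[𝓝 x] fun _ => 0 := notMem_tsupport_iff_eventuallyEq.1 hx
    have : dirDeriv φ x v = 0 := by
      rw [dirDeriv, h0.mfderiv_eq, mfderiv_const]; rfl
    rw [this, abs_zero]
    positivity

/-- The differential is bounded in the metric because the support is compact; integrate it along a
path of nearly minimal length. Extended non-negative reals also cover pairs at infinite distance. -/
theorem LeviDomain.exists_lipschitz_geodesicDist {φ : M → ℝ}
    (hφ : ContMDiff 𝓘(ℝ, Cn n) 𝓘(ℝ, ℝ) ∞ φ) (hc : HasCompactSupport φ) :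
    ∃ C : ℝ, 0 < C ∧ ∀ x y : M,
      ENNReal.ofReal |φ x - φ y| ≤ ENNReal.ofReal C * D.geodesicDist x y := by
  obtain ⟨C, hC0, hC⟩ := D.exists_dirDeriv_bound hφ hc
  refine ⟨C, hC0, fun x y => ?_⟩
  let _ : ∀ x : M, ENorm (TangentSpace 𝓘(ℝ, Cn n) x) :=
    fun x => ⟨fun v => ENNReal.ofReal (√(D.metric.inner x v v))⟩
  have key : ∀ r : ℝ≥0∞, D.geodesicDist x y < r →
      ENNReal.ofReal |φ x - φ y| ≤ ENNReal.ofReal C * r := by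
    intro r hr
    obtain ⟨c, hc0, hc1, hcs, hlen⟩ := Manifold.exists_lt_of_riemannianEDist_lt hr
    refine le_trans ?_ (mul_le_mul_right hlen.le _)
    have hd : ContDiffOn ℝ 1 (φ ∘ c) (Icc 0 1) :=
      contMDiffOn_iff_contDiffOn.1 ((hφ.of_le (by simp)).comp_contMDiffOn hcs)
    have h1 := enorm_sub_le_lintegral_derivWithin_Icc_of_contDiffOn_Icc hd zero_le_one
    rw [Manifold.pathELength_eq_lintegral_mfderivWithin_Icc,
      ← lintegral_const_mul' _ _ ENNReal.ofReal_ne_top]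
    have h2 : ENNReal.ofReal |φ x - φ y| = ‖(φ ∘ c) 1 - (φ ∘ c) 0‖ₑ := by
      rw [Function.comp_apply, Function.comp_apply, hc0, hc1, ← Real.norm_eq_abs, norm_sub_rev,
        ofReal_norm]
    rw [h2]
    refine h1.trans (setLIntegral_mono' measurableSet_Icc fun t ht => ?_)
    have hu : UniqueMDiffWithinAt 𝓘(ℝ, ℝ) (Icc (0 : ℝ) 1) t :=
      (uniqueDiffOn_Icc zero_lt_one t ht).uniqueMDiffWithinAt
    have h3 := mfderiv_comp_mfderivWithin (I := 𝓘(ℝ, ℝ)) (I' := 𝓘(ℝ, Cn n)) (I'' := 𝓘(ℝ, ℝ))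
      (g := φ) (f := c) t (hφ.mdifferentiableAt (by simp))
      (hcs.mdifferentiableOn one_ne_zero t ht) hu
    rw [mfderivWithin_eq_fderivWithin] at h3
    have h4 : derivWithin (φ ∘ c) (Icc 0 1) t =
        dirDeriv φ (c t) (mfderivWithin 𝓘(ℝ, ℝ) 𝓘(ℝ, Cn n) c (Icc 0 1) t (1 : ℝ)) := by
      rw [← fderivWithin_derivWithin]
      exact congr($h3 (1 : ℝ))
    rw [h4, ← ofReal_norm, Real.norm_eq_abs]
    change _ ≤ ENNReal.ofReal C * ENNReal.ofReal _
    rw [← ENNReal.ofReal_mul hC0.le]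
    exact ENNReal.ofReal_le_ofReal (hC _ _)
  refine ENNReal.le_of_forall_pos_le_add fun ε hε _ => ?_
  by_cases htop : D.geodesicDist x y = ⊤
  · rw [htop, ENNReal.mul_top (by simpa using hC0)]
    simp
  -- Paths exist only for lengths strictly above the distance. The slack `ε / (C + 1)` stays below
  -- `ε` after multiplication by `C`.
  · have h1 := key (D.geodesicDist x y + ENNReal.ofReal (ε / (C + 1))) (ENNReal.lt_add_right htop
      (by simpa using by positivity))
    refine h1.trans ?_
    rw [mul_add, ← ENNReal.ofReal_mul hC0.le]
    gcongr
    rw [ENNReal.ofReal_le_iff_le_toReal (by simp), ENNReal.coe_toReal, mul_div_assoc']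
    rw [div_le_iff₀ (by positivity)]
    nlinarith [ε.2]

variable {D} {ρ : M → M → ℝ}

namespace LeviDomain.IsDistanceFunction

theorem self_eq_zero (hρ : D.IsDistanceFunction ρ) (x : M) : ρ x x = 0 := by
  obtain ⟨O, -, hd, hO⟩ := hρ.eq_geodesicDist
  rw [hO x x (hd x)]
  let _ : ∀ x : M, ENorm (TangentSpace 𝓘(ℝ, Cn n) x) :=
    fun x => ⟨fun v => ENNReal.ofReal (√(D.metric.inner x v v))⟩
  have h : D.geodesicDist x x ≤ 0 := by
    have hle : D.geodesicDist x x ≤ ∫⁻ t, ‖mfderiv (𝓡∂ 1) 𝓘(ℝ, Cn n) (Path.refl x) t 1‖ₑ := by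
      rw [LeviDomain.geodesicDist, Manifold.riemannianEDist]
      exact iInf₂_le (f := fun (c : Path x x) (_ : ContMDiff (𝓡∂ 1) 𝓘(ℝ, Cn n) 1 c) =>
        ∫⁻ t, ‖mfderiv (𝓡∂ 1) 𝓘(ℝ, Cn n) c t 1‖ₑ) (Path.refl x) contMDiff_const
    refine hle.trans ?_
    have h0 : ‖(0 : TangentSpace 𝓘(ℝ, Cn n) x)‖ₑ = 0 := by
      change ENNReal.ofReal √(D.metric.inner x 0 0) = 0
      simp
    rw [← lintegral_zero (μ := (volume : Measure unitInterval))]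
    refine lintegral_mono fun t => ?_
    have h1 : mfderiv (𝓡∂ 1) 𝓘(ℝ, Cn n) (Path.refl x) t = 0 := mfderiv_const
    rw [h1]
    exact h0.le
  rw [nonpos_iff_eq_zero.1 h]
  rfl

theorem nonneg (hρ : D.IsDistanceFunction ρ) (x y : M) : 0 ≤ ρ x y := by
  by_cases h : x = y
  · rw [h, hρ.self_eq_zero]
  · exact (hρ.pos x y h).le

theorem continuous (hρ : D.IsDistanceFunction ρ) : Continuous fun p : M × M => ρ p.1 p.2 := by
  have : (fun p : M × M => ρ p.1 p.2) = fun p => √(ρ p.1 p.2 ^ 2) := by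
    ext p; rw [Real.sqrt_sq (hρ.nonneg _ _)]
  rw [this]
  exact hρ.smooth.continuous.sqrt

variable [T2Space M] [SecondCountableTopology M]

/-- The coordinates times a cutoff are compactly supported, hence Lipschitz for the geodesic
distance, which is `ρ` near the diagonal. The opposite comparison, an upper bound of `ρ` by the
chart distance, plays no role in the proof. -/
theorem chart_le (hρ : D.IsDistanceFunction ρ) (p : M) :
    ∃ C : ℝ, 0 < C ∧ ∃ U ∈ 𝓝 p, U ⊆ (chartAt (Cn n) p).source ∧ ∀ x ∈ U, ∀ y ∈ U,
      ‖chartAt (Cn n) p x - chartAt (Cn n) p y‖ ≤ C * ρ x y := by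
  obtain ⟨O, hO, hd, hOρ⟩ := hρ.eq_geodesicDist
  obtain ⟨b, hb, hbc, hbs, hb1, -⟩ := exists_cutoff (n := n) (isCompact_singleton (x := p))
    (chartAt (Cn n) p).open_source (singleton_subset_iff.2 (mem_chart_source _ p))
  rw [nhdsSet_singleton] at hb1
  set e := stdOrthonormalBasis ℝ (Cn n) with he
  have hsm : ∀ i, ContMDiff 𝓘(ℝ, Cn n) 𝓘(ℝ, ℝ) ∞
      (fun x => b x • innerSL ℝ (e i) (chartAt (Cn n) p x)) := fun i =>
    smul_contMDiff_of_tsupport (chartAt (Cn n) p).open_source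
      ((innerSL ℝ (e i)).contMDiff.comp_contMDiffOn contMDiffOn_chart) hb hbs
  choose C hC0 hC using fun i => D.exists_lipschitz_geodesicDist (hsm i) hbc.smul_right
  obtain ⟨u, hu, v, hv, huv⟩ := mem_nhds_prod_iff.1 (hO.mem_nhds (hd p))
  refine ⟨∑ i, C i + 1, by have := Finset.sum_nonneg (fun i (_ : i ∈ Finset.univ) => (hC0 i).le)
                           linarith,
    u ∩ v ∩ ({x | b x = 1} ∩ (chartAt (Cn n) p).source),
    Filter.inter_mem (Filter.inter_mem hu hv) (Filter.inter_mem hb1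
      (chart_source_mem_nhds _ p)), fun x hx => hx.2.2, fun x hx y hy => ?_⟩
  have hxy := hOρ x y (huv ⟨hx.1.1, hy.1.2⟩)
  by_cases hne : x = y
  · rw [hne, sub_self, norm_zero, hρ.self_eq_zero, mul_zero]
  have hpos := hρ.pos x y hne
  -- An infinite distance would give `ρ x y = 0` by the convention `⊤.toReal = 0`, against
  -- positivity off the diagonal.
  have htop : D.geodesicDist x y ≠ ⊤ := by
    intro h
    rw [hxy, h] at hpos
    simp at hpos
  have hi : ∀ i, |inner ℝ (e i) (chartAt (Cn n) p x - chartAt (Cn n) p y)| ≤ C i * ρ x y := by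
    intro i
    have h := hC i x y
    have hbx : b x = 1 := hx.2.1
    have hby : b y = 1 := hy.2.1
    rw [hbx, hby, one_smul, one_smul, innerSL_apply_apply, innerSL_apply_apply,
      ← inner_sub_right, ← ENNReal.ofReal_toReal htop, ← hxy,
      ← ENNReal.ofReal_mul (hC0 i).le] at h
    exact (ENNReal.ofReal_le_ofReal_iff (mul_nonneg (hC0 i).le hpos.le)).1 h
  set w := chartAt (Cn n) p x - chartAt (Cn n) p y
  calc ‖w‖ = ‖∑ i, inner ℝ (e i) w • e i‖ := by rw [e.sum_repr']
    _ ≤ ∑ i, ‖inner ℝ (e i) w • e i‖ := norm_sum_le _ _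
    _ = ∑ i, |inner ℝ (e i) w| := by simp [norm_smul]
    _ ≤ ∑ i, C i * ρ x y := Finset.sum_le_sum fun i _ => hi i
    _ = (∑ i, C i) * ρ x y := by rw [Finset.sum_mul]
    _ ≤ _ := by nlinarith

/-- A local estimate of a function of two points, valid near each point of the diagonal of a
compact set, holds for all pairs of points that are close to each other. -/
theorem local_to_near (hρ : D.IsDistanceFunction ρ) {K T : Set M} (hK : IsCompact K) (hT : T ⊆ K)
    {f g : M → M → ℝ} (hg : ∀ x ∈ T, ∀ y ∈ T, 0 ≤ g x y)
    (h : ∀ p ∈ K, ∃ U ∈ 𝓝 p, ∃ C : ℝ, ∀ x ∈ U ∩ T, ∀ y ∈ U ∩ T, f x y ≤ C * g x y) :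
    ∃ δ > 0, ∃ C : ℝ, 0 ≤ C ∧ ∀ x ∈ T, ∀ y ∈ T, ρ x y < δ → f x y ≤ C * g x y := by
  suffices H : ∃ δ > 0, ∃ C : ℝ, 0 ≤ C ∧ ∀ q ∈ (K ×ˢ K) ∩ (T ×ˢ T), ρ q.1 q.2 < δ →
      f q.1 q.2 ≤ C * g q.1 q.2 by
    obtain ⟨δ, hδ, C, hC0, hC⟩ := H
    exact ⟨δ, hδ, C, hC0, fun x hx y hy hxy => hC (x, y) ⟨⟨hT hx, hT hy⟩, hx, hy⟩ hxy⟩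
  refine IsCompact.induction_on (p := fun s => ∃ δ > 0, ∃ C : ℝ, 0 ≤ C ∧ ∀ q ∈ s ∩ (T ×ˢ T),
    ρ q.1 q.2 < δ → f q.1 q.2 ≤ C * g q.1 q.2) (hK.prod hK) ?_ ?_ ?_ ?_
  · exact ⟨1, one_pos, 0, le_rfl, by simp⟩
  · rintro s t hst ⟨δ, hδ, C, hC0, hC⟩
    exact ⟨δ, hδ, C, hC0, fun q hq => hC q ⟨hst hq.1, hq.2⟩⟩
  · rintro s t ⟨δ, hδ, C, hC0, hC⟩ ⟨δ', hδ', C', hC0', hC'⟩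
    refine ⟨min δ δ', lt_min hδ hδ', max C C', le_max_of_le_left hC0, fun q hq hlt => ?_⟩
    have hgq := hg q.1 hq.2.1 q.2 hq.2.2
    rcases hq.1 with h1 | h1
    · exact (hC q ⟨h1, hq.2⟩ (hlt.trans_le (min_le_left _ _))).trans
        (mul_le_mul_of_nonneg_right (le_max_left _ _) hgq)
    · exact (hC' q ⟨h1, hq.2⟩ (hlt.trans_le (min_le_right _ _))).trans
        (mul_le_mul_of_nonneg_right (le_max_right _ _) hgq)
  · rintro ⟨x, y⟩ ⟨hx, hy⟩
    by_cases hxy : x = y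
    · subst hxy
      obtain ⟨U, hU, C, hC⟩ := h x hx
      refine ⟨U ×ˢ U, mem_nhdsWithin_of_mem_nhds (prod_mem_nhds hU hU), 1, one_pos, |C|,
        abs_nonneg _, fun q hq _ => ?_⟩
      exact (hC q.1 ⟨hq.1.1, hq.2.1⟩ q.2 ⟨hq.1.2, hq.2.2⟩).trans
        (mul_le_mul_of_nonneg_right (le_abs_self _) (hg q.1 hq.2.1 q.2 hq.2.2))
    · have hpos := hρ.pos x y hxy
      -- Near an off-diagonal pair the claim is made vacuous: with `δ = ρ x y / 2` no nearby pair
      -- satisfies `ρ < δ`.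
      refine ⟨{q | ρ x y / 2 < ρ q.1 q.2}, mem_nhdsWithin_of_mem_nhds
        ((isOpen_lt continuous_const hρ.continuous).mem_nhds (by simpa using half_lt_self hpos)),
        ρ x y / 2, half_pos hpos, 0, le_rfl, fun q hq hlt => ?_⟩
      exact absurd hlt (not_lt.2 (le_of_lt hq.1))

theorem bounded (hρ : D.IsDistanceFunction ρ) {K : Set M} (hK : IsCompact K) :
    ∃ R : ℝ, 0 < R ∧ ∀ x ∈ K, ∀ y ∈ K, ρ x y ≤ R := by
  obtain ⟨C, hC⟩ := (hK.prod hK).exists_bound_of_continuousOn hρ.continuous.continuousOn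
  exact ⟨max C 1, lt_max_of_lt_right one_pos, fun x hx y hy =>
    (le_abs_self _).trans ((hC (x, y) ⟨hx, hy⟩).trans (le_max_left _ _))⟩

end LeviDomain.IsDistanceFunction

end Distance


/-! ### Derivatives of kernels -/

section Kernels

variable {n : ℕ} {M : Type*} [TopologicalSpace M] [ChartedSpace (Cn n) M]
  [IsManifold 𝓘(ℂ, Cn n) ω M]
  {F : Type*} [NormedAddCommGroup F] [NormedSpace ℝ F]

/-- The coefficient of `Z^ζ` in the derivative of a kernel. -/
def LeviDomain.Slot.coeffFst : LeviDomain.Slot → ℝ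
  | .fst => 1
  | .snd => 0
  | .both => 1

/-- The coefficient of `Z^z` in the derivative of a kernel. -/
def LeviDomain.Slot.coeffSnd : LeviDomain.Slot → ℝ
  | .fst => 0
  | .snd => 1
  | .both => 1

open LeviDomain (Slot)

/-- The vector field on `M × M` given by `Z` acting in a slot. -/
def kField (o : Slot × SmoothField n M) (p : M × M) :
    TangentSpace (𝓘(ℝ, Cn n).prod 𝓘(ℝ, Cn n)) p :=
  ((o.1.coeffFst • o.2 p.1 : Tan n p.1), (o.1.coeffSnd • o.2 p.2 : Tan n p.2))

theorem fieldOn_kField (o : Slot × SmoothField n M) (S : Set (M × M)) :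
    FieldOn (I := 𝓘(ℝ, Cn n).prod 𝓘(ℝ, Cn n)) ∞ (kField o) S := by
  have h : ∀ c : ℝ, ContMDiff 𝓘(ℝ, Cn n) 𝓘(ℝ, Cn n).tangent ∞
      (fun x => (⟨x, c • o.2 x⟩ : TangentBundle 𝓘(ℝ, Cn n) M)) := fun c =>
    contMDiff_const.smul_section o.2.contMDiff
  have h1 := (contMDiff_equivTangentBundleProd_symm (I := 𝓘(ℝ, Cn n)) (I' := 𝓘(ℝ, Cn n))
    (M := M) (M' := M) (n := ∞)).comp (((h o.1.coeffFst).comp contMDiff_fst).prodMk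
      ((h o.1.coeffSnd).comp contMDiff_snd))
  exact ContMDiff.contMDiffOn h1

theorem lieD_kField (o : Slot × SmoothField n M) {G : M × M → F} {p : M × M}
    (hG : MDifferentiableAt (𝓘(ℝ, Cn n).prod 𝓘(ℝ, Cn n)) 𝓘(ℝ, F) G p) :
    lieD (kField o) G p = o.1.coeffFst • dirDeriv (fun x => G (x, p.2)) p.1 (o.2 p.1) +
      o.1.coeffSnd • dirDeriv (fun y => G (p.1, y)) p.2 (o.2 p.2) := by
  rw [lieD, mfderiv_prod_eq_add_apply hG]
  simp only [kField]
  erw [map_smul, map_smul]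
  rfl

theorem kernelDeriv_eq (o : Slot × SmoothField n M) (A : M → M → F) (ζ z : M) :
    LeviDomain.kernelDeriv o.1 o.2 A ζ z = o.1.coeffFst • dirDeriv (fun x => A x z) ζ (o.2 ζ) +
      o.1.coeffSnd • dirDeriv (fun y => A ζ y) z (o.2 z) := by
  rcases o with ⟨_ | _ | _, Z⟩ <;>
  simp [LeviDomain.kernelDeriv, LeviDomain.Slot.coeffFst, LeviDomain.Slot.coeffSnd]

/-- This translates the nested one-variable derivatives in the definition of the kernel classes into
iterated derivatives along vector fields on `M × M`, to which the symbol calculus applies. Joint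
differentiability is needed to split such a derivative into its two partial ones. -/
theorem foldr_kernelDeriv_eq {S T : Set M} (hS : IsOpen S) (hT : IsOpen T) {A : M → M → F}
    (hA : ContMDiffOn (𝓘(ℝ, Cn n).prod 𝓘(ℝ, Cn n)) 𝓘(ℝ, F) ∞ (fun p : M × M => A p.1 p.2)
      (S ×ˢ T)) (ops : List (Slot × SmoothField n M)) :
    EqOn (fun p : M × M =>
      ops.foldr (fun o B => LeviDomain.kernelDeriv o.1 o.2 B) A p.1 p.2)
      (iterD kField ops fun p : M × M => A p.1 p.2) (S ×ˢ T) := by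
  have hST := hS.prod hT
  induction ops with
  | nil => exact fun _ _ => rfl
  | cons o ops ih =>
    intro p hp
    have hsm := (iterD_smooth hST (fun o => fieldOn_kField o _) hA ops).mdiffAt' hST hp
    rw [iterD_cons, lieD_kField o hsm]
    simp only [List.foldr_cons]
    rw [kernelDeriv_eq]
    have h1 : (fun x => ops.foldr (fun o B => LeviDomain.kernelDeriv o.1 o.2 B) A x p.2) =ᶠ[𝓝 p.1]
        fun x => iterD kField ops (fun p : M × M => A p.1 p.2) (x, p.2) :=
      Filter.eventuallyEq_of_mem (hS.mem_nhds hp.1) fun x hx => ih (x := (x, p.2)) ⟨hx, hp.2⟩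
    have h2 : (fun y => ops.foldr (fun o B => LeviDomain.kernelDeriv o.1 o.2 B) A p.1 y) =ᶠ[𝓝 p.2]
        fun y => iterD kField ops (fun p : M × M => A p.1 p.2) (p.1, y) :=
      Filter.eventuallyEq_of_mem (hT.mem_nhds hp.2) fun y hy => ih (x := (p.1, y)) ⟨hp.1, hy⟩
    rw [dirDeriv, dirDeriv, h1.mfderiv_eq, h2.mfderiv_eq]
    rfl

/-- A function of two points read in the chart at `p`. -/
def inChart₂ (p : M) (G : M × M → F) (q : Cn n × Cn n) : F :=
  G ((chartAt (Cn n) p).symm q.1, (chartAt (Cn n) p).symm q.2)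

theorem inChart₂_contDiffOn (p : M) {G : M × M → F} {k : ℕ∞ω}
    (hG : ContMDiff (𝓘(ℝ, Cn n).prod 𝓘(ℝ, Cn n)) 𝓘(ℝ, F) k G) :
    ContDiffOn ℝ k (inChart₂ p G) ((chartAt (Cn n) p).target ×ˢ (chartAt (Cn n) p).target) := by
  rw [← contMDiffOn_iff_contDiffOn]
  refine hG.comp_contMDiffOn (ContMDiffOn.prodMk ?_ ?_)
  · exact (contMDiffOn_chart_symm (I := 𝓘(ℝ, Cn n))).comp contDiff_fst.contMDiff.contMDiffOn
      fun q hq => hq.1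
  · exact (contMDiffOn_chart_symm (I := 𝓘(ℝ, Cn n))).comp contDiff_snd.contMDiff.contMDiffOn
      fun q hq => hq.2

theorem inChart₂_contDiffAt (p : M) {G : M × M → F} {k : ℕ∞ω}
    (hG : ContMDiff (𝓘(ℝ, Cn n).prod 𝓘(ℝ, Cn n)) 𝓘(ℝ, F) k G) {x y : M}
    (hx : x ∈ (chartAt (Cn n) p).source) (hy : y ∈ (chartAt (Cn n) p).source) :
    ContDiffAt ℝ k (inChart₂ p G) (chartAt (Cn n) p x, chartAt (Cn n) p y) :=
  (inChart₂_contDiffOn p hG).contDiffAt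
    (((chartAt (Cn n) p).open_target.prod (chartAt (Cn n) p).open_target).mem_nhds
      ⟨(chartAt (Cn n) p).map_source hx, (chartAt (Cn n) p).map_source hy⟩)

theorem inChart₂_apply {p : M} {G : M × M → F} {x y : M}
    (hx : x ∈ (chartAt (Cn n) p).source) (hy : y ∈ (chartAt (Cn n) p).source) :
    inChart₂ p G (chartAt (Cn n) p x, chartAt (Cn n) p y) = G (x, y) := by
  simp [inChart₂, (chartAt (Cn n) p).left_inv hx, (chartAt (Cn n) p).left_inv hy]

theorem dirDeriv_fst_eq_fderiv (p : M) {G : M × M → F}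
    (hG : ContMDiff (𝓘(ℝ, Cn n).prod 𝓘(ℝ, Cn n)) 𝓘(ℝ, F) ∞ G) {x y : M}
    (hx : x ∈ (chartAt (Cn n) p).source) (hy : y ∈ (chartAt (Cn n) p).source) (v : Tan n x) :
    dirDeriv (fun x => G (x, y)) x v =
      fderiv ℝ (inChart₂ p G) (chartAt (Cn n) p x, chartAt (Cn n) p y) (chartD p x v, 0) := by
  have hsl : ContMDiff 𝓘(ℝ, Cn n) 𝓘(ℝ, F) ∞ fun x => G (x, y) :=
    hG.comp (contMDiff_id.prodMk contMDiff_const)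
  rw [dirDeriv_eq_fderiv hx (hsl.mdifferentiableAt (by simp))]
  have h1 := ((inChart₂_contDiffAt p hG hx hy).differentiableAt (by simp)).hasFDerivAt
  have h2 := h1.comp (chartAt (Cn n) p x)
    ((hasFDerivAt_id (𝕜 := ℝ) (chartAt (Cn n) p x)).prodMk
      (hasFDerivAt_const (𝕜 := ℝ) (chartAt (Cn n) p y) (chartAt (Cn n) p x)))
  have h3 : (inChart₂ p G ∘ fun u => (id u, chartAt (Cn n) p y)) =
      (fun x => G (x, y)) ∘ (chartAt (Cn n) p).symm := by
    ext u; simp [inChart₂, (chartAt (Cn n) p).left_inv hy]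
  rw [h3] at h2
  rw [h2.fderiv]
  rfl

theorem dirDeriv_snd_eq_fderiv (p : M) {G : M × M → F}
    (hG : ContMDiff (𝓘(ℝ, Cn n).prod 𝓘(ℝ, Cn n)) 𝓘(ℝ, F) ∞ G) {x y : M}
    (hx : x ∈ (chartAt (Cn n) p).source) (hy : y ∈ (chartAt (Cn n) p).source) (v : Tan n y) :
    dirDeriv (fun y => G (x, y)) y v =
      fderiv ℝ (inChart₂ p G) (chartAt (Cn n) p x, chartAt (Cn n) p y) (0, chartD p y v) := by
  have hsl : ContMDiff 𝓘(ℝ, Cn n) 𝓘(ℝ, F) ∞ fun y => G (x, y) :=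
    hG.comp (contMDiff_const.prodMk contMDiff_id)
  rw [dirDeriv_eq_fderiv hy (hsl.mdifferentiableAt (by simp))]
  have h1 := ((inChart₂_contDiffAt p hG hx hy).differentiableAt (by simp)).hasFDerivAt
  have h2 := h1.comp (f := fun u => (chartAt (Cn n) p x, id u)) (chartAt (Cn n) p y)
    ((hasFDerivAt_const (𝕜 := ℝ) (chartAt (Cn n) p x) (chartAt (Cn n) p y)).prodMk
      (hasFDerivAt_id (𝕜 := ℝ) (chartAt (Cn n) p y)))
  have h3 : (inChart₂ p G ∘ fun u => (chartAt (Cn n) p x, id u)) =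
      (fun y => G (x, y)) ∘ (chartAt (Cn n) p).symm := by
    ext u; simp [inChart₂, (chartAt (Cn n) p).left_inv hx]
  rw [h3] at h2
  rw [h2.fderiv]
  rfl

/-- `G` vanishes to second order on the diagonal. -/
def VanishTwo (G : M × M → F) : Prop :=
  (∀ x, G (x, x) = 0) ∧ ∀ x (v : Tan n x),
    dirDeriv (fun y => G (y, x)) x v = 0 ∧ dirDeriv (fun y => G (x, y)) x v = 0

theorem VanishTwo.fderiv_eq_zero {G : M × M → F} (h : VanishTwo (n := n) G)
    (hG : ContMDiff (𝓘(ℝ, Cn n).prod 𝓘(ℝ, Cn n)) 𝓘(ℝ, F) ∞ G) {p x : M}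
    (hx : x ∈ (chartAt (Cn n) p).source) :
    fderiv ℝ (inChart₂ p G) (chartAt (Cn n) p x, chartAt (Cn n) p x) = 0 := by
  refine ContinuousLinearMap.ext fun ⟨v, w⟩ => ?_
  have h1 := dirDeriv_fst_eq_fderiv p hG hx hx (chartDinv p x v)
  have h2 := dirDeriv_snd_eq_fderiv p hG hx hx (chartDinv p x w)
  rw [(h.2 x _).1, chartD_chartDinv hx] at h1
  rw [(h.2 x _).2, chartD_chartDinv hx] at h2
  have : (v, w) = (v, 0) + (0, w) := by simp
  rw [this, map_add, ← h1, ← h2]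
  simp

theorem lieD_kField_inChart₂ (o : Slot × SmoothField n M) (p : M) {G : M × M → F}
    (hG : ContMDiff (𝓘(ℝ, Cn n).prod 𝓘(ℝ, Cn n)) 𝓘(ℝ, F) ∞ G) {x y : M}
    (hx : x ∈ (chartAt (Cn n) p).source) (hy : y ∈ (chartAt (Cn n) p).source) :
    lieD (kField o) G (x, y) =
      fderiv ℝ (inChart₂ p G) (chartAt (Cn n) p x, chartAt (Cn n) p y)
        (o.1.coeffFst • chartD p x (o.2 x), o.1.coeffSnd • chartD p y (o.2 y)) := by
  rw [lieD_kField o (hG.mdifferentiableAt (by simp))]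
  simp only
  rw [dirDeriv_fst_eq_fderiv p hG hx hy, dirDeriv_snd_eq_fderiv p hG hx hy, ← map_smul, ← map_smul,
    ← map_add]
  simp

theorem VanishTwo.lieD_diag {G : M × M → F} (h : VanishTwo (n := n) G)
    (hG : ContMDiff (𝓘(ℝ, Cn n).prod 𝓘(ℝ, Cn n)) 𝓘(ℝ, F) ∞ G) (o : Slot × SmoothField n M) (x : M) :
    lieD (kField o) G (x, x) = 0 := by
  rw [lieD_kField_inChart₂ o x hG (mem_chart_source _ x) (mem_chart_source _ x),
    h.fderiv_eq_zero hG (mem_chart_source _ x)]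
  simp

/-- The derivative of `G(x, x)`. -/
theorem lieD_both_diag {G : M × M → F} (h : ∀ x : M, G (x, x) = 0)
    (hG : ContMDiff (𝓘(ℝ, Cn n).prod 𝓘(ℝ, Cn n)) 𝓘(ℝ, F) ∞ G) (Z : SmoothField n M) (x : M) :
    lieD (kField (n := n) (Slot.both, Z)) G (x, x) = 0 := by
  have hx := mem_chart_source (Cn n) x
  rw [lieD_kField_inChart₂ _ x hG hx hx]
  simp only [Slot.coeffFst, Slot.coeffSnd, one_smul]
  have h1 := ((inChart₂_contDiffAt x hG hx hx).differentiableAt (by simp)).hasFDerivAt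
  have h2 := h1.comp (f := fun u => (id u, id u)) (chartAt (Cn n) x x)
    ((hasFDerivAt_id (𝕜 := ℝ) (chartAt (Cn n) x x)).prodMk
      (hasFDerivAt_id (𝕜 := ℝ) (chartAt (Cn n) x x)))
  have h3 : (inChart₂ x G ∘ fun u : Cn n => (id u, id u)) = fun _ => 0 := by
    ext u; simp [inChart₂, h]
  rw [h3] at h2
  exact congr($(h2.unique (hasFDerivAt_const (0 : F) _)) (chartD x x (Z x)))

/-- In a chart the derivative of `G` along `Z^ζ + Z^z` is `DG(q)` applied to `(Z, Z)`. Differentiate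
this at a diagonal point: the term containing the derivative of `Z` carries the factor `DG = 0`, and
the other is `D²G(w, (Z, Z))`. It vanishes because `DG` is zero along the whole diagonal, to which
`(Z, Z)` is tangent. -/
theorem VanishTwo.lieD_both {G : M × M → F} (h : VanishTwo (n := n) G)
    (hG : ContMDiff (𝓘(ℝ, Cn n).prod 𝓘(ℝ, Cn n)) 𝓘(ℝ, F) ∞ G) (Z : SmoothField n M) :
    VanishTwo (n := n) (lieD (kField (Slot.both, Z)) G) := by
  refine ⟨fun x => h.lieD_diag hG _ x, fun x v => ?_⟩
  have hx := mem_chart_source (Cn n) x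
  set φ := chartAt (Cn n) x with hφ
  have hH : ContMDiff (𝓘(ℝ, Cn n).prod 𝓘(ℝ, Cn n)) 𝓘(ℝ, F) ∞ (lieD (kField (Slot.both, Z)) G) :=
    contMDiffOn_univ.1 (lieD_smooth isOpen_univ (fieldOn_kField _ _) hG.contMDiffOn)
  rw [dirDeriv_fst_eq_fderiv x hH hx hx, dirDeriv_snd_eq_fderiv x hH hx hx]
  suffices H : fderiv ℝ (inChart₂ x (lieD (kField (Slot.both, Z)) G)) (φ x, φ x) = 0 by
    rw [H]; simp
  have hW : φ.target ×ˢ φ.target ∈ 𝓝 (φ x, φ x) :=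
    (φ.open_target.prod φ.open_target).mem_nhds ⟨φ.map_source hx, φ.map_source hx⟩
  let ζ : Cn n → Cn n := fun u => chartD x (φ.symm u) (Z (φ.symm u))
  have hζ : ContDiffOn ℝ ∞ ζ φ.target := by
    have h1 : ContMDiffOn 𝓘(ℝ, Cn n) 𝓘(ℝ, Cn n) ∞ (fun y => chartD x y (Z y)) φ.source :=
      fieldOn_chartD φ.open_source subset_rfl Z.contMDiff.contMDiffOn (by simp)
    exact (comp_chart_symm_contDiffOn (p := x) h1).mono fun u hu => ⟨hu, φ.map_target hu⟩
  have hζ' : DifferentiableAt ℝ ζ (φ x) :=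
    ((hζ.contDiffAt (φ.open_target.mem_nhds (φ.map_source hx))).differentiableAt (by simp))
  have heq : inChart₂ x (lieD (kField (Slot.both, Z)) G) =ᶠ[𝓝 (φ x, φ x)]
      fun q => fderiv ℝ (inChart₂ x G) q (ζ q.1, ζ q.2) := by
    filter_upwards [hW] with q hq
    have h1 := φ.map_target hq.1
    have h2 := φ.map_target hq.2
    rw [← φ.right_inv hq.1, ← φ.right_inv hq.2]
    have := inChart₂_apply (p := x) (G := lieD (kField (Slot.both, Z)) G) h1 h2
    rw [← hφ, φ.right_inv hq.1, φ.right_inv hq.2] at this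
    have e : ∀ q : Cn n × Cn n, q = (q.1, q.2) := fun _ => rfl
    conv_lhs => rw [e q]
    rw [this, lieD_kField_inChart₂ _ x hG h1 h2, ← hφ, φ.right_inv hq.1, φ.right_inv hq.2]
    simp [Slot.coeffFst, Slot.coeffSnd, ζ]
  have hG2 := inChart₂_contDiffAt x hG hx hx
  have hD := ((hG2.fderiv_right (m := 1) (by norm_cast)).differentiableAt (by simp)).hasFDerivAt
  have hsym := hG2.isSymmSndFDerivAt (by simp; norm_cast)
  have hd := hD.clm_apply ((hζ'.hasFDerivAt.comp (φ x, φ x) hasFDerivAt_fst).prodMk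
    (hζ'.hasFDerivAt.comp (φ x, φ x) hasFDerivAt_snd))
  rw [heq.fderiv_eq]
  refine hd.fderiv.trans ?_
  refine ContinuousLinearMap.ext fun w => ?_
  have h0 := h.fderiv_eq_zero hG hx
  have hdiag : fderiv ℝ (fderiv ℝ (inChart₂ x G)) (φ x, φ x) (ζ (φ x), ζ (φ x)) = 0 := by
    have h2 := hD.comp (f := fun u => (id u, id u)) (φ x) ((hasFDerivAt_id (𝕜 := ℝ) (φ x)).prodMk
      (hasFDerivAt_id (𝕜 := ℝ) (φ x)))
    have h3 : (fderiv ℝ (inChart₂ x G) ∘ fun u => (id u, id u)) =ᶠ[𝓝 (φ x)] fun _ => 0 := by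
      filter_upwards [φ.open_target.mem_nhds (φ.map_source hx)] with u hu
      have := h.fderiv_eq_zero hG (p := x) (φ.map_target hu)
      rwa [← hφ, φ.right_inv hu] at this
    have h4 := (h2.congr_of_eventuallyEq h3.symm).unique (hasFDerivAt_const _ _)
    exact congr($h4 (ζ (φ x)))
  -- What is known is that the derivative of `DG` in the diagonal direction is zero; symmetry of the
  -- second derivative exchanges this direction with the arbitrary `w`.
  have h5 := hsym w (ζ (φ x), ζ (φ x))
  rw [hdiag] at h5
  rw [h0]
  simpa using h5

end Kernels


/-! ### Symbol estimates for `ρ²` -/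

theorem norm_sub_le_of_mem_segment' {E : Type*} [NormedAddCommGroup E] [NormedSpace ℝ E]
    {x y q : E} (hq : q ∈ segment ℝ x y) : ‖x - q‖ ≤ ‖x - y‖ := by
  rw [segment_eq_image'] at hq
  obtain ⟨θ, hθ, rfl⟩ := hq
  simp only
  rw [show x - (x + θ • (y - x)) = θ • (x - y) by module, norm_smul,
    Real.norm_of_nonneg hθ.1]
  exact mul_le_of_le_one_left (norm_nonneg _) hθ.2

theorem norm_sub_le_of_snd {E F : Type*} [NormedAddCommGroup E] [NormedSpace ℝ E]
    [NormedAddCommGroup F] [NormedSpace ℝ F] {H : E × E → F} {x y : E} {c : ℝ}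
    (hd : ∀ q ∈ segment ℝ x y, DifferentiableAt ℝ H (x, q))
    (hc : ∀ q ∈ segment ℝ x y, ‖fderiv ℝ H (x, q)‖ ≤ c) :
    ‖H (x, y) - H (x, x)‖ ≤ c * ‖y - x‖ := by
  have key : ∀ q ∈ segment ℝ x y, HasFDerivWithinAt (fun q => H (x, q))
      ((fderiv ℝ H (x, q)).comp (ContinuousLinearMap.inr ℝ E E)) (segment ℝ x y) q := fun q hq =>
    (HasFDerivAt.comp (f := fun u : E => (x, u)) q (hd q hq).hasFDerivAt
      (hasFDerivAt_prodMk_right x q)).hasFDerivWithinAt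
  refine (convex_segment x y).norm_image_sub_le_of_norm_hasFDerivWithin_le (𝕜 := ℝ) key
    (fun q hq => ?_) (left_mem_segment ℝ _ _) (right_mem_segment ℝ _ _)
  refine le_trans (ContinuousLinearMap.opNorm_le_bound _ (norm_nonneg _) fun w => ?_) (hc q hq)
  have := (fderiv ℝ H (x, q)).le_opNorm (0, w)
  simpa [Prod.norm_def] using this

section RhoSq

variable {n : ℕ} {M : Type*} [TopologicalSpace M] [ChartedSpace (Cn n) M]
  [IsManifold 𝓘(ℂ, Cn n) ω M]
  {F : Type*} [NormedAddCommGroup F] [NormedSpace ℝ F] {D : LeviDomain n M} {ρ : M → M → ℝ}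

open LeviDomain (Slot)

/-- In each variable separately, `ρ²` attains its minimum on the diagonal, so its partial
differentials vanish there. -/
theorem LeviDomain.IsDistanceFunction.vanishTwo (hρ : D.IsDistanceFunction ρ) :
    VanishTwo (n := n) (fun p : M × M => ρ p.1 p.2 ^ 2) := by
  refine ⟨fun x => by simp [hρ.self_eq_zero], fun x v => ?_⟩
  have key : ∀ u : M → ℝ, ContMDiff 𝓘(ℝ, Cn n) 𝓘(ℝ, ℝ) ∞ u → (∀ y, u x ≤ u y) →
      dirDeriv u x v = 0 := by
    intro u hu hmin
    rw [dirDeriv_eq_fderiv (mem_chart_source _ x) (hu.mdifferentiableAt (by simp))]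
    have : IsLocalMin (u ∘ (chartAt (Cn n) x).symm) (chartAt (Cn n) x x) := by
      refine Filter.Eventually.of_forall fun y => ?_
      simp only [Function.comp, (chartAt (Cn n) x).left_inv (mem_chart_source _ x)]
      exact hmin _
    rw [this.fderiv_eq_zero]
    rfl
  constructor
  · refine key _ (hρ.smooth.comp (contMDiff_id.prodMk contMDiff_const)) fun y => ?_
    simpa [hρ.self_eq_zero] using sq_nonneg _
  · refine key _ (hρ.smooth.comp (contMDiff_const.prodMk contMDiff_id)) fun y => ?_
    simpa [hρ.self_eq_zero] using sq_nonneg _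

variable [T2Space M] [SecondCountableTopology M]

namespace LeviDomain.IsDistanceFunction

/-- Once `ρ ≥ δ`, a bound of `f` is a bound by a multiple of `ρ^k`, so an estimate of this type only
has to be checked near diagonal points. -/
theorem local_to_global (hρ : D.IsDistanceFunction ρ) {K T : Set M} (hK : IsCompact K) (hT : T ⊆ K)
    {f : M → M → ℝ} (k : ℕ) (hf : ∃ B : ℝ, ∀ x ∈ T, ∀ y ∈ T, f x y ≤ B)
    (h : ∀ p ∈ K, ∃ U ∈ 𝓝 p, ∃ C : ℝ, ∀ x ∈ U ∩ T, ∀ y ∈ U ∩ T, f x y ≤ C * ρ x y ^ k) :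
    ∃ C : ℝ, 0 ≤ C ∧ ∀ x ∈ T, ∀ y ∈ T, f x y ≤ C * ρ x y ^ k := by
  obtain ⟨δ, hδ, C, hC0, hC⟩ := hρ.local_to_near hK hT
    (g := fun x y => ρ x y ^ k) (fun x _ y _ => pow_nonneg (hρ.nonneg x y) k) h
  obtain ⟨B, hB⟩ := hf
  refine ⟨C + |B| / δ ^ k, by positivity, fun x hx y hy => ?_⟩
  have h1 : 0 ≤ ρ x y ^ k := pow_nonneg (hρ.nonneg x y) k
  rcases lt_or_ge (ρ x y) δ with hlt | hge
  · refine (hC x hx y hy hlt).trans (mul_le_mul_of_nonneg_right ?_ h1)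
    linarith [show 0 ≤ |B| / δ ^ k by positivity]
  · calc f x y ≤ |B| := (hB x hx y hy).trans (le_abs_self B)
      _ = |B| / δ ^ k * δ ^ k := by field_simp
      _ ≤ |B| / δ ^ k * ρ x y ^ k := by gcongr
      _ ≤ _ := mul_le_mul_of_nonneg_right (by linarith) h1

theorem norm_le_of_diag (hρ : D.IsDistanceFunction ρ) {K : Set M} (hK : IsCompact K)
    {G : M × M → F} (hG : ContMDiff (𝓘(ℝ, Cn n).prod 𝓘(ℝ, Cn n)) 𝓘(ℝ, F) ∞ G)
    (h : ∀ x, G (x, x) = 0) :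
    ∃ C : ℝ, 0 ≤ C ∧ ∀ x ∈ K, ∀ y ∈ K, ‖G (x, y)‖ ≤ C * ρ x y := by
  have := hρ.local_to_global hK subset_rfl (f := fun x y => ‖G (x, y)‖) 1 ?_ ?_
  · simpa using this
  · obtain ⟨C, hC⟩ := (hK.prod hK).exists_bound_of_continuousOn hG.continuous.continuousOn
    exact ⟨C, fun x hx y hy => hC (x, y) ⟨hx, hy⟩⟩
  · intro p _
    have hp := mem_chart_source (Cn n) p
    obtain ⟨C, hC0, U, hU, hUs, hCU⟩ := hρ.chart_le p
    obtain ⟨L, t, ht, hL⟩ := ((inChart₂_contDiffAt p hG hp hp).of_le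
      (by simp : (1 : ℕ∞ω) ≤ (∞ : ℕ∞ω))).exists_lipschitzOnWith
    obtain ⟨s, hs, s', hs', hss⟩ := mem_nhds_prod_iff.1 ht
    have hc := (chartAt (Cn n) p).continuousAt hp
    refine ⟨U ∩ (chartAt (Cn n) p) ⁻¹' (s ∩ s'), Filter.inter_mem hU
      (hc (Filter.inter_mem hs hs')), L * C, fun x hx y hy => ?_⟩
    have h1 := hL.dist_le_mul (chartAt (Cn n) p x, chartAt (Cn n) p y) (hss ⟨hx.1.2.1, hy.1.2.2⟩)
      (chartAt (Cn n) p x, chartAt (Cn n) p x) (hss ⟨hx.1.2.1, hx.1.2.2⟩)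
    rw [inChart₂_apply (hUs hx.1.1) (hUs hy.1.1), inChart₂_apply (hUs hx.1.1) (hUs hx.1.1), h,
      dist_zero_right] at h1
    refine h1.trans ?_
    have h2 : dist (chartAt (Cn n) p x, chartAt (Cn n) p y)
        (chartAt (Cn n) p x, chartAt (Cn n) p x) =
        ‖chartAt (Cn n) p x - chartAt (Cn n) p y‖ := by
      rw [Prod.dist_eq, dist_self, max_eq_right dist_nonneg, dist_comm, dist_eq_norm]
    rw [h2, pow_one, mul_assoc]
    exact mul_le_mul_of_nonneg_left (hCU x hx.1.1 y hy.1.1) L.2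

/-- In a chart the differential of `G` is Lipschitz and zero on the diagonal, hence `O(|x - y|)` on
the segment from `(x, x)` to `(x, y)`; the mean value inequality contributes the second factor. -/
theorem norm_le_of_vanishTwo (hρ : D.IsDistanceFunction ρ) {K : Set M} (hK : IsCompact K)
    {G : M × M → F} (hG : ContMDiff (𝓘(ℝ, Cn n).prod 𝓘(ℝ, Cn n)) 𝓘(ℝ, F) ∞ G)
    (h : VanishTwo (n := n) G) :
    ∃ C : ℝ, 0 ≤ C ∧ ∀ x ∈ K, ∀ y ∈ K, ‖G (x, y)‖ ≤ C * ρ x y ^ 2 := by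
  refine hρ.local_to_global hK subset_rfl (f := fun x y => ‖G (x, y)‖) 2 ?_ ?_
  · obtain ⟨C, hC⟩ := (hK.prod hK).exists_bound_of_continuousOn hG.continuous.continuousOn
    exact ⟨C, fun x hx y hy => hC (x, y) ⟨hx, hy⟩⟩
  · intro p _
    have hp := mem_chart_source (Cn n) p
    set φ := chartAt (Cn n) p with hφ
    obtain ⟨C, hC0, U, hU, hUs, hCU⟩ := hρ.chart_le p
    have hG2 := inChart₂_contDiffAt p hG hp hp
    obtain ⟨L, t, ht, hL⟩ := (hG2.fderiv_right (m := 1) (by norm_cast)).exists_lipschitzOnWith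
    have hW : φ.target ×ˢ φ.target ∈ 𝓝 (φ p, φ p) :=
      (φ.open_target.prod φ.open_target).mem_nhds ⟨φ.map_source hp, φ.map_source hp⟩
    obtain ⟨ε, hε, hball⟩ := Metric.mem_nhds_iff.1 (Filter.inter_mem ht hW)
    rw [← ball_prod_same] at hball
    have hc := φ.continuousAt hp
    refine ⟨U ∩ φ ⁻¹' (Metric.ball (φ p) ε), Filter.inter_mem hU
      (hc (Metric.ball_mem_nhds _ hε)), L * C ^ 2, fun x hx y hy => ?_⟩
    have hxs := hUs hx.1.1
    have hys := hUs hy.1.1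
    have hxb : φ x ∈ Metric.ball (φ p) ε := hx.1.2
    have hyb : φ y ∈ Metric.ball (φ p) ε := hy.1.2
    have hin : ∀ u ∈ Metric.ball (φ p) ε, ∀ v ∈ Metric.ball (φ p) ε,
        (u, v) ∈ t ∧ (u, v) ∈ φ.target ×ˢ φ.target := fun u hu v hv =>
      hball (mk_mem_prod hu hv)
    have hxy : ∀ q ∈ segment ℝ (φ x) (φ y), ‖fderiv ℝ (inChart₂ p G) (φ x, q)‖ ≤
        L * ‖φ x - φ y‖ := by
      intro q hq
      have hqb : q ∈ Metric.ball (φ p) ε := (convex_ball _ _).segment_subset hxb hyb hq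
      have h1 := hL.dist_le_mul (φ x, q) (hin _ hxb _ hqb).1 (φ x, φ x)
        (hin _ hxb _ hxb).1
      rw [h.fderiv_eq_zero hG hxs, dist_zero_right] at h1
      refine h1.trans (mul_le_mul_of_nonneg_left ?_ L.2)
      rw [Prod.dist_eq, dist_self, max_eq_right dist_nonneg, dist_comm, dist_eq_norm]
      exact norm_sub_le_of_mem_segment' hq
    have hmv := norm_sub_le_of_snd (H := inChart₂ p G) (x := φ x) (y := φ y)
      (c := L * ‖φ x - φ y‖) (fun q hq => by
        have hqb : q ∈ Metric.ball (φ p) ε := (convex_ball _ _).segment_subset hxb hyb hq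
        exact ((inChart₂_contDiffOn p hG).contDiffAt
          ((φ.open_target.prod φ.open_target).mem_nhds (hin _ hxb _ hqb).2)).differentiableAt
          (by simp)) hxy
    rw [inChart₂_apply hxs hys, inChart₂_apply hxs hxs, h.1, sub_zero, norm_sub_rev] at hmv
    have h2 := hCU x hx.1.1 y hy.1.1
    have h3 : ‖φ x - φ y‖ ^ 2 ≤ (C * ρ x y) ^ 2 := pow_le_pow_left₀ (norm_nonneg _) h2 2
    calc ‖G (x, y)‖ ≤ L * ‖φ x - φ y‖ ^ 2 := by
          rw [norm_sub_rev (φ y) (φ x)] at hmv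
          rw [pow_two, ← mul_assoc]; exact hmv
      _ ≤ L * (C * ρ x y) ^ 2 := mul_le_mul_of_nonneg_left h3 L.2
      _ = _ := by ring

end LeviDomain.IsDistanceFunction

/-- Pairs of distinct points of `D'`. -/
def LeviDomain.offDiag (D : LeviDomain n M) : Set (M × M) :=
  {p | p ∈ D.reg ×ˢ D.reg ∧ p.1 ≠ p.2}

theorem LeviDomain.isOpen_offDiag (D : LeviDomain n M) : IsOpen D.offDiag :=
  (D.isOpen_reg.prod D.isOpen_reg).inter (isOpen_ne_fun continuous_fst continuous_snd)

/-- The scales as functions on `M × M`. -/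
def LeviDomain.kScale (D : LeviDomain n M) (ρ : M → M → ℝ) (o : Slot × SmoothField n M)
    (p : M × M) : ℝ :=
  D.scale ρ o.1 p.1 p.2

theorem LeviDomain.IsDistanceFunction.kScale_pos (hρ : D.IsDistanceFunction ρ)
    (o : Slot × SmoothField n M) : ∀ p ∈ D.offDiag, 0 < D.kScale ρ o p := by
  intro p hp
  have h1 := D.gamma_pos hp.1.1
  have h2 := D.gamma_pos hp.1.2
  have h3 := hρ.pos _ _ hp.2
  rcases o with ⟨_ | _ | _, Z⟩ <;> simp [LeviDomain.kScale, LeviDomain.scale, h1, h2, h3]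

theorem LeviDomain.exists_gamma_le (D : LeviDomain n M) :
    ∃ Γ : ℝ, 1 ≤ Γ ∧ ∀ x ∈ closure D.carrier, D.gamma x ≤ Γ := by
  obtain ⟨C, hC⟩ := D.isCompact_closure.exists_bound_of_continuousOn D.gamma_continuous.continuousOn
  exact ⟨max C 1, le_max_right _ _, fun x hx =>
    (le_abs_self _).trans ((hC x hx).trans (le_max_left _ _))⟩

theorem LeviDomain.reg_subset_closure (D : LeviDomain n M) : D.reg ⊆ closure D.carrier :=
  D.reg_subset_carrier.trans subset_closure

/-- The number of derivatives that are not tangent to the diagonal. -/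
def transversal (l : List (Slot × SmoothField n M)) : ℕ :=
  (l.map fun o => match o.1 with
    | .both => 0
    | _ => 1).sum

/-- Each transversal derivative has a scale at most `ρ`; the others have scale at most `Γ`. Since `Γ
≥ 1`, one factor `Γ` may be spent on every derivative. -/
theorem LeviDomain.IsDistanceFunction.prod_kScale_le (hρ : D.IsDistanceFunction ρ) {Γ : ℝ}
    (hΓ1 : 1 ≤ Γ) (hΓ : ∀ x ∈ closure D.carrier, D.gamma x ≤ Γ)
    (l : List (Slot × SmoothField n M)) {p : M × M} (hp : p ∈ D.offDiag) :
    (l.map fun o => D.kScale ρ o p).prod ≤ ρ p.1 p.2 ^ transversal l * Γ ^ l.length := by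
  have hr := hρ.nonneg p.1 p.2
  induction l with
  | nil => simp [transversal]
  | cons o l ih =>
    have h0 := prod_nonneg_of_scale (s := D.kScale ρ) (x := p)
      (fun o => (hρ.kScale_pos o p hp).le) l
    have h1 : D.kScale ρ o p ≤ ρ p.1 p.2 ^ transversal [o] * Γ := by
      have hg := (D.gamma_nonneg p.1)
      have hg' := hΓ p.1 (D.reg_subset_closure hp.1.1)
      rcases o with ⟨_ | _ | _, Z⟩ <;>
        simp only [LeviDomain.kScale, LeviDomain.scale, transversal, List.map_cons, List.map_nil,
          List.sum_cons, List.sum_nil, add_zero, pow_one, pow_zero, one_mul]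
      · exact (min_le_left _ _).trans (le_mul_of_one_le_right hr hΓ1)
      · exact (min_le_left _ _).trans (le_mul_of_one_le_right hr hΓ1)
      · exact (min_le_left _ _).trans hg'
    have h2 : transversal (o :: l) = transversal [o] + transversal l := by
      simp [transversal]
    rw [List.map_cons, List.prod_cons, h2, List.length_cons]
    calc _ ≤ (ρ p.1 p.2 ^ transversal [o] * Γ) * (ρ p.1 p.2 ^ transversal l * Γ ^ l.length) :=
          mul_le_mul h1 ih h0 (by positivity)
      _ = _ := by ring

/-- Derivatives along `Z^ζ + Z^z` keep the order of vanishing on the diagonal, the other two kinds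
lower it by at most one. With `t` transversal derivatives the result is `O(ρ^{2-t})`, and the scales
contribute `ρ^t`. -/
theorem LeviDomain.IsDistanceFunction.symb_rhoSq (hρ : D.IsDistanceFunction ρ) :
    Symb D.offDiag kField (D.kScale ρ) (fun p => ρ p.1 p.2 ^ 2)
      (fun p : M × M => ρ p.1 p.2 ^ 2) := by
  refine ⟨hρ.smooth.contMDiffOn, fun l => ?_⟩
  have hsm : ∀ l, ContMDiff (𝓘(ℝ, Cn n).prod 𝓘(ℝ, Cn n)) 𝓘(ℝ, ℝ) ∞
      (iterD kField l fun p : M × M => ρ p.1 p.2 ^ 2) := fun l =>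
    contMDiffOn_univ.1 (iterD_smooth isOpen_univ (fun o => fieldOn_kField o _)
      hρ.smooth.contMDiffOn l)
  have hv : ∀ l, (transversal l = 0 → VanishTwo (n := n)
      (iterD kField l fun p : M × M => ρ p.1 p.2 ^ 2)) ∧
      (transversal l = 1 → ∀ x : M, iterD (kField (n := n)) l (fun p : M × M => ρ p.1 p.2 ^ 2) (x, x) = 0) := by
    intro l
    induction l with
    | nil => exact ⟨fun _ => hρ.vanishTwo, by simp [transversal]⟩
    | cons o l ih =>
      rcases o with ⟨_ | _ | _, Z⟩ <;> simp only [transversal, List.map_cons, List.sum_cons] at ih ⊢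
      · refine ⟨fun h => by omega, fun h x => (ih.1 (by omega)).lieD_diag (hsm l) _ x⟩
      · refine ⟨fun h => by omega, fun h x => (ih.1 (by omega)).lieD_diag (hsm l) _ x⟩
      · refine ⟨fun h => (ih.1 (by omega)).lieD_both (hsm l) Z, fun h x =>
          lieD_both_diag (ih.2 (by omega)) (hsm l) Z x⟩
  obtain ⟨C, hC0, hC⟩ : ∃ C : ℝ, 0 ≤ C ∧ ∀ x ∈ closure D.carrier, ∀ y ∈ closure D.carrier,
      ‖iterD kField l (fun p : M × M => ρ p.1 p.2 ^ 2) (x, y)‖ ≤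
        C * ρ x y ^ (2 - transversal l) := by
    rcases h : transversal l with _ | _ | k
    · exact hρ.norm_le_of_vanishTwo D.isCompact_closure (hsm l) ((hv l).1 h)
    · simpa using hρ.norm_le_of_diag D.isCompact_closure (hsm l) ((hv l).2 h)
    · obtain ⟨C, hC⟩ := (D.isCompact_closure.prod D.isCompact_closure).exists_bound_of_continuousOn
        (hsm l).continuous.continuousOn
      refine ⟨|C|, abs_nonneg _, fun x hx y hy => ?_⟩
      rw [show 2 - (k + 1 + 1) = 0 by omega, pow_zero, mul_one]
      exact (hC (x, y) ⟨hx, hy⟩).trans (le_abs_self _)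
  obtain ⟨R, hR0, hR⟩ := hρ.bounded D.isCompact_closure
  obtain ⟨Γ, hΓ1, hΓ⟩ := D.exists_gamma_le
  -- Both differences `2 - t` and `t - 2` are truncated, and `t + (2 - t) = (t - 2) + 2` in every
  -- case. The surplus `ρ^{t-2}`, present for `t > 2`, is bounded by `R^{t-2}`.
  refine ⟨(Γ ^ l.length * C) * R ^ (transversal l - 2), fun p hp => ?_⟩
  have hr := hρ.nonneg p.1 p.2
  have h1 := D.reg_subset_closure hp.1.1
  have h2 := D.reg_subset_closure hp.1.2
  calc _ ≤ (ρ p.1 p.2 ^ transversal l * Γ ^ l.length) * (C * ρ p.1 p.2 ^ (2 - transversal l)) :=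
        mul_le_mul (hρ.prod_kScale_le hΓ1 hΓ l hp) (hC _ h1 _ h2) (norm_nonneg _) (by positivity)
    _ = (Γ ^ l.length * C) * (ρ p.1 p.2 ^ (transversal l + (2 - transversal l))) := by ring
    _ = (Γ ^ l.length * C) * (ρ p.1 p.2 ^ (transversal l - 2) * ρ p.1 p.2 ^ 2) := by
        rw [← pow_add]; congr 2; omega
    _ ≤ (Γ ^ l.length * C) * (R ^ (transversal l - 2) * ρ p.1 p.2 ^ 2) := by
        gcongr
        exact hR _ h1 _ h2
    _ = _ := by ring

end RhoSq


/-! ### The functions of class `ξ` -/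

theorem lieD_real_comp {E : Type*} [NormedAddCommGroup E] [NormedSpace ℝ E] {H : Type*}
    [TopologicalSpace H] {I : ModelWithCorners ℝ E H} {N : Type*} [TopologicalSpace N]
    [ChartedSpace H N] {F : Type*} [NormedAddCommGroup F] [NormedSpace ℝ F]
    {Y : ∀ x : N, TangentSpace I x} {u : N → ℝ} {h : ℝ → F} {h' : F} {x : N}
    (hh : HasDerivAt h h' (u x)) (hu : MDifferentiableAt I 𝓘(ℝ, ℝ) u x) :
    lieD Y (fun y => h (u y)) x = lieD Y u x • h' := by
  have h2 := hh.hasFDerivAt.hasMFDerivAt.comp x hu.hasMFDerivAt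
  have h3 := h2.mfderiv
  simp only [lieD]
  have : (h ∘ u) = fun y => h (u y) := rfl
  rw [this] at h3
  rw [h3]
  rfl

section Xi

variable {n : ℕ} {M : Type*} [TopologicalSpace M] [ChartedSpace (Cn n) M]
  [IsManifold 𝓘(ℂ, Cn n) ω M]
  {F : Type*} [NormedAddCommGroup F] [NormedSpace ℝ F] {D : LeviDomain n M} {ρ : M → M → ℝ}

/-- Smooth vector fields as a family of vector fields. -/
def fld (Z : SmoothField n M) (x : M) : TangentSpace 𝓘(ℝ, Cn n) x := Z x

theorem fieldOn_fld (Z : SmoothField n M) (S : Set M) :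
    FieldOn (I := 𝓘(ℝ, Cn n)) ∞ (fld Z) S := Z.contMDiff.contMDiffOn

/-- Symbol estimates on `S` with scale `γ`. -/
def LeviDomain.XiOn (D : LeviDomain n M) (S : Set M) (φ : M → ℝ) (u : M → F) : Prop :=
  Symb S fld (fun _ : SmoothField n M => D.gamma) φ u

theorem prod_map_const (l : List (SmoothField n M)) (c : ℝ) :
    (l.map fun _ => c).prod = c ^ l.length := by
  simp

theorem LeviDomain.IsXi.xiOn {S : Set M} {u : M → F} (h : D.IsXi S 0 u) :
    D.XiOn S (fun _ => 1) u := by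
  refine ⟨h.1, fun l => ?_⟩
  obtain ⟨C, hC⟩ := h.2 l
  refine ⟨C, fun x hx => ?_⟩
  rw [prod_map_const]
  simpa using! hC x hx

variable [T2Space M] [SecondCountableTopology M]

theorem LeviDomain.gamma_pos_reg (D : LeviDomain n M) :
    ∀ _ : SmoothField n M, ∀ x ∈ D.reg, 0 < D.gamma x := fun _ _ hx => D.gamma_pos hx

/-- Derivatives are bounded on `K` and `γ` is bounded on the closure of `D`. Smoothness is asked
only on the neighbourhood `O` of `K`, as the fields and coefficients in question need not be defined
smoothly on all of `M`. -/
theorem LeviDomain.xiOn_of_smooth (D : LeviDomain n M) {O K T : Set M} (hO : IsOpen O)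
    (hK : IsCompact K) (hKO : K ⊆ O) (hTK : T ⊆ K) (hT : T ⊆ closure D.carrier) {u : M → F}
    (hu : ContMDiffOn 𝓘(ℝ, Cn n) 𝓘(ℝ, F) ∞ u O) : D.XiOn T (fun _ => 1) u := by
  refine ⟨hu.mono (hTK.trans hKO), fun l => ?_⟩
  obtain ⟨Γ, hΓ1, hΓ⟩ := D.exists_gamma_le
  obtain ⟨C, hC⟩ := hK.exists_bound_of_continuousOn
    ((iterD_smooth hO (fun Z => fieldOn_fld Z _) hu l).continuousOn.mono hKO)
  refine ⟨Γ ^ l.length * C, fun x hx => ?_⟩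
  rw [prod_map_const, mul_one]
  exact mul_le_mul (pow_le_pow_left₀ (D.gamma_nonneg x) (hΓ x (hT hx)) _) (hC x (hTK hx))
    (norm_nonneg _) (by positivity)

theorem LeviDomain.xiOn_reg_of_smooth (D : LeviDomain n M) {u : M → F}
    (hu : ContMDiff 𝓘(ℝ, Cn n) 𝓘(ℝ, F) ∞ u) : D.XiOn D.reg (fun _ => 1) u :=
  D.xiOn_of_smooth isOpen_univ D.isCompact_closure (subset_univ _) D.reg_subset_closure
    D.reg_subset_closure hu.contMDiffOn

theorem LeviDomain.exists_abs_lieD_r_le (D : LeviDomain n M) (Z : SmoothField n M) :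
    ∃ C : ℝ, 0 ≤ C ∧ ∀ x ∈ closure D.carrier, |dirDeriv D.r x (Z x)| ≤ C * D.gamma x := by
  have hg : Continuous fun x => √(D.metric.inner x (Z x) (Z x)) :=
    (contMDiffOn_univ.1 (D.metric_contMDiffOn (k := ∞) le_rfl (fieldOn_fld Z univ)
      (fieldOn_fld Z univ))).continuous.sqrt
  obtain ⟨C, hC⟩ := D.isCompact_closure.exists_bound_of_continuousOn hg.continuousOn
  refine ⟨2 * |C|, by positivity, fun x hx => (D.abs_dirDeriv_r_le x (Z x)).trans ?_⟩
  have h1 := (le_abs_self _).trans ((hC x hx).trans (le_abs_self C))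
  have := mul_le_mul_of_nonneg_left h1 (D.gamma_nonneg x)
  linarith

/-- Without further derivatives this is `|dr| ≲ γ`. As soon as there is one, plain boundedness
suffices, because the scales already provide a factor `γ`. -/
theorem LeviDomain.xiOn_lieD_r (D : LeviDomain n M) (Z : SmoothField n M) :
    D.XiOn D.reg D.gamma (lieD (fld Z) D.r) := by
  have hsm : ContMDiff 𝓘(ℝ, Cn n) 𝓘(ℝ, ℝ) ∞ (lieD (fld Z) D.r) :=
    contMDiffOn_univ.1 (lieD_smooth isOpen_univ (fieldOn_fld Z _) D.smooth_r.contMDiffOn)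
  refine ⟨hsm.contMDiffOn, fun l => ?_⟩
  rcases l with _ | ⟨Z', l⟩
  · obtain ⟨C, -, hC⟩ := D.exists_abs_lieD_r_le Z
    exact ⟨C, fun x hx => by simpa [lieD] using! hC x (D.reg_subset_closure hx)⟩
  · obtain ⟨Γ, hΓ1, hΓ⟩ := D.exists_gamma_le
    obtain ⟨C, hC⟩ := D.isCompact_closure.exists_bound_of_continuousOn
      ((iterD_smooth isOpen_univ (fun Z => fieldOn_fld Z _) hsm.contMDiffOn
        (Z' :: l)).continuousOn.mono (subset_univ (closure D.carrier)))
    refine ⟨Γ ^ l.length * C, fun x hx => ?_⟩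
    have hx' := D.reg_subset_closure hx
    have h0 := D.gamma_nonneg x
    rw [prod_map_const, List.length_cons, pow_succ]
    calc _ ≤ (Γ ^ l.length * D.gamma x) * C :=
          mul_le_mul (mul_le_mul_of_nonneg_right (pow_le_pow_left₀ h0 (hΓ x hx') _) h0)
            (hC x hx') (norm_nonneg _) (by positivity)
      _ = _ := by ring

theorem IsFrameOn.dirDeriv_eq {N : ℕ} {K : Set M} {φ : Fin N → M → ℝ} {Z : Fin N → SmoothField n M}
    (h : IsFrameOn K φ Z) {x : M} (hx : x ∈ K) (u : M → F) (v : Tan n x) :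
    dirDeriv u x v = ∑ j, dirDeriv (φ j) x v • dirDeriv u x (Z j x) := by
  let L : Cn n →L[ℝ] F := mfderiv 𝓘(ℝ, Cn n) 𝓘(ℝ, F) u x
  change L v = ∑ j, dirDeriv (φ j) x v • L (Z j x)
  conv_lhs => rw [h.eq_sum x hx v]
  erw [map_sum]
  exact Finset.sum_congr rfl fun j _ => L.map_smul _ _

/-- Expanding `grad r` in the frame, `4γ² = ∑ⱼ (grad φⱼ)(r) · Zⱼ r`: a sum of products of two
functions of class `ξ₁`. -/
theorem LeviDomain.xiOn_gammaSq (D : LeviDomain n M) :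
    D.XiOn D.reg (fun x => D.gamma x ^ 2) D.gammaSq := by
  obtain ⟨N, φ, Z, hZ⟩ := exists_frame (n := n) D.isCompact_closure
  have hY := fun Z : SmoothField n M => fieldOn_fld Z D.reg
  have h0 : ∀ x ∈ D.reg, 0 ≤ D.gamma x := fun x _ => D.gamma_nonneg x
  have key : ∀ j ∈ Finset.univ, D.XiOn D.reg (fun x => D.gamma x * D.gamma x) (fun x =>
      ((1 / 4 : ℝ) • ContinuousLinearMap.mul ℝ ℝ) (lieD (fld (D.gradField (hZ.smooth j))) D.r x)
        (lieD (fld (Z j)) D.r x)) := fun j _ =>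
    Symb.bilin _ D.isOpen_reg hY D.gamma_pos_reg h0 h0 (D.xiOn_lieD_r _) (D.xiOn_lieD_r _)
  have h := Symb.sum D.isOpen_reg hY D.gamma_pos_reg (fun x _ => mul_self_nonneg (D.gamma x)) key
  refine Symb.mono (h.congr D.isOpen_reg fun x hx => ?_) 1 (fun x _ => mul_self_nonneg _)
    fun x _ => by rw [one_mul, pow_two]
  rw [LeviDomain.gammaSq]
  rw [hZ.dirDeriv_eq (D.reg_subset_closure hx) D.r (D.grad D.r x), Finset.sum_div]
  refine Finset.sum_congr rfl fun j _ => ?_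
  -- By symmetry of the metric `dφⱼ(grad r) = dr(grad φⱼ)`, which exhibits the coefficient as a
  -- derivative of `r` along a smooth field.
  have h1 : dirDeriv (φ j) x (D.grad D.r x) = lieD (fld (D.gradField (hZ.smooth j))) D.r x := by
    rw [← D.inner_grad, D.metric.symm, D.inner_grad]
    rfl
  rw [h1]
  simp only [_root_.smul_apply, ContinuousLinearMap.mul_apply', smul_eq_mul]
  change _ * lieD (fld (Z j)) D.r x / 4 = _
  ring

theorem LeviDomain.gammaSq_pos (D : LeviDomain n M) {x : M} (hx : x ∈ D.reg) : 0 < D.gammaSq x := by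
  rw [← D.gamma_sq]; exact pow_pos (D.gamma_pos hx) 2

/-- From `Z(γ⁻¹) = -½ γ⁻³ Z(γ²)` the estimates of order `k + 1` follow from those of order `k` and
from the class of `γ²`. The inverse comes before `γ` itself because its recursion involves only
`γ⁻¹` and `γ²`. -/
theorem LeviDomain.xiOn_gamma_inv (D : LeviDomain n M) :
    D.XiOn D.reg (fun x => (D.gamma x)⁻¹) (fun x => (D.gamma x)⁻¹) := by
  have hY := fun Z : SmoothField n M => fieldOn_fld Z D.reg
  have h0 : ∀ x ∈ D.reg, 0 ≤ (D.gamma x)⁻¹ := fun x _ => inv_nonneg.2 (D.gamma_nonneg x)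
  have heq : (fun x => (D.gamma x)⁻¹) = fun x => (√(D.gammaSq x))⁻¹ := by
    ext x; rw [D.gamma_eq]
  have hsm : ContMDiffOn 𝓘(ℝ, Cn n) 𝓘(ℝ, ℝ) ∞ (fun x => (D.gamma x)⁻¹) D.reg := by
    rw [heq]
    intro x hx
    have h1 : ContDiffAt ℝ ∞ (fun t : ℝ => (√t)⁻¹) (D.gammaSq x) :=
      (Real.contDiffAt_sqrt (D.gammaSq_pos hx).ne').inv
        (Real.sqrt_pos.2 (D.gammaSq_pos hx)).ne'
    exact (h1.contMDiffAt.comp x (D.gammaSq_smooth x)).contMDiffWithinAt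
  have hder : ∀ Z : SmoothField n M, EqOn (lieD (fld Z) fun x => (D.gamma x)⁻¹)
      (fun x => ((-(1 / 2) : ℝ) • ContinuousLinearMap.mul ℝ ℝ) (((ContinuousLinearMap.mul ℝ ℝ)
        ((D.gamma x)⁻¹)) (((ContinuousLinearMap.mul ℝ ℝ) ((D.gamma x)⁻¹)) ((D.gamma x)⁻¹)))
        (lieD (fld Z) D.gammaSq x)) D.reg := by
    intro Z x hx
    have hq := D.gammaSq_pos hx
    have hs := Real.sqrt_pos.2 hq
    have h1 := (Real.hasDerivAt_sqrt hq.ne').inv hs.ne'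
    rw [heq, lieD_real_comp (h := fun t => (√t)⁻¹) h1
      (D.gammaSq_smooth.mdifferentiableAt (by simp))]
    simp only [_root_.smul_apply, ContinuousLinearMap.mul_apply', smul_eq_mul]
    rw [D.gamma_eq]
    field_simp
  refine ⟨hsm, fun l => ?_⟩
  suffices H : ∀ k, SymbLe k D.reg fld (fun _ : SmoothField n M => D.gamma)
      (fun x => (D.gamma x)⁻¹) (fun x => (D.gamma x)⁻¹) from (H l.length).2 l le_rfl
  intro k
  have hb : ∃ C : ℝ, ∀ x ∈ D.reg, ‖(D.gamma x)⁻¹‖ ≤ C * (D.gamma x)⁻¹ :=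
    ⟨1, fun x hx => by rw [one_mul, Real.norm_of_nonneg (h0 x hx)]⟩
  induction k with
  | zero =>
    refine ⟨hsm, fun l hl => ?_⟩
    obtain rfl : l = [] := List.length_eq_zero_iff.1 (by simpa using hl)
    simpa using hb
  | succ k ih =>
    refine symbLe_of_lieD hsm D.gamma_pos_reg hb fun Z => ?_
    have h2 := SymbLe.bilin (ContinuousLinearMap.mul ℝ ℝ) D.isOpen_reg hY D.gamma_pos_reg h0 h0
      ih ih
    have h00 := fun x hx => mul_nonneg (h0 x hx) (h0 x hx)
    have h3 := SymbLe.bilin (ContinuousLinearMap.mul ℝ ℝ) D.isOpen_reg hY D.gamma_pos_reg h0 h00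
      ih h2
    have h4 := (D.xiOn_gammaSq.lieD D.isOpen_reg hY D.gamma_pos_reg Z).symbLe k
    have h5 := SymbLe.bilin ((-(1 / 2) : ℝ) • ContinuousLinearMap.mul ℝ ℝ) D.isOpen_reg hY
      D.gamma_pos_reg (fun x hx => mul_nonneg (h0 x hx) (h00 x hx))
      (fun x hx => div_nonneg (sq_nonneg _) (D.gamma_nonneg x)) h3 h4
    -- The weights match: `γ⁻³` times the weight `γ²/γ` of `Z(γ²)` is `γ⁻¹/γ`, one derivative of a
    -- function of weight `γ⁻¹`.
    have h6 := h5.congr_weight (ψ := fun x => (D.gamma x)⁻¹ / D.gamma x) fun x hx => by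
      have := D.gamma_pos hx
      field_simp
    refine ⟨lieD_smooth D.isOpen_reg (hY Z) hsm, fun l hl => ?_⟩
    obtain ⟨C, hC⟩ := h6.2 l hl
    refine ⟨C, fun x hx => ?_⟩
    rw [iterD_congr D.isOpen_reg (hder Z) l hx]
    exact hC x hx

theorem LeviDomain.xiOn_gamma (D : LeviDomain n M) : D.XiOn D.reg D.gamma D.gamma := by
  have hY := fun Z : SmoothField n M => fieldOn_fld Z D.reg
  have h := Symb.bilin (ContinuousLinearMap.mul ℝ ℝ) D.isOpen_reg hY D.gamma_pos_reg
    (fun x _ => sq_nonneg _) (fun x _ => inv_nonneg.2 (D.gamma_nonneg x)) D.xiOn_gammaSq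
    D.xiOn_gamma_inv
  have h0 : ∀ x ∈ D.reg, D.gamma x ^ 2 * (D.gamma x)⁻¹ = D.gamma x := fun x hx => by
    have := D.gamma_pos hx
    field_simp
  refine (h.congr D.isOpen_reg fun x hx => ?_).mono 1 (fun x hx => ?_) fun x hx => ?_
  · rw [ContinuousLinearMap.mul_apply', ← D.gamma_sq, h0 x hx]
  · rw [h0 x hx]; exact D.gamma_nonneg x
  · rw [h0 x hx, one_mul]

theorem LeviDomain.gamma_smoothOn (D : LeviDomain n M) :
    ContMDiffOn 𝓘(ℝ, Cn n) 𝓘(ℝ, ℝ) ∞ D.gamma D.reg := D.xiOn_gamma.1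

end Xi


/-! ### Paths inside a sublevel set -/

section Paths

variable {E : Type*} [NormedAddCommGroup E] [NormedSpace ℝ E]

/-- The path from `a` to `a + w` that is bent in the direction `ν`. -/
def bentPath (a w ν : E) (t : ℝ) : E := a + t • w + (t * (1 - t) * ‖w‖) • ν

theorem bentPath_zero (a w ν : E) : bentPath a w ν 0 = a := by simp [bentPath]

theorem bentPath_one (a w ν : E) : bentPath a w ν 1 = a + w := by simp [bentPath]

theorem bentPath_hasDerivAt (a w ν : E) (t : ℝ) :
    HasDerivAt (bentPath a w ν) (w + ((1 - 2 * t) * ‖w‖) • ν) t := by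
  have h1 : HasDerivAt (fun t : ℝ => t * (1 - t) * ‖w‖) ((1 - 2 * t) * ‖w‖) t := by
    have := (((hasDerivAt_id t).mul ((hasDerivAt_const t (1 : ℝ)).sub (hasDerivAt_id t)))).mul_const
      ‖w‖
    convert! this using 1
    simp only [id, Pi.sub_apply]
    ring
  have h2 := ((hasDerivAt_id t).smul_const w).const_add a
  convert! h2.add (h1.smul_const ν) using 1
  simp

theorem bentPath_deriv_norm_le {w ν : E} (hν : ‖ν‖ ≤ 1) {t : ℝ} (ht : t ∈ Icc (0 : ℝ) 1) :
    ‖w + ((1 - 2 * t) * ‖w‖) • ν‖ ≤ 2 * ‖w‖ := by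
  have h1 : |1 - 2 * t| ≤ 1 := abs_le.2 ⟨by linarith [ht.2], by linarith [ht.1]⟩
  calc _ ≤ ‖w‖ + ‖((1 - 2 * t) * ‖w‖) • ν‖ := norm_add_le _ _
    _ = ‖w‖ + |1 - 2 * t| * ‖w‖ * ‖ν‖ := by
        rw [norm_smul, Real.norm_eq_abs, abs_mul, abs_norm]
    _ ≤ ‖w‖ + 1 * ‖w‖ * 1 := by gcongr
    _ = _ := by ring

theorem bentPath_sub_norm_le {a w ν : E} (hν : ‖ν‖ ≤ 1) {t : ℝ} (ht : t ∈ Icc (0 : ℝ) 1) :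
    ‖bentPath a w ν t - a‖ ≤ 2 * ‖w‖ := by
  have h0 : bentPath a w ν t - a = t • w + (t * (1 - t) * ‖w‖) • ν := by
    rw [bentPath]; abel
  have h1 : 0 ≤ t * (1 - t) := mul_nonneg ht.1 (by linarith [ht.2])
  have h2 : t * (1 - t) ≤ 1 := mul_le_one₀ ht.2 (by linarith [ht.2]) (by linarith [ht.1])
  rw [h0]
  calc _ ≤ ‖t • w‖ + ‖(t * (1 - t) * ‖w‖) • ν‖ := norm_add_le _ _
    _ = t * ‖w‖ + t * (1 - t) * ‖w‖ * ‖ν‖ := by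
        rw [norm_smul, norm_smul, Real.norm_of_nonneg ht.1,
          Real.norm_of_nonneg (mul_nonneg h1 (norm_nonneg _))]
    _ ≤ 1 * ‖w‖ + 1 * ‖w‖ * 1 := by
        have := ht.2
        gcongr
    _ = _ := by ring

/-- If `r` is negative at two points whose distance is small compared with `|dr|`, then it is
negative on a bent path between them. -/
theorem neg_on_bentPath {c : E} {ε : ℝ} {r : E → ℝ} {L : ℝ}
    (hr : ContDiffOn ℝ 2 r (Metric.ball c ε))
    (hL : ∀ x ∈ Metric.ball c ε, ‖fderiv ℝ (fderiv ℝ r) x‖ ≤ L) {a w ν : E}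
    (ha : a ∈ Metric.ball c (ε / 3)) (hw : ‖w‖ < ε / 3) (hν : ‖ν‖ ≤ 1)
    (hdr : fderiv ℝ r a ν ≤ -(1 / 2) * ‖fderiv ℝ r a‖) (hsmall : 8 * L * ‖w‖ ≤ ‖fderiv ℝ r a‖)
    (h0 : r a < 0) (h1 : r (a + w) < 0) :
    ∀ t ∈ Icc (0 : ℝ) 1, bentPath a w ν t ∈ Metric.ball c ε ∧ r (bentPath a w ν t) < 0 ∧
      (1 / 2) * ‖fderiv ℝ r a‖ ≤ ‖fderiv ℝ r (bentPath a w ν t)‖ := by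
  have hab : a ∈ Metric.ball c ε := by
    rw [Metric.mem_ball] at ha ⊢
    have := dist_nonneg (x := a) (y := c)
    linarith
  have hL0 : 0 ≤ L := le_trans (norm_nonneg (fderiv ℝ (fderiv ℝ r) a)) (hL a hab)
  have hball : ∀ t ∈ Icc (0 : ℝ) 1, bentPath a w ν t ∈ Metric.ball c ε := by
    intro t ht
    have h2 := bentPath_sub_norm_le (a := a) (w := w) hν ht
    rw [Metric.mem_ball, dist_eq_norm] at ha ⊢
    calc _ ≤ ‖bentPath a w ν t - a‖ + ‖a - c‖ := norm_sub_le_norm_sub_add_norm_sub _ _ _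
      _ < ε := by linarith
  have hd1 : ∀ x ∈ Metric.ball c ε, HasFDerivAt r (fderiv ℝ r x) x := fun x hx =>
    ((hr.contDiffAt (Metric.isOpen_ball.mem_nhds hx)).differentiableAt (by simp)).hasFDerivAt
  have hd2 : ∀ x ∈ Metric.ball c ε,
      HasFDerivAt (fderiv ℝ r) (fderiv ℝ (fderiv ℝ r) x) x := fun x hx =>
    (((hr.contDiffAt (Metric.isOpen_ball.mem_nhds hx)).fderiv_right (m := 1)
      (by norm_num)).differentiableAt (by simp)).hasFDerivAt
  have hlip : ∀ x ∈ Metric.ball c ε, ‖fderiv ℝ r x - fderiv ℝ r a‖ ≤ L * ‖x - a‖ := fun x hx =>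
    (convex_ball c ε).norm_image_sub_le_of_norm_hasFDerivWithin_le (𝕜 := ℝ)
      (fun y hy => (hd2 y hy).hasFDerivWithinAt) hL hab hx
  have hclose : ∀ t ∈ Icc (0 : ℝ) 1,
      ‖fderiv ℝ r (bentPath a w ν t) - fderiv ℝ r a‖ ≤ 2 * L * ‖w‖ := fun t ht => by
    have := mul_le_mul_of_nonneg_left (bentPath_sub_norm_le (a := a) (w := w) hν ht) hL0
    linarith [hlip _ (hball t ht)]
  have hg1 : ∀ t ∈ Icc (0 : ℝ) 1, HasDerivAt (fun t => r (bentPath a w ν t))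
      (fderiv ℝ r (bentPath a w ν t) (w + ((1 - 2 * t) * ‖w‖) • ν)) t := fun t ht =>
    (hd1 _ (hball t ht)).comp_hasDerivAt t (bentPath_hasDerivAt a w ν t)
  have hp2 : ∀ t : ℝ, HasDerivAt (fun t : ℝ => w + ((1 - 2 * t) * ‖w‖) • ν)
      ((-2 * ‖w‖) • ν) t := by
    intro t
    have h3 : HasDerivAt (fun t : ℝ => (1 - 2 * t) * ‖w‖) (-2 * ‖w‖) t := by
      have := (((hasDerivAt_id t).const_mul 2).const_sub 1).mul_const ‖w‖
      simpa using this
    exact (h3.smul_const ν).const_add w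
  have hg2 : ∀ t ∈ Icc (0 : ℝ) 1, HasDerivAt
      (fun t => fderiv ℝ r (bentPath a w ν t) (w + ((1 - 2 * t) * ‖w‖) • ν))
      (fderiv ℝ (fderiv ℝ r) (bentPath a w ν t) (w + ((1 - 2 * t) * ‖w‖) • ν)
        (w + ((1 - 2 * t) * ‖w‖) • ν) + fderiv ℝ r (bentPath a w ν t) ((-2 * ‖w‖) • ν)) t :=
    fun t ht => ((hd2 _ (hball t ht)).comp_hasDerivAt t (bentPath_hasDerivAt a w ν t)).clm_apply
      (hp2 t)
  -- The second derivative of `r` along the path is at least `-4L|w|²` from the Hessian plus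
  -- `|w||dr(a)| - 4L|w|²` from the bending, that is `|w|(|dr(a)| - 8L|w|)`. This is where the
  -- constant in `hsmall` comes from.
  have hnn : ∀ t ∈ Icc (0 : ℝ) 1,
      0 ≤ fderiv ℝ (fderiv ℝ r) (bentPath a w ν t) (w + ((1 - 2 * t) * ‖w‖) • ν)
        (w + ((1 - 2 * t) * ‖w‖) • ν) + fderiv ℝ r (bentPath a w ν t) ((-2 * ‖w‖) • ν) := by
    intro t ht
    have e1 : -(L * (2 * ‖w‖) * (2 * ‖w‖)) ≤ fderiv ℝ (fderiv ℝ r) (bentPath a w ν t)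
        (w + ((1 - 2 * t) * ‖w‖) • ν) (w + ((1 - 2 * t) * ‖w‖) • ν) := by
      refine neg_le_of_abs_le ?_
      rw [← Real.norm_eq_abs]
      have h3 := bentPath_deriv_norm_le (w := w) hν ht
      refine ((fderiv ℝ (fderiv ℝ r) (bentPath a w ν t)).le_opNorm₂ _ _).trans ?_
      have := hL _ (hball t ht)
      gcongr
    have e2 : fderiv ℝ r (bentPath a w ν t) ν ≤ -(1 / 2) * ‖fderiv ℝ r a‖ + 2 * L * ‖w‖ := by
      have h3 := (fderiv ℝ r (bentPath a w ν t) - fderiv ℝ r a).le_opNorm ν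
      have h4 : ‖fderiv ℝ r (bentPath a w ν t) - fderiv ℝ r a‖ * ‖ν‖ ≤ 2 * L * ‖w‖ * 1 :=
        mul_le_mul (hclose t ht) hν (norm_nonneg _) (by positivity)
      have h5 := (le_abs_self _).trans ((Real.norm_eq_abs _ ▸ h3).trans h4)
      rw [_root_.sub_apply] at h5
      linarith
    rw [map_smul, smul_eq_mul]
    have hw0 := norm_nonneg w
    nlinarith
  -- A convex function that is negative at both ends of an interval is negative in between.
  have hconv : ConvexOn ℝ (Icc (0 : ℝ) 1) fun t => r (bentPath a w ν t) := by
    refine convexOn_of_hasDerivWithinAt2_nonneg (convex_Icc 0 1)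
      (fun t ht => (hg1 t ht).continuousAt.continuousWithinAt)
      (fun t ht => (hg1 t (interior_subset ht)).hasDerivWithinAt)
      (fun t ht => (hg2 t (interior_subset ht)).hasDerivWithinAt)
      (fun t ht => hnn t (interior_subset ht))
  intro t ht
  refine ⟨hball t ht, ?_, ?_⟩
  · have h3 := hconv.2 (left_mem_Icc.2 zero_le_one) (right_mem_Icc.2 zero_le_one)
      (show 0 ≤ 1 - t by linarith [ht.2]) ht.1 (by ring)
    simp only [smul_eq_mul, mul_zero, mul_one, zero_add, bentPath_zero, bentPath_one] at h3
    rcases ht.1.eq_or_lt with h | h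
    · rw [← h, bentPath_zero]; exact h0
    · nlinarith [ht.2, mul_nonneg (show 0 ≤ 1 - t by linarith [ht.2]) (neg_nonneg.2 h0.le),
        mul_pos h (neg_pos.2 h1)]
  · have h3 : ‖fderiv ℝ r a‖ - ‖fderiv ℝ r (bentPath a w ν t)‖ ≤
        ‖fderiv ℝ r (bentPath a w ν t) - fderiv ℝ r a‖ := by
      rw [norm_sub_rev]
      exact norm_sub_norm_le _ _
    have := hclose t ht
    have h4 : 0 ≤ ‖fderiv ℝ r a‖ := norm_nonneg _
    linarith

/-- The factor `1/2` avoids the question whether the norm is attained. -/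
theorem exists_descent (ℓ : E →L[ℝ] ℝ) : ∃ ν : E, ‖ν‖ ≤ 1 ∧ ℓ ν ≤ -(1 / 2) * ‖ℓ‖ := by
  by_cases h : ‖ℓ‖ = 0
  · exact ⟨0, by simp, by simp [h]⟩
  obtain ⟨v, hv, hlt⟩ := ℓ.exists_lt_apply_of_lt_opNorm (r := ‖ℓ‖ / 2)
    (half_lt_self (lt_of_le_of_ne (norm_nonneg _) (Ne.symm h)))
  rw [Real.norm_eq_abs] at hlt
  rcases abs_cases (ℓ v) with h1 | h1
  · exact ⟨-v, by rw [norm_neg]; exact hv.le, by rw [map_neg]; linarith⟩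
  · exact ⟨v, hv.le, by linarith⟩

end Paths

/-! ### Comparison of `γ` with the norm of `dr` in charts -/

section Compare

variable {n : ℕ} {M : Type*} [TopologicalSpace M] [ChartedSpace (Cn n) M]
  [IsManifold 𝓘(ℂ, Cn n) ω M]
  {F : Type*} [NormedAddCommGroup F] [NormedSpace ℝ F] {D : LeviDomain n M} {ρ : M → M → ℝ}

/-- A function on `M` read in the chart at `p`. -/
abbrev inChart (p : M) (u : M → F) : Cn n → F := u ∘ (chartAt (Cn n) p).symm

/-- In the chart `4γ² = ℓ(G⁻¹ ℓ)`, with `ℓ` the differential of `r` and `G` the Gram operator, and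
both `G` and `G⁻¹` are locally bounded. -/
theorem LeviDomain.gamma_compare (D : LeviDomain n M) (p : M) :
    ∃ C : ℝ, 0 < C ∧ ∃ U ∈ 𝓝 p, U ⊆ (chartAt (Cn n) p).source ∧ ∀ x ∈ U,
      D.gamma x ≤ C * ‖fderiv ℝ (inChart p D.r) (chartAt (Cn n) p x)‖ ∧
      ‖fderiv ℝ (inChart p D.r) (chartAt (Cn n) p x)‖ ≤ C * D.gamma x := by
  have hp := mem_chart_source (Cn n) p
  have hsrc := (chartAt (Cn n) p).open_source.mem_nhds hp
  have hG : ContinuousAt (D.gramOp p) p := (D.gramOp_contMDiffOn p).continuousOn.continuousAt hsrc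
  have hGi : ContinuousAt (fun x => Ring.inverse (D.gramOp p x)) p := by
    obtain ⟨u, hu⟩ := D.isUnit_gramOp hp
    refine ContinuousAt.comp (g := Ring.inverse) ?_ hG
    rw [← hu]
    exact NormedRing.inverse_continuousAt u
  have e1 := hG.norm.eventually (gt_mem_nhds (lt_add_one _))
  have e2 := hGi.norm.eventually (gt_mem_nhds (lt_add_one _))
  set A := ‖D.gramOp p p‖ + 1
  set B := ‖Ring.inverse (D.gramOp p p)‖ + 1
  have hA : 0 < A := by positivity
  have hB : 0 < B := by positivity
  -- The first inequality holds with `B + 1`, the second with `2(A + 1)`; a common constant is `B +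
  -- 2A + 1` since `B ≥ 1`.
  refine ⟨B + 2 * A + 1, by positivity, _, Filter.inter_mem hsrc (Filter.inter_mem e1 e2),
    inter_subset_left, fun x ⟨hx, (h1 : ‖_‖ < A), (h2 : ‖_‖ < B)⟩ => ?_⟩
  set ℓ := fderiv ℝ (inChart p D.r) (chartAt (Cn n) p x) with hℓ
  have hg := D.gamma_nonneg x
  have hdr : ∀ w : Cn n, dirDeriv D.r x (chartDinv p x w) = ℓ w := fun w =>
    dirDeriv_chartDinv hx (D.r_mdiff x) w
  constructor
  · set u := chartD p x (D.grad D.r x) with hu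
    have hGu : ∀ w, inner ℝ (D.gramOp p x u) w = ℓ w := fun w => by
      rw [D.inner_gramOp, hu, chartDinv_chartD hx, D.inner_grad, hdr]
    have hGn : ‖D.gramOp p x u‖ ≤ ‖ℓ‖ := by
      by_cases h0 : ‖D.gramOp p x u‖ = 0
      · rw [h0]; positivity
      have h3 := hGu (D.gramOp p x u)
      rw [real_inner_self_eq_norm_sq] at h3
      have h4 := (le_abs_self _).trans (ℓ.le_opNorm (D.gramOp p x u))
      rw [← h3, pow_two] at h4
      exact le_of_mul_le_mul_right h4 (lt_of_le_of_ne (norm_nonneg _) (Ne.symm h0))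
    have hun : ‖u‖ ≤ B * ‖ℓ‖ := by
      have h3 : Ring.inverse (D.gramOp p x) (D.gramOp p x u) = u := by
        have := Ring.inverse_mul_cancel _ (D.isUnit_gramOp hx)
        exact congr($this u)
      calc ‖u‖ = ‖Ring.inverse (D.gramOp p x) (D.gramOp p x u)‖ := by rw [h3]
        _ ≤ ‖Ring.inverse (D.gramOp p x)‖ * ‖D.gramOp p x u‖ := ContinuousLinearMap.le_opNorm _ _
        _ ≤ _ := by gcongr
    have h5 : 4 * D.gamma x ^ 2 = ℓ u := by
      rw [D.gamma_sq, LeviDomain.gammaSq, hu, ← hdr, chartDinv_chartD hx]; ring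
    have h6 := (le_abs_self _).trans (ℓ.le_opNorm u)
    have h7 : 4 * D.gamma x ^ 2 ≤ B * ‖ℓ‖ ^ 2 := by
      rw [h5]
      refine h6.trans ?_
      have := mul_le_mul_of_nonneg_left hun (norm_nonneg ℓ)
      linarith
    have hℓ0 := norm_nonneg ℓ
    have h8 : D.gamma x ^ 2 ≤ ((B + 1) * ‖ℓ‖) ^ 2 := by
      nlinarith [sq_nonneg ‖ℓ‖, mul_nonneg hB.le (sq_nonneg ‖ℓ‖),
        mul_nonneg (mul_nonneg hB.le hB.le) (sq_nonneg ‖ℓ‖)]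
    have h9 := abs_le_of_sq_le_sq h8 (by positivity)
    refine (le_abs_self _).trans (h9.trans (mul_le_mul_of_nonneg_right (by linarith) hℓ0))
  · refine ContinuousLinearMap.opNorm_le_bound _ (by positivity) fun w => ?_
    have h3 := D.abs_dirDeriv_r_le x (chartDinv p x w)
    rw [hdr, ← D.inner_gramOp] at h3
    have h4 : inner ℝ (D.gramOp p x w) w ≤ ((A + 1) * ‖w‖) ^ 2 := by
      have h5 := (real_inner_le_norm (D.gramOp p x w) w).trans
        (mul_le_mul_of_nonneg_right ((D.gramOp p x).le_opNorm w) (norm_nonneg w))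
      have h6 : ‖D.gramOp p x‖ * ‖w‖ * ‖w‖ ≤ A * ‖w‖ * ‖w‖ := by gcongr
      nlinarith [sq_nonneg ‖w‖, mul_nonneg hA.le (sq_nonneg ‖w‖),
        mul_nonneg (mul_nonneg hA.le hA.le) (sq_nonneg ‖w‖)]
    have h5 := Real.sqrt_le_sqrt h4
    rw [Real.sqrt_sq (by positivity)] at h5
    rw [Real.norm_eq_abs]
    refine h3.trans ?_
    have h6 := mul_le_mul_of_nonneg_left h5 (show 0 ≤ 2 * D.gamma x by positivity)
    have hB1 : 1 ≤ B := by simp [B]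
    have h7 : 0 ≤ D.gamma x * ‖w‖ := by positivity
    have h8 := mul_le_mul_of_nonneg_right hB1 h7
    linarith

end Compare


/-! ### Differences of functions of class `ξ` -/

section Differences

variable {n : ℕ} {M : Type*} [TopologicalSpace M] [ChartedSpace (Cn n) M]
  [IsManifold 𝓘(ℂ, Cn n) ω M] [T2Space M] [SecondCountableTopology M]
  {F : Type*} [NormedAddCommGroup F] [NormedSpace ℝ F] {D : LeviDomain n M} {ρ : M → M → ℝ}

theorem inChart_contDiffAt {p x : M} {u : M → F} {k : ℕ∞ω}
    (hx : x ∈ (chartAt (Cn n) p).source) (hu : ContMDiffAt 𝓘(ℝ, Cn n) 𝓘(ℝ, F) k u x) :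
    ContDiffAt ℝ k (inChart p u) (chartAt (Cn n) p x) := by
  rw [← contMDiffAt_iff_contDiffAt]
  refine ContMDiffAt.comp _ ?_ (contMDiffOn_chart_symm.contMDiffAt
    ((chartAt (Cn n) p).open_target.mem_nhds ((chartAt (Cn n) p).map_source hx)))
  rwa [(chartAt (Cn n) p).left_inv hx]

theorem inChart_apply {p x : M} (hx : x ∈ (chartAt (Cn n) p).source) (u : M → F) :
    inChart p u (chartAt (Cn n) p x) = u x := by
  simp [inChart, (chartAt (Cn n) p).left_inv hx]

/-- `γ(ζ) ≲ γ(z) + ρ(ζ, z)`. -/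
theorem LeviDomain.IsDistanceFunction.gamma_le (hρ : D.IsDistanceFunction ρ) :
    ∃ C : ℝ, 1 ≤ C ∧ ∀ x ∈ closure D.carrier, ∀ y ∈ closure D.carrier,
      D.gamma x ≤ C * (D.gamma y + ρ x y) := by
  obtain ⟨Γ, hΓ1, hΓ⟩ := D.exists_gamma_le
  have hnn : ∀ x y, 0 ≤ D.gamma y + ρ x y := fun x y => add_nonneg (D.gamma_nonneg y)
    (hρ.nonneg x y)
  -- Near the diagonal, `γ` is comparable to `|dr|` in a chart, which is Lipschitz for the chart
  -- distance and hence for `ρ`. Away from it, `ρ` alone dominates the bounded function `γ`.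
  obtain ⟨δ, hδ, C, hC0, hC⟩ := hρ.local_to_near D.isCompact_closure subset_rfl
    (f := fun x _ => D.gamma x) (g := fun x y => D.gamma y + ρ x y) (fun x _ y _ => hnn x y) (by
      intro p _
      have hp := mem_chart_source (Cn n) p
      obtain ⟨A, hA, U, hU, hUs, hUA⟩ := D.gamma_compare p
      obtain ⟨C₁, hC₁, V, hV, -, hVC⟩ := hρ.chart_le p
      obtain ⟨L, t, ht, hL⟩ := ((inChart_contDiffAt hp (D.smooth_r p)).fderiv_right (m := 1)
        (by norm_cast)).exists_lipschitzOnWith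
      refine ⟨U ∩ V ∩ chartAt (Cn n) p ⁻¹' t, Filter.inter_mem (Filter.inter_mem hU hV)
        ((chartAt (Cn n) p).continuousAt hp ht), A * (A + L * C₁), fun x hx y hy => ?_⟩
      have h1 := (hUA x hx.1.1.1).1
      have h2 := (hUA y hy.1.1.1).2
      have h3 := hL.dist_le_mul _ hx.1.2 _ hy.1.2
      rw [dist_eq_norm, dist_eq_norm] at h3
      have h4 := hVC x hx.1.1.2 y hy.1.1.2
      have h5 : ‖fderiv ℝ (inChart p D.r) (chartAt (Cn n) p x)‖ -
          ‖fderiv ℝ (inChart p D.r) (chartAt (Cn n) p y)‖ ≤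
          ‖fderiv ℝ (inChart p D.r) (chartAt (Cn n) p x) -
            fderiv ℝ (inChart p D.r) (chartAt (Cn n) p y)‖ := norm_sub_norm_le _ _
      have h6 : (L : ℝ) * ‖chartAt (Cn n) p x - chartAt (Cn n) p y‖ ≤ L * (C₁ * ρ x y) :=
        mul_le_mul_of_nonneg_left h4 L.2
      have h7 : ‖fderiv ℝ (inChart p D.r) (chartAt (Cn n) p x)‖ ≤
          A * D.gamma y + L * (C₁ * ρ x y) := by
        linarith [h5.trans h3]
      have h8 : A * D.gamma y + L * (C₁ * ρ x y) ≤ (A + L * C₁) * (D.gamma y + ρ x y) := by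
        have e1 : 0 ≤ A * ρ x y := mul_nonneg hA.le (hρ.nonneg x y)
        have e2 : 0 ≤ L * C₁ * D.gamma y :=
          mul_nonneg (mul_nonneg L.2 hC₁.le) (D.gamma_nonneg y)
        nlinarith
      calc D.gamma x ≤ _ := h1
        _ ≤ A * ((A + L * C₁) * (D.gamma y + ρ x y)) :=
          mul_le_mul_of_nonneg_left (h7.trans h8) hA.le
        _ = _ := by ring)
  refine ⟨C + Γ / δ + 1, by have : 0 ≤ Γ / δ := by positivity
                            linarith, fun x hx y hy => ?_⟩
  have h0 : 0 ≤ Γ / δ := by positivity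
  rcases lt_or_ge (ρ x y) δ with h | h
  · exact (hC x hx y hy h).trans (mul_le_mul_of_nonneg_right (by linarith) (hnn x y))
  · calc D.gamma x ≤ Γ := hΓ x hx
      _ = Γ / δ * δ := by field_simp
      _ ≤ Γ / δ * (D.gamma y + ρ x y) := by
          have := D.gamma_nonneg y
          gcongr
          linarith
      _ ≤ _ := mul_le_mul_of_nonneg_right (by linarith) (hnn x y)

/-- The hypothesis gives one constant for each field; expanding a coordinate vector in the global
frame yields a single constant for all coordinate directions near `p`. -/
theorem LeviDomain.exists_norm_dirDeriv_le (D : LeviDomain n M) {h : M → F} {L : ℕ}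
    (hZ : ∀ Z : SmoothField n M, ∃ C : ℝ, ∀ x ∈ D.reg,
      D.gamma x ^ L * ‖dirDeriv h x (Z x)‖ ≤ C) (p : M) :
    ∃ C : ℝ, 0 ≤ C ∧ ∃ U ∈ 𝓝 p, U ⊆ (chartAt (Cn n) p).source ∧ ∀ x ∈ U ∩ D.reg, ∀ w : Cn n,
      D.gamma x ^ L * ‖dirDeriv h x (chartDinv p x w)‖ ≤ C * ‖w‖ := by
  obtain ⟨N, φ, Z, hZφ⟩ := exists_frame (n := n) D.isCompact_closure
  have hp := mem_chart_source (Cn n) p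
  choose C hC using fun j => hZ (Z j)
  have hc : ∀ j, ∀ᶠ x in 𝓝 p, ‖fderiv ℝ (inChart p (φ j)) (chartAt (Cn n) p x)‖ <
      ‖fderiv ℝ (inChart p (φ j)) (chartAt (Cn n) p p)‖ + 1 := fun j => by
    have h1 : ContinuousAt (fderiv ℝ (inChart p (φ j))) (chartAt (Cn n) p p) :=
      ((inChart_contDiffAt hp (hZφ.smooth j p)).fderiv_right (m := 0) (by norm_cast)).continuousAt
    have h2 := (h1.comp (f := chartAt (Cn n) p) ((chartAt (Cn n) p).continuousAt hp)).norm
    exact h2.eventually (gt_mem_nhds (lt_add_one _))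
  refine ⟨∑ j, (‖fderiv ℝ (inChart p (φ j)) (chartAt (Cn n) p p)‖ + 1) * |C j|,
    Finset.sum_nonneg fun j _ => by positivity, _,
    Filter.inter_mem ((chartAt (Cn n) p).open_source.mem_nhds hp) (Filter.eventually_all.2 hc),
    inter_subset_left, ?_⟩
  rintro x ⟨⟨hx, hx'⟩, hxr⟩ w
  rw [hZφ.dirDeriv_eq (D.reg_subset_closure hxr), Finset.sum_mul]
  have h0 := pow_nonneg (D.gamma_nonneg x) L
  calc _ ≤ D.gamma x ^ L * ∑ j, ‖dirDeriv (φ j) x (chartDinv p x w) • dirDeriv h x (Z j x)‖ :=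
        mul_le_mul_of_nonneg_left (norm_sum_le _ _) h0
    _ = ∑ j, |dirDeriv (φ j) x (chartDinv p x w)| *
        (D.gamma x ^ L * ‖dirDeriv h x (Z j x)‖) := by
        rw [Finset.mul_sum]
        refine Finset.sum_congr rfl fun j _ => ?_
        rw [norm_smul, Real.norm_eq_abs]; ring
    _ ≤ _ := by
        refine Finset.sum_le_sum fun j _ => ?_
        have h1 : |dirDeriv (φ j) x (chartDinv p x w)| ≤
            (‖fderiv ℝ (inChart p (φ j)) (chartAt (Cn n) p p)‖ + 1) * ‖w‖ := by
          rw [dirDeriv_chartDinv hx ((hZφ.smooth j).mdifferentiableAt (by simp)),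
            ← Real.norm_eq_abs]
          refine (ContinuousLinearMap.le_opNorm _ _).trans ?_
          exact mul_le_mul_of_nonneg_right (le_of_lt (hx' j)) (norm_nonneg w)
        calc _ ≤ (‖fderiv ℝ (inChart p (φ j)) (chartAt (Cn n) p p)‖ + 1) * ‖w‖ * |C j| :=
              mul_le_mul h1 ((hC j x hxr).trans (le_abs_self _)) (by positivity) (by positivity)
          _ = _ := by ring

/-- If the chart distance of the points is not small compared with `|dr|`, then `γ ≲ ρ` at both
points and the size of `h` gives the bound. Otherwise the points are joined by a bent path inside
`D` on which `γ` is at least a fixed multiple of its initial value, and the mean value inequality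
applies. The hypotheses are those satisfied by an `L`-th derivative of a function of class `ξ₁`. -/
theorem LeviDomain.IsDistanceFunction.xi_sub_le (hρ : D.IsDistanceFunction ρ) {h : M → F} {L : ℕ}
    (hh : ContMDiffOn 𝓘(ℝ, Cn n) 𝓘(ℝ, F) ∞ h D.reg)
    (h0 : ∃ C : ℝ, ∀ x ∈ D.reg, D.gamma x ^ L * ‖h x‖ ≤ C * D.gamma x)
    (hZ : ∀ Z : SmoothField n M, ∃ C : ℝ, ∀ x ∈ D.reg,
      D.gamma x ^ L * ‖dirDeriv h x (Z x)‖ ≤ C) :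
    ∃ C : ℝ, 0 ≤ C ∧ ∀ x ∈ D.reg, ∀ y ∈ D.reg,
      min (D.gamma x) (D.gamma y) ^ L * ‖h y - h x‖ ≤ C * ρ x y := by
  obtain ⟨Γ, hΓ1, hΓ⟩ := D.exists_gamma_le
  obtain ⟨Q, hQ1, hQ⟩ := hρ.gamma_le
  obtain ⟨C₀, hC₀⟩ := h0
  have htriv : ∀ x ∈ D.reg, ∀ y ∈ D.reg, min (D.gamma x) (D.gamma y) ^ L * ‖h y - h x‖ ≤
      |C₀| * (D.gamma x + D.gamma y) := by
    intro x hx y hy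
    have gx := D.gamma_nonneg x
    have gy := D.gamma_nonneg y
    have hm : 0 ≤ min (D.gamma x) (D.gamma y) := le_min gx gy
    calc _ ≤ min (D.gamma x) (D.gamma y) ^ L * (‖h y‖ + ‖h x‖) :=
          mul_le_mul_of_nonneg_left (norm_sub_le _ _) (by positivity)
      _ = min (D.gamma x) (D.gamma y) ^ L * ‖h y‖ + min (D.gamma x) (D.gamma y) ^ L * ‖h x‖ := by
          ring
      _ ≤ D.gamma y ^ L * ‖h y‖ + D.gamma x ^ L * ‖h x‖ := by
          gcongr
          · exact min_le_right _ _
          · exact min_le_left _ _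
      _ ≤ |C₀| * D.gamma y + |C₀| * D.gamma x := by
          refine add_le_add ((hC₀ y hy).trans ?_) ((hC₀ x hx).trans ?_) <;>
          exact mul_le_mul_of_nonneg_right (le_abs_self _) ‹_›
      _ = _ := by ring
  have key := hρ.local_to_global D.isCompact_closure D.reg_subset_closure
    (f := fun x y => min (D.gamma x) (D.gamma y) ^ L * ‖h y - h x‖) 1
    ⟨|C₀| * (Γ + Γ), fun x hx y hy => (htriv x hx y hy).trans (by
      have := hΓ x (D.reg_subset_closure hx)
      have := hΓ y (D.reg_subset_closure hy)
      gcongr)⟩ ?_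
  · simpa using key
  intro p _
  have hp := mem_chart_source (Cn n) p
  set ψ := chartAt (Cn n) p with hψ
  obtain ⟨A, hA, U₁, hU₁, -, hUA⟩ := D.gamma_compare p
  obtain ⟨C₁, hC₁, U₂, hU₂, -, hUC⟩ := hρ.chart_le p
  obtain ⟨B, hB, U₃, hU₃, hU₃s, hUB⟩ := D.exists_norm_dirDeriv_le hZ p
  have hr2 := inChart_contDiffAt hp (D.smooth_r p)
  have hD2 : ContinuousAt (fderiv ℝ (fderiv ℝ (inChart p D.r))) (ψ p) :=
    ((hr2.fderiv_right (m := 1) (by norm_cast)).fderiv_right (m := 0) (by norm_cast)).continuousAt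
  set L' := ‖fderiv ℝ (fderiv ℝ (inChart p D.r)) (ψ p)‖ + 1 with hL'
  have hbd : ∀ᶠ q in 𝓝 (ψ p), ‖fderiv ℝ (fderiv ℝ (inChart p D.r)) q‖ < L' :=
    (show ContinuousAt (fun q => ‖fderiv ℝ (fderiv ℝ (inChart p D.r)) q‖) (ψ p) from
      ContinuousAt.norm (E := Cn n →L[ℝ] Cn n →L[ℝ] ℝ) hD2).eventually (gt_mem_nhds (lt_add_one _))
  have hsymm : ψ.symm ⁻¹' (U₁ ∩ U₃) ∈ 𝓝 (ψ p) := by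
    have := ψ.symm.continuousAt (ψ.map_source hp)
    refine this ?_
    rw [ψ.left_inv hp]
    exact Filter.inter_mem hU₁ hU₃
  obtain ⟨ε, hε, hball⟩ := Metric.mem_nhds_iff.1 (Filter.inter_mem
    (Filter.inter_mem (ψ.open_target.mem_nhds (ψ.map_source hp)) hbd) hsymm)
  -- For a point `q` on the path, `γ(x) ≤ A|dr(x)| ≤ 2A|dr(q)| ≤ 2A²γ(q)`.
  set c₅ := (2 * A * A)⁻¹ with hc₅
  have hc₅0 : 0 < c₅ := by positivity
  refine ⟨U₁ ∩ U₂ ∩ U₃ ∩ ψ ⁻¹' Metric.ball (ψ p) (ε / 6),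
    Filter.inter_mem (Filter.inter_mem (Filter.inter_mem hU₁ hU₂) hU₃)
      (ψ.continuousAt hp (Metric.ball_mem_nhds _ (by positivity))),
    |C₀| * (A * (8 * L' * C₁) + Q * (A * (8 * L' * C₁) + 1)) + B * (2 * C₁) / c₅ ^ L,
    fun x ⟨hxU, hxr⟩ y ⟨hyU, hyr⟩ => ?_⟩
  have hxs := hU₃s hxU.1.2
  have hys := hU₃s hyU.1.2
  have hr0 := hρ.nonneg x y
  have hw : ‖ψ y - ψ x‖ ≤ C₁ * ρ x y := by
    rw [norm_sub_rev]; exact hUC x hxU.1.1.2 y hyU.1.1.2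
  have hL'0 : 0 < L' := by
    have : 0 ≤ ‖fderiv ℝ (fderiv ℝ (inChart p D.r)) (ψ p)‖ :=
      norm_nonneg (E := Cn n →L[ℝ] Cn n →L[ℝ] ℝ) _
    linarith
  have hpos1 : 0 ≤ |C₀| * (A * (8 * L' * C₁) + Q * (A * (8 * L' * C₁) + 1)) := by positivity
  have hpos2 : 0 ≤ B * (2 * C₁) / c₅ ^ L := by positivity
  rw [pow_one]
  -- The dividing line is exactly the smallness required for convexity of `r` along the bent path.
  rcases le_or_gt (8 * L' * ‖ψ y - ψ x‖) ‖fderiv ℝ (inChart p D.r) (ψ x)‖ with hsm | hlg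
  · refine le_trans ?_ (mul_le_mul_of_nonneg_right (le_add_of_nonneg_left hpos1) hr0)
    obtain ⟨ν, hν1, hν2⟩ := exists_descent (fderiv ℝ (inChart p D.r) (ψ x))
    have hxb : ψ x ∈ Metric.ball (ψ p) (ε / 6) := hxU.2
    have hyb : ψ y ∈ Metric.ball (ψ p) (ε / 6) := hyU.2
    rw [Metric.mem_ball, dist_eq_norm] at hxb hyb
    have hwε : ‖ψ y - ψ x‖ < ε / 3 := by
      have := norm_sub_le_norm_sub_add_norm_sub (ψ y) (ψ p) (ψ x)
      rw [norm_sub_rev (ψ p) (ψ x)] at this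
      linarith
    have hpath := neg_on_bentPath (c := ψ p) (ε := ε) (r := inChart p D.r) (L := L')
      (((comp_chart_symm_contDiffOn (D.smooth_r.contMDiffOn (s := univ))).of_le (by norm_cast)).mono
        fun q hq => ⟨(hball hq).1.1, mem_univ _⟩)
      (fun q hq => le_of_lt (hball hq).1.2) (a := ψ x) (w := ψ y - ψ x)
      (by rw [Metric.mem_ball, dist_eq_norm]; linarith) hwε hν1 hν2 hsm
      (by rw [inChart_apply hxs]; exact hxr.1)
      (by rw [add_sub_cancel, inChart_apply hys]; exact hyr.1)
    have hgx := D.gamma_pos hxr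
    have hq : ∀ t ∈ Icc (0 : ℝ) 1, ∃ q ∈ U₃ ∩ D.reg, ψ q = bentPath (ψ x) (ψ y - ψ x) ν t ∧
        c₅ * D.gamma x ≤ D.gamma q := by
      intro t ht
      obtain ⟨hb, hneg, hlow⟩ := hpath t ht
      have hbt := (hball hb).1.1
      have hq1 := (hball hb).2
      refine ⟨ψ.symm (bentPath (ψ x) (ψ y - ψ x) ν t), ⟨hq1.2, ?_⟩, ψ.right_inv hbt, ?_⟩
      all_goals
        have h1 := (hUA _ hq1.1).2
        rw [← hψ, ψ.right_inv hbt] at h1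
        have h2 := (hUA x hxU.1.1.1).1
        have h3 : c₅ * D.gamma x ≤ D.gamma (ψ.symm (bentPath (ψ x) (ψ y - ψ x) ν t)) := by
          rw [hc₅, inv_mul_le_iff₀ (by positivity)]
          calc D.gamma x ≤ A * ‖fderiv ℝ (inChart p D.r) (ψ x)‖ := h2
            _ ≤ A * (2 * (A * D.gamma (ψ.symm (bentPath (ψ x) (ψ y - ψ x) ν t)))) := by
              refine mul_le_mul_of_nonneg_left ?_ hA.le
              linarith
            _ = _ := by ring
      · exact ⟨hneg, (lt_of_lt_of_le (by positivity) h3).ne'⟩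
      · exact h3
    have hder : ∀ t ∈ Icc (0 : ℝ) 1, HasDerivAt
        (fun t => inChart p h (bentPath (ψ x) (ψ y - ψ x) ν t))
        (fderiv ℝ (inChart p h) (bentPath (ψ x) (ψ y - ψ x) ν t)
          ((ψ y - ψ x) + ((1 - 2 * t) * ‖ψ y - ψ x‖) • ν)) t := by
      intro t ht
      obtain ⟨q, hq1, hq2, -⟩ := hq t ht
      have h1 := ((inChart_contDiffAt (hU₃s hq1.1) (hh.contMDiffAt
        (D.isOpen_reg.mem_nhds hq1.2))).differentiableAt (by simp)).hasFDerivAt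
      rw [← hψ, hq2] at h1
      exact h1.comp_hasDerivAt t (bentPath_hasDerivAt _ _ _ t)
    have hbound : ∀ t ∈ Icc (0 : ℝ) 1, ‖fderiv ℝ (inChart p h) (bentPath (ψ x) (ψ y - ψ x) ν t)
          ((ψ y - ψ x) + ((1 - 2 * t) * ‖ψ y - ψ x‖) • ν)‖ ≤
        B * (2 * ‖ψ y - ψ x‖) / (c₅ * D.gamma x) ^ L := by
      intro t ht
      obtain ⟨q, hq1, hq2, hq3⟩ := hq t ht
      have h1 := hUB q hq1 ((ψ y - ψ x) + ((1 - 2 * t) * ‖ψ y - ψ x‖) • ν)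
      rw [dirDeriv_chartDinv (hU₃s hq1.1) (hh.mdiffAt' D.isOpen_reg hq1.2), ← hψ, hq2] at h1
      rw [le_div_iff₀ (by positivity), mul_comm]
      calc _ ≤ D.gamma q ^ L * _ := by gcongr
        _ ≤ _ := h1
        _ ≤ _ := mul_le_mul_of_nonneg_left (bentPath_deriv_norm_le hν1 ht) hB
    have hmv := norm_image_sub_le_of_norm_deriv_le_segment_01'
      (f := fun t => inChart p h (bentPath (ψ x) (ψ y - ψ x) ν t))
      (fun t ht => (hder t ht).hasDerivWithinAt)
      (fun t ht => hbound t (Ico_subset_Icc_self ht))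
    rw [bentPath_one, bentPath_zero, add_sub_cancel, inChart_apply hys, inChart_apply hxs] at hmv
    calc _ ≤ D.gamma x ^ L * (B * (2 * ‖ψ y - ψ x‖) / (c₅ * D.gamma x) ^ L) := by
          refine mul_le_mul (pow_le_pow_left₀ (le_min hgx.le (D.gamma_nonneg y))
            (min_le_left _ _) L) hmv (norm_nonneg _) (by positivity)
      _ = B * (2 * ‖ψ y - ψ x‖) / c₅ ^ L := by
          rw [mul_pow]
          field_simp
      _ ≤ B * (2 * (C₁ * ρ x y)) / c₅ ^ L := by gcongr
      _ = _ := by ring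
  · refine le_trans ?_ (mul_le_mul_of_nonneg_right (le_add_of_nonneg_right hpos2) hr0)
    refine (htriv x hxr y hyr).trans ?_
    rw [mul_assoc]
    refine mul_le_mul_of_nonneg_left ?_ (abs_nonneg _)
    -- Here `γ(x) ≲ |dr(x)| ≲ |ψ y - ψ x| ≲ ρ`, and then also `γ(y) ≲ γ(x) + ρ ≲ ρ`.
    have h1 : D.gamma x ≤ A * (8 * L' * C₁) * ρ x y := by
      calc D.gamma x ≤ A * ‖fderiv ℝ (inChart p D.r) (ψ x)‖ := (hUA x hxU.1.1.1).1
        _ ≤ A * (8 * L' * (C₁ * ρ x y)) := by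
          refine mul_le_mul_of_nonneg_left (hlg.le.trans ?_) hA.le
          exact mul_le_mul_of_nonneg_left hw (by positivity)
        _ = _ := by ring
    have h2 := hQ y (D.reg_subset_closure hyr) x (D.reg_subset_closure hxr)
    rw [hρ.symm y x] at h2
    have h3 : Q * (D.gamma x + ρ x y) ≤ Q * (A * (8 * L' * C₁) * ρ x y + ρ x y) := by gcongr
    linarith

end Differences


/-! ### Tangential derivatives of kernels -/

section Tangential

variable {n : ℕ} {M : Type*} [TopologicalSpace M] [ChartedSpace (Cn n) M]
  [IsManifold 𝓘(ℂ, Cn n) ω M]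
  {F : Type*} [NormedAddCommGroup F] [NormedSpace ℝ F] {D : LeviDomain n M} {ρ : M → M → ℝ}

open LeviDomain (Slot)

/-- The product of the slot coefficients is `0` if some derivative acts in the second variable only,
and `1` otherwise. -/
theorem iterD_comp_fst {S T : Set M} (hS : IsOpen S) (hT : IsOpen T) {u : M → F}
    (hu : ContMDiffOn 𝓘(ℝ, Cn n) 𝓘(ℝ, F) ∞ u S) (l : List (Slot × SmoothField n M)) :
    EqOn (iterD kField l fun p : M × M => u p.1)
      (fun p => (l.map fun o => o.1.coeffFst).prod • iterD fld (l.map Prod.snd) u p.1)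
      (S ×ˢ T) := by
  induction l with
  | nil => intro p _; simp
  | cons o l ih =>
    intro p hp
    rw [iterD_cons, lieD_congr (hS.prod hT) ih hp]
    have hsm := iterD_smooth hS (fun Z => fieldOn_fld Z _) hu (l.map Prod.snd)
    have h1 : ContMDiffOn (𝓘(ℝ, Cn n).prod 𝓘(ℝ, Cn n)) 𝓘(ℝ, F) ∞
        (fun p : M × M => iterD fld (l.map Prod.snd) u p.1) (S ×ˢ T) :=
      hsm.comp contMDiff_fst.contMDiffOn fun p hp => hp.1
    have h2 := lieD_clm ((l.map fun o => o.1.coeffFst).prod • ContinuousLinearMap.id ℝ F)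
      (Y := kField o) (h1.mdiffAt' (hS.prod hT) hp)
    refine h2.trans ?_
    rw [lieD_kField o (h1.mdiffAt' (hS.prod hT) hp)]
    have h3 : dirDeriv (fun _ : M => iterD fld (l.map Prod.snd) u p.1) p.2 (o.2 p.2) = 0 :=
      lieD_const (o.2 : ∀ x, Tan n x) _ p.2
    rw [h3, smul_zero, add_zero]
    simp only [List.map_cons, List.prod_cons, iterD_cons, _root_.smul_apply,
      ContinuousLinearMap.id_apply, smul_smul, mul_comm]
    rfl

theorem iterD_comp_snd {S T : Set M} (hS : IsOpen S) (hT : IsOpen T) {u : M → F}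
    (hu : ContMDiffOn 𝓘(ℝ, Cn n) 𝓘(ℝ, F) ∞ u T) (l : List (Slot × SmoothField n M)) :
    EqOn (iterD kField l fun p : M × M => u p.2)
      (fun p => (l.map fun o => o.1.coeffSnd).prod • iterD fld (l.map Prod.snd) u p.2)
      (S ×ˢ T) := by
  induction l with
  | nil => intro p _; simp
  | cons o l ih =>
    intro p hp
    rw [iterD_cons, lieD_congr (hS.prod hT) ih hp]
    have hsm := iterD_smooth hT (fun Z => fieldOn_fld Z _) hu (l.map Prod.snd)
    have h1 : ContMDiffOn (𝓘(ℝ, Cn n).prod 𝓘(ℝ, Cn n)) 𝓘(ℝ, F) ∞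
        (fun p : M × M => iterD fld (l.map Prod.snd) u p.2) (S ×ˢ T) :=
      hsm.comp contMDiff_snd.contMDiffOn fun p hp => hp.2
    have h2 := lieD_clm ((l.map fun o => o.1.coeffSnd).prod • ContinuousLinearMap.id ℝ F)
      (Y := kField o) (h1.mdiffAt' (hS.prod hT) hp)
    refine h2.trans ?_
    rw [lieD_kField o (h1.mdiffAt' (hS.prod hT) hp)]
    have h3 : dirDeriv (fun _ : M => iterD fld (l.map Prod.snd) u p.2) p.1 (o.2 p.1) = 0 :=
      lieD_const (o.2 : ∀ x, Tan n x) _ p.1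
    rw [h3, smul_zero, zero_add]
    simp only [List.map_cons, List.prod_cons, iterD_cons, _root_.smul_apply,
      ContinuousLinearMap.id_apply, smul_smul, mul_comm]
    rfl

variable [T2Space M] [SecondCountableTopology M]

theorem LeviDomain.IsDistanceFunction.prod_coeffFst_le (hρ : D.IsDistanceFunction ρ)
    (l : List (Slot × SmoothField n M)) {p : M × M} (hp : p ∈ D.offDiag) :
    (l.map fun o => D.kScale ρ o p).prod * |(l.map fun o => o.1.coeffFst).prod| ≤
      D.gamma p.1 ^ l.length := by
  have hg := D.gamma_nonneg p.1
  induction l with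
  | nil => simp
  | cons o l ih =>
    have h0 := prod_nonneg_of_scale (s := D.kScale ρ) (x := p)
      (fun o => (hρ.kScale_pos o p hp).le) l
    have h1 : D.kScale ρ o p * |o.1.coeffFst| ≤ D.gamma p.1 := by
      rcases o with ⟨_ | _ | _, Z⟩ <;>
        simp [LeviDomain.kScale, LeviDomain.scale, Slot.coeffFst, hg]
    rw [List.map_cons, List.prod_cons, List.map_cons, List.prod_cons, abs_mul, List.length_cons,
      pow_succ']
    calc _ = (D.kScale ρ o p * |o.1.coeffFst|) *
          ((l.map fun o => D.kScale ρ o p).prod * |(l.map fun o => o.1.coeffFst).prod|) := by ring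
      _ ≤ _ := mul_le_mul h1 ih (by positivity) hg

theorem LeviDomain.IsDistanceFunction.prod_coeffSnd_le (hρ : D.IsDistanceFunction ρ)
    (l : List (Slot × SmoothField n M)) {p : M × M} (hp : p ∈ D.offDiag) :
    (l.map fun o => D.kScale ρ o p).prod * |(l.map fun o => o.1.coeffSnd).prod| ≤
      D.gamma p.2 ^ l.length := by
  have hg := D.gamma_nonneg p.2
  induction l with
  | nil => simp
  | cons o l ih =>
    have h0 := prod_nonneg_of_scale (s := D.kScale ρ) (x := p)
      (fun o => (hρ.kScale_pos o p hp).le) l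
    have h1 : D.kScale ρ o p * |o.1.coeffSnd| ≤ D.gamma p.2 := by
      rcases o with ⟨_ | _ | _, Z⟩ <;>
        simp [LeviDomain.kScale, LeviDomain.scale, Slot.coeffSnd, hg]
    rw [List.map_cons, List.prod_cons, List.map_cons, List.prod_cons, abs_mul, List.length_cons,
      pow_succ']
    calc _ = (D.kScale ρ o p * |o.1.coeffSnd|) *
          ((l.map fun o => D.kScale ρ o p).prod * |(l.map fun o => o.1.coeffSnd).prod|) := by ring
      _ ≤ _ := mul_le_mul h1 ih (by positivity) hg

/-- If the product of coefficients is not zero, any transversal derivative acts in the first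
variable, and its scale is at most `ρ`. Thus one factor `γ` is exchanged for a factor `ρ`. -/
theorem LeviDomain.IsDistanceFunction.prod_coeffFst_le' (hρ : D.IsDistanceFunction ρ)
    (l : List (Slot × SmoothField n M)) {p : M × M} (hp : p ∈ D.offDiag)
    (hl : 1 ≤ transversal l) :
    (l.map fun o => D.kScale ρ o p).prod * |(l.map fun o => o.1.coeffFst).prod| ≤
      ρ p.1 p.2 * D.gamma p.1 ^ (l.length - 1) := by
  have hg := D.gamma_nonneg p.1
  have hr := hρ.nonneg p.1 p.2
  induction l with
  | nil => simp [transversal] at hl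
  | cons o l ih =>
    have h0 := prod_nonneg_of_scale (s := D.kScale ρ) (x := p)
      (fun o => (hρ.kScale_pos o p hp).le) l
    have h2 := hρ.prod_coeffFst_le l hp
    have e : (List.map (fun o => D.kScale ρ o p) (o :: l)).prod *
        |(List.map (fun o => o.1.coeffFst) (o :: l)).prod| = (D.kScale ρ o p * |o.1.coeffFst|) *
        ((l.map fun o => D.kScale ρ o p).prod * |(l.map fun o => o.1.coeffFst).prod|) := by
      rw [List.map_cons, List.prod_cons, List.map_cons, List.prod_cons, abs_mul]
      ring
    rw [e, List.length_cons, Nat.add_sub_cancel]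
    rcases o with ⟨_ | _ | _, Z⟩
    · refine mul_le_mul ?_ h2 (by positivity) hr
      simp [LeviDomain.kScale, LeviDomain.scale, Slot.coeffFst]
    · simp only [Slot.coeffFst, abs_zero, mul_zero, zero_mul]
      positivity
    · have hl' : 1 ≤ transversal l := by simpa [transversal] using hl
      have hlen : 1 ≤ l.length := by
        rcases l with _ | ⟨_, _⟩
        · simp [transversal] at hl'
        · simp
      have h3 : D.kScale ρ (Slot.both, Z) p * |Slot.both.coeffFst| ≤ D.gamma p.1 := by
        simp [LeviDomain.kScale, LeviDomain.scale, Slot.coeffFst]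
      calc _ ≤ D.gamma p.1 * (ρ p.1 p.2 * D.gamma p.1 ^ (l.length - 1)) :=
            mul_le_mul h3 (ih hl') (by positivity) hg
        _ = ρ p.1 p.2 * (D.gamma p.1 ^ (l.length - 1 + 1)) := by ring
        _ = _ := by rw [Nat.sub_add_cancel hlen]

theorem LeviDomain.IsDistanceFunction.prod_coeffSnd_le' (hρ : D.IsDistanceFunction ρ)
    (l : List (Slot × SmoothField n M)) {p : M × M} (hp : p ∈ D.offDiag)
    (hl : 1 ≤ transversal l) :
    (l.map fun o => D.kScale ρ o p).prod * |(l.map fun o => o.1.coeffSnd).prod| ≤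
      ρ p.1 p.2 * D.gamma p.2 ^ (l.length - 1) := by
  have hg := D.gamma_nonneg p.2
  have hr := hρ.nonneg p.1 p.2
  induction l with
  | nil => simp [transversal] at hl
  | cons o l ih =>
    have h0 := prod_nonneg_of_scale (s := D.kScale ρ) (x := p)
      (fun o => (hρ.kScale_pos o p hp).le) l
    have h2 := hρ.prod_coeffSnd_le l hp
    have e : (List.map (fun o => D.kScale ρ o p) (o :: l)).prod *
        |(List.map (fun o => o.1.coeffSnd) (o :: l)).prod| = (D.kScale ρ o p * |o.1.coeffSnd|) *
        ((l.map fun o => D.kScale ρ o p).prod * |(l.map fun o => o.1.coeffSnd).prod|) := by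
      rw [List.map_cons, List.prod_cons, List.map_cons, List.prod_cons, abs_mul]
      ring
    rw [e, List.length_cons, Nat.add_sub_cancel]
    rcases o with ⟨_ | _ | _, Z⟩
    · simp only [Slot.coeffSnd, abs_zero, mul_zero, zero_mul]
      positivity
    · refine mul_le_mul ?_ h2 (by positivity) hr
      simp [LeviDomain.kScale, LeviDomain.scale, Slot.coeffSnd]
    · have hl' : 1 ≤ transversal l := by simpa [transversal] using hl
      have hlen : 1 ≤ l.length := by
        rcases l with _ | ⟨_, _⟩
        · simp [transversal] at hl'
        · simp
      have h3 : D.kScale ρ (Slot.both, Z) p * |Slot.both.coeffSnd| ≤ D.gamma p.2 := by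
        simp [LeviDomain.kScale, LeviDomain.scale, Slot.coeffSnd]
      calc _ ≤ D.gamma p.2 * (ρ p.1 p.2 * D.gamma p.2 ^ (l.length - 1)) :=
            mul_le_mul h3 (ih hl') (by positivity) hg
        _ = ρ p.1 p.2 * (D.gamma p.2 ^ (l.length - 1 + 1)) := by ring
        _ = _ := by rw [Nat.sub_add_cancel hlen]

theorem prod_of_transversal_eq_zero (D : LeviDomain n M) (ρ : M → M → ℝ)
    (l : List (Slot × SmoothField n M)) (p : M × M) (hl : transversal l = 0) :
    (l.map fun o => D.kScale ρ o p).prod = min (D.gamma p.1) (D.gamma p.2) ^ l.length ∧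
      (l.map fun o => o.1.coeffFst).prod = 1 ∧ (l.map fun o => o.1.coeffSnd).prod = 1 := by
  induction l with
  | nil => simp
  | cons o l ih =>
    rcases o with ⟨_ | _ | _, Z⟩
    · simp [transversal] at hl
    · simp [transversal] at hl
    · have hl' : transversal l = 0 := by simpa [transversal] using hl
      obtain ⟨h1, h2, h3⟩ := ih hl'
      rw [List.map_cons, List.map_cons, List.map_cons, List.prod_cons, List.prod_cons,
        List.prod_cons, h1, h2, h3, List.length_cons, pow_succ']
      simp [LeviDomain.kScale, LeviDomain.scale, Slot.coeffFst, Slot.coeffSnd]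

theorem LeviDomain.offDiag_subset (D : LeviDomain n M) : D.offDiag ⊆ D.reg ×ˢ D.reg :=
  fun _ h => h.1

theorem LeviDomain.IsDistanceFunction.symb_comp_fst (hρ : D.IsDistanceFunction ρ) {u : M → F}
    {φ : M → ℝ} (hu : D.XiOn D.reg φ u) :
    Symb D.offDiag kField (D.kScale ρ) (fun p => φ p.1) (fun p : M × M => u p.1) := by
  refine ⟨hu.1.comp contMDiff_fst.contMDiffOn fun p hp => hp.1.1, fun l => ?_⟩
  obtain ⟨C, hC⟩ := hu.2 (l.map Prod.snd)
  refine ⟨C, fun p hp => ?_⟩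
  rw [iterD_comp_fst D.isOpen_reg D.isOpen_reg hu.1 l hp.1, norm_smul, Real.norm_eq_abs,
    ← mul_assoc]
  refine (mul_le_mul_of_nonneg_right (hρ.prod_coeffFst_le l hp) (norm_nonneg _)).trans ?_
  have := hC p.1 hp.1.1
  rwa [prod_map_const, List.length_map] at this

theorem LeviDomain.IsDistanceFunction.symb_comp_snd (hρ : D.IsDistanceFunction ρ) {u : M → F}
    {φ : M → ℝ} (hu : D.XiOn D.reg φ u) :
    Symb D.offDiag kField (D.kScale ρ) (fun p => φ p.2) (fun p : M × M => u p.2) := by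
  refine ⟨hu.1.comp contMDiff_snd.contMDiffOn fun p hp => hp.1.2, fun l => ?_⟩
  obtain ⟨C, hC⟩ := hu.2 (l.map Prod.snd)
  refine ⟨C, fun p hp => ?_⟩
  rw [iterD_comp_snd D.isOpen_reg D.isOpen_reg hu.1 l hp.1, norm_smul, Real.norm_eq_abs,
    ← mul_assoc]
  refine (mul_le_mul_of_nonneg_right (hρ.prod_coeffSnd_le l hp) (norm_nonneg _)).trans ?_
  have := hC p.2 hp.1.2
  rwa [prod_map_const, List.length_map] at this

/-- If `g` is of class `ξ₁`, then `g(z) - g(ζ)` is of class `𝓔₁`. -/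
theorem LeviDomain.IsDistanceFunction.symb_sub (hρ : D.IsDistanceFunction ρ) {g : M → F}
    (hg : D.XiOn D.reg D.gamma g) :
    Symb D.offDiag kField (D.kScale ρ) (fun p => ρ p.1 p.2)
      (fun p : M × M => g p.2 - g p.1) := by
  have h1 : ContMDiffOn (𝓘(ℝ, Cn n).prod 𝓘(ℝ, Cn n)) 𝓘(ℝ, F) ∞
      (fun p : M × M => g p.1) D.offDiag := hg.1.comp contMDiff_fst.contMDiffOn fun p hp => hp.1.1
  have h2 : ContMDiffOn (𝓘(ℝ, Cn n).prod 𝓘(ℝ, Cn n)) 𝓘(ℝ, F) ∞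
      (fun p : M × M => g p.2) D.offDiag := hg.1.comp contMDiff_snd.contMDiffOn fun p hp => hp.1.2
  refine ⟨h2.sub h1, fun l => ?_⟩
  have heq : EqOn (iterD kField l fun p : M × M => g p.2 - g p.1)
      (fun p => (l.map fun o => o.1.coeffSnd).prod • iterD fld (l.map Prod.snd) g p.2 -
        (l.map fun o => o.1.coeffFst).prod • iterD fld (l.map Prod.snd) g p.1) D.offDiag := by
    intro p hp
    have e1 : (fun p : M × M => g p.2 - g p.1) = fun p => g p.2 +
        (-ContinuousLinearMap.id ℝ F) (g p.1) := by
      ext p; simp [sub_eq_add_neg]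
    rw [e1, iterD_add (v := fun p => (-ContinuousLinearMap.id ℝ F) (g p.1)) D.isOpen_offDiag
      (fun o => fieldOn_kField o _) h2
      ((-ContinuousLinearMap.id ℝ F).contMDiff.comp_contMDiffOn h1) l hp]
    simp only
    rw [iterD_clm (-ContinuousLinearMap.id ℝ F) D.isOpen_offDiag (fun o => fieldOn_kField o _) h1
      l hp]
    simp only
    rw [iterD_comp_fst D.isOpen_reg D.isOpen_reg hg.1 l hp.1,
      iterD_comp_snd D.isOpen_reg D.isOpen_reg hg.1 l hp.1]
    simp [sub_eq_add_neg]
  obtain ⟨C, hC⟩ := hg.2 (l.map Prod.snd)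
  simp only [prod_map_const, List.length_map] at hC
  -- If all derivatives are of the form `Z^ζ + Z^z`, the result is again a difference of values of
  -- one function and the cancellation of `xi_sub_le` is needed. Otherwise a transversal scale
  -- already supplies the factor `ρ`, and the two terms are estimated separately.
  rcases Nat.eq_zero_or_pos (transversal l) with h0 | h0
  · obtain ⟨K, -, hK⟩ := hρ.xi_sub_le (L := l.length)
      (iterD_smooth D.isOpen_reg (fun Z => fieldOn_fld Z _) hg.1 (l.map Prod.snd)) ⟨C, hC⟩
      (fun Z => by
        obtain ⟨C', hC'⟩ := hg.2 (Z :: l.map Prod.snd)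
        refine ⟨C', fun x hx => ?_⟩
        have h3 := hC' x hx
        rw [prod_map_const, List.length_cons, List.length_map, pow_succ] at h3
        have h4 := D.gamma_pos hx
        refine le_of_mul_le_mul_right ?_ h4
        calc _ = D.gamma x ^ l.length * D.gamma x *
              ‖iterD fld (Z :: l.map Prod.snd) g x‖ := by
              rw [iterD_cons]
              simp only [lieD, dirDeriv, fld]
              ring
          _ ≤ _ := h3)
    refine ⟨K, fun p hp => ?_⟩
    obtain ⟨e1, e2, e3⟩ := prod_of_transversal_eq_zero D ρ l p h0
    rw [heq hp, e1]
    simp only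
    rw [e2, e3, one_smul, one_smul]
    exact hK _ hp.1.1 _ hp.1.2
  · have hlen : 1 ≤ l.length := by
      rcases l with _ | ⟨_, _⟩
      · simp [transversal] at h0
      · simp
    have hC' : ∀ x ∈ D.reg, D.gamma x ^ (l.length - 1) *
        ‖iterD fld (l.map Prod.snd) g x‖ ≤ C := fun x hx => by
      have h4 := D.gamma_pos hx
      have h3 := hC x hx
      rw [← Nat.sub_add_cancel hlen, pow_succ] at h3
      refine le_of_mul_le_mul_right ?_ h4
      linarith
    refine ⟨C + C, fun p hp => ?_⟩
    have hr := hρ.nonneg p.1 p.2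
    have hP := prod_nonneg_of_scale (s := D.kScale ρ) (x := p)
      (fun o => (hρ.kScale_pos o p hp).le) l
    rw [heq hp]
    calc _ ≤ (l.map fun o => D.kScale ρ o p).prod *
          (‖(l.map fun o => o.1.coeffSnd).prod • iterD fld (l.map Prod.snd) g p.2‖ +
          ‖(l.map fun o => o.1.coeffFst).prod • iterD fld (l.map Prod.snd) g p.1‖) :=
          mul_le_mul_of_nonneg_left (norm_sub_le _ _) hP
      _ = ((l.map fun o => D.kScale ρ o p).prod * |(l.map fun o => o.1.coeffSnd).prod|) *
            ‖iterD fld (l.map Prod.snd) g p.2‖ +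
          ((l.map fun o => D.kScale ρ o p).prod * |(l.map fun o => o.1.coeffFst).prod|) *
            ‖iterD fld (l.map Prod.snd) g p.1‖ := by
          rw [norm_smul, norm_smul, Real.norm_eq_abs, Real.norm_eq_abs]; ring
      _ ≤ (ρ p.1 p.2 * D.gamma p.2 ^ (l.length - 1)) * ‖iterD fld (l.map Prod.snd) g p.2‖ +
          (ρ p.1 p.2 * D.gamma p.1 ^ (l.length - 1)) * ‖iterD fld (l.map Prod.snd) g p.1‖ := by
          exact add_le_add
            (mul_le_mul_of_nonneg_right (hρ.prod_coeffSnd_le' l hp h0) (norm_nonneg _))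
            (mul_le_mul_of_nonneg_right (hρ.prod_coeffFst_le' l hp h0) (norm_nonneg _))
      _ ≤ ρ p.1 p.2 * C + ρ p.1 p.2 * C := by
          rw [mul_assoc, mul_assoc]
          gcongr
          · exact hC' _ hp.1.2
          · exact hC' _ hp.1.1
      _ = _ := by ring

end Tangential

/-! ### The action of `γ X^ζ + γ* X^z` on symbol classes -/

section TangDeriv

variable {n : ℕ} {M : Type*} [TopologicalSpace M] [ChartedSpace (Cn n) M]
  [IsManifold 𝓘(ℂ, Cn n) ω M]
  {F : Type*} [NormedAddCommGroup F] [NormedSpace ℂ F] {D : LeviDomain n M} {ρ : M → M → ℝ}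
  {N : ℕ}

open LeviDomain (Slot)

/-- `∑ⱼ (gⱼ Zⱼ^ζ + gⱼ* Zⱼ^z) u`. -/
def tangDeriv (g : Fin N → M → ℂ) (Z : Fin N → SmoothField n M) (u : M × M → F) (p : M × M) : F :=
  ∑ j, (g j p.1 • lieD (kField (Slot.fst, Z j)) u p + g j p.2 • lieD (kField (Slot.snd, Z j)) u p)

/-- Complex scalar multiplication as a real bilinear map. -/
abbrev smulB (F : Type*) [NormedAddCommGroup F] [NormedSpace ℂ F] : ℂ →L[ℝ] F →L[ℝ] F :=
  ContinuousLinearMap.lsmul ℝ ℂ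

theorem tangDeriv_contMDiffOn {g : Fin N → M → ℂ} {Z : Fin N → SmoothField n M} {u : M × M → F}
    {S T : Set M} (hS : IsOpen S) (hT : IsOpen T) {k m : ℕ∞ω} (hkm : m + 1 ≤ k)
    (hm : m ≤ (∞ : ℕ∞ω))
    (hg : ∀ j, ContMDiffOn 𝓘(ℝ, Cn n) 𝓘(ℝ, ℂ) m (g j) S)
    (hg' : ∀ j, ContMDiffOn 𝓘(ℝ, Cn n) 𝓘(ℝ, ℂ) m (g j) T)
    (hu : ContMDiffOn (𝓘(ℝ, Cn n).prod 𝓘(ℝ, Cn n)) 𝓘(ℝ, F) k u (S ×ˢ T)) :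
    ContMDiffOn (𝓘(ℝ, Cn n).prod 𝓘(ℝ, Cn n)) 𝓘(ℝ, F) m (tangDeriv g Z u) (S ×ˢ T) := by
  have hd : ∀ o, ContMDiffOn (𝓘(ℝ, Cn n).prod 𝓘(ℝ, Cn n)) 𝓘(ℝ, F) m
      (lieD (kField o) u) (S ×ˢ T) := fun o =>
    lieD_contMDiffOn (hS.prod hT) (ContMDiffOn.of_le (fieldOn_kField o _) hm) hu hkm
  have hb : ∀ {a : M × M → ℂ} {b : M × M → F},
      ContMDiffOn (𝓘(ℝ, Cn n).prod 𝓘(ℝ, Cn n)) 𝓘(ℝ, ℂ) m a (S ×ˢ T) →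
      ContMDiffOn (𝓘(ℝ, Cn n).prod 𝓘(ℝ, Cn n)) 𝓘(ℝ, F) m b (S ×ˢ T) →
      ContMDiffOn (𝓘(ℝ, Cn n).prod 𝓘(ℝ, Cn n)) 𝓘(ℝ, F) m (fun p => a p • b p) (S ×ˢ T) :=
    fun ha hb => ((smulB F).isBoundedBilinearMap.contDiff.contMDiff.comp_contMDiffOn
      (ha.prodMk_space hb))
  refine contMDiffOn_finsetSum fun j _ => ContMDiffOn.add (hb ?_ (hd _)) (hb ?_ (hd _))
  · exact (hg j).comp contMDiff_fst.contMDiffOn fun p hp => hp.1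
  · exact (hg' j).comp contMDiff_snd.contMDiffOn fun p hp => hp.2

variable [T2Space M] [SecondCountableTopology M]

/-- The heart of the matter: no power of `ρ` is lost. The sum is written in two ways, as it stands
and as `g (Z^ζ + Z^z) + (g* - g) Z^z`. The first is bounded by `ρ^m` where `γ ≲ ρ`, the second where
`ρ ≲ γ`, and the minimum of the two weights is `O(ρ^m)` everywhere. -/
theorem LeviDomain.IsDistanceFunction.symb_tangDeriv (hρ : D.IsDistanceFunction ρ)
    {g : Fin N → M → ℂ} {Z : Fin N → SmoothField n M} {u : M × M → F} {m : ℕ}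
    (hg : ∀ j, D.XiOn D.reg D.gamma (g j))
    (hu : Symb D.offDiag kField (D.kScale ρ) (fun p => ρ p.1 p.2 ^ m) u) :
    Symb D.offDiag kField (D.kScale ρ) (fun p => ρ p.1 p.2 ^ m) (tangDeriv g Z u) := by
  have hY := fun o : Slot × SmoothField n M => fieldOn_kField o D.offDiag
  have hs := hρ.kScale_pos (D := D)
  have hr : ∀ p ∈ D.offDiag, 0 ≤ ρ p.1 p.2 := fun p _ => hρ.nonneg _ _
  have hrm : ∀ p ∈ D.offDiag, 0 ≤ ρ p.1 p.2 ^ m := fun p hp => pow_nonneg (hr p hp) m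
  have hrd : ∀ o : Slot × SmoothField n M, ∀ p ∈ D.offDiag,
      0 ≤ ρ p.1 p.2 ^ m / D.kScale ρ o p := fun o p hp => div_nonneg (hrm p hp) (hs o p hp).le
  have hg1 : ∀ p ∈ D.offDiag, 0 ≤ D.gamma p.1 := fun p _ => D.gamma_nonneg _
  have hg2 : ∀ p ∈ D.offDiag, 0 ≤ D.gamma p.2 := fun p _ => D.gamma_nonneg _
  refine Symb.sum D.isOpen_offDiag hY hs hrm fun j _ => ?_
  have hd := fun o => hu.lieD D.isOpen_offDiag hY hs o
  have s1 := (hρ.symb_comp_fst (hg j)).bilin (smulB F) D.isOpen_offDiag hY hs hg1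
    (hrd (Slot.fst, Z j)) (hd (Slot.fst, Z j))
  have s2 := (hρ.symb_comp_snd (hg j)).bilin (smulB F) D.isOpen_offDiag hY hs hg2
    (hrd (Slot.snd, Z j)) (hd (Slot.snd, Z j))
  have s3 := (hρ.symb_comp_fst (hg j)).bilin (smulB F) D.isOpen_offDiag hY hs hg1
    (hrd (Slot.both, Z j)) (hd (Slot.both, Z j))
  have s4 := (hρ.symb_sub (hg j)).bilin (smulB F) D.isOpen_offDiag hY hs hr
    (hrd (Slot.snd, Z j)) (hd (Slot.snd, Z j))
  have p1 : ∀ p ∈ D.offDiag, 0 ≤ D.gamma p.1 * (ρ p.1 p.2 ^ m / D.kScale ρ (Slot.fst, Z j) p) :=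
    fun p hp => mul_nonneg (hg1 p hp) (hrd _ p hp)
  have p2 : ∀ p ∈ D.offDiag, 0 ≤ D.gamma p.2 * (ρ p.1 p.2 ^ m / D.kScale ρ (Slot.snd, Z j) p) :=
    fun p hp => mul_nonneg (hg2 p hp) (hrd _ p hp)
  have p3 : ∀ p ∈ D.offDiag, 0 ≤ D.gamma p.1 * (ρ p.1 p.2 ^ m / D.kScale ρ (Slot.both, Z j) p) :=
    fun p hp => mul_nonneg (hg1 p hp) (hrd _ p hp)
  have p4 : ∀ p ∈ D.offDiag, 0 ≤ ρ p.1 p.2 * (ρ p.1 p.2 ^ m / D.kScale ρ (Slot.snd, Z j) p) :=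
    fun p hp => mul_nonneg (hr p hp) (hrd _ p hp)
  have t1 := s1.add D.isOpen_offDiag hY hs p1 p2 s2
  have t2 := (s3.add D.isOpen_offDiag hY hs p3 p4 s4).congr D.isOpen_offDiag
    (v := fun p => smulB F (g j p.1) (lieD (kField (Slot.fst, Z j)) u p) +
      smulB F (g j p.2) (lieD (kField (Slot.snd, Z j)) u p)) (by
      intro p hp
      have hmd := hu.1.mdiffAt' D.isOpen_offDiag hp
      simp only [ContinuousLinearMap.lsmul_apply]
      rw [lieD_kField _ hmd, lieD_kField _ hmd, lieD_kField _ hmd]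
      simp only [Slot.coeffFst, Slot.coeffSnd, one_smul, zero_smul, add_zero, zero_add]
      module)
  obtain ⟨Q, hQ1, hQ⟩ := hρ.gamma_le
  refine (t1.min t2 (fun p hp => add_nonneg (p1 p hp) (p2 p hp))
    (fun p hp => add_nonneg (p3 p hp) (p4 p hp))).mono (2 * Q + Q * (2 * Q + 1) + 1)
    (fun p hp => le_min (add_nonneg (p1 p hp) (p2 p hp)) (add_nonneg (p3 p hp) (p4 p hp)))
    fun p hp => ?_
  have h1 := D.gamma_pos hp.1.1
  have h2 := D.gamma_pos hp.1.2
  have h3 := hρ.pos _ _ hp.2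
  have q1 := hQ _ (D.reg_subset_closure hp.1.1) _ (D.reg_subset_closure hp.1.2)
  have q2 := hQ _ (D.reg_subset_closure hp.1.2) _ (D.reg_subset_closure hp.1.1)
  rw [hρ.symm p.2 p.1] at q2
  simp only [LeviDomain.kScale, LeviDomain.scale]
  generalize ρ p.1 p.2 = r at *
  generalize D.gamma p.1 = a at *
  generalize D.gamma p.2 = b at *
  have hrm' : 0 < r ^ m := pow_pos h3 m
  have hratio : ∀ {x y K : ℝ}, 0 < y → x ≤ K * y → x * (r ^ m / y) ≤ K * r ^ m := by
    intro x y K hy hxy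
    rw [mul_div_assoc', div_le_iff₀ hy]
    nlinarith
  have hQQ : 0 ≤ Q * (2 * Q + 1) := by positivity
  have hle : ∀ {x K : ℝ}, 0 < x → 1 ≤ K → x ≤ K * x := fun hx hK =>
    le_mul_of_one_le_left hx.le hK
  -- With `a = γ(ζ)`, `b = γ(z)`: from `2Qr ≤ a ≤ Q(b + r)` one gets `a ≤ 2Qb` and `r ≤ b`, so both
  -- `a / min(a, b)` and `r / min(r, b)` are bounded. In the other case `a ≤ 2Qr` and `b ≤ Q(a + r)
  -- ≤ Q(2Q + 1)r`, so `a / min(r, a)` and `b / min(r, b)` are bounded.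
  by_cases hc : 2 * Q * r ≤ a
  · refine (min_le_right _ _).trans ?_
    have hb : a ≤ 2 * Q * b := by linarith
    have hrb : r ≤ b := by
      have : Q * r ≤ Q * b := by linarith
      exact le_of_mul_le_mul_left this (by linarith)
    have e1 : a * (r ^ m / min a b) ≤ 2 * Q * r ^ m := hratio (lt_min h1 h2) (by
      rcases le_total a b with h | h
      · rw [min_eq_left h]; exact hle h1 (by linarith)
      · rw [min_eq_right h]; exact hb)
    have e2 : r * (r ^ m / min r b) ≤ 1 * r ^ m := hratio (lt_min h3 h2) (by
      rw [min_eq_left hrb, one_mul])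
    nlinarith
  · refine (min_le_left _ _).trans ?_
    have ha : a ≤ 2 * Q * r := by linarith
    have hb : b ≤ Q * (2 * Q + 1) * r := by
      calc b ≤ Q * (a + r) := q2
        _ ≤ Q * (2 * Q * r + r) := by gcongr
        _ = _ := by ring
    have e1 : a * (r ^ m / min r a) ≤ 2 * Q * r ^ m := hratio (lt_min h3 h1) (by
      rcases le_total r a with h | h
      · rw [min_eq_left h]; exact ha
      · rw [min_eq_right h]; exact hle h1 (by linarith))
    have e2 : b * (r ^ m / min r b) ≤ Q * (2 * Q + 1) * r ^ m := hratio (lt_min h3 h2) (by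
      rcases le_total r b with h | h
      · rw [min_eq_left h]; exact hb
      · rw [min_eq_right h]; exact hle h2 (by nlinarith))
    nlinarith

theorem LeviDomain.IsE.symb {m : ℕ} {A : M → M → F} (hA : D.IsE ρ m 0 A) :
    Symb D.offDiag kField (D.kScale ρ) (fun p => ρ p.1 p.2 ^ m) (fun p : M × M => A p.1 p.2) := by
  refine ⟨hA.1.mono D.offDiag_subset, fun l => ?_⟩
  obtain ⟨C, hC⟩ := hA.2 l
  refine ⟨C, fun p hp => ?_⟩
  have h1 := hC p.1 hp.1.1 p.2 hp.1.2
  have h2 := foldr_kernelDeriv_eq D.isOpen_reg D.isOpen_reg hA.1 l hp.1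
  simp only at h2
  rw [h2] at h1
  simpa using! h1

theorem exists_ne_of_nhds (hn : n ≠ 0) {S : Set M} {x : M} (hS : S ∈ 𝓝 x) (y : M) :
    ∃ z ∈ S, z ≠ y := by
  have hx := mem_chart_source (Cn n) x
  have : NeZero n := ⟨hn⟩
  have : Nontrivial (Cn n) := inferInstance
  have h1 : (chartAt (Cn n) x).symm ⁻¹' S ∩ (chartAt (Cn n) x).target ∈ 𝓝 (chartAt (Cn n) x x) := by
    refine Filter.inter_mem ((chartAt (Cn n) x).symm.continuousAt
      ((chartAt (Cn n) x).map_source hx) ?_) ((chartAt (Cn n) x).open_target.mem_nhds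
        ((chartAt (Cn n) x).map_source hx))
    rwa [(chartAt (Cn n) x).left_inv hx]
  have h2 : ((chartAt (Cn n) x).symm ⁻¹' S ∩ (chartAt (Cn n) x).target).Infinite :=
    infinite_of_mem_nhds _ h1
  obtain ⟨u, hu, hne⟩ := h2.exists_notMem_finset {chartAt (Cn n) x y}
  refine ⟨(chartAt (Cn n) x).symm u, hu.1, fun h => hne ?_⟩
  rw [Finset.mem_singleton, ← h, (chartAt (Cn n) x).right_inv hu.2]

/-- The symbol calculus divides by the scales and so works off the diagonal, whereas the kernel
class demands the estimate on all of `D' × D'`. Both sides are continuous, and for `n ≠ 0` the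
off-diagonal pairs are dense. -/
theorem LeviDomain.IsDistanceFunction.isE_of_symb (hρ : D.IsDistanceFunction ρ) (hn : n ≠ 0)
    {m : ℕ} {A : M → M → F}
    (hA : ContMDiffOn (𝓘(ℝ, Cn n).prod 𝓘(ℝ, Cn n)) 𝓘(ℝ, F) ∞ (fun p : M × M => A p.1 p.2)
      (D.reg ×ˢ D.reg))
    (h : Symb D.offDiag kField (D.kScale ρ) (fun p => ρ p.1 p.2 ^ m)
      (fun p : M × M => A p.1 p.2)) : D.IsE ρ m 0 A := by
  refine ⟨hA, fun l => ?_⟩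
  obtain ⟨C, hC⟩ := h.2 l
  refine ⟨C, fun ζ hζ z hz => ?_⟩
  have hreg := D.isOpen_reg.prod D.isOpen_reg
  have hp : ((ζ, z) : M × M) ∈ D.reg ×ˢ D.reg := ⟨hζ, hz⟩
  have h2 := foldr_kernelDeriv_eq D.isOpen_reg D.isOpen_reg hA l hp
  simp only at h2
  rw [h2, zpow_zero, mul_one]
  have hcl : ((ζ, z) : M × M) ∈ closure D.offDiag := by
    rw [mem_closure_iff_nhds]
    intro t ht
    obtain ⟨s, hs, s', hs', hss⟩ := mem_nhds_prod_iff.1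
      (Filter.inter_mem ht (hreg.mem_nhds hp))
    obtain ⟨x, hx, hne⟩ := exists_ne_of_nhds hn hs z
    have := hss (mk_mem_prod hx (mem_of_mem_nhds hs'))
    exact ⟨(x, z), this.1, this.2, hne⟩
  have hgc := D.gamma_continuous
  have hsc : ∀ o : Slot × SmoothField n M, Continuous fun p : M × M => D.kScale ρ o p := by
    rintro ⟨_ | _ | _, Z⟩
    · exact hρ.continuous.min (hgc.comp continuous_fst)
    · exact hρ.continuous.min (hgc.comp continuous_snd)
    · exact (hgc.comp continuous_fst).min (hgc.comp continuous_snd)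
  have hpc : Continuous fun p : M × M => (l.map fun o => D.kScale ρ o p).prod :=
    continuous_list_prod l fun o _ => hsc o
  have hlc : ContinuousAt (fun p : M × M => (l.map fun o => D.kScale ρ o p).prod *
      ‖iterD kField l (fun p : M × M => A p.1 p.2) p‖) (ζ, z) :=
    hpc.continuousAt.mul ((iterD_smooth hreg (fun o => fieldOn_kField o _) hA
      l).continuousOn.continuousAt (hreg.mem_nhds hp)).norm
  have hrc : ContinuousAt (fun p : M × M => C * ρ p.1 p.2 ^ m) (ζ, z) :=
    (continuous_const.mul (hρ.continuous.pow m)).continuousAt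
  have hne : (𝓝[D.offDiag] ((ζ, z) : M × M)).NeBot := mem_closure_iff_nhdsWithin_neBot.1 hcl
  exact le_of_tendsto_of_tendsto (hlc.mono_left nhdsWithin_le_nhds)
    (hrc.mono_left nhdsWithin_le_nhds) (eventually_mem_nhdsWithin.mono fun p hp => hC p hp)

end TangDeriv


/-! ### Coefficients of smooth tangential vector fields -/

section ComplexStructure

variable {n : ℕ} {M : Type*} [TopologicalSpace M] [ChartedSpace (Cn n) M]
  [IsManifold 𝓘(ℂ, Cn n) ω M]

/-- The tangent space at `x` is identified with `ℂⁿ` by the chart at `x`, so the differential of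
another chart is that of a holomorphic coordinate change and is complex linear. Hence `J` of a
smooth field is smooth. -/
theorem chartD_mulI {p x : M} (hx : x ∈ (chartAt (Cn n) p).source) (v : Tan n x) :
    chartD p x (mulI v) = Complex.I • chartD p x v := by
  have h1 : chartD p x = tangentCoordChange 𝓘(ℝ, Cn n) x p x :=
    mfderiv_chartAt_eq_tangentCoordChange (I := 𝓘(ℝ, Cn n)) (by simpa using hx)
  have hc := ((contDiffGroupoid ω 𝓘(ℂ, Cn n)).compatible (chart_mem_atlas (Cn n) x)
    (chart_mem_atlas (Cn n) p)).1
  have hmem : chartAt (Cn n) x x ∈ ((chartAt (Cn n) x).symm.trans (chartAt (Cn n) p)).source := by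
    simp [hx, mem_chart_source]
  have hc' : ContDiffOn ℂ ω ((chartAt (Cn n) p) ∘ (chartAt (Cn n) x).symm)
      ((chartAt (Cn n) x).symm.trans (chartAt (Cn n) p)).source := by
    simpa [contDiffPregroupoid, Function.comp_def] using! hc
  have hd : DifferentiableAt ℂ ((chartAt (Cn n) p) ∘ (chartAt (Cn n) x).symm)
      (chartAt (Cn n) x x) :=
    (hc'.contDiffAt (((chartAt (Cn n) x).symm.trans
      (chartAt (Cn n) p)).open_source.mem_nhds hmem)).differentiableAt (by simp)
  have h2 : ∀ w : Cn n, tangentCoordChange 𝓘(ℝ, Cn n) x p x w =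
      fderiv ℂ ((chartAt (Cn n) p) ∘ (chartAt (Cn n) x).symm) (chartAt (Cn n) x x) w := by
    intro w
    rw [tangentCoordChange_def]
    simp only [mfld_simps, fderivWithin_univ]
    have := (hd.hasFDerivAt.restrictScalars ℝ).fderiv
    exact congr($this w)
  rw [h1]
  change tangentCoordChange 𝓘(ℝ, Cn n) x p x (Complex.I • (show Cn n from v)) = _
  erw [h2, h2, map_smul]

/-- The field `JZ`. -/
def SmoothField.mulI (Z : SmoothField n M) : SmoothField n M :=
  ⟨fun x => HL.mulI (Z x), by
    intro p
    have hp := mem_chart_source (Cn n) p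
    have h1 := fieldOn_chartD (chartAt (Cn n) p).open_source subset_rfl
      (Z.contMDiff.contMDiffOn (s := (chartAt (Cn n) p).source)) (by simp)
    have h2 : ContMDiffOn 𝓘(ℝ, Cn n) 𝓘(ℝ, Cn n) ∞
        (fun x => Complex.I • chartD p x (Z x)) (chartAt (Cn n) p).source := by
      have hI : ContDiff ℝ ∞ (fun w : Cn n => Complex.I • w) := contDiff_const_smul _
      exact hI.contMDiff.comp_contMDiffOn h1
    have h3 := fieldOn_chartDinv (p := p) subset_rfl h2 (by simp)
    refine (ContMDiffOn.congr h3 fun x hx => ?_).contMDiffAt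
      ((chartAt (Cn n) p).open_source.mem_nhds hp)
    have h4 : HL.mulI (Z x) = chartDinv p x (Complex.I • chartD p x (Z x)) := by
      rw [← chartD_mulI hx, chartDinv_chartD hx]
    simp only [h4]⟩

theorem IsFrameOn.dirDeriv_mulI {N : ℕ} {K : Set M} {φ : Fin N → M → ℝ}
    {Z : Fin N → SmoothField n M} (h : IsFrameOn K φ Z) {x : M} (hx : x ∈ K) (u : M → ℝ)
    (v : Tan n x) :
    dirDeriv u x (mulI v) = ∑ j, dirDeriv (φ j) x v * dirDeriv u x ((Z j).mulI x) := by
  let L : Cn n →L[ℝ] ℝ := mfderiv 𝓘(ℝ, Cn n) 𝓘(ℝ, ℝ) u x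
  have h0 : (show Cn n from v) = ∑ j, dirDeriv (φ j) x v • (show Cn n from Z j x) :=
    h.eq_sum x hx v
  have h1 : (show Cn n from mulI v) =
      ∑ j, dirDeriv (φ j) x v • (show Cn n from (Z j).mulI x) := by
    refine (congrArg (fun w : Cn n => Complex.I • w) h0).trans ?_
    simp only
    rw [Finset.smul_sum]
    refine Finset.sum_congr rfl fun j _ => ?_
    exact smul_comm (M := ℂ) (N := ℝ) Complex.I (dirDeriv (φ j) x v) (show Cn n from Z j x)
  change L (show Cn n from mulI v) = ∑ j, dirDeriv (φ j) x v * L (show Cn n from (Z j).mulI x)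
  rw [h1, map_sum]
  exact Finset.sum_congr rfl fun j _ => L.map_smul _ _

end ComplexStructure

/-! ### Coefficients of class `ξ₀` and the estimate `X r = O(r)` -/

section Xi0

variable {n : ℕ} {M : Type*} [TopologicalSpace M] [ChartedSpace (Cn n) M]
  [IsManifold 𝓘(ℂ, Cn n) ω M] [T2Space M] [SecondCountableTopology M] {D : LeviDomain n M}
  {S : Set M}

theorem LeviDomain.XiOn.mul (hS : IsOpen S) (hSr : S ⊆ D.reg) {φ ψ : M → ℝ} {u v : M → ℂ}
    (hφ : ∀ x ∈ S, 0 ≤ φ x) (hψ : ∀ x ∈ S, 0 ≤ ψ x) (hu : D.XiOn S φ u) (hv : D.XiOn S ψ v) :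
    D.XiOn S (fun x => φ x * ψ x) (fun x => u x * v x) :=
  Symb.bilin (ContinuousLinearMap.mul ℝ ℂ) hS (fun Z => fieldOn_fld Z S)
    (fun _ _ hx => D.gamma_pos (hSr hx)) hφ hψ hu hv

theorem LeviDomain.XiOn.mul_one (hS : IsOpen S) (hSr : S ⊆ D.reg) {u v : M → ℂ}
    (hu : D.XiOn S (fun _ => 1) u) (hv : D.XiOn S (fun _ => 1) v) :
    D.XiOn S (fun _ => 1) (fun x => u x * v x) := by
  have := hu.mul hS hSr (fun _ _ => zero_le_one) (fun _ _ => zero_le_one) hv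
  simpa using this

theorem LeviDomain.XiOn.add_one (hS : IsOpen S) (hSr : S ⊆ D.reg) {u v : M → ℂ}
    (hu : D.XiOn S (fun _ => 1) u) (hv : D.XiOn S (fun _ => 1) v) :
    D.XiOn S (fun _ => 1) (fun x => u x + v x) :=
  (Symb.add hS (fun Z => fieldOn_fld Z S) (fun _ _ hx => D.gamma_pos (hSr hx))
    (fun _ _ => zero_le_one) (fun _ _ => zero_le_one) hu hv).mono 2
    (fun _ _ => by norm_num) fun _ _ => by norm_num

theorem LeviDomain.XiOn.ofReal (hS : IsOpen S) (hSr : S ⊆ D.reg) {φ : M → ℝ} {u : M → ℝ}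
    (hu : D.XiOn S φ u) : D.XiOn S φ (fun x => (u x : ℂ)) :=
  Symb.clm Complex.ofRealCLM hS (fun Z => fieldOn_fld Z S)
    (fun _ _ hx => D.gamma_pos (hSr hx)) hu

theorem LeviDomain.XiOn.sum_one {ι : Type*} {t : Finset ι} (hS : IsOpen S) (hSr : S ⊆ D.reg)
    {F : Type*} [NormedAddCommGroup F] [NormedSpace ℝ F] {u : ι → M → F}
    (hu : ∀ j ∈ t, D.XiOn S (fun _ => 1) (u j)) :
    D.XiOn S (fun _ => 1) (fun x => ∑ j ∈ t, u j x) :=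
  Symb.sum hS (fun Z => fieldOn_fld Z S) (fun _ _ hx => D.gamma_pos (hSr hx))
    (fun _ _ => zero_le_one) hu

theorem LeviDomain.XiOn.const (hSr : S ⊆ D.reg) (c : ℂ) : D.XiOn S (fun _ => 1) (fun _ => c) :=
  Symb.mono_set (D.xiOn_reg_of_smooth contMDiff_const) hSr

theorem LeviDomain.xiOn_of_local {F : Type*} [NormedAddCommGroup F] [NormedSpace ℝ F] {u : M → F}
    {φ : M → ℝ} (hφ : ∀ x ∈ D.reg, 0 ≤ φ x)
    (h : ∀ p ∈ closure D.carrier, ∃ V ∈ 𝓝 p, IsOpen V ∧ D.XiOn (V ∩ D.reg) φ u) :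
    D.XiOn D.reg φ u := by
  refine ⟨fun x hx => ?_, fun l => ?_⟩
  · obtain ⟨V, hV, hVo, hu⟩ := h x (D.reg_subset_closure hx)
    exact (hu.1.contMDiffAt ((hVo.inter D.isOpen_reg).mem_nhds
      ⟨mem_of_mem_nhds hV, hx⟩)).contMDiffWithinAt
  · have key : ∃ C : ℝ, ∀ x ∈ closure D.carrier ∩ D.reg,
        (l.map fun _ : SmoothField n M => D.gamma x).prod * ‖iterD fld l u x‖ ≤ C * φ x := by
      refine D.isCompact_closure.induction_on (p := fun s => ∃ C : ℝ, ∀ x ∈ s ∩ D.reg,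
        (l.map fun _ : SmoothField n M => D.gamma x).prod * ‖iterD fld l u x‖ ≤ C * φ x)
        ⟨0, by simp⟩ ?_ ?_ ?_
      · rintro s t hst ⟨C, hC⟩
        exact ⟨C, fun x hx => hC x ⟨hst hx.1, hx.2⟩⟩
      · rintro s t ⟨C, hC⟩ ⟨C', hC'⟩
        refine ⟨max C C', fun x hx => ?_⟩
        rcases hx.1 with h1 | h1
        · exact (hC x ⟨h1, hx.2⟩).trans (mul_le_mul_of_nonneg_right (le_max_left _ _) (hφ x hx.2))
        · exact (hC' x ⟨h1, hx.2⟩).trans (mul_le_mul_of_nonneg_right (le_max_right _ _) (hφ x hx.2))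
      · intro p hp
        obtain ⟨V, hV, -, hu⟩ := h p hp
        obtain ⟨C, hC⟩ := hu.2 l
        exact ⟨V, mem_nhdsWithin_of_mem_nhds hV, C, hC⟩
    obtain ⟨C, hC⟩ := key
    exact ⟨C, fun x hx => hC x ⟨D.reg_subset_closure hx, hx⟩⟩

theorem exists_compact_nhds (n : ℕ) {M : Type*} [TopologicalSpace M] [ChartedSpace (Cn n) M]
    {U : Set M} (hU : IsOpen U) {p : M} (hp : p ∈ U) :
    ∃ V K : Set M, IsOpen V ∧ p ∈ V ∧ V ⊆ K ∧ IsCompact K ∧ K ⊆ U := by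
  have := locallyCompact n M
  obtain ⟨K, hK, h1, h2⟩ := exists_compact_subset hU hp
  exact ⟨interior K, K, isOpen_interior, h1, interior_subset, hK, h2⟩

/-- The properties of smooth tangential vector fields that are used below. -/
structure LeviDomain.IsAdmissible (D : LeviDomain n M) (X : ComplexField n M) : Prop where
  re_smooth : FieldOn (I := 𝓘(ℝ, Cn n)) ∞ X.re D.carrier
  im_smooth : FieldOn (I := 𝓘(ℝ, Cn n)) ∞ X.im D.carrier
  coeff : ∀ φ : M → ℝ, ContMDiff 𝓘(ℝ, Cn n) 𝓘(ℝ, ℝ) ∞ φ →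
    D.XiOn D.reg (fun _ => 1) (X.apply fun y => (φ y : ℂ))
  r_le : ∃ C : ℝ, ∀ x ∈ D.reg, ‖X.apply (fun y => (D.r y : ℂ)) x‖ ≤ C * |D.r x|

theorem ComplexField.apply_ofReal (X : ComplexField n M) {φ : M → ℝ} {x : M}
    (hφ : MDifferentiableAt 𝓘(ℝ, Cn n) 𝓘(ℝ, ℝ) φ x) :
    X.apply (fun y => (φ y : ℂ)) x =
      ((dirDeriv φ x (X.re x) : ℝ) : ℂ) + Complex.I * ((dirDeriv φ x (X.im x) : ℝ) : ℂ) := by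
  rw [ComplexField.apply, dirDeriv_ofReal hφ, dirDeriv_ofReal hφ, smul_eq_mul]

theorem ComplexField.apply_ofReal_contMDiffOn {X : ComplexField n M} {O : Set M} (hO : IsOpen O)
    (hre : FieldOn (I := 𝓘(ℝ, Cn n)) ∞ X.re O) (him : FieldOn (I := 𝓘(ℝ, Cn n)) ∞ X.im O)
    {φ : M → ℝ} (hφ : ContMDiff 𝓘(ℝ, Cn n) 𝓘(ℝ, ℝ) ∞ φ) :
    ContMDiffOn 𝓘(ℝ, Cn n) 𝓘(ℝ, ℂ) ∞ (X.apply fun y => (φ y : ℂ)) O := by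
  have h1 := lieD_smooth hO hre hφ.contMDiffOn
  have h2 := lieD_smooth hO him hφ.contMDiffOn
  have h3 : ContMDiffOn 𝓘(ℝ, Cn n) 𝓘(ℝ, ℂ) ∞
      (fun x => Complex.ofRealCLM (lieD X.re φ x)) O :=
    Complex.ofRealCLM.contMDiff.comp_contMDiffOn h1
  have h4 : ContMDiffOn 𝓘(ℝ, Cn n) 𝓘(ℝ, ℂ) ∞
      (fun x => (ContinuousLinearMap.mul ℝ ℂ Complex.I) (Complex.ofRealCLM (lieD X.im φ x))) O :=
    (ContinuousLinearMap.contMDiff _).comp_contMDiffOn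
      (Complex.ofRealCLM.contMDiff.comp_contMDiffOn h2)
  refine (h3.add h4).congr fun x _ => ?_
  rw [X.apply_ofReal (hφ.mdifferentiableAt (by simp))]
  rfl

/-- The frame condition controls `dφ(v)`, but `L` and `L̄` also involve `dφ(Jv)`. Expanding `v` in a
global frame gives `dφ(Jv) = ∑ dψⱼ(v) (JZⱼ)φ`, where only smooth fields and controlled coefficients
occur. -/
theorem LeviDomain.IsFrame.xiOn_hol {i₀ : Fin n} {v : Fin n → ∀ x : M, Tan n x} {S : Set M}
    (hS : IsOpen S) (hSr : S ⊆ D.reg)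
    (hv : D.IsFrame S i₀ v) {φ : M → ℝ} (hφ : ContMDiff 𝓘(ℝ, Cn n) 𝓘(ℝ, ℝ) ∞ φ) (i : Fin n) :
    D.XiOn S (fun _ => 1) (fun x => holDeriv (fun y => (φ y : ℂ)) x (v i x)) ∧
    D.XiOn S (fun _ => 1) (fun x => antiholDeriv (fun y => (φ y : ℂ)) x (v i x)) := by
  obtain ⟨N, ψ, Z, hZ⟩ := exists_frame (n := n) D.isCompact_closure
  have h1 := ((hv.coeff i φ hφ).xiOn).ofReal hS hSr
  have h2 : D.XiOn S (fun _ => 1) fun x => ((dirDeriv φ x (mulI (v i x)) : ℝ) : ℂ) := by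
    have : ∀ j ∈ Finset.univ, D.XiOn S (fun _ => 1) fun x =>
        ((dirDeriv (ψ j) x (v i x) : ℝ) : ℂ) * ((dirDeriv φ x ((Z j).mulI x) : ℝ) : ℂ) :=
      fun j _ => (((hv.coeff i (ψ j) (hZ.smooth j)).xiOn).ofReal hS hSr).mul_one hS hSr
        (LeviDomain.XiOn.ofReal hS hSr (Symb.mono_set (D.xiOn_reg_of_smooth (contMDiffOn_univ.1
          (lieD_smooth isOpen_univ (fieldOn_fld (Z j).mulI _) hφ.contMDiffOn))) hSr))
    refine Symb.congr hS (LeviDomain.XiOn.sum_one hS hSr this) fun x hx => ?_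
    rw [hZ.dirDeriv_mulI (D.reg_subset_closure (hSr hx))]
    push_cast
    rfl
  have hmd : ∀ x, MDifferentiableAt 𝓘(ℝ, Cn n) 𝓘(ℝ, ℝ) φ x := fun x =>
    hφ.mdifferentiableAt (by simp)
  have hc := fun c : ℂ => LeviDomain.XiOn.const (D := D) hSr c
  constructor
  · refine Symb.congr hS ((hc (1 / 2)).mul_one hS hSr
      (h1.add_one hS hSr ((hc (-Complex.I)).mul_one hS hSr h2))) fun x _ => ?_
    rw [holDeriv_ofReal (hmd x)]
    ring
  · refine Symb.congr hS ((hc (1 / 2)).mul_one hS hSr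
      (h1.add_one hS hSr ((hc Complex.I).mul_one hS hSr h2))) fun x _ => ?_
    rw [antiholDeriv_ofReal (hmd x)]

/-- As `r` and `γ` are real, this is the conjugate of the frame condition on `∂r`. -/
theorem LeviDomain.IsFrame.antihol_r {i₀ : Fin n} {v : Fin n → ∀ x : M, Tan n x} {S : Set M}
    (hv : D.IsFrame S i₀ v) {x : M} (hx : x ∈ S) (i : Fin n) :
    antiholDeriv (fun y => (D.r y : ℂ)) x (v i x) = if i = i₀ then (D.gamma x : ℂ) else 0 := by
  have h := hv.delR_eq x hx i
  rw [LeviDomain.delR, holDeriv_ofReal (D.r_mdiff x)] at h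
  rw [antiholDeriv_ofReal (D.r_mdiff x)]
  have h2 := congrArg (starRingEnd ℂ) h
  rw [apply_ite (starRingEnd ℂ)] at h2
  simp only [map_mul, map_sub, Complex.conj_ofReal, Complex.conj_I, map_div₀, map_one, map_ofNat,
    map_zero] at h2
  rw [← h2]
  ring

/-- Compactness of the closure reduces both estimates to neighbourhoods of interior points, where
`X` is smooth and `|r|` is bounded below, and of boundary points, where the local formula applies.
In that formula `Lᵢ r` and `L̄ᵢ r` vanish for `i ≠ i₀`, and `(L_{i₀} - L̄_{i₀}) r = γ - γ = 0`; what
remains is `d · r · 2γ`, a multiple of `r`. -/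
theorem LeviDomain.IsSmoothTangential.isAdmissible {X : ComplexField n M}
    (hX : D.IsSmoothTangential X) : D.IsAdmissible X := by
  obtain ⟨hre, him, hloc⟩ := hX
  refine ⟨hre, him, fun φ hφ => ?_, ?_⟩
  · refine D.xiOn_of_local (fun _ _ => zero_le_one) fun p hp => ?_
    rw [closure_eq_self_union_frontier] at hp
    rcases hp with hp | hp
    · obtain ⟨V, K, hV, hpV, hVK, hK, hKU⟩ := exists_compact_nhds n D.isOpen_carrier hp
      exact ⟨V, hV.mem_nhds hpV, hV, D.xiOn_of_smooth D.isOpen_carrier hK hKU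
        (inter_subset_left.trans hVK) (inter_subset_right.trans D.reg_subset_closure)
        (ComplexField.apply_ofReal_contMDiffOn D.isOpen_carrier hre him hφ)⟩
    · obtain ⟨U, i₀, v, a, b, c, d, hU, hpU, hv, ha, hb, hc, hd, hXU⟩ := hloc p hp
      obtain ⟨V, K, hV, hpV, hVK, hK, hKU⟩ := exists_compact_nhds n hU hpU
      refine ⟨V, hV.mem_nhds hpV, hV, ?_⟩
      have hS : IsOpen (V ∩ D.reg) := hV.inter D.isOpen_reg
      have hSr : V ∩ D.reg ⊆ D.reg := inter_subset_right
      have hSU : V ∩ D.reg ⊆ U ∩ D.reg := inter_subset_inter_left _ (hVK.trans hKU)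
      have hsm : ∀ {u : M → ℂ}, ContMDiffOn 𝓘(ℝ, Cn n) 𝓘(ℝ, ℂ) ∞ u U →
          D.XiOn (V ∩ D.reg) (fun _ => 1) u := fun hu =>
        D.xiOn_of_smooth hU hK hKU (inter_subset_left.trans hVK)
          (inter_subset_right.trans D.reg_subset_closure) hu
      have hh := fun i => hv.xiOn_hol (hU.inter D.isOpen_reg) inter_subset_right hφ i
      have h1 : ∀ i, D.XiOn (V ∩ D.reg) (fun _ => 1)
          (fun x => holDeriv (fun y => (φ y : ℂ)) x (v i x)) := fun i =>
        Symb.mono_set (hh i).1 hSU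
      have h2 : ∀ i, D.XiOn (V ∩ D.reg) (fun _ => 1)
          (fun x => antiholDeriv (fun y => (φ y : ℂ)) x (v i x)) := fun i =>
        Symb.mono_set (hh i).2 hSU
      have hcs := fun c : ℂ => LeviDomain.XiOn.const (D := D) hSr c
      have hr : D.XiOn (V ∩ D.reg) (fun _ => 1) (fun x => (D.r x : ℂ)) :=
        LeviDomain.XiOn.ofReal hS hSr (Symb.mono_set (D.xiOn_reg_of_smooth D.smooth_r) hSr)
      have e1 : ∀ i ∈ Finset.univ.erase i₀, D.XiOn (V ∩ D.reg) (fun _ => 1) (fun x =>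
          a i x * holDeriv (fun y => (φ y : ℂ)) x (v i x) +
          b i x * antiholDeriv (fun y => (φ y : ℂ)) x (v i x)) := fun i _ =>
        ((hsm (ha i)).mul_one hS hSr (h1 i)).add_one hS hSr ((hsm (hb i)).mul_one hS hSr (h2 i))
      have e2 := (hsm hc).mul_one hS hSr ((h1 i₀).add_one hS hSr
        ((hcs (-1)).mul_one hS hSr (h2 i₀)))
      have e3 := (hsm hd).mul_one hS hSr (hr.mul_one hS hSr ((h1 i₀).add_one hS hSr (h2 i₀)))
      refine Symb.congr hS (((LeviDomain.XiOn.sum_one hS hSr e1).add_one hS hSr e2).add_one hS hSr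
        e3) fun x hx => ?_
      rw [hXU (fun y => (φ y : ℂ)) (Complex.ofRealCLM.contMDiff.comp hφ) x (hSU hx)]
      ring
  · have key : ∃ C : ℝ, ∀ x ∈ closure D.carrier ∩ D.reg,
        ‖X.apply (fun y => (D.r y : ℂ)) x‖ ≤ C * |D.r x| := by
      refine D.isCompact_closure.induction_on (p := fun s => ∃ C : ℝ, ∀ x ∈ s ∩ D.reg,
        ‖X.apply (fun y => (D.r y : ℂ)) x‖ ≤ C * |D.r x|) ⟨0, by simp⟩ ?_ ?_ ?_
      · rintro s t hst ⟨C, hC⟩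
        exact ⟨C, fun x hx => hC x ⟨hst hx.1, hx.2⟩⟩
      · rintro s t ⟨C, hC⟩ ⟨C', hC'⟩
        refine ⟨max C C', fun x hx => ?_⟩
        rcases hx.1 with h1 | h1
        · exact (hC x ⟨h1, hx.2⟩).trans (mul_le_mul_of_nonneg_right (le_max_left _ _) (abs_nonneg _))
        · exact (hC' x ⟨h1, hx.2⟩).trans
            (mul_le_mul_of_nonneg_right (le_max_right _ _) (abs_nonneg _))
      · intro p hp
        rw [closure_eq_self_union_frontier] at hp
        rcases hp with hp | hp
        · obtain ⟨V, K, hV, hpV, hVK, hK, hKU⟩ := exists_compact_nhds n D.isOpen_carrier hp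
          obtain ⟨C, hC⟩ := hK.exists_bound_of_continuousOn
            ((ComplexField.apply_ofReal_contMDiffOn D.isOpen_carrier hre him
              D.smooth_r).continuousOn.mono hKU)
          obtain ⟨x₀, hx₀, hmin⟩ := hK.exists_isMinOn ⟨p, hVK hpV⟩
            (D.smooth_r.continuous.abs.continuousOn)
          have hpos : 0 < |D.r x₀| := abs_pos.2 (ne_of_lt (hKU hx₀))
          refine ⟨V, mem_nhdsWithin_of_mem_nhds (hV.mem_nhds hpV), |C| / |D.r x₀|, fun x hx => ?_⟩
          calc _ ≤ |C| := (hC x (hVK hx.1)).trans (le_abs_self _)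
            _ = |C| / |D.r x₀| * |D.r x₀| := by field_simp
            _ ≤ _ := mul_le_mul_of_nonneg_left (hmin (hVK hx.1)) (by positivity)
        · obtain ⟨U, i₀, v, a, b, c, d, hU, hpU, hv, ha, hb, hc, hd, hXU⟩ := hloc p hp
          obtain ⟨V, K, hV, hpV, hVK, hK, hKU⟩ := exists_compact_nhds n hU hpU
          obtain ⟨C, hC⟩ := hK.exists_bound_of_continuousOn (hd.continuousOn.mono hKU)
          obtain ⟨Γ, hΓ1, hΓ⟩ := D.exists_gamma_le
          refine ⟨V, mem_nhdsWithin_of_mem_nhds (hV.mem_nhds hpV), |C| * (Γ + Γ), fun x hx => ?_⟩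
          have hx' : x ∈ U ∩ D.reg := ⟨hKU (hVK hx.1), hx.2⟩
          rw [hXU (fun y => (D.r y : ℂ)) (Complex.ofRealCLM.contMDiff.comp D.smooth_r) x hx']
          have hhol : ∀ i, holDeriv (fun y => (D.r y : ℂ)) x (v i x) =
              if i = i₀ then (D.gamma x : ℂ) else 0 := fun i => hv.delR_eq x hx' i
          simp only [hhol, hv.antihol_r hx']
          -- Only the normal term survives, and it carries the explicit factor `r`.
          rw [Finset.sum_eq_zero (fun i hi => by simp [Finset.ne_of_mem_erase hi])]
          simp only [if_true, sub_self, mul_zero, add_zero, zero_add]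
          rw [norm_mul, norm_mul, Complex.norm_real, Real.norm_eq_abs]
          have h1 : ‖(D.gamma x : ℂ) + (D.gamma x : ℂ)‖ ≤ Γ + Γ := by
            have h2 : ‖(D.gamma x : ℂ)‖ ≤ Γ := by
              rw [Complex.norm_real, Real.norm_of_nonneg (D.gamma_nonneg x)]
              exact hΓ x (D.reg_subset_closure hx.2)
            exact (norm_add_le _ _).trans (add_le_add h2 h2)
          calc _ ≤ |C| * (|D.r x| * (Γ + Γ)) := by
                refine mul_le_mul ((hC x (hVK hx.1)).trans (le_abs_self _)) ?_ (by positivity)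
                  (abs_nonneg _)
                exact mul_le_mul_of_nonneg_left h1 (abs_nonneg _)
            _ = _ := by ring
    obtain ⟨C, hC⟩ := key
    exact ⟨C, fun x hx => hC x ⟨D.reg_subset_closure hx, hx⟩⟩

/-- These fields have no tangency condition to satisfy: on their support `r` is bounded away from
zero. They supply enough directions to prove that the integral operator is differentiable. -/
theorem LeviDomain.isAdmissible_of_compact_support (D : LeviDomain n M) (Z : SmoothField n M)
    {Q : Set M} (hQ : IsCompact Q) (hQr : Q ⊆ D.reg) (hZ : ∀ x, x ∉ Q → Z x = 0) :
    D.IsAdmissible ⟨fun x => Z x, fun _ => 0⟩ := by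
  have happ : ∀ (φ : M → ℝ), ContMDiff 𝓘(ℝ, Cn n) 𝓘(ℝ, ℝ) ∞ φ → ∀ x,
      ComplexField.apply ⟨fun x => Z x, fun _ => 0⟩ (fun y => (φ y : ℂ)) x =
        ((lieD (fld Z) φ x : ℝ) : ℂ) := by
    intro φ hφ x
    rw [ComplexField.apply_ofReal _ (hφ.mdifferentiableAt (by simp))]
    have : dirDeriv φ x (0 : Tan n x) = 0 := map_zero (mfderiv 𝓘(ℝ, Cn n) 𝓘(ℝ, ℝ) φ x)
    simp only [this, Complex.ofReal_zero, mul_zero, add_zero]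
    rfl
  have hsm : ∀ (φ : M → ℝ), ContMDiff 𝓘(ℝ, Cn n) 𝓘(ℝ, ℝ) ∞ φ →
      ContMDiff 𝓘(ℝ, Cn n) 𝓘(ℝ, ℝ) ∞ (lieD (fld Z) φ) := fun φ hφ =>
    contMDiffOn_univ.1 (lieD_smooth isOpen_univ (fieldOn_fld Z _) hφ.contMDiffOn)
  refine ⟨fieldOn_fld Z _, ?_, fun φ hφ => ?_, ?_⟩
  · exact (fieldOn_fld (0 : SmoothField n M) _)
  · refine Symb.congr D.isOpen_reg (LeviDomain.XiOn.ofReal D.isOpen_reg subset_rfl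
      (D.xiOn_reg_of_smooth (hsm φ hφ))) fun x _ => happ φ hφ x
  · obtain ⟨C, hC⟩ := hQ.exists_bound_of_continuousOn (hsm _ D.smooth_r).continuous.continuousOn
    have hz : ∀ x, x ∉ Q → ‖((lieD (fld Z) D.r x : ℝ) : ℂ)‖ = 0 := fun x hx => by
      have h1 : fld Z x = 0 := hZ x hx
      have h2 : lieD (fld Z) D.r x = 0 := by
        rw [lieD, h1]
        exact map_zero (mfderiv 𝓘(ℝ, Cn n) 𝓘(ℝ, ℝ) D.r x)
      rw [h2, Complex.ofReal_zero, norm_zero]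
    rcases Q.eq_empty_or_nonempty with h0 | hne
    · refine ⟨0, fun x _ => ?_⟩
      rw [happ _ D.smooth_r, hz x (by simp [h0]), zero_mul]
    obtain ⟨x₀, hx₀, hmin⟩ := hQ.exists_isMinOn hne (D.smooth_r.continuous.abs.continuousOn)
    have hpos : 0 < |D.r x₀| := abs_pos.2 (ne_of_lt (hQr hx₀).1)
    refine ⟨|C| / |D.r x₀|, fun x _ => ?_⟩
    rw [happ _ D.smooth_r]
    by_cases hx : x ∈ Q
    · calc _ ≤ |C| := by
            rw [Complex.norm_real]
            exact (hC x hx).trans (le_abs_self _)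
        _ = |C| / |D.r x₀| * |D.r x₀| := by field_simp
        _ ≤ _ := mul_le_mul_of_nonneg_left (hmin hx) (by positivity)
    · rw [hz x hx]
      positivity

end Xi0


/-! ### Derivatives of isotropic kernels along tangential fields -/

section TangKernel

variable {n : ℕ} {M : Type*} [TopologicalSpace M] [ChartedSpace (Cn n) M]
  [IsManifold 𝓘(ℂ, Cn n) ω M]
  {F : Type*} [NormedAddCommGroup F] [NormedSpace ℂ F] {D : LeviDomain n M} {ρ : M → M → ℝ}
  {N : ℕ}

open LeviDomain (Slot)

theorem tangDeriv_congr {g : Fin N → M → ℂ} {Z : Fin N → SmoothField n M} {u v : M × M → F}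
    {S : Set (M × M)} (hS : IsOpen S) (h : EqOn u v S) :
    EqOn (tangDeriv g Z u) (tangDeriv g Z v) S := fun p hp => by
  simp only [tangDeriv]
  refine Finset.sum_congr rfl fun j _ => ?_
  rw [lieD_congr hS h hp, lieD_congr hS h hp]

theorem tangDeriv_smul {g : Fin N → M → ℂ} {Z : Fin N → SmoothField n M} {b : M × M → ℂ}
    {u : M × M → F} {p : M × M}
    (hb : MDifferentiableAt (𝓘(ℝ, Cn n).prod 𝓘(ℝ, Cn n)) 𝓘(ℝ, ℂ) b p)
    (hu : MDifferentiableAt (𝓘(ℝ, Cn n).prod 𝓘(ℝ, Cn n)) 𝓘(ℝ, F) u p) :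
    tangDeriv g Z (fun q => b q • u q) p =
      tangDeriv g Z b p • u p + b p • tangDeriv g Z u p := by
  have h : ∀ o, lieD (kField o) (fun q => b q • u q) p =
      lieD (kField o) b p • u p + b p • lieD (kField o) u p := fun o =>
    lieD_bilin (smulB F) hb hu
  simp only [tangDeriv, h, Finset.sum_smul, Finset.smul_sum, ← Finset.sum_add_distrib]
  refine Finset.sum_congr rfl fun j _ => ?_
  simp only [smul_eq_mul]
  module

theorem tangDeriv_real_comp {g : Fin N → M → ℂ} {Z : Fin N → SmoothField n M} {a : M × M → ℝ}
    {h : ℝ → ℝ} {h' : ℝ} {p : M × M} (hh : HasDerivAt h h' (a p))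
    (ha : MDifferentiableAt (𝓘(ℝ, Cn n).prod 𝓘(ℝ, Cn n)) 𝓘(ℝ, ℝ) a p) :
    tangDeriv g Z (fun q => ((h (a q) : ℝ) : ℂ)) p =
      (h' : ℂ) * tangDeriv g Z (fun q => (a q : ℂ)) p := by
  have h1 : ∀ o, lieD (kField o) (fun q => ((h (a q) : ℝ) : ℂ)) p =
      (h' : ℂ) * lieD (kField o) (fun q => (a q : ℂ)) p := fun o => by
    have e1 := lieD_real_comp (Y := kField o) (h := fun t => ((h t : ℝ) : ℂ)) hh.ofReal_comp ha
    have e2 := lieD_real_comp (Y := kField o) (h := fun t : ℝ => (t : ℂ))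
      (hasDerivAt_id (a p)).ofReal_comp ha
    rw [e1, e2]
    simp only [Complex.real_smul, Complex.ofReal_one, mul_one]
    ring
  simp only [tangDeriv, h1, Finset.mul_sum]
  refine Finset.sum_congr rfl fun j _ => ?_
  simp only [smul_eq_mul]
  ring

/-- The coefficients of `γX` in a frame. -/
def LeviDomain.tang (D : LeviDomain n M) (X : ComplexField n M) (φ : Fin N → M → ℝ) :
    Fin N → M → ℂ :=
  fun j x => (D.gamma x : ℂ) * X.apply (fun y => (φ j y : ℂ)) x

variable [T2Space M] [SecondCountableTopology M]

theorem IsFrameOn.sum_apply {K : Set M} {φ : Fin N → M → ℝ} {Z : Fin N → SmoothField n M}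
    (h : IsFrameOn K φ Z) {x : M} (hx : x ∈ K) (X : ComplexField n M) (u : M → F) :
    ∑ j, X.apply (fun y => (φ j y : ℂ)) x • dirDeriv u x (Z j x) = X.apply u x := by
  have hφ := fun j => X.apply_ofReal ((h.smooth j).mdifferentiableAt (x := x) (by simp))
  simp only [hφ]
  rw [ComplexField.apply, h.dirDeriv_eq hx u (X.re x), h.dirDeriv_eq hx u (X.im x), Finset.smul_sum,
    ← Finset.sum_add_distrib]
  refine Finset.sum_congr rfl fun j _ => ?_
  rw [add_smul, mul_smul, Complex.coe_smul, Complex.coe_smul]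

/-- With the coefficients `γ Xφⱼ` the frame sum is `γ X^ζ + γ* X^z`; the expansion makes it
accessible to estimates along the smooth fields `Zⱼ`, for which the kernel classes are defined. -/
theorem IsFrameOn.tangDeriv_eq {K : Set M} {φ : Fin N → M → ℝ} {Z : Fin N → SmoothField n M}
    (h : IsFrameOn K φ Z) (X : ComplexField n M) {u : M × M → F} {p : M × M} (h1 : p.1 ∈ K)
    (h2 : p.2 ∈ K) (hu : MDifferentiableAt (𝓘(ℝ, Cn n).prod 𝓘(ℝ, Cn n)) 𝓘(ℝ, F) u p) :
    tangDeriv (D.tang X φ) Z u p =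
      (D.gamma p.1 : ℂ) • X.apply (fun x => u (x, p.2)) p.1 +
      (D.gamma p.2 : ℂ) • X.apply (fun y => u (p.1, y)) p.2 := by
  rw [← h.sum_apply h1, ← h.sum_apply h2, Finset.smul_sum, Finset.smul_sum,
    ← Finset.sum_add_distrib]
  refine Finset.sum_congr rfl fun j _ => ?_
  rw [lieD_kField _ hu, lieD_kField _ hu]
  simp only [Slot.coeffFst, Slot.coeffSnd, one_smul, zero_smul, add_zero, zero_add,
    LeviDomain.tang, mul_smul]

theorem ComplexField.apply_const (X : ComplexField n M) (c : F) (x : M) :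
    X.apply (fun _ => c) x = 0 := by
  have h : ∀ v : Tan n x, dirDeriv (fun _ : M => c) x v = 0 := fun v =>
    lieD_const (fun _ : M => (v : Cn n)) c x
  rw [ComplexField.apply, h, h]
  simp

theorem LeviDomain.IsAdmissible.xiOn_tang {X : ComplexField n M} (hX : D.IsAdmissible X)
    {φ : Fin N → M → ℝ} (hφ : ∀ j, ContMDiff 𝓘(ℝ, Cn n) 𝓘(ℝ, ℝ) ∞ (φ j)) (j : Fin N) :
    D.XiOn D.reg D.gamma (D.tang X φ j) := by
  have := (D.xiOn_gamma.ofReal D.isOpen_reg subset_rfl).mul D.isOpen_reg subset_rfl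
    (fun x _ => D.gamma_nonneg x) (fun _ _ => zero_le_one) (hX.coeff (φ j) (hφ j))
  simpa only [mul_one] using! this

/-- The kernel `(γX^ζ + γ*X^z) (A / ρ^{2k})`, multiplied by `ρ^{2k+2}`. -/
def tangKernel (ρ : M → M → ℝ) (g : Fin N → M → ℂ) (Z : Fin N → SmoothField n M) (k : ℕ)
    (A : M → M → F) (ζ z : M) : F :=
  ((ρ ζ z ^ 2 : ℝ) : ℂ) • tangDeriv g Z (fun p => A p.1 p.2) (ζ, z) -
    ((k : ℂ) * tangDeriv g Z (fun p => ((ρ p.1 p.2 ^ 2 : ℝ) : ℂ)) (ζ, z)) • A ζ z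

theorem LeviDomain.IsDistanceFunction.symb_ofReal_sq (hρ : D.IsDistanceFunction ρ) :
    Symb D.offDiag kField (D.kScale ρ) (fun p => ρ p.1 p.2 ^ 2)
      (fun p : M × M => ((ρ p.1 p.2 ^ 2 : ℝ) : ℂ)) :=
  Symb.clm Complex.ofRealCLM D.isOpen_offDiag (fun o => fieldOn_kField o _) hρ.kScale_pos
    hρ.symb_rhoSq

theorem LeviDomain.IsDistanceFunction.smooth_ofReal_sq (hρ : D.IsDistanceFunction ρ) :
    ContMDiff (𝓘(ℝ, Cn n).prod 𝓘(ℝ, Cn n)) 𝓘(ℝ, ℂ) ∞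
      (fun p : M × M => ((ρ p.1 p.2 ^ 2 : ℝ) : ℂ)) :=
  Complex.ofRealCLM.contMDiff.comp hρ.smooth

/-- Since `T` preserves weights, both `ρ² T A` and `T(ρ²) A` have weight `ρ² ρ^m`. The gain of two
powers compensates for the denominator `ρ^{2k+2}`. -/
theorem LeviDomain.IsDistanceFunction.isE_tangKernel (hρ : D.IsDistanceFunction ρ) (hn : n ≠ 0)
    {m : ℕ} {A : M → M → F} (hA : D.IsE ρ m 0 A) {g : Fin N → M → ℂ}
    (Z : Fin N → SmoothField n M) (hg : ∀ j, D.XiOn D.reg D.gamma (g j)) (k : ℕ) :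
    D.IsE ρ (m + 2) 0 (tangKernel ρ g Z k A) := by
  have hR := D.isOpen_reg
  have hY := fun o : Slot × SmoothField n M => fieldOn_kField o D.offDiag
  have hs := hρ.kScale_pos (D := D)
  have hr : ∀ q, ∀ p ∈ D.offDiag, 0 ≤ ρ p.1 p.2 ^ q := fun q p _ => pow_nonneg (hρ.nonneg _ _) q
  have hT1 := tangDeriv_contMDiffOn (Z := Z) hR hR (by simp) le_rfl (fun j => (hg j).1)
    (fun j => (hg j).1) hA.1
  have hT2 := tangDeriv_contMDiffOn (Z := Z) hR hR (by simp) le_rfl (fun j => (hg j).1)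
    (fun j => (hg j).1) (hρ.smooth_ofReal_sq (D := D)).contMDiffOn
  have hb : ∀ {a : M × M → ℂ} {b : M × M → F},
      ContMDiffOn (𝓘(ℝ, Cn n).prod 𝓘(ℝ, Cn n)) 𝓘(ℝ, ℂ) ∞ a (D.reg ×ˢ D.reg) →
      ContMDiffOn (𝓘(ℝ, Cn n).prod 𝓘(ℝ, Cn n)) 𝓘(ℝ, F) ∞ b (D.reg ×ˢ D.reg) →
      ContMDiffOn (𝓘(ℝ, Cn n).prod 𝓘(ℝ, Cn n)) 𝓘(ℝ, F) ∞ (fun p => a p • b p)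
        (D.reg ×ˢ D.reg) := fun ha hb =>
    ((smulB F).isBoundedBilinearMap.contDiff.contMDiff.comp_contMDiffOn (ha.prodMk_space hb))
  have hmul : ContDiff ℝ ∞ fun t : ℂ => (-k : ℂ) * t := contDiff_const.mul contDiff_id
  have heq : (fun p : M × M => tangKernel ρ g Z k A p.1 p.2) = fun p : M × M =>
      smulB F ((ρ p.1 p.2 ^ 2 : ℝ) : ℂ) (tangDeriv g Z (fun p => A p.1 p.2) p) +
      smulB F (ContinuousLinearMap.mul ℝ ℂ (-k : ℂ)
        (tangDeriv g Z (fun p => ((ρ p.1 p.2 ^ 2 : ℝ) : ℂ)) p)) (A p.1 p.2) := by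
    ext p
    simp only [tangKernel, ContinuousLinearMap.lsmul_apply, ContinuousLinearMap.mul_apply', neg_mul,
      neg_smul, sub_eq_add_neg]
  refine hρ.isE_of_symb hn ?_ ?_
  · rw [heq]
    exact (hb (hρ.smooth_ofReal_sq (D := D)).contMDiffOn hT1).add
      (hb (hmul.contMDiff.comp_contMDiffOn hT2) hA.1)
  · rw [heq]
    have s1 := hρ.symb_ofReal_sq.bilin (smulB F) D.isOpen_offDiag hY hs (hr 2) (hr m)
      (hρ.symb_tangDeriv (Z := Z) hg hA.symb)
    have s2 := (Symb.clm (ContinuousLinearMap.mul ℝ ℂ (-k : ℂ)) D.isOpen_offDiag hY hs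
      (hρ.symb_tangDeriv (Z := Z) hg hρ.symb_ofReal_sq)).bilin (smulB F) D.isOpen_offDiag hY hs
      (hr 2) (hr m) hA.symb
    have hw : ∀ p ∈ D.offDiag, 0 ≤ ρ p.1 p.2 ^ 2 * ρ p.1 p.2 ^ m := fun p hp =>
      mul_nonneg (hr 2 p hp) (hr m p hp)
    refine (s1.add D.isOpen_offDiag hY hs hw hw s2).mono 2
      (fun p hp => add_nonneg (hw p hp) (hw p hp)) fun p _ => le_of_eq (by ring)

theorem LeviDomain.IsDistanceFunction.tangDeriv_quotient (hρ : D.IsDistanceFunction ρ)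
    {m : ℕ} {A : M → M → F} (hA : D.IsE ρ m 0 A) (g : Fin N → M → ℂ)
    (Z : Fin N → SmoothField n M) (k : ℕ) {p : M × M} (hp : p ∈ D.offDiag) :
    tangDeriv g Z (fun q => (ρ q.1 q.2 ^ (2 * k))⁻¹ • A q.1 q.2) p =
      (ρ p.1 p.2 ^ (2 * (k + 1)))⁻¹ • tangKernel ρ g Z k A p.1 p.2 := by
  have h0 : ρ p.1 p.2 ≠ 0 := (hρ.pos _ _ hp.2).ne'
  have hmd : MDifferentiableAt (𝓘(ℝ, Cn n).prod 𝓘(ℝ, Cn n)) 𝓘(ℝ, ℝ)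
      (fun p : M × M => ρ p.1 p.2 ^ 2) p := hρ.smooth.mdifferentiableAt (by simp)
  have hAd := hA.1.mdiffAt' (D.isOpen_reg.prod D.isOpen_reg) hp.1
  have hd : HasDerivAt (fun t : ℝ => (t ^ k)⁻¹)
      (-(k * (ρ p.1 p.2 ^ 2) ^ (k - 1) * 1) / ((ρ p.1 p.2 ^ 2) ^ k) ^ 2) (ρ p.1 p.2 ^ 2) :=
    ((hasDerivAt_id _).fun_pow k).fun_inv (pow_ne_zero _ (pow_ne_zero _ h0))
  have e1 : (fun q : M × M => (ρ q.1 q.2 ^ (2 * k))⁻¹ • A q.1 q.2) =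
      fun q => (((((ρ q.1 q.2 ^ 2) ^ k)⁻¹ : ℝ) : ℂ)) • A q.1 q.2 := by
    ext q
    rw [Complex.coe_smul, pow_mul]
  have hdm : MDifferentiableAt (𝓘(ℝ, Cn n).prod 𝓘(ℝ, Cn n)) 𝓘(ℝ, ℂ)
      (fun q : M × M => (((((ρ q.1 q.2 ^ 2) ^ k)⁻¹ : ℝ) : ℂ))) p :=
    (hd.ofReal_comp.differentiableAt.mdifferentiableAt).comp p hmd
  rw [e1, tangDeriv_smul hdm hAd, tangDeriv_real_comp (h := fun t => (t ^ k)⁻¹) hd hmd, tangKernel,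
    ← Complex.coe_smul, smul_sub, smul_smul, smul_smul, add_comm, sub_eq_add_neg, ← neg_smul]
  have hc : (ρ p.1 p.2 : ℂ) ≠ 0 := by exact_mod_cast h0
  congr 2
  · push_cast
    rw [← pow_mul]
    field_simp
    rw [← pow_add]
    congr 1
  · push_cast
    -- The derivative of `t^k` contains the truncated exponent `k - 1`; for `k = 0` the factor `k`
    -- makes it irrelevant.
    rcases k with _ | k
    · simp
    · rw [Nat.add_sub_cancel]
      field_simp
      ring

end TangKernel


/-! ### The Riemannian volume in charts -/

section Density

variable {n : ℕ} {M : Type*} [TopologicalSpace M] [ChartedSpace (Cn n) M]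
  [IsManifold 𝓘(ℂ, Cn n) ω M] {D : LeviDomain n M}

/-- The Gram matrix of the metric in the chart at `p`. -/
def LeviDomain.gramMat (D : LeviDomain n M) (p x : M) :
    Matrix (Fin (Module.finrank ℝ (Cn n))) (Fin (Module.finrank ℝ (Cn n))) ℝ :=
  Matrix.of fun i j => inner ℝ (D.gramOp p x (stdOrthonormalBasis ℝ (Cn n) i))
    (stdOrthonormalBasis ℝ (Cn n) j)

theorem LeviDomain.density_eq (D : LeviDomain n M) {p : M} {y : Cn n}
    (hy : y ∈ (chartAt (Cn n) p).target) :
    D.density p y = √((D.gramMat p ((chartAt (Cn n) p).symm y)).det) := by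
  have e : chartAt (Cn n) p ((chartAt (Cn n) p).symm y) = y := (chartAt (Cn n) p).right_inv hy
  have h : ∀ y', y' = y → ∀ v w : Cn n,
      D.metric.inner ((chartAt (Cn n) p).symm y)
        (mfderiv 𝓘(ℝ, Cn n) 𝓘(ℝ, Cn n) (chartAt (Cn n) p).symm y v : Cn n)
        (mfderiv 𝓘(ℝ, Cn n) 𝓘(ℝ, Cn n) (chartAt (Cn n) p).symm y w : Cn n) =
      D.metric.inner ((chartAt (Cn n) p).symm y)
        (mfderiv 𝓘(ℝ, Cn n) 𝓘(ℝ, Cn n) (chartAt (Cn n) p).symm y' v : Cn n)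
        (mfderiv 𝓘(ℝ, Cn n) 𝓘(ℝ, Cn n) (chartAt (Cn n) p).symm y' w : Cn n) := by
    rintro _ rfl _ _; rfl
  rw [LeviDomain.density]
  congr 2
  ext i j
  simp only [LeviDomain.gramMat, LeviDomain.inner_gramOp, Matrix.of_apply]
  exact h _ e _ _

/-- The determinant of an operator does not refer to a basis, so it is multiplicative under changes
of chart without matrix computations. -/
theorem LeviDomain.gramMat_det (D : LeviDomain n M) (p x : M) :
    (D.gramMat p x).det = (D.gramOp p x).det := by
  have h : D.gramMat p x = (LinearMap.toMatrix (stdOrthonormalBasis ℝ (Cn n)).toBasis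
      (stdOrthonormalBasis ℝ (Cn n)).toBasis (D.gramOp p x).toLinearMap).transpose := by
    ext i j
    rw [Matrix.transpose_apply, LinearMap.toMatrix_apply, OrthonormalBasis.coe_toBasis_repr_apply,
      OrthonormalBasis.repr_apply_apply, OrthonormalBasis.coe_toBasis, real_inner_comm]
    rfl
  rw [h, Matrix.det_transpose, LinearMap.det_toMatrix]

theorem LeviDomain.gramMat_det_pos (D : LeviDomain n M) {p x : M}
    (hx : x ∈ (chartAt (Cn n) p).source) : 0 < (D.gramMat p x).det := by
  refine Matrix.PosDef.det_pos (Matrix.PosDef.of_dotProduct_mulVec_pos ?_ fun v hv => ?_)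
  · ext i j
    simp only [Matrix.conjTranspose_apply, LeviDomain.gramMat, Matrix.of_apply, star_trivial,
      LeviDomain.inner_gramOp]
    exact D.metric.symm x _ _
  · set e := stdOrthonormalBasis ℝ (Cn n) with he
    have h1 : star v ⬝ᵥ (D.gramMat p x).mulVec v =
        inner ℝ (D.gramOp p x (∑ i, v i • e i)) (∑ j, v j • e j) := by
      simp only [map_sum, map_smul, sum_inner, inner_sum, inner_smul_left, inner_smul_right,
        RCLike.conj_to_real, dotProduct, Matrix.mulVec, LeviDomain.gramMat, Matrix.of_apply, ← he,
        star_trivial, Finset.mul_sum]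
      refine Finset.sum_congr rfl fun i _ => Finset.sum_congr rfl fun j _ => ?_
      rw [D.inner_gramOp, D.inner_gramOp, D.metric.symm]
      ring
    rw [h1, D.inner_gramOp]
    refine D.metric.pos x _ fun h => hv ?_
    have h2 : ∑ i, v i • e i = 0 := by
      rw [← chartD_chartDinv hx (∑ i, v i • e i), h, map_zero]
    ext i
    exact Fintype.linearIndependent_iff.1 e.orthonormal.linearIndependent v h2 i

theorem LeviDomain.density_pos (D : LeviDomain n M) {p : M} {y : Cn n}
    (hy : y ∈ (chartAt (Cn n) p).target) : 0 < D.density p y := by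
  rw [D.density_eq hy]
  exact Real.sqrt_pos.2 (D.gramMat_det_pos ((chartAt (Cn n) p).map_target hy))

theorem LeviDomain.density_contDiffOn (D : LeviDomain n M) (p : M) :
    ContDiffOn ℝ ∞ (D.density p) (chartAt (Cn n) p).target := by
  have h1 : ContDiffOn ℝ ∞ (D.gramOp p ∘ (chartAt (Cn n) p).symm) (chartAt (Cn n) p).target := by
    refine (comp_chart_symm_contDiffOn (D.gramOp_contMDiffOn p)).mono fun y hy =>
      ⟨hy, (chartAt (Cn n) p).map_target hy⟩
  have h2 : ∀ i j, ContDiffOn ℝ ∞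
      (fun y => D.gramMat p ((chartAt (Cn n) p).symm y) i j) (chartAt (Cn n) p).target :=
    fun i j => (h1.clm_apply contDiffOn_const).inner ℝ contDiffOn_const
  have h3 : ContDiffOn ℝ ∞ (fun y => (D.gramMat p ((chartAt (Cn n) p).symm y)).det)
      (chartAt (Cn n) p).target := by
    simp only [Matrix.det_apply]
    exact ContDiffOn.sum fun σ _ => (contDiffOn_prod fun i _ => h2 _ _).const_smul _
  refine (h3.sqrt fun y hy => (D.gramMat_det_pos ((chartAt (Cn n) p).map_target hy)).ne').congr
    fun y hy => D.density_eq hy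

/-- The coordinate change from the chart at `p` to the chart at `q`. -/
def trans (p q : M) : Cn n → Cn n := chartAt (Cn n) q ∘ (chartAt (Cn n) p).symm

theorem fderiv_trans {p q x : M} (hp : x ∈ (chartAt (Cn n) p).source)
    (hq : x ∈ (chartAt (Cn n) q).source) (w : Cn n) :
    fderiv ℝ (trans p q) (chartAt (Cn n) p x) w = chartD q x (chartDinv p x w) :=
  (dirDeriv_chartDinv hp ((chart_mdiff q).mdifferentiableAt hq) w).symm

theorem trans_differentiableAt {p q x : M} (hp : x ∈ (chartAt (Cn n) p).source)
    (hq : x ∈ (chartAt (Cn n) q).source) :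
    DifferentiableAt ℝ (trans p q) (chartAt (Cn n) p x) := by
  have h := comp_chart_symm_contDiffOn (p := p)
    (contMDiffOn_chart (I := 𝓘(ℝ, Cn n)) (x := q) (n := 1))
  refine (h.contDiffAt (((chartAt (Cn n) p).isOpen_inter_preimage_symm
    (chartAt (Cn n) q).open_source).mem_nhds ⟨(chartAt (Cn n) p).map_source hp, ?_⟩)).differentiableAt
    (by simp)
  rwa [mem_preimage, (chartAt (Cn n) p).left_inv hp]

/-- The Gram operators are related by `G_p = Aᵗ G_q A`, with `A` the differential of the coordinate
change; take determinants and square roots. -/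
theorem LeviDomain.density_trans (D : LeviDomain n M) {p q x : M}
    (hp : x ∈ (chartAt (Cn n) p).source) (hq : x ∈ (chartAt (Cn n) q).source) :
    D.density p (chartAt (Cn n) p x) =
      |(fderiv ℝ (trans p q) (chartAt (Cn n) p x)).det| * D.density q (chartAt (Cn n) q x) := by
  rw [D.density_eq ((chartAt (Cn n) p).map_source hp),
    D.density_eq ((chartAt (Cn n) q).map_source hq), (chartAt (Cn n) p).left_inv hp,
    (chartAt (Cn n) q).left_inv hq, D.gramMat_det, D.gramMat_det]
  set A := fderiv ℝ (trans p q) (chartAt (Cn n) p x) with hA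
  have h1 : (D.gramOp p x).toLinearMap =
      LinearMap.adjoint A.toLinearMap ∘ₗ (D.gramOp q x).toLinearMap ∘ₗ A.toLinearMap := by
    ext1 w
    refine ext_inner_right ℝ fun w' => ?_
    simp only [LinearMap.comp_apply, LinearMap.adjoint_inner_left, ContinuousLinearMap.coe_coe]
    rw [D.inner_gramOp, D.inner_gramOp, hA, fderiv_trans hp hq, fderiv_trans hp hq,
      chartDinv_chartD hq, chartDinv_chartD hq]
  have h2 : LinearMap.det (LinearMap.adjoint A.toLinearMap) = LinearMap.det A.toLinearMap := by
    rw [← LinearMap.det_toMatrix (stdOrthonormalBasis ℝ (Cn n)).toBasis,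
      LinearMap.toMatrix_adjoint, Matrix.det_conjTranspose, LinearMap.det_toMatrix, star_trivial]
  have h3 : (D.gramOp p x).det = A.det ^ 2 * (D.gramOp q x).det := by
    change LinearMap.det (D.gramOp p x).toLinearMap =
      LinearMap.det A.toLinearMap ^ 2 * LinearMap.det (D.gramOp q x).toLinearMap
    rw [h1, LinearMap.det_comp, LinearMap.det_comp, h2]
    ring
  rw [h3, Real.sqrt_mul (sq_nonneg _), Real.sqrt_sq_eq_abs]

end Density

/-! ### The volume measure and its restriction to chart domains -/

section Volume

variable {n : ℕ} {M : Type*} [TopologicalSpace M] [ChartedSpace (Cn n) M]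
  [IsManifold 𝓘(ℂ, Cn n) ω M] [MeasurableSpace M] [BorelSpace M] {D : LeviDomain n M}

theorem chart_symm_aemeasurable (p : M) (f : Cn n → ℝ≥0∞) :
    AEMeasurable (chartAt (Cn n) p).symm
      (((volume : Measure (Cn n)).withDensity f).restrict (chartAt (Cn n) p).target) :=
  (chartAt (Cn n) p).continuousOn_symm.aemeasurable (chartAt (Cn n) p).open_target.measurableSet

theorem chart_image_eq {p : M} {s : Set M} (hs : s ⊆ (chartAt (Cn n) p).source) :
    chartAt (Cn n) p '' s = (chartAt (Cn n) p).symm ⁻¹' s ∩ (chartAt (Cn n) p).target := by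
  rw [inter_comm, ← (chartAt (Cn n) p).image_eq_target_inter_inv_preimage hs]

theorem measurableSet_chart_image {p : M} {s : Set M} (hs : s ⊆ (chartAt (Cn n) p).source)
    (hm : MeasurableSet s) : MeasurableSet (chartAt (Cn n) p '' s) := by
  rw [chart_image_eq hs, inter_comm, ← Subtype.image_preimage_coe]
  exact (chartAt (Cn n) p).open_target.measurableSet.subtype_image
    ((continuousOn_iff_continuous_domRestrict.1 (chartAt (Cn n) p).continuousOn_symm).measurable hm)

theorem LeviDomain.chartVolume_apply (D : LeviDomain n M) (p : M) {s : Set M}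
    (hs : MeasurableSet s) :
    D.chartVolume p s =
      ∫⁻ y in chartAt (Cn n) p '' (s ∩ (chartAt (Cn n) p).source), ENNReal.ofReal (D.density p y) := by
  rw [LeviDomain.chartVolume, Measure.map_apply_of_aemeasurable (chart_symm_aemeasurable p _) hs,
    Measure.restrict_apply' (chartAt (Cn n) p).open_target.measurableSet, withDensity_apply',
    chart_image_eq inter_subset_right]
  congr 2
  ext y
  simp only [mem_inter_iff, mem_preimage]
  exact ⟨fun h => ⟨⟨h.1, (chartAt (Cn n) p).map_target h.2⟩, h.2⟩, fun h => ⟨h.1.1, h.2⟩⟩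

/-- The change of variables formula, with the transformation law of the densities. -/
theorem LeviDomain.chartVolume_eq (D : LeviDomain n M) {p q : M} {s : Set M} (hs : MeasurableSet s)
    (hp : s ⊆ (chartAt (Cn n) p).source) (hq : s ⊆ (chartAt (Cn n) q).source) :
    D.chartVolume p s = D.chartVolume q s := by
  rw [D.chartVolume_apply p hs, D.chartVolume_apply q hs, inter_eq_left.2 hp, inter_eq_left.2 hq]
  have himg : chartAt (Cn n) q '' s = trans p q '' (chartAt (Cn n) p '' s) := by
    rw [image_image]
    refine image_congr fun x hx => ?_
    simp [trans, (chartAt (Cn n) p).left_inv (hp hx)]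
  rw [himg, lintegral_image_eq_lintegral_abs_det_fderiv_mul volume
    (measurableSet_chart_image hp hs) (f' := fderiv ℝ (trans p q))]
  · refine setLIntegral_congr_fun (measurableSet_chart_image hp hs) ?_
    rintro _ ⟨x, hx, rfl⟩
    simp only
    rw [D.density_trans (hp hx) (hq hx), ENNReal.ofReal_mul (abs_nonneg _)]
    simp [trans, (chartAt (Cn n) p).left_inv (hp hx)]
  · rintro _ ⟨x, hx, rfl⟩
    exact (trans_differentiableAt (hp hx) (hq hx)).hasFDerivAt.hasFDerivWithinAt
  · rintro _ ⟨x, hx, rfl⟩ _ ⟨x', hx', rfl⟩ h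
    simp only [trans, Function.comp, (chartAt (Cn n) p).left_inv (hp hx),
      (chartAt (Cn n) p).left_inv (hp hx')] at h
    rw [(chartAt (Cn n) q).injOn (hq hx) (hq hx') h]

variable [SecondCountableTopology M]

/-- The pieces of the disjointed cover lie in different charts, but on overlaps all chart volumes
agree. So the choice of the cover is immaterial, and integrals may be computed in any chart. -/
theorem LeviDomain.vol_restrict_source (D : LeviDomain n M) (p : M) :
    D.vol.restrict (chartAt (Cn n) p).source = D.chartVolume p := by
  have hne : Nonempty M := ⟨p⟩
  have hmp := (chartAt (Cn n) p).open_source.measurableSet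
  ext s hs
  rw [Measure.restrict_apply hs, LeviDomain.vol, dif_pos hne]
  set c := (HL.exists_chart_cover n M).choose with hc
  have hcov : ⋃ i, (chartAt (Cn n) (c i)).source = univ := (HL.exists_chart_cover n M).choose_spec
  simp only
  rw [Measure.sum_apply _ (hs.inter hmp)]
  set d := disjointed fun j => (chartAt (Cn n) (c j)).source with hd
  have hdm : ∀ i, MeasurableSet (d i) :=
    MeasurableSet.disjointed fun i => (chartAt (Cn n) (c i)).open_source.measurableSet
  have h1 : ∀ i, ((D.chartVolume (c i)).restrict (d i)) (s ∩ (chartAt (Cn n) p).source) =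
      D.chartVolume p (s ∩ (chartAt (Cn n) p).source ∩ d i) := fun i => by
    rw [Measure.restrict_apply (hs.inter hmp)]
    exact D.chartVolume_eq ((hs.inter hmp).inter (hdm i))
      (inter_subset_right.trans (disjointed_subset _ i))
      (inter_subset_left.trans inter_subset_right)
  simp only [h1]
  rw [← measure_iUnion, ← inter_iUnion, hd, iUnion_disjointed, hcov, inter_univ,
    D.chartVolume_apply p (hs.inter hmp), D.chartVolume_apply p hs, inter_assoc, inter_self]
  · exact (disjoint_disjointed _).mono fun i j h => h.mono inter_subset_right inter_subset_right
  · exact fun i => (hs.inter hmp).inter (hdm i)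

theorem LeviDomain.density_aemeasurable (D : LeviDomain n M) (p : M) :
    AEMeasurable (fun y => ENNReal.ofReal (D.density p y))
      ((volume : Measure (Cn n)).restrict (chartAt (Cn n) p).target) :=
  ((D.density_contDiffOn p).continuousOn.aemeasurable
    (chartAt (Cn n) p).open_target.measurableSet).ennreal_ofReal

theorem LeviDomain.setIntegral_source {F : Type*} [NormedAddCommGroup F] [NormedSpace ℝ F]
    (D : LeviDomain n M) (p : M) {g : M → F}
    (hg : AEStronglyMeasurable g (D.vol.restrict (chartAt (Cn n) p).source)) :
    ∫ x in (chartAt (Cn n) p).source, g x ∂D.vol =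
      ∫ y in (chartAt (Cn n) p).target, D.density p y • g ((chartAt (Cn n) p).symm y) := by
  rw [D.vol_restrict_source] at hg ⊢
  rw [LeviDomain.chartVolume, integral_map (chart_symm_aemeasurable p _) hg,
    restrict_withDensity (chartAt (Cn n) p).open_target.measurableSet,
    integral_withDensity_eq_integral_toReal_smul₀ (D.density_aemeasurable p) (by simp)]
  refine setIntegral_congr_fun (chartAt (Cn n) p).open_target.measurableSet fun y hy => ?_
  rw [ENNReal.toReal_ofReal (D.density_pos hy).le]

theorem LeviDomain.setLIntegral_eq (D : LeviDomain n M) (p : M) {g : M → ℝ≥0∞}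
    (hg : Measurable g) {s : Set M} (hs : MeasurableSet s)
    (hsp : s ⊆ (chartAt (Cn n) p).source) :
    ∫⁻ x in s, g x ∂D.vol = ∫⁻ y in chartAt (Cn n) p '' s,
      ENNReal.ofReal (D.density p y) * g ((chartAt (Cn n) p).symm y) := by
  have hT := (chartAt (Cn n) p).open_target.measurableSet
  have h1 : D.vol.restrict s = (D.chartVolume p).restrict s := by
    rw [← D.vol_restrict_source, Measure.restrict_restrict hs, inter_eq_left.2 hsp]
  have hm : MeasurableSet (chartAt (Cn n) p '' s) := measurableSet_chart_image hsp hs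
  have hsub : chartAt (Cn n) p '' s ⊆ (chartAt (Cn n) p).target :=
    image_subset_iff.2 fun x hx => (chartAt (Cn n) p).map_source (hsp hx)
  have hsm : AEMeasurable (chartAt (Cn n) p).symm
      ((volume : Measure (Cn n)).restrict (chartAt (Cn n) p).target) :=
    (chartAt (Cn n) p).continuousOn_symm.aemeasurable hT
  rw [h1, ← lintegral_indicator hs, LeviDomain.chartVolume,
    lintegral_map' (hg.indicator hs).aemeasurable (chart_symm_aemeasurable p _),
    restrict_withDensity hT, lintegral_withDensity_eq_lintegral_mul₀ (D.density_aemeasurable p)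
      (g := fun y => s.indicator g ((chartAt (Cn n) p).symm y))
      ((hg.indicator hs).comp_aemeasurable hsm), ← lintegral_indicator hT,
    ← lintegral_indicator hm]
  refine lintegral_congr fun y => ?_
  by_cases hy : y ∈ chartAt (Cn n) p '' s
  · rw [indicator_of_mem (hsub hy), indicator_of_mem hy, Pi.mul_apply]
    obtain ⟨x, hx, rfl⟩ := hy
    rw [(chartAt (Cn n) p).left_inv (hsp hx), indicator_of_mem hx]
  · rw [indicator_of_notMem hy]
    by_cases hyt : y ∈ (chartAt (Cn n) p).target
    · rw [indicator_of_mem hyt, Pi.mul_apply, indicator_of_notMem, mul_zero]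
      exact fun h => hy ⟨_, h, (chartAt (Cn n) p).right_inv hyt⟩
    · rw [indicator_of_notMem hyt]

theorem LeviDomain.vol_eq_zero_iff (D : LeviDomain n M) {p : M} {s : Set M} (hs : MeasurableSet s)
    (hsp : s ⊆ (chartAt (Cn n) p).source) :
    D.vol s = 0 ↔ volume (chartAt (Cn n) p '' s) = 0 := by
  have hm : MeasurableSet (chartAt (Cn n) p '' s) := measurableSet_chart_image hsp hs
  have hsub : chartAt (Cn n) p '' s ⊆ (chartAt (Cn n) p).target :=
    image_subset_iff.2 fun x hx => (chartAt (Cn n) p).map_source (hsp hx)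
  have h1 := D.setLIntegral_eq p measurable_one hs hsp
  simp only [Pi.one_apply, lintegral_one, mul_one, Measure.restrict_apply_univ] at h1
  rw [h1, lintegral_eq_zero_iff' ((D.density_aemeasurable p).mono_set hsub),
    Filter.EventuallyEq, ae_restrict_iff' hm]
  constructor
  · intro h
    refine measure_mono_null (fun y hy => ?_) (ae_iff.1 h)
    have := D.density_pos (hsub hy)
    simp only [mem_ofPred_eq, Classical.not_imp]
    exact ⟨hy, by simpa using this⟩
  · intro h
    filter_upwards [measure_eq_zero_iff_ae_notMem.1 h] with y hy hy'
    exact absurd hy' hy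

instance LeviDomain.isOpenPosMeasure_vol (D : LeviDomain n M) : D.vol.IsOpenPosMeasure where
  open_pos U hU := by
    rintro ⟨p, hp⟩ h0
    have hV := hU.inter (chartAt (Cn n) p).open_source
    have h1 := (D.vol_eq_zero_iff hV.measurableSet inter_subset_right).1
      (measure_mono_null inter_subset_left h0)
    have h2 : IsOpen (chartAt (Cn n) p '' (U ∩ (chartAt (Cn n) p).source)) :=
      (chartAt (Cn n) p).isOpen_image_of_subset_source hV inter_subset_right
    exact h2.measure_ne_zero volume ⟨_, p, ⟨hp, mem_chart_source _ p⟩, rfl⟩ h1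

instance LeviDomain.isLocallyFiniteMeasure_vol (D : LeviDomain n M) :
    IsLocallyFiniteMeasure D.vol where
  finiteAtNhds p := by
    obtain ⟨V, K, hV, hpV, hVK, hK, hKs⟩ := exists_compact_nhds n (chartAt (Cn n) p).open_source
      (mem_chart_source (Cn n) p)
    refine ⟨V, hV.mem_nhds hpV, ?_⟩
    have h1 := D.setLIntegral_eq p measurable_one hV.measurableSet (hVK.trans hKs)
    simp only [Pi.one_apply, lintegral_one, mul_one, Measure.restrict_apply_univ] at h1
    have hKi : IsCompact (chartAt (Cn n) p '' K) :=
      hK.image_of_continuousOn ((chartAt (Cn n) p).continuousOn.mono hKs)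
    have hsub : chartAt (Cn n) p '' K ⊆ (chartAt (Cn n) p).target :=
      image_subset_iff.2 fun x hx => (chartAt (Cn n) p).map_source (hKs hx)
    obtain ⟨C, hC⟩ := hKi.exists_bound_of_continuousOn
      ((D.density_contDiffOn p).continuousOn.mono hsub)
    rw [h1]
    calc _ ≤ ∫⁻ y in chartAt (Cn n) p '' K, ENNReal.ofReal (D.density p y) :=
          lintegral_mono_set (image_mono hVK)
      _ ≤ ∫⁻ _ in chartAt (Cn n) p '' K, ENNReal.ofReal C := by
          refine setLIntegral_mono' hKi.measurableSet fun y hy => ENNReal.ofReal_le_ofReal ?_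
          exact (le_abs_self _).trans (hC y hy)
      _ < ⊤ := by
          rw [lintegral_const, Measure.restrict_apply_univ]
          exact ENNReal.mul_lt_top ENNReal.ofReal_lt_top hKi.measure_lt_top

theorem LeviDomain.vol_singleton (hn : n ≠ 0) [T1Space M] (D : LeviDomain n M) (p : M) :
    D.vol {p} = 0 := by
  have : NeZero n := ⟨hn⟩
  rw [D.vol_eq_zero_iff (p := p) (measurableSet_singleton p)
    (singleton_subset_iff.2 (mem_chart_source _ p)), image_singleton]
  exact measure_singleton _

end Volume


/-! ### Divergence and integration by parts -/

/-- Integration by parts against the constant function one. -/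
theorem integral_fderiv_eq_zero {E F : Type*} [NormedAddCommGroup E] [NormedSpace ℝ E]
    [FiniteDimensional ℝ E] [MeasurableSpace E] [BorelSpace E] (μ : Measure E) [μ.IsAddHaarMeasure]
    [NormedAddCommGroup F] [NormedSpace ℝ F] {G : E → F} (hG : ContDiff ℝ 1 G)
    (hc : HasCompactSupport G) (v : E) : ∫ y, fderiv ℝ G y v ∂μ = 0 := by
  have hd : Differentiable ℝ G := hG.differentiable (by simp)
  have hcont : Continuous fun y => fderiv ℝ G y v :=
    (hG.continuous_fderiv (by simp)).clm_apply continuous_const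
  have h := integral_bilinear_hasLineDerivAt_right_eq_neg_left_of_integrable (μ := μ)
    (f := fun _ : E => (1 : ℝ)) (f' := fun _ => 0) (g := G) (g' := fun y => fderiv ℝ G y v) (v := v)
    (B := ContinuousLinearMap.lsmul ℝ ℝ) (by simp)
    (by simpa using hcont.integrable_of_hasCompactSupport (hc.fderiv_apply (𝕜 := ℝ) v))
    (by simpa using hG.continuous.integrable_of_hasCompactSupport hc)
    (fun x _ => (hasFDerivAt_const (1 : ℝ) x).hasLineDerivAt v)
    (fun x _ => (hd x).hasFDerivAt.hasLineDerivAt v)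
  simpa using h

section Divergence

variable {n : ℕ} {M : Type*} [TopologicalSpace M] [ChartedSpace (Cn n) M]
  [IsManifold 𝓘(ℂ, Cn n) ω M] {D : LeviDomain n M} {F : Type*} [NormedAddCommGroup F]
  [NormedSpace ℝ F]

/-- The field `Z` in the chart at `p`, multiplied by the density of the volume. -/
def LeviDomain.fluxAt (D : LeviDomain n M) (p : M) (Z : ∀ x : M, Tan n x) (y : Cn n) : Cn n :=
  D.density p y • chartD p ((chartAt (Cn n) p).symm y) (Z ((chartAt (Cn n) p).symm y))

/-- The divergence, computed in the chart at `p`. -/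
def LeviDomain.divAt (D : LeviDomain n M) (p : M) (Z : ∀ x : M, Tan n x) (x : M) : ℝ :=
  LinearMap.trace ℝ (Cn n) (fderiv ℝ (D.fluxAt p Z) (chartAt (Cn n) p x)).toLinearMap /
    D.density p (chartAt (Cn n) p x)

theorem LeviDomain.divergence_eq (D : LeviDomain n M) (Z : ∀ x : M, Tan n x) (x : M) :
    D.divergence Z x = D.divAt x Z x := rfl

theorem LeviDomain.fluxAt_contDiffOn (D : LeviDomain n M) (p : M) {Z : ∀ x : M, Tan n x}
    {S : Set M} (hS : IsOpen S) (hZ : FieldOn (I := 𝓘(ℝ, Cn n)) ∞ Z S) :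
    ContDiffOn ℝ ∞ (D.fluxAt p Z) ((chartAt (Cn n) p).target ∩ (chartAt (Cn n) p).symm ⁻¹' S) := by
  have h1 : ContMDiffOn 𝓘(ℝ, Cn n) 𝓘(ℝ, Cn n) ∞ (fun x => chartD p x (Z x))
      (S ∩ (chartAt (Cn n) p).source) :=
    fieldOn_chartD (hS.inter (chartAt (Cn n) p).open_source) inter_subset_right
      (ContMDiffOn.mono hZ inter_subset_left) (by simp)
  exact ((D.density_contDiffOn p).mono inter_subset_left).smul
    ((comp_chart_symm_contDiffOn h1).mono fun y hy =>
      ⟨hy.1, hy.2, (chartAt (Cn n) p).map_target hy.1⟩)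

theorem chart_mem_inter {p x : M} {S : Set M} (hx : x ∈ S ∩ (chartAt (Cn n) p).source) :
    chartAt (Cn n) p x ∈ (chartAt (Cn n) p).target ∩ (chartAt (Cn n) p).symm ⁻¹' S :=
  ⟨(chartAt (Cn n) p).map_source hx.2, by
    rw [mem_preimage, (chartAt (Cn n) p).left_inv hx.2]; exact hx.1⟩

theorem LeviDomain.divAt_continuousOn (D : LeviDomain n M) (p : M) {Z : ∀ x : M, Tan n x}
    {S : Set M} (hS : IsOpen S) (hZ : FieldOn (I := 𝓘(ℝ, Cn n)) ∞ Z S) :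
    ContinuousOn (D.divAt p Z) (S ∩ (chartAt (Cn n) p).source) := by
  have hO := (chartAt (Cn n) p).isOpen_inter_preimage_symm hS
  have h1 := (D.fluxAt_contDiffOn p hS hZ).continuousOn_fderiv_of_isOpen hO (by simp)
  have hφ : ContinuousOn (chartAt (Cn n) p) (S ∩ (chartAt (Cn n) p).source) :=
    (chartAt (Cn n) p).continuousOn.mono inter_subset_right
  have h2 := h1.comp hφ fun x hx => chart_mem_inter hx
  have h3 : Continuous fun T : Cn n →L[ℝ] Cn n => LinearMap.trace ℝ (Cn n) T.toLinearMap :=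
    ((LinearMap.trace ℝ (Cn n)).comp
      (ContinuousLinearMap.coeLM ℝ (M := Cn n) (N₃ := Cn n))).continuous_of_finiteDimensional
  exact (h3.comp_continuousOn h2).div ((D.density_contDiffOn p).continuousOn.comp hφ
    fun x hx => (chart_mem_inter hx).1) fun x hx => (D.density_pos (chart_mem_inter hx).1).ne'

theorem trace_smul_add (c : ℝ) (T : Cn n →L[ℝ] Cn n) (L : Cn n →L[ℝ] ℝ) (w : Cn n) :
    LinearMap.trace ℝ (Cn n) (c • T + L.smulRight w).toLinearMap =
      c * LinearMap.trace ℝ (Cn n) T.toLinearMap + L w := by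
  have h : (c • T + L.smulRight w).toLinearMap =
      c • T.toLinearMap + L.toLinearMap.smulRight w := rfl
  rw [h, map_add, map_smul, LinearMap.trace_smulRight]
  rfl

/-- Differentiating `c` times the flux of `Z` gives `c` times the differential of the flux plus a
rank one operator, whose trace is `dc(Z)` times the density. -/
theorem LeviDomain.divergence_sum (D : LeviDomain n M) {N : ℕ} {X : ∀ x : M, Tan n x}
    {c : Fin N → M → ℝ} {Z : Fin N → SmoothField n M} {S : Set M} (hS : IsOpen S)
    (hc : ∀ j, ContMDiffOn 𝓘(ℝ, Cn n) 𝓘(ℝ, ℝ) ∞ (c j) S)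
    (hX : ∀ x ∈ S, X x = ∑ j, c j x • Z j x) {x : M} (hx : x ∈ S) :
    D.divergence X x = ∑ j, (c j x * D.divergence (fun x => Z j x) x +
      dirDeriv (c j) x (Z j x)) := by
  have hxs := mem_chart_source (Cn n) x
  have hO := (chartAt (Cn n) x).isOpen_inter_preimage_symm hS
  have hmem := chart_mem_inter (S := S) ⟨hx, hxs⟩
  have hcd : ∀ j, ContDiffOn ℝ ∞ (c j ∘ (chartAt (Cn n) x).symm) _ := fun j =>
    comp_chart_symm_contDiffOn (p := x) (hc j)
  have hfd : ∀ j, HasFDerivAt (c j ∘ (chartAt (Cn n) x).symm)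
      (fderiv ℝ (c j ∘ (chartAt (Cn n) x).symm) (chartAt (Cn n) x x)) (chartAt (Cn n) x x) :=
    fun j => (((hcd j).contDiffAt (hO.mem_nhds hmem)).differentiableAt (by simp)).hasFDerivAt
  have hZd : ∀ j, HasFDerivAt (D.fluxAt x fun x => Z j x)
      (fderiv ℝ (D.fluxAt x fun x => Z j x) (chartAt (Cn n) x x)) (chartAt (Cn n) x x) := fun j =>
    ((((D.fluxAt_contDiffOn x isOpen_univ (Z := fun x => Z j x)
      (fieldOn_fld (Z j) univ)).contDiffAt (((chartAt (Cn n) x).isOpen_inter_preimage_symm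
        isOpen_univ).mem_nhds ⟨hmem.1, trivial⟩)).differentiableAt (by simp))).hasFDerivAt
  have heq : D.fluxAt x X =ᶠ[𝓝 (chartAt (Cn n) x x)] fun y =>
      ∑ j, (c j ∘ (chartAt (Cn n) x).symm) y • D.fluxAt x (fun x => Z j x) y := by
    filter_upwards [hO.mem_nhds hmem] with y hy
    simp only [LeviDomain.fluxAt, hX _ hy.2, map_sum, map_smul, Finset.smul_sum, Function.comp]
    exact Finset.sum_congr rfl fun j _ => smul_comm _ _ _
  have hsum := (HasFDerivAt.fun_sum (u := Finset.univ) fun j _ => (hfd j).smul (hZd j)).congr_of_eventuallyEq heq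
  have hpos := (D.density_pos hmem.1).ne'
  rw [D.divergence_eq, LeviDomain.divAt, hsum.fderiv, ContinuousLinearMap.toLinearMap_sum, map_sum,
    Finset.sum_div]
  refine Finset.sum_congr rfl fun j _ => ?_
  rw [trace_smul_add, D.divergence_eq, LeviDomain.divAt, add_div, mul_div_assoc]
  have e : (chartAt (Cn n) x).symm (chartAt (Cn n) x x) = x := (chartAt (Cn n) x).left_inv hxs
  congr 1
  · simp only [Function.comp, e]
  · rw [dirDeriv_eq_fderiv hxs ((hc j).mdiffAt' hS hx), LeviDomain.fluxAt, map_smul, smul_eq_mul,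
      mul_div_cancel_left₀ _ hpos, e]

end Divergence


/-! ### The divergence theorem and the independence of the divergence of the chart -/

section PartialIntegration

variable {n : ℕ} {M : Type*} [TopologicalSpace M] [ChartedSpace (Cn n) M]
  [IsManifold 𝓘(ℂ, Cn n) ω M] [T2Space M] {D : LeviDomain n M}
  {F : Type*} [NormedAddCommGroup F] [NormedSpace ℝ F]

theorem dirDeriv_eq_zero_of_notMem_tsupport {h : M → F} {x : M} (hx : x ∉ tsupport h)
    (v : Tan n x) : dirDeriv h x v = 0 := by
  have h1 : h =ᶠ[𝓝 x] fun _ => 0 := notMem_tsupport_iff_eventuallyEq.1 hx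
  rw [dirDeriv, h1.mfderiv_eq, mfderiv_const]
  rfl

theorem dirDeriv_sum {ι : Type*} (t : Finset ι) {u : ι → M → F} {x : M}
    (hu : ∀ i ∈ t, MDifferentiableAt 𝓘(ℝ, Cn n) 𝓘(ℝ, F) (u i) x) (v : Tan n x) :
    dirDeriv (fun y => ∑ i ∈ t, u i y) x v = ∑ i ∈ t, dirDeriv (u i) x v := by
  classical
  suffices H : MDifferentiableAt 𝓘(ℝ, Cn n) 𝓘(ℝ, F) (fun y => ∑ i ∈ t, u i y) x ∧
      dirDeriv (fun y => ∑ i ∈ t, u i y) x v = ∑ i ∈ t, dirDeriv (u i) x v from H.2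
  induction t using Finset.induction_on with
  | empty =>
    simp only [Finset.sum_empty]
    exact ⟨mdifferentiableAt_const, lieD_const (fun _ : M => (v : Cn n)) 0 x⟩
  | insert i s hi ih =>
    obtain ⟨h1, h2⟩ := ih fun j hj => hu j (Finset.mem_insert_of_mem hj)
    have h3 := hu i (Finset.mem_insert_self i s)
    simp only [Finset.sum_insert hi]
    exact ⟨h3.add h1, (lieD_add (Y := fun _ : M => (v : Cn n)) h3 h1).trans
      (congrArg (dirDeriv (u i) x v + ·) h2)⟩

/-- `Zh + h div Z`, with the divergence computed in the chart at `p`. -/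
def LeviDomain.divPair (D : LeviDomain n M) (p : M) (Z : ∀ x : M, Tan n x) (h : M → F) (x : M) : F :=
  dirDeriv h x (Z x) + D.divAt p Z x • h x

theorem LeviDomain.divPair_eq_zero {p : M} {Z : ∀ x : M, Tan n x} {h : M → F} {x : M}
    (hx : x ∉ tsupport h) : D.divPair p Z h x = 0 := by
  rw [LeviDomain.divPair, dirDeriv_eq_zero_of_notMem_tsupport hx, image_eq_zero_of_notMem_tsupport hx,
    smul_zero, add_zero]

theorem LeviDomain.continuous_divPair (D : LeviDomain n M) {p : M} {Z : ∀ x : M, Tan n x}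
    {S : Set M} (hS : IsOpen S) (hZ : FieldOn (I := 𝓘(ℝ, Cn n)) ∞ Z S) {h : M → F}
    (hh : ContMDiffOn 𝓘(ℝ, Cn n) 𝓘(ℝ, F) 1 h S)
    (hs : tsupport h ⊆ S ∩ (chartAt (Cn n) p).source) : Continuous (D.divPair p Z h) := by
  have hO := hS.inter (chartAt (Cn n) p).open_source
  have hts : tsupport (D.divPair p Z h) ⊆ tsupport h :=
    closure_minimal (fun x hx => by
      by_contra h0; exact hx (D.divPair_eq_zero h0)) (isClosed_tsupport h)
  refine continuous_of_tsupport fun x hx => ?_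
  have h1 : ContinuousOn (lieD Z h) S :=
    (lieD_contMDiffOn (m := 0) hS (ContMDiffOn.of_le hZ (by simp)) hh (by simp)).continuousOn
  have h2 : ContinuousOn (D.divPair p Z h) (S ∩ (chartAt (Cn n) p).source) :=
    (h1.mono inter_subset_left).add ((D.divAt_continuousOn p hS hZ).smul
      (hh.continuousOn.mono inter_subset_left))
  exact h2.continuousAt (hO.mem_nhds (hs (hts hx)))

theorem LeviDomain.hasCompactSupport_divPair {p : M} {Z : ∀ x : M, Tan n x} {h : M → F}
    (hc : HasCompactSupport h) : HasCompactSupport (D.divPair p Z h) :=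
  HasCompactSupport.intro' hc (isClosed_tsupport h) fun _ hx => D.divPair_eq_zero hx

/-- In the chart, the density times the integrand is the Euclidean divergence of `h` times the flux,
and each of its terms is a partial derivative of a compactly supported function. -/
theorem LeviDomain.integral_divPair [MeasurableSpace M] [BorelSpace M] [SecondCountableTopology M]
    (D : LeviDomain n M) {p : M} {Z : ∀ x : M, Tan n x}
    {S : Set M} (hS : IsOpen S) (hZ : FieldOn (I := 𝓘(ℝ, Cn n)) ∞ Z S) {h : M → F}
    (hh : ContMDiffOn 𝓘(ℝ, Cn n) 𝓘(ℝ, F) 1 h S) (hc : HasCompactSupport h)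
    (hs : tsupport h ⊆ S ∩ (chartAt (Cn n) p).source) :
    ∫ x, D.divPair p Z h x ∂D.vol = 0 := by
  classical
  set φ := chartAt (Cn n) p with hφ
  have hO : IsOpen (φ.target ∩ φ.symm ⁻¹' S) := φ.isOpen_inter_preimage_symm hS
  have hTc : IsCompact (φ '' tsupport h) :=
    hc.isCompact.image_of_continuousOn (φ.continuousOn.mono (hs.trans inter_subset_right))
  have hTO : φ '' tsupport h ⊆ φ.target ∩ φ.symm ⁻¹' S := by
    rintro _ ⟨x, hx, rfl⟩
    exact chart_mem_inter (hs hx)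
  have hh' : ContDiffOn ℝ 1 (h ∘ φ.symm) (φ.target ∩ φ.symm ⁻¹' S) := comp_chart_symm_contDiffOn hh
  have hw : ContDiffOn ℝ 1 (D.fluxAt p Z) (φ.target ∩ φ.symm ⁻¹' S) :=
    (D.fluxAt_contDiffOn p hS hZ).of_le (by simp)
  have hh0 : ∀ y ∈ φ.target, y ∉ φ '' tsupport h → h (φ.symm y) = 0 := fun y hy hyT => by
    by_contra h0
    exact hyT ⟨φ.symm y, subset_tsupport h h0, φ.right_inv hy⟩
  let e := stdOrthonormalBasis ℝ (Cn n)
  -- The components of `h` times the flux, extended by zero outside the open set on which the flux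
  -- is smooth; the compact support of `h` makes the extension `C¹` on the whole space.
  let G : Fin (Module.finrank ℝ (Cn n)) → Cn n → F := fun i =>
    indicator (φ.target ∩ φ.symm ⁻¹' S) fun y => inner ℝ (e i) (D.fluxAt p Z y) • h (φ.symm y)
  have hG0 : ∀ i y, y ∉ φ '' tsupport h → G i y = 0 := fun i y hy => by
    by_cases hyO : y ∈ φ.target ∩ φ.symm ⁻¹' S
    · simp only [G, indicator_of_mem hyO, hh0 y hyO.1 hy, smul_zero]
    · exact indicator_of_notMem hyO _
  have hGt : ∀ i, tsupport (G i) ⊆ φ '' tsupport h := fun i =>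
    closure_minimal (fun y hy => by
      by_contra h0; exact hy (hG0 i y h0)) hTc.isClosed
  have hGO : ∀ i, ContDiffOn ℝ 1 (G i) (φ.target ∩ φ.symm ⁻¹' S) := fun i =>
    ((contDiffOn_const.inner ℝ hw).smul hh').congr fun y hy => indicator_of_mem hy _
  have hG : ∀ i, ContDiff ℝ 1 (G i) := fun i => by
    rw [← contMDiff_iff_contDiff]
    refine contMDiff_of_tsupport fun y hy => ?_
    exact ((hGO i).contDiffAt (hO.mem_nhds (hTO (hGt i hy)))).contMDiffAt
  have hGc : ∀ i, HasCompactSupport (G i) := fun i =>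
    HasCompactSupport.intro hTc fun y hy => hG0 i y hy
  have hcont := D.continuous_divPair hS hZ hh hs
  have key : ∀ y ∈ φ.target, D.density p y • D.divPair p Z h (φ.symm y) =
      ∑ i, fderiv ℝ (G i) y (e i) := by
    intro y hy
    by_cases hyO : y ∈ φ.target ∩ φ.symm ⁻¹' S
    · have d1 : HasFDerivAt (h ∘ φ.symm) (fderiv ℝ (h ∘ φ.symm) y) y :=
        ((hh'.contDiffAt (hO.mem_nhds hyO)).differentiableAt (by simp)).hasFDerivAt
      have d2 : HasFDerivAt (D.fluxAt p Z) (fderiv ℝ (D.fluxAt p Z) y) y :=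
        ((hw.contDiffAt (hO.mem_nhds hyO)).differentiableAt (by simp)).hasFDerivAt
      have d3 : ∀ i, fderiv ℝ (G i) y (e i) =
          inner ℝ (e i) (D.fluxAt p Z y) • fderiv ℝ (h ∘ φ.symm) y (e i) +
          inner ℝ (e i) (fderiv ℝ (D.fluxAt p Z) y (e i)) • h (φ.symm y) := fun i => by
        have heq : G i =ᶠ[𝓝 y] fun y =>
            (innerSL ℝ (e i) (D.fluxAt p Z y)) • (h ∘ φ.symm) y := by
          filter_upwards [hO.mem_nhds hyO] with y' hy'
          exact indicator_of_mem hy' _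
        have d4 := (((innerSL ℝ (e i)).hasFDerivAt.comp y d2).smul d1).congr_of_eventuallyEq heq
        rw [d4.fderiv]
        rfl
      have hx : φ.symm y ∈ φ.source := φ.map_target hy
      have hey : φ (φ.symm y) = y := φ.right_inv hy
      have hmd : MDifferentiableAt 𝓘(ℝ, Cn n) 𝓘(ℝ, F) h (φ.symm y) :=
        (hh.contMDiffAt (hS.mem_nhds hyO.2)).mdifferentiableAt (by simp)
      have hpos := (D.density_pos hy).ne'
      have e1 : D.density p y • dirDeriv h (φ.symm y) (Z (φ.symm y)) =
          fderiv ℝ (h ∘ φ.symm) y (D.fluxAt p Z y) := by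
        rw [dirDeriv_eq_fderiv hx hmd, ← hφ, hey, LeviDomain.fluxAt, map_smul]
      rw [Finset.sum_congr rfl fun i _ => d3 i, Finset.sum_add_distrib, LeviDomain.divPair, smul_add,
        e1]
      congr 1
      · conv_lhs => rw [← e.sum_repr' (D.fluxAt p Z y), map_sum]
        exact Finset.sum_congr rfl fun i _ => map_smul _ _ _
      · rw [← Finset.sum_smul, smul_smul, LeviDomain.divAt, ← hφ, hey, mul_div_cancel₀ _ hpos,
          LinearMap.trace_eq_sum_inner _ e]
        rfl
    · have hx : φ.symm y ∉ tsupport h := fun h0 => hyO ⟨hy, (hs h0).1⟩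
      have hyT : y ∉ φ '' tsupport h := fun h0 => hyO (hTO h0)
      rw [D.divPair_eq_zero hx, smul_zero]
      refine (Finset.sum_eq_zero fun i _ => ?_).symm
      rw [fderiv_of_notMem_tsupport ℝ fun h0 => hyT (hGt i h0)]
      rfl
  have h1 : ∫ x, D.divPair p Z h x ∂D.vol = ∫ x in φ.source, D.divPair p Z h x ∂D.vol :=
    (setIntegral_eq_integral_of_forall_compl_eq_zero fun x hx =>
      D.divPair_eq_zero fun h0 => hx (hs h0).2).symm
  rw [h1, D.setIntegral_source p hcont.aestronglyMeasurable,
    setIntegral_congr_fun φ.open_target.measurableSet key,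
    setIntegral_eq_integral_of_forall_compl_eq_zero, integral_finsetSum]
  · exact Finset.sum_eq_zero fun i _ => integral_fderiv_eq_zero volume (hG i) (hGc i) (e i)
  · exact fun i _ => (((hG i).continuous_fderiv (by simp)).clm_apply
      continuous_const).integrable_of_hasCompactSupport ((hGc i).fderiv_apply (𝕜 := ℝ) (e i))
  · intro y hy
    refine Finset.sum_eq_zero fun i _ => ?_
    rw [fderiv_of_notMem_tsupport ℝ fun h0 => hy (hTO (hGt i h0)).1]
    rfl

variable [MeasurableSpace M] [BorelSpace M] [SecondCountableTopology M]

/-- Both expressions satisfy `∫ (Zg + g div Z) = 0` for all test functions `g` supported in the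
overlap, with respect to the same measure. So they agree almost everywhere, and by continuity
everywhere; no transformation of second derivatives is computed. -/
theorem LeviDomain.divAt_eq (D : LeviDomain n M) {p q : M} {Z : ∀ x : M, Tan n x}
    {S : Set M} (hS : IsOpen S) (hZ : FieldOn (I := 𝓘(ℝ, Cn n)) ∞ Z S) {x : M} (hx : x ∈ S)
    (hp : x ∈ (chartAt (Cn n) p).source) (hq : x ∈ (chartAt (Cn n) q).source) :
    D.divAt p Z x = D.divAt q Z x := by
  have := sigmaCompact n M
  have := locallyCompact n M
  set U := S ∩ (chartAt (Cn n) p).source ∩ (chartAt (Cn n) q).source with hU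
  have hUo : IsOpen U := (hS.inter (chartAt (Cn n) p).open_source).inter (chartAt (Cn n) q).open_source
  have hUp : U ⊆ S ∩ (chartAt (Cn n) p).source := inter_subset_left
  have hUq : U ⊆ S ∩ (chartAt (Cn n) q).source := fun y hy => ⟨hy.1.1, hy.2⟩
  have c1 := (D.divAt_continuousOn p hS hZ).mono hUp
  have c2 := (D.divAt_continuousOn q hS hZ).mono hUq
  have h0 : ∀ᵐ y ∂D.vol, y ∈ U → (fun y => D.divAt p Z y - D.divAt q Z y) y = 0 := by
    refine hUo.ae_eq_zero_of_integral_contMDiff_smul_eq_zero 𝓘(ℝ, Cn n)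
      ((c1.sub c2).locallyIntegrableOn hUo.measurableSet) fun g hg hgc hgs => ?_
    have hg1 : ContMDiffOn 𝓘(ℝ, Cn n) 𝓘(ℝ, ℝ) 1 g S := (hg.of_le (by simp)).contMDiffOn
    have i1 := D.integral_divPair hS hZ hg1 hgc (hgs.trans hUp)
    have i2 := D.integral_divPair hS hZ hg1 hgc (hgs.trans hUq)
    have j1 := (D.continuous_divPair hS hZ hg1 (hgs.trans hUp)).integrable_of_hasCompactSupport
      (D.hasCompactSupport_divPair hgc) (μ := D.vol)
    have j2 := (D.continuous_divPair hS hZ hg1 (hgs.trans hUq)).integrable_of_hasCompactSupport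
      (D.hasCompactSupport_divPair hgc) (μ := D.vol)
    have := integral_sub j1 j2
    rw [i1, i2, sub_zero] at this
    rw [← this]
    refine integral_congr_ae (Filter.Eventually.of_forall fun y => ?_)
    simp only [LeviDomain.divPair, smul_eq_mul]
    ring
  have h1 := Measure.eqOn_open_of_ae_eq (μ := D.vol) (U := U)
    (f := fun y => D.divAt p Z y - D.divAt q Z y) (g := fun _ => 0)
    ((ae_restrict_iff' hUo.measurableSet).2 h0) hUo (c1.sub c2) continuousOn_const
  exact sub_eq_zero.1 (h1 ⟨⟨hx, hp⟩, hq⟩)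

/-- The divergence at `x` is computed in the chart at `x`, which varies with `x`; chart independence
allows one chart to be kept near each point. -/
theorem LeviDomain.divergence_continuousOn (D : LeviDomain n M) {Z : ∀ x : M, Tan n x}
    {S : Set M} (hS : IsOpen S) (hZ : FieldOn (I := 𝓘(ℝ, Cn n)) ∞ Z S) :
    ContinuousOn (D.divergence Z) S := by
  intro p hp
  have hps := mem_chart_source (Cn n) p
  have hO := hS.inter (chartAt (Cn n) p).open_source
  refine ContinuousAt.continuousWithinAt ?_
  refine ((D.divAt_continuousOn p hS hZ).continuousAt (hO.mem_nhds ⟨hp, hps⟩)).congr ?_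
  filter_upwards [hO.mem_nhds ⟨hp, hps⟩] with x hx
  exact D.divAt_eq hS hZ hx.1 hx.2 (mem_chart_source _ x)

/-- The divergence theorem for compactly supported functions. -/
theorem LeviDomain.integral_divergence (D : LeviDomain n M) {Z : ∀ x : M, Tan n x}
    {S : Set M} (hS : IsOpen S) (hZ : FieldOn (I := 𝓘(ℝ, Cn n)) ∞ Z S) {h : M → F}
    (hh : ContMDiffOn 𝓘(ℝ, Cn n) 𝓘(ℝ, F) 1 h S) (hc : HasCompactSupport h)
    (hs : tsupport h ⊆ S) :
    Integrable (fun x => dirDeriv h x (Z x) + D.divergence Z x • h x) D.vol ∧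
    ∫ x, (dirDeriv h x (Z x) + D.divergence Z x • h x) ∂D.vol = 0 := by
  obtain ⟨t, ψ, hψ, -, hψs, hψ1⟩ := exists_finite_partition (n := n) hc.isCompact hS hs
  have hsub : ∀ p, tsupport (fun x => ψ p x • h x) ⊆ S ∩ (chartAt (Cn n) p).source := fun p =>
    (closure_mono (Function.support_smul_subset_left _ _)).trans ((hψs p).trans (by
      rw [inter_comm]))
  have hc' : ∀ p, HasCompactSupport fun x => ψ p x • h x := fun p => hc.smul_left
  have hh' : ∀ p, ContMDiffOn 𝓘(ℝ, Cn n) 𝓘(ℝ, F) 1 (fun x => ψ p x • h x) S := fun p =>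
    ((hψ p).of_le (by simp)).contMDiffOn.smul hh
  have heq : (fun x => dirDeriv h x (Z x) + D.divergence Z x • h x) =
      fun x => ∑ p ∈ t, D.divPair p Z (fun x => ψ p x • h x) x := by
    ext x
    by_cases hx : x ∈ tsupport h
    · have hxS := hs hx
      have hmd : MDifferentiableAt 𝓘(ℝ, Cn n) 𝓘(ℝ, F) h x :=
        (hh.contMDiffAt (hS.mem_nhds hxS)).mdifferentiableAt (by simp)
      have hψd : ∀ p, MDifferentiableAt 𝓘(ℝ, Cn n) 𝓘(ℝ, ℝ) (ψ p) x := fun p =>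
        (hψ p).mdifferentiableAt (by simp)
      have h1 : ∀ p ∈ t, D.divPair p Z (fun x => ψ p x • h x) x =
          dirDeriv (fun x => ψ p x • h x) x (Z x) + ψ p x • (D.divergence Z x • h x) := by
        intro p _
        rw [LeviDomain.divPair]
        congr 1
        by_cases h0 : ψ p x = 0
        · simp [h0]
        · have hxp := hψs p (subset_tsupport _ h0)
          rw [D.divAt_eq hS hZ hxS hxp.1 (mem_chart_source _ x), ← D.divergence_eq, smul_comm]
      have h2 : ∑ p ∈ t, dirDeriv (fun x => ψ p x • h x) x (Z x) = dirDeriv h x (Z x) := by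
        have h3 : h = fun x => ∑ p ∈ t, ψ p x • h x := by
          ext y
          by_cases hy : y ∈ tsupport h
          · rw [← Finset.sum_smul, hψ1 y hy, one_smul]
          · simp [image_eq_zero_of_notMem_tsupport hy]
        conv_rhs => rw [h3]
        exact (dirDeriv_sum t (fun p _ => (hψd p).smul hmd) _).symm
      rw [Finset.sum_congr rfl h1, Finset.sum_add_distrib, h2, ← Finset.sum_smul, hψ1 x hx, one_smul]
    · rw [dirDeriv_eq_zero_of_notMem_tsupport hx, image_eq_zero_of_notMem_tsupport hx, smul_zero,
        add_zero]
      refine (Finset.sum_eq_zero fun p _ => D.divPair_eq_zero fun h0 => hx ?_).symm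
      exact closure_mono (Function.support_smul_subset_right _ _) h0
  have hint : ∀ p ∈ t, Integrable (D.divPair p Z fun x => ψ p x • h x) D.vol := fun p _ =>
    (D.continuous_divPair hS hZ (hh' p) (hsub p)).integrable_of_hasCompactSupport
      (D.hasCompactSupport_divPair (hc' p))
  rw [heq]
  refine ⟨integrable_finsetSum _ hint, ?_⟩
  rw [integral_finsetSum _ hint]
  exact Finset.sum_eq_zero fun p _ => D.integral_divPair hS hZ (hh' p) (hc' p) (hsub p)

end PartialIntegration


/-! ### Null sets and integrals of the kernel weight -/

section Weight

variable {n : ℕ} {M : Type*} [TopologicalSpace M] [ChartedSpace (Cn n) M]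
  [IsManifold 𝓘(ℂ, Cn n) ω M] [T2Space M] [SecondCountableTopology M] {D : LeviDomain n M} {ρ : M → M → ℝ}

/-- At a critical point the derivative of `dr` in the chart is the Hessian. It is injective by the
Morse condition, hence bounded below, so `dr` does not vanish at other nearby points. -/
theorem LeviDomain.eventually_gamma_ne (D : LeviDomain n M) {x : M} (hx : x ∈ D.carrier)
    (h0 : D.gamma x = 0) : ∀ᶠ y in 𝓝[≠] x, D.gamma y ≠ 0 := by
  set φ := chartAt (Cn n) x with hφ
  have hxs := mem_chart_source (Cn n) x
  have hsm : ContDiffAt ℝ ∞ (D.r ∘ φ.symm) (φ x) :=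
    inChart_contDiffAt hxs D.smooth_r.contMDiffAt
  have hd : HasFDerivAt (fderiv ℝ (D.r ∘ φ.symm)) (fderiv ℝ (fderiv ℝ (D.r ∘ φ.symm)) (φ x)) (φ x) :=
    ((hsm.fderiv_right (m := ∞) (by simp)).differentiableAt (by simp)).hasFDerivAt
  have hinj : Function.Injective (fderiv ℝ (fderiv ℝ (D.r ∘ φ.symm)) (φ x)) := by
    rw [injective_iff_map_eq_zero]
    intro v hv
    by_contra hne
    obtain ⟨w, hw⟩ := D.morse x (subset_closure hx) ((D.gamma_eq_zero_iff x).1 h0) v hne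
    exact hw congr($hv w)
  have hanti := (LinearMap.injective_iff_antilipschitz
    (f := (fderiv ℝ (fderiv ℝ (D.r ∘ φ.symm)) (φ x)).toLinearMap)).1 hinj
  obtain ⟨K, -, hK⟩ := hanti
  have h1 := hd.eventually_ne (c := 0) ⟨K, hK⟩
  have hcont : Filter.Tendsto φ (𝓝[≠] x) (𝓝[≠] (φ x)) := by
    refine tendsto_nhdsWithin_of_tendsto_nhds_of_eventually_within _
      ((φ.continuousAt hxs).mono_left nhdsWithin_le_nhds) ?_
    filter_upwards [mem_nhdsWithin_of_mem_nhds (φ.open_source.mem_nhds hxs), self_mem_nhdsWithin]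
      with y hys hyne h
    exact hyne (φ.injOn hys hxs h)
  filter_upwards [hcont.eventually h1,
    mem_nhdsWithin_of_mem_nhds (φ.open_source.mem_nhds hxs)] with y hy hys h
  refine hy ?_
  ext w
  have h2 := (D.gamma_eq_zero_iff y).1 h (chartDinv x y w)
  rwa [dirDeriv_chartDinv hys (D.r_mdiff y)] at h2

variable [MeasurableSpace M] [BorelSpace M]

theorem LeviDomain.vol_carrier_diff_reg (hn : n ≠ 0) (D : LeviDomain n M) :
    D.vol (D.carrier \ D.reg) = 0 := by
  refine measure_null_of_locally_null _ fun x hx => ⟨{x}, ?_, D.vol_singleton hn x⟩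
  have hg : D.gamma x = 0 := by
    by_contra h
    exact hx.2 ⟨hx.1, h⟩
  have h1 := D.eventually_gamma_ne hx.1 hg
  rw [eventually_nhdsWithin_iff] at h1
  refine mem_nhdsWithin_iff_exists_mem_nhds_inter.2 ⟨_, h1, ?_⟩
  rintro y ⟨hy, hyD⟩
  by_contra hne
  exact hyD.2 ⟨hyD.1, hy hne⟩

theorem LeviDomain.vol_carrier_lt_top (D : LeviDomain n M) : D.vol D.carrier < ⊤ :=
  (measure_mono subset_closure).trans_lt D.isCompact_closure.measure_lt_top

/-- The weight `t^{1-2n}`. -/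
def wt (n : ℕ) (t : ℝ) : ℝ := (t ^ (2 * n - 1))⁻¹

theorem wt_nonneg {t : ℝ} (ht : 0 ≤ t) : 0 ≤ wt n t := inv_nonneg.2 (pow_nonneg ht _)

theorem wt_zero (hn : n ≠ 0) : wt n 0 = 0 := by
  rw [wt, zero_pow (by omega), inv_zero]

theorem wt_anti {s t : ℝ} (hs : 0 < s) (hst : s ≤ t) : wt n t ≤ wt n s :=
  inv_anti₀ (pow_pos hs _) (pow_le_pow_left₀ hs.le hst _)

theorem wt_measurable (n : ℕ) : Measurable (wt n) := (measurable_id.pow_const _).inv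

theorem finrank_Cn (n : ℕ) : Module.finrank ℝ (Cn n) = 2 * n := by
  rw [← Module.finrank_mul_finrank ℝ ℂ (Cn n), Complex.finrank_real_complex, finrank_euclideanSpace,
    Fintype.card_fin]

theorem lintegral_wt_ball_lt_top (hn : n ≠ 0) (R : ℝ) :
    ∫⁻ y in Metric.ball (0 : Cn n) R, ENNReal.ofReal (wt n ‖y‖) < ⊤ := by
  have : NeZero n := ⟨hn⟩
  -- In polar coordinates the real dimension `2n` contributes `t^{2n-1}`, which cancels the weight
  -- exactly; a bounded interval of length `R` remains.
  have h1 : Integrable (fun y : Cn n => (indicator (Iio R) (wt n)) ‖y‖) := by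
    rw [integrable_fun_norm_addHaar, finrank_Cn]
    have h2 : IntegrableOn (indicator (Iio R) fun _ : ℝ => (1 : ℝ)) (Ioi 0) := by
      rw [integrableOn_indicator_iff measurableSet_Iio, inter_comm]
      refine integrableOn_const ?_ 
      rw [Ioi_inter_Iio]
      simp
    refine h2.congr_fun (fun t ht => ?_) measurableSet_Ioi
    by_cases hR : t ∈ Iio R
    · rw [indicator_of_mem hR, indicator_of_mem hR, wt, smul_eq_mul,
        mul_inv_cancel₀ (pow_ne_zero _ (ne_of_gt ht))]
    · rw [indicator_of_notMem hR, indicator_of_notMem hR, smul_zero]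
  have h3 := h1.lintegral_lt_top
  refine lt_of_eq_of_lt ?_ h3
  rw [← lintegral_indicator measurableSet_ball]
  refine lintegral_congr fun y => ?_
  by_cases hy : ‖y‖ < R
  · rw [indicator_of_mem (by simpa using hy), indicator_of_mem (show ‖y‖ ∈ Iio R from hy)]
  · rw [indicator_of_notMem (by simpa using hy), indicator_of_notMem (show ‖y‖ ∉ Iio R from hy),
      ENNReal.ofReal_zero]

/-- Absolute continuity of the integral over the unit ball: the balls shrink to a point, which is a
null set. -/
theorem exists_lintegral_wt_ball_le (hn : n ≠ 0) {η : ℝ≥0∞} (hη : 0 < η) :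
    ∃ R : ℝ, 0 < R ∧ ∫⁻ y in Metric.ball (0 : Cn n) R, ENNReal.ofReal (wt n ‖y‖) ≤ η := by
  have : NeZero n := ⟨hn⟩
  obtain ⟨δ, hδ, h⟩ := exists_pos_setLIntegral_lt_of_measure_lt
    (μ := (volume : Measure (Cn n)).restrict (Metric.ball 0 1))
    (lintegral_wt_ball_lt_top hn 1).ne hη.ne'
  have ht : Filter.Tendsto (fun k : ℕ => (volume : Measure (Cn n)) (Metric.ball 0 (1 / ((k : ℝ) + 1))))
      Filter.atTop (𝓝 (volume (⋂ k : ℕ, Metric.ball (0 : Cn n) (1 / ((k : ℝ) + 1))))) := by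
    refine tendsto_measure_iInter_atTop (fun k => measurableSet_ball.nullMeasurableSet) ?_
      ⟨0, measure_ball_lt_top.ne⟩
    intro k l hkl
    exact Metric.ball_subset_ball (one_div_le_one_div_of_le (by positivity)
      (by have : (k : ℝ) ≤ l := by exact_mod_cast hkl
          linarith))
  have h0 : (⋂ k : ℕ, Metric.ball (0 : Cn n) (1 / ((k : ℝ) + 1))) = {0} := by
    ext y
    simp only [mem_iInter, mem_ball_zero_iff, mem_singleton_iff]
    constructor
    · intro hy
      by_contra hne
      obtain ⟨k, hk⟩ := exists_nat_one_div_lt (norm_pos_iff.2 hne)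
      exact (hy k).not_gt hk
    · rintro rfl k
      rw [norm_zero]
      positivity
  rw [h0, measure_singleton] at ht
  obtain ⟨k, hk⟩ := ((tendsto_order.1 ht).2 δ hδ).exists
  have hsub : Metric.ball (0 : Cn n) (1 / ((k : ℝ) + 1)) ⊆ Metric.ball 0 1 :=
    Metric.ball_subset_ball (by
      rw [div_le_one (by positivity)]
      linarith [(Nat.cast_nonneg k : (0 : ℝ) ≤ k)])
  refine ⟨1 / ((k : ℝ) + 1), by positivity, ?_⟩
  have h2 := h (Metric.ball 0 (1 / ((k : ℝ) + 1))) (by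
    rw [Measure.restrict_apply measurableSet_ball, inter_eq_left.2 hsub]
    exact hk)
  rw [Measure.restrict_restrict measurableSet_ball, inter_eq_left.2 hsub] at h2
  exact h2.le

namespace LeviDomain.IsDistanceFunction

/-- In a chart `ρ ≥ |y - a| / C`, so the weight is at most `C^{2n-1}` times its Euclidean
counterpart centred at `a`. Translation invariance removes `a`, and the bound is uniform in `z`. -/
theorem exists_local_lintegral_le (hρ : D.IsDistanceFunction ρ) (hn : n ≠ 0) (q : M) :
    ∃ (V : Set M) (A C : ℝ), IsOpen V ∧ q ∈ V ∧ 0 < C ∧ ∀ z ∈ V, ∀ δ : ℝ,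
      ∫⁻ ζ in V ∩ {ζ | ρ ζ z < δ}, ENNReal.ofReal (wt n (ρ ζ z)) ∂D.vol ≤
        ENNReal.ofReal A * ∫⁻ y in Metric.ball (0 : Cn n) (C * δ), ENNReal.ofReal (wt n ‖y‖) := by
  obtain ⟨C, hC, U, hU, hUs, hle⟩ := hρ.chart_le q
  obtain ⟨V, K, hV, hqV, hVK, hK, hKU⟩ := exists_compact_nhds n isOpen_interior
    (mem_interior_iff_mem_nhds.2 hU)
  have hVU : V ⊆ U := hVK.trans (hKU.trans interior_subset)
  have hKs : K ⊆ (chartAt (Cn n) q).source := hKU.trans (interior_subset.trans hUs)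
  have hVs : V ⊆ (chartAt (Cn n) q).source := hVK.trans hKs
  have hsub : chartAt (Cn n) q '' K ⊆ (chartAt (Cn n) q).target :=
    image_subset_iff.2 fun x hx => (chartAt (Cn n) q).map_source (hKs hx)
  obtain ⟨B, hB⟩ := (hK.image_of_continuousOn
    ((chartAt (Cn n) q).continuousOn.mono hKs)).exists_bound_of_continuousOn
      ((D.density_contDiffOn q).continuousOn.mono hsub)
  refine ⟨V, |B| * C ^ (2 * n - 1), C, hV, hqV, hC, fun z hz δ => ?_⟩
  have hcz : Continuous fun ζ => ρ ζ z := hρ.continuous.comp (continuous_id.prodMk continuous_const)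
  have hs : MeasurableSet (V ∩ {ζ | ρ ζ z < δ}) :=
    hV.measurableSet.inter (hcz.measurable measurableSet_Iio)
  have hm : Measurable fun ζ => ENNReal.ofReal (wt n (ρ ζ z)) :=
    ((wt_measurable n).comp hcz.measurable).ennreal_ofReal
  rw [D.setLIntegral_eq q hm hs
    (inter_subset_left.trans hVs)]
  set a := chartAt (Cn n) q z with ha
  have hpt : ∀ y ∈ chartAt (Cn n) q '' (V ∩ {ζ | ρ ζ z < δ}),
      ENNReal.ofReal (D.density q y) *
        ENNReal.ofReal (wt n (ρ ((chartAt (Cn n) q).symm y) z)) ≤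
      ENNReal.ofReal (|B| * C ^ (2 * n - 1)) *
        (Metric.ball (0 : Cn n) (C * δ)).indicator (fun y => ENNReal.ofReal (wt n ‖y‖)) (y - a) := by
    rintro _ ⟨x, ⟨hxV, hxδ⟩, rfl⟩
    rw [(chartAt (Cn n) q).left_inv (hVs hxV)]
    have h1 : ‖chartAt (Cn n) q x - a‖ ≤ C * ρ x z := hle x (hVU hxV) z (hVU hz)
    have hmem : chartAt (Cn n) q x - a ∈ Metric.ball (0 : Cn n) (C * δ) := by
      rw [mem_ball_zero_iff]
      exact h1.trans_lt (mul_lt_mul_of_pos_left hxδ hC)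
    rw [indicator_of_mem hmem, ← ENNReal.ofReal_mul (D.density_pos (hsub ⟨x, hVK hxV, rfl⟩)).le,
      ← ENNReal.ofReal_mul (by positivity)]
    refine ENNReal.ofReal_le_ofReal ?_
    have h2 : D.density q (chartAt (Cn n) q x) ≤ |B| :=
      (le_abs_self _).trans ((hB _ ⟨x, hVK hxV, rfl⟩).trans (le_abs_self _))
    have h3 : wt n (ρ x z) ≤ C ^ (2 * n - 1) * wt n ‖chartAt (Cn n) q x - a‖ := by
      by_cases hxz : x = z
      · rw [hxz, hρ.self_eq_zero, wt_zero hn]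
        exact mul_nonneg (by positivity) (wt_nonneg (norm_nonneg _))
      · have hpos : 0 < ‖chartAt (Cn n) q x - a‖ := by
          rw [norm_pos_iff, sub_ne_zero]
          exact fun h => hxz ((chartAt (Cn n) q).injOn (hVs hxV) (hVs hz) h)
        have h4 : ‖chartAt (Cn n) q x - a‖ / C ≤ ρ x z := by
          rw [div_le_iff₀ hC]; linarith
        refine (wt_anti (div_pos hpos hC) h4).trans (le_of_eq ?_)
        rw [wt, wt, div_pow, inv_div, div_eq_mul_inv]
    calc _ ≤ |B| * (C ^ (2 * n - 1) * wt n ‖chartAt (Cn n) q x - a‖) :=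
          mul_le_mul h2 h3 (wt_nonneg (hρ.nonneg _ _)) (abs_nonneg _)
      _ = _ := by ring
  calc _ ≤ ∫⁻ y in chartAt (Cn n) q '' (V ∩ {ζ | ρ ζ z < δ}),
        ENNReal.ofReal (|B| * C ^ (2 * n - 1)) * (Metric.ball (0 : Cn n) (C * δ)).indicator
          (fun y => ENNReal.ofReal (wt n ‖y‖)) (y - a) :=
        setLIntegral_mono' (measurableSet_chart_image (inter_subset_left.trans hVs) hs) hpt
    _ ≤ ∫⁻ y, ENNReal.ofReal (|B| * C ^ (2 * n - 1)) * (Metric.ball (0 : Cn n) (C * δ)).indicator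
          (fun y => ENNReal.ofReal (wt n ‖y‖)) (y - a) := setLIntegral_le_lintegral _ _
    _ = _ := by
        rw [lintegral_const_mul' _ _ ENNReal.ofReal_ne_top, lintegral_sub_right_eq_self
          (fun y => (Metric.ball (0 : Cn n) (C * δ)).indicator
            (fun y => ENNReal.ofReal (wt n ‖y‖)) y) a, lintegral_indicator measurableSet_ball]

/-- The compact set `D̄ ∖ V` has positive distance from `q`, and the tube lemma keeps half of it for
`z` near `q`. -/
theorem exists_le_of_notMem (hρ : D.IsDistanceFunction ρ) {V : Set M} (hV : IsOpen V) {q : M}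
    (hq : q ∈ V) : ∃ (δ : ℝ) (N : Set M), 0 < δ ∧ N ∈ 𝓝 q ∧
      ∀ z ∈ N, ∀ ζ ∈ closure D.carrier, ζ ∉ V → δ ≤ ρ ζ z := by
  have hK : IsCompact (closure D.carrier \ V) := D.isCompact_closure.diff hV
  rcases (closure D.carrier \ V).eq_empty_or_nonempty with h0 | hne
  · refine ⟨1, univ, one_pos, Filter.univ_mem, fun z _ ζ hζ hζV => ?_⟩
    have : ζ ∈ closure D.carrier \ V := ⟨hζ, hζV⟩
    simp [h0] at this
  have hcq : Continuous fun ζ => ρ ζ q := hρ.continuous.comp (continuous_id.prodMk continuous_const)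
  obtain ⟨x₀, hx₀, hmin⟩ := hK.exists_isMinOn hne hcq.continuousOn
  have hpos : 0 < ρ x₀ q := hρ.pos _ _ fun h => hx₀.2 (h ▸ hq)
  have hO : IsOpen {p : M × M | ρ x₀ q / 2 < ρ p.1 p.2} := isOpen_lt continuous_const hρ.continuous
  obtain ⟨U, N, -, hN, hKU, hqN, hUN⟩ := generalized_tube_lemma hK (isCompact_singleton (x := q)) hO
    (by
      rintro ⟨ζ, z⟩ ⟨hζ, hz⟩
      rw [mem_singleton_iff] at hz
      simp only at hz hζ
      subst hz
      have : ρ x₀ z ≤ ρ ζ z := hmin hζ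
      simp only [mem_ofPred_eq]
      linarith)
  refine ⟨ρ x₀ q / 2, N, half_pos hpos, hN.mem_nhds (hqN rfl), fun z hz ζ hζ hζV => ?_⟩
  have : (ζ, z) ∈ {p : M × M | ρ x₀ q / 2 < ρ p.1 p.2} := hUN ⟨hKU ⟨hζ, hζV⟩, hz⟩
  exact (show ρ x₀ q / 2 < ρ ζ z from this).le

theorem exists_lintegral_near_le (hρ : D.IsDistanceFunction ρ) (hn : n ≠ 0) (q : M) {η : ℝ≥0∞}
    (hη : 0 < η) : ∃ (δ : ℝ) (N : Set M), 0 < δ ∧ N ∈ 𝓝 q ∧ ∀ z ∈ N,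
      ∫⁻ ζ in D.carrier ∩ {ζ | ρ ζ z < δ}, ENNReal.ofReal (wt n (ρ ζ z)) ∂D.vol ≤ η := by
  obtain ⟨V, A, C, hV, hq, hC, hle⟩ := hρ.exists_local_lintegral_le hn q
  obtain ⟨δ, N, hδ, hN, hfar⟩ := hρ.exists_le_of_notMem hV hq
  obtain ⟨R, hR, hRle⟩ := exists_lintegral_wt_ball_le (n := n) hn
    (η := η / ENNReal.ofReal (|A| + 1)) (ENNReal.div_pos hη.ne' ENNReal.ofReal_ne_top)
  refine ⟨min δ (R / C), N ∩ V, lt_min hδ (div_pos hR hC), Filter.inter_mem hN (hV.mem_nhds hq),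
    fun z hz => ?_⟩
  have hsub : D.carrier ∩ {ζ | ρ ζ z < min δ (R / C)} ⊆ V ∩ {ζ | ρ ζ z < min δ (R / C)} := by
    rintro ζ ⟨hζ, hζδ⟩
    refine ⟨?_, hζδ⟩
    by_contra h
    exact ((hfar z hz.1 ζ (subset_closure hζ) h).trans_lt hζδ).not_ge (min_le_left _ _)
  have hball : Metric.ball (0 : Cn n) (C * min δ (R / C)) ⊆ Metric.ball 0 R :=
    Metric.ball_subset_ball (by
      calc C * min δ (R / C) ≤ C * (R / C) := mul_le_mul_of_nonneg_left (min_le_right _ _) hC.le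
        _ = R := by field_simp)
  calc _ ≤ _ := lintegral_mono_set hsub
    _ ≤ _ := hle z hz.2 _
    _ ≤ ENNReal.ofReal (|A| + 1) * (η / ENNReal.ofReal (|A| + 1)) :=
        mul_le_mul' (ENNReal.ofReal_le_ofReal (by linarith [le_abs_self A]))
          ((lintegral_mono_set hball).trans hRle)
    _ = η := ENNReal.mul_div_cancel (by simp; positivity) ENNReal.ofReal_ne_top

theorem measurable_wt (hρ : D.IsDistanceFunction ρ) (z : M) :
    Measurable fun ζ => ENNReal.ofReal (wt n (ρ ζ z)) :=
  ((wt_measurable n).comp (hρ.continuous.comp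
    (continuous_id.prodMk continuous_const)).measurable).ennreal_ofReal

/-- The integral over a set where `ρ` is not small. -/
theorem lintegral_far_le (hρ : D.IsDistanceFunction ρ) {δ : ℝ} (hδ : 0 < δ) (z : M) (s : Set M) :
    ∫⁻ ζ in s ∩ {ζ | ρ ζ z < δ}ᶜ, ENNReal.ofReal (wt n (ρ ζ z)) ∂D.vol ≤
      ENNReal.ofReal (wt n δ) * D.vol s := by
  calc _ ≤ ∫⁻ _ in s ∩ {ζ | ρ ζ z < δ}ᶜ, ENNReal.ofReal (wt n δ) ∂D.vol := by
        rw [inter_comm]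
        have hm : MeasurableSet {ζ | ρ ζ z < δ}ᶜ := ((hρ.continuous.comp
          (continuous_id.prodMk continuous_const)).measurable measurableSet_Iio).compl
        rw [← Measure.restrict_restrict hm]
        exact setLIntegral_mono' hm fun ζ hζ => ENNReal.ofReal_le_ofReal
          (wt_anti hδ (not_lt.1 hζ))
    _ ≤ _ := by
        rw [lintegral_const, Measure.restrict_apply_univ]
        exact mul_le_mul' le_rfl (measure_mono inter_subset_left)

/-- Near the singularity the smallness comes from `δ`, independently of `s`; elsewhere the weight is
at most `δ^{1-2n}` and only the volume matters. -/
theorem lintegral_split_le (hρ : D.IsDistanceFunction ρ) {δ : ℝ} (hδ : 0 < δ) (z : M)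
    {s t : Set M} (hst : s ⊆ t ∪ {ζ | ρ ζ z < δ}) (hs : s ⊆ D.carrier) :
    ∫⁻ ζ in s, ENNReal.ofReal (wt n (ρ ζ z)) ∂D.vol ≤
      ∫⁻ ζ in D.carrier ∩ {ζ | ρ ζ z < δ}, ENNReal.ofReal (wt n (ρ ζ z)) ∂D.vol +
      ENNReal.ofReal (wt n δ) * D.vol (D.carrier ∩ t) := by
  have hsub : s ⊆ (D.carrier ∩ {ζ | ρ ζ z < δ}) ∪ ((D.carrier ∩ t) ∩ {ζ | ρ ζ z < δ}ᶜ) := by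
    intro ζ hζ
    by_cases h : ρ ζ z < δ
    · exact Or.inl ⟨hs hζ, h⟩
    · exact Or.inr ⟨⟨hs hζ, (hst hζ).resolve_right h⟩, h⟩
  calc _ ≤ _ := lintegral_mono_set hsub
    _ ≤ _ := lintegral_union_le _ _ _
    _ ≤ _ := add_le_add le_rfl (hρ.lintegral_far_le hδ z _)

theorem lintegral_wt_lt_top (hρ : D.IsDistanceFunction ρ) (hn : n ≠ 0) (z : M) :
    ∫⁻ ζ in D.carrier, ENNReal.ofReal (wt n (ρ ζ z)) ∂D.vol < ⊤ := by
  obtain ⟨δ, N, hδ, hN, h⟩ := hρ.exists_lintegral_near_le hn z one_pos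
  have h1 := hρ.lintegral_split_le (n := n) hδ z (s := D.carrier) (t := univ) (by simp) subset_rfl
  refine h1.trans_lt (ENNReal.add_lt_top.2 ⟨(h z (mem_of_mem_nhds hN)).trans_lt ENNReal.one_lt_top,
    ENNReal.mul_lt_top ENNReal.ofReal_lt_top ?_⟩)
  rw [inter_univ]
  exact D.vol_carrier_lt_top

end LeviDomain.IsDistanceFunction

/-- A smooth function that is positive exactly on `D'` among the points of `D`. -/
def LeviDomain.defn (D : LeviDomain n M) (x : M) : ℝ := -D.r x * D.gammaSq x

theorem LeviDomain.defn_smooth (D : LeviDomain n M) :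
    ContMDiff 𝓘(ℝ, Cn n) 𝓘(ℝ, ℝ) ∞ D.defn := D.smooth_r.neg.mul D.gammaSq_smooth

theorem LeviDomain.defn_pos (D : LeviDomain n M) {x : M} (hx : x ∈ D.reg) : 0 < D.defn x :=
  mul_pos (neg_pos.2 hx.1) (D.gammaSq_pos hx)

theorem LeviDomain.mem_reg_of_defn_pos (D : LeviDomain n M) {x : M} (hx : x ∈ closure D.carrier)
    (h : 0 < D.defn x) : x ∈ D.reg := by
  have h1 : D.r x ≤ 0 := by
    have : closure D.carrier ⊆ {x | D.r x ≤ 0} := closure_minimal (fun y hy => show D.r y ≤ 0 from le_of_lt hy)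
      (isClosed_le D.smooth_r.continuous continuous_const)
    exact this hx
  have h2 : D.r x ≠ 0 := fun h0 => by simp [LeviDomain.defn, h0] at h
  refine ⟨lt_of_le_of_ne h1 h2, fun h0 => ?_⟩
  have := D.gamma_sq x
  rw [h0] at this
  simp [LeviDomain.defn, ← this] at h

/-- As `t` decreases to zero these sets shrink into `D ∖ D'`, a null set, and `D` has finite volume.
-/
theorem LeviDomain.exists_vol_defn_le (D : LeviDomain n M) (hn : n ≠ 0) {η : ℝ≥0∞} (hη : 0 < η) :
    ∃ t : ℝ, 0 < t ∧ D.vol (D.carrier ∩ {x | D.defn x < t}) ≤ η := by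
  have hm : ∀ t : ℝ, MeasurableSet (D.carrier ∩ {x | D.defn x < t}) := fun t =>
    D.isOpen_carrier.measurableSet.inter (D.defn_smooth.continuous.measurable measurableSet_Iio)
  have ht : Filter.Tendsto (fun k : ℕ => D.vol (D.carrier ∩ {x | D.defn x < 1 / ((k : ℝ) + 1)}))
      Filter.atTop (𝓝 (D.vol (⋂ k : ℕ, D.carrier ∩ {x | D.defn x < 1 / ((k : ℝ) + 1)}))) := by
    refine tendsto_measure_iInter_atTop (fun k => (hm _).nullMeasurableSet) ?_ ?_
    swap
    · exact ⟨0, ((measure_mono inter_subset_left).trans_lt D.vol_carrier_lt_top).ne⟩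
    rintro k l hkl x ⟨hx, hxl⟩
    have hkl' : (k : ℝ) + 1 ≤ l + 1 := by
      have : (k : ℝ) ≤ l := by exact_mod_cast hkl
      linarith
    exact ⟨hx, lt_of_lt_of_le (show D.defn x < 1 / ((l : ℝ) + 1) from hxl)
      (one_div_le_one_div_of_le (by positivity) hkl')⟩
  have h0 : D.vol (⋂ k : ℕ, D.carrier ∩ {x | D.defn x < 1 / ((k : ℝ) + 1)}) = 0 := by
    refine measure_mono_null (fun x hx => ?_) (D.vol_carrier_diff_reg hn)
    rw [mem_iInter] at hx
    refine ⟨(hx 0).1, fun h => ?_⟩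
    obtain ⟨k, hk⟩ := exists_nat_one_div_lt (D.defn_pos h)
    exact ((hx k).2 : D.defn x < _).not_gt hk
  rw [h0] at ht
  obtain ⟨k, hk⟩ := ((tendsto_order.1 ht).2 η hη).exists
  exact ⟨_, by positivity, hk.le⟩

/-- The function that is cut off. -/
def LeviDomain.cutArg (D : LeviDomain n M) (ρ : M → M → ℝ) (p : M × M) : ℝ :=
  D.defn p.1 * ρ p.1 p.2 ^ 2

/-- Where the cutoff is not yet one, either `ρ < δ`, or `-r γ² < t` once `k` is large. The first
part is small by the local integrability of the weight, the second by its small volume; everything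
is uniform for `z` near `q`. -/
theorem LeviDomain.IsDistanceFunction.eventually_lintegral_bad_le (hρ : D.IsDistanceFunction ρ)
    (hn : n ≠ 0) (q : M) {η : ℝ≥0∞} (hη : 0 < η) : ∃ N ∈ 𝓝 q, ∀ᶠ k : ℕ in Filter.atTop, ∀ z ∈ N,
      ∫⁻ ζ in D.carrier ∩ {ζ | k * D.cutArg ρ (ζ, z) < 2},
        ENNReal.ofReal (wt n (ρ ζ z)) ∂D.vol ≤ η := by
  obtain ⟨δ, N, hδ, hN, h⟩ := hρ.exists_lintegral_near_le hn q (ENNReal.half_pos hη.ne')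
  have hw : 0 < wt n δ := inv_pos.2 (pow_pos hδ _)
  obtain ⟨t, ht, hvol⟩ := D.exists_vol_defn_le hn (η := η / 2 / ENNReal.ofReal (wt n δ))
    (ENNReal.div_pos (ENNReal.half_pos hη.ne').ne' ENNReal.ofReal_ne_top)
  -- For such `k`, a point with `-r γ² ≥ t` and `ρ ≥ δ` has `k u ≥ k t δ² > 2` and is not in the bad
  -- set.
  obtain ⟨k₀, hk₀⟩ := exists_nat_gt (2 / (t * δ ^ 2))
  refine ⟨N, hN, Filter.eventually_atTop.2 ⟨k₀, fun k hk z hz => ?_⟩⟩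
  have hkt : 2 < k * (t * δ ^ 2) := by
    rw [div_lt_iff₀ (by positivity)] at hk₀
    refine hk₀.trans_le (mul_le_mul_of_nonneg_right (by exact_mod_cast hk) (by positivity))
  refine (hρ.lintegral_split_le (n := n) hδ z (t := {x | D.defn x < t}) ?_ inter_subset_left).trans ?_
  · rintro ζ ⟨hζ, hζk⟩
    by_contra hcon
    rw [mem_union, not_or] at hcon
    have h1 : t ≤ D.defn ζ := not_lt.1 hcon.1
    have h2 : δ ≤ ρ ζ z := not_lt.1 hcon.2
    have h3 : (k : ℝ) * (D.defn ζ * ρ ζ z ^ 2) < 2 := hζk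
    have h4 : (k : ℝ) * (t * δ ^ 2) ≤ k * (D.defn ζ * ρ ζ z ^ 2) :=
      mul_le_mul_of_nonneg_left (mul_le_mul h1 (pow_le_pow_left₀ hδ.le h2 2) (by positivity)
        (ht.le.trans h1)) (Nat.cast_nonneg k)
    linarith
  · calc _ ≤ η / 2 + ENNReal.ofReal (wt n δ) * (η / 2 / ENNReal.ofReal (wt n δ)) :=
          add_le_add (h z hz) (mul_le_mul' le_rfl hvol)
      _ = η := by
          rw [ENNReal.mul_div_cancel (by simpa using hw) ENNReal.ofReal_ne_top, ENNReal.add_halves]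

/-- Isotropic kernels are dominated by the weight. -/
theorem LeviDomain.IsDistanceFunction.exists_kernel_le (hρ : D.IsDistanceFunction ρ)
    {F : Type*} [NormedAddCommGroup F] [NormedSpace ℝ F] {K : M → M → F}
    (hK : D.IsIsotropicKernel ρ 1 K) :
    ∃ C : ℝ, 0 ≤ C ∧ ∀ ζ ∈ D.reg, ∀ z ∈ D.reg, ζ ≠ z → ‖K ζ z‖ ≤ C * wt n (ρ ζ z) := by
  obtain ⟨m, k, A, hmk, hA, hKA⟩ := hK
  obtain ⟨C, hC⟩ := hA.2 []
  obtain ⟨R, hR0, hR⟩ := hρ.bounded D.isCompact_closure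
  -- The surplus exponent `j` of the kernel over `1 - 2n`; the factor `ρ^j` is bounded on the
  -- compact closure.
  obtain ⟨j, hj⟩ : ∃ j : ℕ, m + (2 * n - 1) = 2 * k + j := ⟨m + (2 * n - 1) - 2 * k, by omega⟩
  refine ⟨|C| * R ^ j, by positivity, fun ζ hζ z hz hne => ?_⟩
  have h1 := hC ζ hζ z hz
  simp only [List.map_nil, List.prod_nil, one_mul, List.foldr_nil, zpow_zero, mul_one] at h1
  have hpos := hρ.pos ζ z hne
  have h2 := hR ζ (D.reg_subset_closure hζ) z (D.reg_subset_closure hz)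
  rw [hKA ζ hζ z hz hne, norm_smul, norm_inv, norm_pow, Real.norm_of_nonneg hpos.le]
  calc _ ≤ (ρ ζ z ^ (2 * k))⁻¹ * (|C| * ρ ζ z ^ m) := by
        refine mul_le_mul_of_nonneg_left (h1.trans ?_) (by positivity)
        exact mul_le_mul_of_nonneg_right (le_abs_self _) (by positivity)
    _ = |C| * ρ ζ z ^ j * wt n (ρ ζ z) := by
        rw [wt]
        field_simp
        rw [mul_assoc, ← pow_add, hj, pow_add]
        ring
    _ ≤ _ := by
        refine mul_le_mul_of_nonneg_right ?_ (wt_nonneg hpos.le)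
        gcongr

end Weight


/-! ### Cutting off a kernel near the diagonal and near the critical points -/

section Cut

variable {n : ℕ} {M : Type*} [TopologicalSpace M] [ChartedSpace (Cn n) M]
  [IsManifold 𝓘(ℂ, Cn n) ω M] [T2Space M] [SecondCountableTopology M]
  [MeasurableSpace M] [BorelSpace M] {D : LeviDomain n M} {ρ : M → M → ℝ} {F : Type*} [NormedAddCommGroup F] [NormedSpace ℂ F] {N : ℕ}

/-- By the product rule for `-r γ²`: `X r = O(r)` handles the first factor, and `γ Z(γ²) = O(γ²)`
with bounded coefficients of `X` the second. The factor `γ` is essential for the second. -/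
theorem LeviDomain.IsAdmissible.exists_apply_defn_le {X : ComplexField n M}
    (hX : D.IsAdmissible X) : ∃ C : ℝ, 0 ≤ C ∧ ∀ x ∈ D.reg,
      D.gamma x * ‖X.apply (fun y => (D.defn y : ℂ)) x‖ ≤ C * D.defn x := by
  obtain ⟨N, φ, Z, hZ⟩ := exists_frame (n := n) D.isCompact_closure
  obtain ⟨C₀, hC₀⟩ := hX.r_le
  obtain ⟨Γ, hΓ1, hΓ⟩ := D.exists_gamma_le
  choose a ha using fun j => (hX.coeff _ (hZ.smooth j)).2 []
  choose b hb using fun j => D.xiOn_gammaSq.2 [Z j]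
  refine ⟨Γ * |C₀| + ∑ j, |a j| * |b j|, by positivity, fun x hx => ?_⟩
  have hxc := D.reg_subset_closure hx
  have hr : MDifferentiableAt 𝓘(ℝ, Cn n) 𝓘(ℝ, ℝ) D.r x := D.smooth_r.mdifferentiableAt (by simp)
  have hg : MDifferentiableAt 𝓘(ℝ, Cn n) 𝓘(ℝ, ℝ) D.gammaSq x :=
    D.gammaSq_smooth.mdifferentiableAt (by simp)
  have hγ := D.gamma_pos hx
  have hrneg : D.r x < 0 := hx.1
  have hbil : ∀ v : Tan n x, dirDeriv D.defn x v =
      -(dirDeriv D.r x v * D.gammaSq x + D.r x * dirDeriv D.gammaSq x v) := fun v => by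
    have h1 := dirDeriv_bilin (-(ContinuousLinearMap.mul ℝ ℝ)) hr hg v
    have h2 : D.defn = fun y => (-(ContinuousLinearMap.mul ℝ ℝ)) (D.r y) (D.gammaSq y) := by
      ext y; simp [LeviDomain.defn]
    rw [h2, h1]
    simp
    ring
  have hsplit : X.apply (fun y => (D.defn y : ℂ)) x =
      -(X.apply (fun y => (D.r y : ℂ)) x * (D.gammaSq x : ℂ) +
        (D.r x : ℂ) * X.apply (fun y => (D.gammaSq y : ℂ)) x) := by
    rw [X.apply_ofReal (D.defn_smooth.mdifferentiableAt (by simp)), X.apply_ofReal hr,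
      X.apply_ofReal hg, hbil, hbil]
    push_cast
    ring
  have hga : D.gamma x * ‖X.apply (fun y => (D.gammaSq y : ℂ)) x‖ ≤
      (∑ j, |a j| * |b j|) * D.gammaSq x := by
    have hgc : MDifferentiableAt 𝓘(ℝ, Cn n) 𝓘(ℝ, ℝ) D.gammaSq x := hg
    rw [← hZ.sum_apply hxc X]
    refine (mul_le_mul_of_nonneg_left (norm_sum_le _ _) hγ.le).trans ?_
    rw [Finset.mul_sum, Finset.sum_mul]
    refine Finset.sum_le_sum fun j _ => ?_
    have h1 : ‖X.apply (fun y => (φ j y : ℂ)) x‖ ≤ |a j| := by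
      have := ha j x hx
      simp only [List.map_nil, List.prod_nil, one_mul, mul_one] at this
      exact this.trans (le_abs_self _)
    have h2 : D.gamma x * ‖dirDeriv (fun y => (D.gammaSq y : ℂ)) x (Z j x)‖ ≤
        |b j| * D.gammaSq x := by
      have h3 := hb j x hx
      have h4 : dirDeriv (fun y => (D.gammaSq y : ℂ)) x (Z j x) =
          ((dirDeriv D.gammaSq x (Z j x) : ℝ) : ℂ) := dirDeriv_clm Complex.ofRealCLM hg _
      rw [h4, Complex.norm_real]
      have h5 : D.gamma x * ‖dirDeriv D.gammaSq x (Z j x)‖ ≤ b j * D.gamma x ^ 2 := by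
        simpa using! h3
      rw [← D.gamma_sq]
      exact h5.trans (mul_le_mul_of_nonneg_right (le_abs_self _) (by positivity))
    rw [norm_smul]
    calc _ = ‖X.apply (fun y => (φ j y : ℂ)) x‖ *
          (D.gamma x * ‖dirDeriv (fun y => (D.gammaSq y : ℂ)) x (Z j x)‖) := by ring
      _ ≤ |a j| * (|b j| * D.gammaSq x) := by gcongr
      _ = _ := by ring
  have hgs := D.gammaSq_pos hx
  rw [hsplit, norm_neg]
  calc _ ≤ D.gamma x * (‖X.apply (fun y => (D.r y : ℂ)) x‖ * D.gammaSq x +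
        |D.r x| * ‖X.apply (fun y => (D.gammaSq y : ℂ)) x‖) := by
        gcongr
        refine (norm_add_le _ _).trans (le_of_eq ?_)
        rw [norm_mul, norm_mul, Complex.norm_real, Complex.norm_real, Real.norm_of_nonneg hgs.le,
          Real.norm_eq_abs]
    _ = D.gamma x * (‖X.apply (fun y => (D.r y : ℂ)) x‖ * D.gammaSq x) +
        |D.r x| * (D.gamma x * ‖X.apply (fun y => (D.gammaSq y : ℂ)) x‖) := by ring
    _ ≤ Γ * ((|C₀| * |D.r x|) * D.gammaSq x) +
        |D.r x| * ((∑ j, |a j| * |b j|) * D.gammaSq x) := by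
        have h6 := hΓ x hxc
        have h7 : ‖X.apply (fun y => (D.r y : ℂ)) x‖ ≤ |C₀| * |D.r x| :=
          (hC₀ x hx).trans (mul_le_mul_of_nonneg_right (le_abs_self _) (abs_nonneg _))
        gcongr
    _ = _ := by
        rw [LeviDomain.defn, abs_of_neg hrneg]
        ring

theorem LeviDomain.cutArg_smooth (hρ : D.IsDistanceFunction ρ) :
    ContMDiff (𝓘(ℝ, Cn n).prod 𝓘(ℝ, Cn n)) 𝓘(ℝ, ℝ) ∞ (D.cutArg ρ) :=
  (D.defn_smooth.comp contMDiff_fst).mul hρ.smooth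

theorem LeviDomain.cutArg_nonneg {p : M × M} (hp : p.1 ∈ D.reg) : 0 ≤ D.cutArg ρ p :=
  mul_nonneg (D.defn_pos hp).le (sq_nonneg _)

/-- The factor `-r γ²` depends on `ζ` only, so only `γ X^ζ` acts on it; the factor `ρ²` is covered
by the fact that `T` preserves its symbol class. -/
theorem LeviDomain.IsAdmissible.exists_tangDeriv_cutArg_le (hρ : D.IsDistanceFunction ρ)
    {X : ComplexField n M} (hX : D.IsAdmissible X) {φ : Fin N → M → ℝ}
    {Z : Fin N → SmoothField n M} (hZ : IsFrameOn (closure D.carrier) φ Z) :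
    ∃ C : ℝ, 0 ≤ C ∧ ∀ p ∈ D.offDiag,
      ‖tangDeriv (D.tang X φ) Z (fun q => (D.cutArg ρ q : ℂ)) p‖ ≤ C * D.cutArg ρ p := by
  obtain ⟨C₁, hC₁, h1⟩ := hX.exists_apply_defn_le
  obtain ⟨C₂, h2⟩ := (hρ.symb_tangDeriv (Z := Z) (hX.xiOn_tang hZ.smooth) hρ.symb_ofReal_sq).2 []
  refine ⟨C₁ + |C₂|, by positivity, fun p hp => ?_⟩
  have hd : ContMDiff (𝓘(ℝ, Cn n).prod 𝓘(ℝ, Cn n)) 𝓘(ℝ, ℂ) ∞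
      fun q : M × M => (D.defn q.1 : ℂ) :=
    (Complex.ofRealCLM.contDiff.contMDiff.comp D.defn_smooth).comp contMDiff_fst
  have hdp := hd.mdifferentiableAt (x := p) (by simp)
  have e1 : (fun q => (D.cutArg ρ q : ℂ)) =
      fun q : M × M => (D.defn q.1 : ℂ) • ((ρ q.1 q.2 ^ 2 : ℝ) : ℂ) := by
    ext q
    simp [LeviDomain.cutArg]
  have e2 := hZ.tangDeriv_eq (D := D) X (p := p) (D.reg_subset_closure hp.1.1)
    (D.reg_subset_closure hp.1.2) hdp
  rw [show X.apply (fun y => (D.defn ((p.1, y) : M × M).1 : ℂ)) p.2 = 0 from X.apply_const (D.defn p.1 : ℂ) p.2,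
    smul_zero, add_zero] at e2
  rw [e1, tangDeriv_smul hdp (hρ.smooth_ofReal_sq.mdifferentiableAt (by simp)), e2]
  have h3 := h1 p.1 hp.1.1
  have h4 := h2 p hp
  simp only [List.map_nil, List.prod_nil, one_mul, iterD_nil] at h4
  have h5 : 0 < D.defn p.1 := D.defn_pos hp.1.1
  refine (norm_add_le _ _).trans ?_
  rw [norm_smul, norm_smul, norm_smul, Complex.norm_real, Complex.norm_real, Complex.norm_real,
    Real.norm_of_nonneg (D.gamma_nonneg _), Real.norm_of_nonneg h5.le,
    Real.norm_of_nonneg (sq_nonneg _)]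
  calc _ ≤ C₁ * D.defn p.1 * ρ p.1 p.2 ^ 2 + D.defn p.1 * (|C₂| * ρ p.1 p.2 ^ 2) := by
        gcongr
        exact h4.trans (mul_le_mul_of_nonneg_right (le_abs_self _) (sq_nonneg _))
    _ = _ := by rw [LeviDomain.cutArg]; ring

theorem exists_hasDerivAt_smoothTransition : ∃ c : ℝ, 0 ≤ c ∧ ∀ t : ℝ, ∃ d : ℝ,
    HasDerivAt Real.smoothTransition d t ∧ |d| ≤ c ∧ (1 ≤ t → d = 0) := by
  have hsm : ContDiff ℝ 1 Real.smoothTransition := Real.smoothTransition.contDiff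
  have h1 : ∀ t, 1 ≤ t → deriv Real.smoothTransition t = 0 := fun t ht =>
    IsLocalMax.deriv_eq_zero (Filter.Eventually.of_forall fun s => by
      rw [Real.smoothTransition.one_of_one_le ht]; exact Real.smoothTransition.le_one s)
  have h0 : ∀ t, t ≤ 0 → deriv Real.smoothTransition t = 0 := fun t ht =>
    IsLocalMin.deriv_eq_zero (Filter.Eventually.of_forall fun s => by
      rw [Real.smoothTransition.zero_of_nonpos ht]; exact Real.smoothTransition.nonneg s)
  obtain ⟨c, hc⟩ := (isCompact_Icc (a := (0 : ℝ)) (b := 1)).exists_bound_of_continuousOn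
    (hsm.continuous_deriv le_rfl).continuousOn
  refine ⟨max c 0, le_max_right _ _, fun t => ⟨_, (hsm.differentiable (by simp) t).hasDerivAt, ?_,
    h1 t⟩⟩
  rcases le_total t 0 with h | h
  · simp [h0 t h]
  rcases le_total 1 t with h' | h'
  · simp [h1 t h']
  · exact (hc t ⟨h, h'⟩).trans (le_max_left _ _)

/-- A smooth function of the pair `(ζ, z)` that vanishes near the diagonal, near the critical
points and near the boundary; as `j → ∞` it converges to one. -/
def LeviDomain.cutoff (D : LeviDomain n M) (ρ : M → M → ℝ) (j : ℕ) (p : M × M) : ℝ :=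
  Real.smoothTransition (j * D.cutArg ρ p - 1)

theorem LeviDomain.cutoff_smooth (hρ : D.IsDistanceFunction ρ) (j : ℕ) :
    ContMDiff (𝓘(ℝ, Cn n).prod 𝓘(ℝ, Cn n)) 𝓘(ℝ, ℝ) ∞ (D.cutoff ρ j) := by
  have h : ContDiff ℝ ∞ fun t : ℝ => Real.smoothTransition (j * t - 1) :=
    Real.smoothTransition.contDiff.comp ((contDiff_const.mul contDiff_id).sub contDiff_const)
  exact h.contMDiff.comp (D.cutArg_smooth hρ)

theorem LeviDomain.cutoff_eq_one {j : ℕ} {p : M × M} (h : 2 ≤ j * D.cutArg ρ p) :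
    D.cutoff ρ j p = 1 :=
  Real.smoothTransition.one_of_one_le (by linarith)

theorem LeviDomain.cutoff_eq_zero {j : ℕ} {p : M × M} (h : j * D.cutArg ρ p ≤ 1) :
    D.cutoff ρ j p = 0 :=
  Real.smoothTransition.zero_of_nonpos (by linarith)

/-- The chain rule gives `j χ'(ju - 1) T u` with `|T u| ≤ C u`, and `χ'` vanishes unless `ju ≤ 2`;
hence `j |T u| ≤ 2C` and the bound does not depend on `j`. This is why no boundary term appears. -/
theorem LeviDomain.IsAdmissible.exists_tangDeriv_cutoff_le (hρ : D.IsDistanceFunction ρ)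
    {X : ComplexField n M} (hX : D.IsAdmissible X) {φ : Fin N → M → ℝ}
    {Z : Fin N → SmoothField n M} (hZ : IsFrameOn (closure D.carrier) φ Z) :
    ∃ C : ℝ, 0 ≤ C ∧ ∀ (j : ℕ), ∀ p ∈ D.offDiag,
      ‖tangDeriv (D.tang X φ) Z (fun q => (D.cutoff ρ j q : ℂ)) p‖ ≤ C ∧
      (2 ≤ j * D.cutArg ρ p → tangDeriv (D.tang X φ) Z (fun q => (D.cutoff ρ j q : ℂ)) p = 0) := by
  obtain ⟨C, hC, h⟩ := hX.exists_tangDeriv_cutArg_le hρ hZ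
  obtain ⟨c, hc, hd⟩ := exists_hasDerivAt_smoothTransition
  refine ⟨c * (2 * C), by positivity, fun j p hp => ?_⟩
  obtain ⟨d, hd1, hd2, hd3⟩ := hd (j * D.cutArg ρ p - 1)
  have hd4 : HasDerivAt (fun t : ℝ => Real.smoothTransition (j * t - 1)) (d * j)
      (D.cutArg ρ p) := by
    have h1 : HasDerivAt (fun t : ℝ => j * t - 1) (j : ℝ) (D.cutArg ρ p) := by
      simpa using ((hasDerivAt_id (D.cutArg ρ p)).const_mul (j : ℝ)).sub_const 1
    exact HasDerivAt.comp (h₂ := Real.smoothTransition) _ hd1 h1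
  have e := tangDeriv_real_comp (g := D.tang X φ) (Z := Z) hd4
    ((D.cutArg_smooth hρ).mdifferentiableAt (by simp))
  have e' : tangDeriv (D.tang X φ) Z (fun q => (D.cutoff ρ j q : ℂ)) p =
      ((d * j : ℝ) : ℂ) * tangDeriv (D.tang X φ) Z (fun q => (D.cutArg ρ q : ℂ)) p := e
  have h0 : 2 ≤ j * D.cutArg ρ p →
      tangDeriv (D.tang X φ) Z (fun q => (D.cutoff ρ j q : ℂ)) p = 0 := fun h2 => by
    rw [e', hd3 (by linarith)]
    simp
  refine ⟨?_, h0⟩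
  rcases le_total 2 (j * D.cutArg ρ p) with h2 | h2
  · rw [h0 h2, norm_zero]; positivity
  rw [e', norm_mul, Complex.norm_real, norm_mul, Real.norm_eq_abs, Real.norm_of_nonneg (by simp)]
  calc _ ≤ |d| * j * (C * D.cutArg ρ p) := by gcongr; exact h p hp
    _ = |d| * ((j * D.cutArg ρ p) * C) := by ring
    _ ≤ c * (2 * C) := by
        have := mul_nonneg (Nat.cast_nonneg (α := ℝ) j) (D.cutArg_nonneg (ρ := ρ) hp.1.1)
        gcongr

/-- The kernel `H` cut off near the diagonal, the critical points and the boundary. -/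
def LeviDomain.cut (D : LeviDomain n M) (ρ : M → M → ℝ) (H : M → M → F) (j : ℕ) (ζ z : M) : F :=
  (D.reg ×ˢ D.reg).indicator (fun p => (D.cutoff ρ j p : ℂ) • H p.1 p.2) (ζ, z)

theorem LeviDomain.cut_eq (D : LeviDomain n M) (ρ : M → M → ℝ) (H : M → M → F) (j : ℕ) {ζ z : M}
    (hζ : ζ ∈ D.reg) (hz : z ∈ D.reg) :
    D.cut ρ H j ζ z = (D.cutoff ρ j (ζ, z) : ℂ) • H ζ z :=
  indicator_of_mem (mk_mem_prod hζ hz) _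

/-- The singularity disappears because `u` is zero on the diagonal: there the cutoff vanishes in a
whole neighbourhood. -/
theorem LeviDomain.cut_contMDiffOn (hρ : D.IsDistanceFunction ρ) {H : M → M → F}
    (hH : ContMDiffOn (𝓘(ℝ, Cn n).prod 𝓘(ℝ, Cn n)) 𝓘(ℝ, F) ∞ (fun p : M × M => H p.1 p.2)
      D.offDiag) (j : ℕ) :
    ContMDiffOn (𝓘(ℝ, Cn n).prod 𝓘(ℝ, Cn n)) 𝓘(ℝ, F) ∞ (fun p : M × M => D.cut ρ H j p.1 p.2)
      (D.reg ×ˢ D.reg) := by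
  have hR := D.isOpen_reg.prod D.isOpen_reg
  have hc : ContMDiff (𝓘(ℝ, Cn n).prod 𝓘(ℝ, Cn n)) 𝓘(ℝ, ℂ) ∞
      fun q : M × M => (D.cutoff ρ j q : ℂ) :=
    Complex.ofRealCLM.contDiff.contMDiff.comp (D.cutoff_smooth hρ j)
  intro p hp
  refine ContMDiffAt.contMDiffWithinAt ?_
  by_cases h : p.1 = p.2
  · have h0 : D.cutArg ρ p = 0 := by
      rw [LeviDomain.cutArg, h, hρ.self_eq_zero]
      simp
    have hev : ∀ᶠ q in 𝓝 p, (j : ℝ) * D.cutArg ρ q < 1 := by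
      refine ((continuous_const.mul (D.cutArg_smooth hρ).continuous).tendsto p).eventually_lt_const ?_
      simp [h0]
    refine (contMDiffAt_const (c := (0 : F))).congr_of_eventuallyEq ?_
    filter_upwards [hev, hR.mem_nhds hp] with q hq hq'
    rw [D.cut_eq ρ H j hq'.1 hq'.2, D.cutoff_eq_zero hq.le]
    simp
  · have h1 : ContMDiffAt (𝓘(ℝ, Cn n).prod 𝓘(ℝ, Cn n)) 𝓘(ℝ, F) ∞
        (fun p : M × M => (D.cutoff ρ j p : ℂ) • H p.1 p.2) p := by
      have h2 := hH.contMDiffAt (D.isOpen_offDiag.mem_nhds ⟨hp, h⟩)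
      exact (((smulB F).isBoundedBilinearMap.contDiff).contMDiff.contMDiffAt (x := (_, _))).comp p
        ((hc p).prodMk_space h2)
    refine h1.congr_of_eventuallyEq ?_
    filter_upwards [hR.mem_nhds hp] with q hq
    exact D.cut_eq ρ H j hq.1 hq.2

theorem LeviDomain.norm_cut_sub_le (H : M → M → F) (j : ℕ) {ζ z : M} (hζ : ζ ∈ D.reg)
    (hz : z ∈ D.reg) : ‖D.cut ρ H j ζ z - H ζ z‖ ≤ ‖H ζ z‖ ∧
      (2 ≤ j * D.cutArg ρ (ζ, z) → D.cut ρ H j ζ z - H ζ z = 0) := by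
  rw [D.cut_eq ρ H j hζ hz]
  refine ⟨?_, fun h => by rw [D.cutoff_eq_one h]; simp⟩
  have h0 : 0 ≤ D.cutoff ρ j (ζ, z) := Real.smoothTransition.nonneg _
  have h1 : D.cutoff ρ j (ζ, z) ≤ 1 := Real.smoothTransition.le_one _
  have e : (D.cutoff ρ j (ζ, z) : ℂ) • H ζ z - H ζ z =
      ((D.cutoff ρ j (ζ, z) - 1 : ℝ) : ℂ) • H ζ z := by
    push_cast
    rw [sub_smul, one_smul]
  rw [e, norm_smul, Complex.norm_real]
  refine mul_le_of_le_one_left (norm_nonneg _) ?_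
  rw [Real.norm_eq_abs, abs_le]
  constructor <;> linarith

theorem LeviDomain.IsAdmissible.exists_tangDeriv_cut_sub_le (hρ : D.IsDistanceFunction ρ)
    {X : ComplexField n M} (hX : D.IsAdmissible X) {φ : Fin N → M → ℝ}
    {Z : Fin N → SmoothField n M} (hZ : IsFrameOn (closure D.carrier) φ Z) {H : M → M → F}
    (hH : ContMDiffOn (𝓘(ℝ, Cn n).prod 𝓘(ℝ, Cn n)) 𝓘(ℝ, F) ∞ (fun p : M × M => H p.1 p.2)
      D.offDiag) :
    ∃ C : ℝ, 0 ≤ C ∧ ∀ (j : ℕ), ∀ p ∈ D.offDiag,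
      ‖tangDeriv (D.tang X φ) Z (fun q => D.cut ρ H j q.1 q.2) p -
        tangDeriv (D.tang X φ) Z (fun q => H q.1 q.2) p‖ ≤
        C * ‖H p.1 p.2‖ + ‖tangDeriv (D.tang X φ) Z (fun q => H q.1 q.2) p‖ ∧
      (2 ≤ j * D.cutArg ρ p → tangDeriv (D.tang X φ) Z (fun q => D.cut ρ H j q.1 q.2) p -
        tangDeriv (D.tang X φ) Z (fun q => H q.1 q.2) p = 0) := by
  obtain ⟨C, hC, h⟩ := hX.exists_tangDeriv_cutoff_le hρ hZ
  refine ⟨C, hC, fun j p hp => ?_⟩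
  have hcs : ContMDiff (𝓘(ℝ, Cn n).prod 𝓘(ℝ, Cn n)) 𝓘(ℝ, ℂ) ∞
      fun q : M × M => (D.cutoff ρ j q : ℂ) :=
    Complex.ofRealCLM.contDiff.contMDiff.comp (D.cutoff_smooth hρ j)
  have e : tangDeriv (D.tang X φ) Z (fun q => D.cut ρ H j q.1 q.2) p =
      tangDeriv (D.tang X φ) Z (fun q => (D.cutoff ρ j q : ℂ)) p • H p.1 p.2 +
      (D.cutoff ρ j p : ℂ) • tangDeriv (D.tang X φ) Z (fun q => H q.1 q.2) p := by
    rw [← tangDeriv_smul (hcs.mdifferentiableAt (by simp)) (hH.mdiffAt' D.isOpen_offDiag hp)]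
    exact tangDeriv_congr D.isOpen_offDiag (fun q hq => D.cut_eq ρ H j hq.1.1 hq.1.2) hp
  have h0 : 0 ≤ D.cutoff ρ j p := Real.smoothTransition.nonneg _
  have h1 : D.cutoff ρ j p ≤ 1 := Real.smoothTransition.le_one _
  rw [e]
  refine ⟨?_, fun h2 => by rw [(h j p hp).2 h2, D.cutoff_eq_one h2]; simp⟩
  have e2 : ∀ a b : F, a + (D.cutoff ρ j p : ℂ) • b - b =
      a + ((D.cutoff ρ j p - 1 : ℝ) : ℂ) • b := fun a b => by
    push_cast
    rw [sub_smul, one_smul, add_sub_assoc]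
  rw [e2]
  refine (norm_add_le _ _).trans ?_
  rw [norm_smul, norm_smul, Complex.norm_real]
  refine add_le_add (mul_le_mul_of_nonneg_right (h j p hp).1 (norm_nonneg _))
    (mul_le_of_le_one_left (norm_nonneg _) ?_)
  rw [Real.norm_eq_abs, abs_le]
  constructor <;> linarith

/-- Where the cutoff is not zero, `-r γ²` is at least a positive constant because `ρ ≤ R`. On the
closure of `D` this confines `ζ` to a compact subset of `D'`, the same for all `z`. -/
theorem LeviDomain.exists_compact_cut_eq_zero (hρ : D.IsDistanceFunction ρ) (H : M → M → F)
    (j : ℕ) : ∃ Q : Set M, IsCompact Q ∧ Q ⊆ D.reg ∧ ∀ ζ ∉ Q, ∀ z, D.cut ρ H j ζ z = 0 := by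
  obtain ⟨R, hR0, hR⟩ := hρ.bounded D.isCompact_closure
  have hjR : 0 < ((j : ℝ) + 1) * R ^ 2 := by positivity
  refine ⟨closure D.carrier ∩ {x | 1 / ((j + 1) * R ^ 2) ≤ D.defn x},
    D.isCompact_closure.inter_right (isClosed_le continuous_const D.defn_smooth.continuous),
    fun x hx => D.mem_reg_of_defn_pos hx.1 (lt_of_lt_of_le (by positivity) hx.2),
    fun ζ hζ z => ?_⟩
  by_cases h : (ζ, z) ∈ D.reg ×ˢ D.reg
  swap
  · exact indicator_of_notMem h _
  rw [D.cut_eq ρ H j h.1 h.2, D.cutoff_eq_zero, Complex.ofReal_zero, zero_smul]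
  have h1 : D.defn ζ < 1 / ((j + 1) * R ^ 2) := by
    by_contra h2
    exact hζ ⟨D.reg_subset_closure h.1, not_lt.1 h2⟩
  have h2 := hR ζ (D.reg_subset_closure h.1) z (D.reg_subset_closure h.2)
  have h3 := D.defn_pos h.1
  rw [lt_div_iff₀ hjR] at h1
  calc (j : ℝ) * D.cutArg ρ (ζ, z) ≤ (j + 1) * (D.defn ζ * R ^ 2) := by
        rw [LeviDomain.cutArg]
        have := hρ.nonneg ζ z
        have h4 : (j : ℝ) ≤ j + 1 := by linarith
        dsimp only
        gcongr
    _ ≤ 1 := by nlinarith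

end Cut


/-! ### Operators whose kernels are smooth and compactly supported in the first variable -/

section Regular

variable {n : ℕ} {M : Type*} [TopologicalSpace M] [ChartedSpace (Cn n) M]
  [IsManifold 𝓘(ℂ, Cn n) ω M] [T2Space M] [SecondCountableTopology M]
  [MeasurableSpace M] [BorelSpace M] {D : LeviDomain n M}
  {V W : Type*} [NormedAddCommGroup V] [NormedSpace ℂ V] [NormedAddCommGroup W] [NormedSpace ℂ W]

theorem continuous_of_continuousOn_of_zero {X Y : Type*} [TopologicalSpace X] [TopologicalSpace Y]
    [Zero Y] {S Q : Set X} {g : X → Y} (hS : IsOpen S) (hQ : IsClosed Q) (hQS : Q ⊆ S)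
    (hg : ContinuousOn g S) (h0 : ∀ x ∉ Q, g x = 0) : Continuous g := by
  rw [continuous_iff_continuousAt]
  intro x
  by_cases hx : x ∈ S
  · exact hg.continuousAt (hS.mem_nhds hx)
  · refine ContinuousAt.congr (f := fun _ => (0 : Y)) continuousAt_const ?_
    filter_upwards [hQ.isOpen_compl.mem_nhds fun h => hx (hQS h)] with y hy
    exact (h0 y hy).symm

theorem LeviDomain.integrable_of_compact (D : LeviDomain n M) {F : Type*} [NormedAddCommGroup F]
    {Q : Set M} (hQ : IsCompact Q) (hQr : Q ⊆ D.reg) {g : M → F} (hg : ContinuousOn g D.reg)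
    (h0 : ∀ x ∉ Q, g x = 0) : Integrable g D.vol :=
  (continuous_of_continuousOn_of_zero D.isOpen_reg hQ.isClosed hQr hg
    h0).integrable_of_hasCompactSupport (HasCompactSupport.intro hQ h0)

/-- Evaluation of complex linear maps as a real bilinear map. -/
abbrev evalB (V W : Type*) [NormedAddCommGroup V] [NormedSpace ℂ V] [NormedAddCommGroup W]
    [NormedSpace ℂ W] : (V →L[ℂ] W) →L[ℝ] V →L[ℝ] W :=
  ContinuousLinearMap.restrictScalarsL ℂ V W ℝ ℝ

theorem continuousOn_eval {S : Set M} {T : M → V →L[ℂ] W} {u : M → V} (hT : ContinuousOn T S)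
    (hu : ContinuousOn u S) : ContinuousOn (fun x => T x (u x)) S :=
  hT.clm_apply hu

theorem continuousOn_dirDeriv {S : Set M} (hS : IsOpen S) {F : Type*} [NormedAddCommGroup F]
    [NormedSpace ℝ F] {u : M → F} (hu : ContMDiffOn 𝓘(ℝ, Cn n) 𝓘(ℝ, F) 1 u S)
    {Z : ∀ x : M, Tan n x} (hZ : FieldOn (I := 𝓘(ℝ, Cn n)) ∞ Z S) :
    ContinuousOn (fun x => dirDeriv u x (Z x)) S :=
  (lieD_contMDiffOn (m := 0) hS (ContMDiffOn.of_le hZ (by simp)) hu (by simp)).continuousOn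

theorem continuousOn_apply {S : Set M} (hS : IsOpen S) {F : Type*} [NormedAddCommGroup F]
    [NormedSpace ℂ F] {u : M → F} (hu : ContMDiffOn 𝓘(ℝ, Cn n) 𝓘(ℝ, F) 1 u S)
    {X : ComplexField n M} (hre : FieldOn (I := 𝓘(ℝ, Cn n)) ∞ X.re S)
    (him : FieldOn (I := 𝓘(ℝ, Cn n)) ∞ X.im S) : ContinuousOn (X.apply u) S :=
  (continuousOn_dirDeriv hS hu hre).add ((continuousOn_dirDeriv hS hu him).const_smul Complex.I)

theorem LeviDomain.continuousOn_adjoint (D : LeviDomain n M) {S : Set M} (hS : IsOpen S)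
    {u : M → V} (hu : ContMDiffOn 𝓘(ℝ, Cn n) 𝓘(ℝ, V) 1 u S)
    {X : ComplexField n M} (hre : FieldOn (I := 𝓘(ℝ, Cn n)) ∞ X.re S)
    (him : FieldOn (I := 𝓘(ℝ, Cn n)) ∞ X.im S) : ContinuousOn (D.adjoint X u) S := by
  have h1 := D.divergence_continuousOn hS hre
  have h2 := D.divergence_continuousOn hS him
  have h3 : ContinuousOn (fun x => (D.divergence X.re x : ℂ) +
      Complex.I * (D.divergence X.im x : ℂ)) S :=
    (Complex.continuous_ofReal.comp_continuousOn h1).add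
      (continuousOn_const.mul (Complex.continuous_ofReal.comp_continuousOn h2))
  exact (continuousOn_apply hS hu hre him).neg.sub (h3.smul hu.continuousOn)

/-- Partial integration of a complex vector field. -/
theorem LeviDomain.integral_apply_eval (D : LeviDomain n M) {Q : Set M} (hQ : IsCompact Q)
    (hQr : Q ⊆ D.reg) {T : M → V →L[ℂ] W}
    (hT : ContMDiffOn 𝓘(ℝ, Cn n) 𝓘(ℝ, V →L[ℂ] W) ∞ T D.reg) (hT0 : ∀ x ∉ Q, T x = 0)
    {u : M → V} (hu : ContMDiffOn 𝓘(ℝ, Cn n) 𝓘(ℝ, V) 1 u D.reg) {X : ComplexField n M}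
    (hre : FieldOn (I := 𝓘(ℝ, Cn n)) ∞ X.re D.reg)
    (him : FieldOn (I := 𝓘(ℝ, Cn n)) ∞ X.im D.reg) :
    Integrable (fun x => X.apply T x (u x)) D.vol ∧
    Integrable (fun x => T x (D.adjoint X u x)) D.vol ∧
    ∫ x, X.apply T x (u x) ∂D.vol = ∫ x, T x (D.adjoint X u x) ∂D.vol := by
  have hT1 : ContMDiffOn 𝓘(ℝ, Cn n) 𝓘(ℝ, V →L[ℂ] W) 1 T D.reg := hT.of_le (by simp)
  have hts : tsupport T ⊆ Q := closure_minimal (fun x hx => by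
    by_contra h
    exact hx (hT0 x h)) hQ.isClosed
  have hd0 : ∀ x ∉ Q, ∀ v : Tan n x, dirDeriv T x v = 0 := fun x hx v =>
    dirDeriv_eq_zero_of_notMem_tsupport (fun h => hx (hts h)) v
  have hi1 : Integrable (fun x => X.apply T x (u x)) D.vol :=
    D.integrable_of_compact hQ hQr (continuousOn_eval
      (continuousOn_apply D.isOpen_reg hT1 hre him) hu.continuousOn) fun x hx => by
        simp [ComplexField.apply, hd0 x hx]
  have hi2 : Integrable (fun x => T x (D.adjoint X u x)) D.vol :=
    D.integrable_of_compact hQ hQr (continuousOn_eval hT.continuousOn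
      (D.continuousOn_adjoint D.isOpen_reg hu hre him)) fun x hx => by simp [hT0 x hx]
  refine ⟨hi1, hi2, ?_⟩
  set h : M → W := fun x => T x (u x) with hh
  have hh1 : ContMDiffOn 𝓘(ℝ, Cn n) 𝓘(ℝ, W) 1 h D.reg := fun x hx =>
    ((evalB V W).isBoundedBilinearMap.contDiff.contMDiff.contMDiffAt
      (x := (T x, u x))).comp_contMDiffWithinAt x ((hT1 x hx).prodMk_space (hu x hx))
  have hhQ : tsupport h ⊆ Q := closure_minimal (fun x hx => by
    by_contra h'
    exact hx (by simp [hh, hT0 x h'])) hQ.isClosed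
  have hhc : HasCompactSupport h := HasCompactSupport.intro hQ fun x hx => by simp [hh, hT0 x hx]
  obtain ⟨a1, a2⟩ := D.integral_divergence D.isOpen_reg hre hh1 hhc (hhQ.trans hQr)
  obtain ⟨b1, b2⟩ := D.integral_divergence D.isOpen_reg him hh1 hhc (hhQ.trans hQr)
  have hprod : ∀ x ∈ D.reg, ∀ v : Tan n x,
      dirDeriv h x v = dirDeriv T x v (u x) + T x (dirDeriv u x v) := fun x hx v =>
    dirDeriv_bilin (evalB V W) (hT.mdiffAt' D.isOpen_reg hx)
      ((hu.contMDiffAt (D.isOpen_reg.mem_nhds hx)).mdifferentiableAt (by simp)) v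
  -- The difference of the integrands is `X h + h div X` for `h = T u`, to which the divergence
  -- theorem applies separately along the real and imaginary parts of `X`.
  have heq : (fun x => X.apply T x (u x) - T x (D.adjoint X u x)) = fun x =>
      (dirDeriv h x (X.re x) + D.divergence X.re x • h x) +
      Complex.I • (dirDeriv h x (X.im x) + D.divergence X.im x • h x) := by
    ext x
    by_cases hx : x ∈ D.reg
    · rw [hprod x hx, hprod x hx]
      simp only [ComplexField.apply, LeviDomain.adjoint, _root_.add_apply, _root_.smul_apply,
        map_sub, map_neg, map_add, map_smul, hh, ← Complex.coe_smul]
      module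
    · have hxQ : x ∉ Q := fun h' => hx (hQr h')
      rw [dirDeriv_eq_zero_of_notMem_tsupport (fun h' => hxQ (hhQ h')),
        dirDeriv_eq_zero_of_notMem_tsupport (fun h' => hxQ (hhQ h'))]
      simp [ComplexField.apply, hd0 x hxQ, hT0 x hxQ, hh]
  have b3 : Integrable (fun x => Complex.I • (dirDeriv h x (X.im x) +
      D.divergence X.im x • h x)) D.vol := b1.smul Complex.I
  rw [← sub_eq_zero, ← integral_sub hi1 hi2, heq, integral_add a1 b3, integral_smul, a2, b2]
  simp

/-- Differentiation of an operator with a regular kernel. -/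
theorem LeviDomain.mdifferentiableAt_regular (D : LeviDomain n M) {Q : Set M} (hQ : IsCompact Q)
    (hQr : Q ⊆ D.reg) {G : M → M → V →L[ℂ] W}
    (hG : ContMDiffOn (𝓘(ℝ, Cn n).prod 𝓘(ℝ, Cn n)) 𝓘(ℝ, V →L[ℂ] W) ∞
      (fun p : M × M => G p.1 p.2) (D.reg ×ˢ D.reg)) (hG0 : ∀ ζ ∉ Q, ∀ z, G ζ z = 0)
    {f : M → V} (hf : ContinuousOn f D.reg) {z : M} (hz : z ∈ D.reg) :
    MDifferentiableAt 𝓘(ℝ, Cn n) 𝓘(ℝ, W) (fun z => ∫ ζ, G ζ z (f ζ) ∂D.vol) z ∧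
    ∀ v : Tan n z, Integrable (fun ζ => dirDeriv (G ζ) z v (f ζ)) D.vol ∧
      dirDeriv (fun z => ∫ ζ, G ζ z (f ζ) ∂D.vol) z v =
        ∫ ζ, dirDeriv (G ζ) z v (f ζ) ∂D.vol := by
  set e := chartAt (Cn n) z with he
  have hzs : z ∈ e.source := mem_chart_source _ z
  have hezt : e z ∈ e.target := e.map_source hzs
  have hU : IsOpen (e.target ∩ e.symm ⁻¹' D.reg) :=
    e.symm.isOpen_inter_preimage D.isOpen_reg
  have hzU : e z ∈ e.target ∩ e.symm ⁻¹' D.reg := ⟨hezt, by simpa [e.left_inv hzs] using hz⟩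
  set U := e.target ∩ e.symm ⁻¹' D.reg with hUdef
  obtain ⟨ε, hε, hεU⟩ := Metric.nhds_basis_closedBall.mem_iff.1 (hU.mem_nhds hzU)
  have hsymm : ContMDiffOn 𝓘(ℝ, Cn n) 𝓘(ℝ, Cn n) ∞ e.symm e.target :=
    contMDiffOn_chart_symm
  have hsm : ∀ ζ ∈ D.reg, ∀ y ∈ U, ContMDiffAt (𝓘(ℝ, Cn n).prod 𝓘(ℝ, Cn n)) 𝓘(ℝ, V →L[ℂ] W) ∞
      (fun q : M × Cn n => G q.1 (e.symm q.2)) (ζ, y) := fun ζ hζ y hy => by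
    have h1 := hG.contMDiffAt ((D.isOpen_reg.prod D.isOpen_reg).mem_nhds (mk_mem_prod hζ hy.2))
    have h2 : ContMDiffAt 𝓘(ℝ, Cn n) 𝓘(ℝ, Cn n) ∞ e.symm y :=
      hsymm.contMDiffAt (e.open_target.mem_nhds hy.1)
    exact ContMDiffAt.comp (ζ, y) (g := fun p : M × M => G p.1 p.2) h1
      (contMDiffAt_fst.prodMk (h2.comp (ζ, y) contMDiffAt_snd))
  set P : M → Cn n → Cn n →L[ℝ] V →L[ℂ] W := fun ζ y => fderiv ℝ (fun y => G ζ (e.symm y)) y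
  -- Joint continuity of the `z`-derivative bounds it on the compact set `Q × B̄`, which gives the
  -- constant majorant for differentiation under the integral.
  have hP : ContinuousOn (fun q : M × Cn n => P q.1 q.2) (D.reg ×ˢ U) := by
    intro q hq
    refine ContinuousAt.continuousWithinAt ?_
    have h1 : ContMDiffAt ((𝓘(ℝ, Cn n).prod 𝓘(ℝ, Cn n)).prod 𝓘(ℝ, Cn n)) 𝓘(ℝ, V →L[ℂ] W) ∞
        (Function.uncurry fun (q : M × Cn n) (y : Cn n) => G q.1 (e.symm y)) (q, q.2) :=
      ContMDiffAt.comp (q, q.2) (g := fun q : M × Cn n => G q.1 (e.symm q.2))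
        (f := fun r : (M × Cn n) × Cn n => (r.1.1, r.2)) (hsm q.1 hq.1 q.2 hq.2)
        ((contMDiffAt_fst.comp (q, q.2) contMDiffAt_fst).prodMk contMDiffAt_snd)
    have h2 := ContMDiffAt.mfderiv (m := 0) (fun (q : M × Cn n) (y : Cn n) => G q.1 (e.symm y))
      Prod.snd h1 contMDiffAt_snd (by simp)
    have h3 := inTangentCoordinates_model_space (I := 𝓘(ℝ, Cn n)) (I' := 𝓘(ℝ, V →L[ℂ] W))
      Prod.snd (fun x : M × Cn n => G x.1 (e.symm x.2)) (fun q => P q.1 q.2) q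
    have h4 : (fun x : M × Cn n => (mfderiv 𝓘(ℝ, Cn n) 𝓘(ℝ, V →L[ℂ] W)
        (fun y => G x.1 (e.symm y)) x.2 : Cn n →L[ℝ] V →L[ℂ] W)) = fun q => P q.1 q.2 :=
      funext fun _ => mfderiv_eq_fderiv
    have h5 := h2.continuousAt
    erw [h4, h3] at h5
    exact h5
  have hcpt : IsCompact (Q ×ˢ Metric.closedBall (e z) ε) :=
    hQ.prod (isCompact_closedBall _ _)
  obtain ⟨C, hC⟩ := hcpt.exists_bound_of_continuousOn
    (E := Cn n →L[ℝ] V →L[ℂ] W) (hP.mono (prod_mono hQr hεU))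
  have hfder : ∀ ζ, ∀ y ∈ U, HasFDerivAt (fun y => G ζ (e.symm y)) (P ζ y) y := fun ζ y hy => by
    by_cases hζ : ζ ∈ Q
    · have h1 : ContMDiffAt 𝓘(ℝ, Cn n) 𝓘(ℝ, V →L[ℂ] W) ∞ (fun y => G ζ (e.symm y)) y :=
        ContMDiffAt.comp y (g := fun q : M × Cn n => G q.1 (e.symm q.2)) (f := fun y => (ζ, y))
          (hsm ζ (hQr hζ) y hy) (contMDiffAt_const.prodMk contMDiffAt_id)
      exact (h1.contDiffAt.differentiableAt (by simp)).hasFDerivAt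
    · have h1 : (fun y => G ζ (e.symm y)) = fun _ => 0 := by ext1 y; exact hG0 ζ hζ _
      simp only [P, h1]
      simpa using hasFDerivAt_const (0 : V →L[ℂ] W) y
  have hP0 : ∀ ζ ∉ Q, ∀ y, P ζ y = 0 := fun ζ hζ y => by
    have h1 : (fun y => G ζ (e.symm y)) = fun _ => 0 := by ext1 y; exact hG0 ζ hζ _
    simp [P, h1]
  set P' : Cn n → M → Cn n →L[ℝ] W := fun y ζ => ((evalB V W).flip (f ζ)).comp (P ζ y)
  obtain ⟨B, hB⟩ := hQ.exists_bound_of_continuousOn (hf.mono hQr)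
  have hbound : ∀ ζ ∈ Q, ∀ y ∈ Metric.closedBall (e z) ε, ‖P' y ζ‖ ≤ C * B := fun ζ hζ y hy => by
    have hC0 := hC (ζ, y) ⟨hζ, hy⟩
    have hB0 := hB ζ hζ
    refine ContinuousLinearMap.opNorm_le_bound _
      (mul_nonneg ((norm_nonneg _).trans hC0) ((norm_nonneg _).trans hB0)) fun w => ?_
    calc ‖P' y ζ w‖ = ‖(P ζ y w) (f ζ)‖ := rfl
      _ ≤ ‖P ζ y‖ * ‖w‖ * ‖f ζ‖ := (ContinuousLinearMap.le_opNorm _ _).trans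
          (mul_le_mul_of_nonneg_right (ContinuousLinearMap.le_opNorm _ _) (norm_nonneg _))
      _ ≤ C * ‖w‖ * B := by
          have := (norm_nonneg _).trans hC0
          gcongr
      _ = _ := by ring
  have hGc : ∀ y ∈ D.reg, ContinuousOn (fun ζ => G ζ y (f ζ)) D.reg := fun y hy =>
    continuousOn_eval (hG.continuousOn.comp (f := fun ζ => (ζ, y))
      (continuous_id.prodMk continuous_const).continuousOn fun ζ hζ => mk_mem_prod hζ hy) hf
  have hGi : ∀ y ∈ D.reg, Integrable (fun ζ => G ζ y (f ζ)) D.vol := fun y hy =>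
    D.integrable_of_compact hQ hQr (hGc y hy) fun ζ hζ => by simp [hG0 ζ hζ]
  have hPi : Integrable (P' (e z)) D.vol := by
    refine D.integrable_of_compact hQ hQr ?_ fun ζ hζ => ?_
    · have h1 : ContinuousOn (fun ζ => P ζ (e z)) D.reg :=
        hP.comp (f := fun ζ => (ζ, e z)) (continuous_id.prodMk continuous_const).continuousOn
          fun ζ hζ => mk_mem_prod hζ hzU
      exact ((evalB V W).flip.continuous.comp_continuousOn hf).clm_comp h1
    · simp [P', hP0 ζ hζ]
  have key := hasFDerivAt_integral_of_dominated_of_fderiv_le (μ := D.vol) (𝕜 := ℝ)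
    (F := fun y ζ => G ζ (e.symm y) (f ζ)) (F' := P') (x₀ := e z)
    (s := Metric.closedBall (e z) ε) (bound := Q.indicator fun _ => C * B)
    (Metric.closedBall_mem_nhds _ hε)
    (by filter_upwards [hU.mem_nhds hzU] with y hy using (hGi _ hy.2).aestronglyMeasurable)
    (hGi _ hzU.2) hPi.aestronglyMeasurable
    (Filter.Eventually.of_forall fun ζ y hy => by
      by_cases hζ : ζ ∈ Q
      · rw [indicator_of_mem hζ]; exact hbound ζ hζ y hy
      · rw [indicator_of_notMem hζ]; simp [P', hP0 ζ hζ])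
    ((integrableOn_const hQ.measure_lt_top.ne).integrable_indicator hQ.measurableSet)
    (Filter.Eventually.of_forall fun ζ y hy =>
      ((evalB V W).flip (f ζ)).hasFDerivAt.comp y (hfder ζ y (hεU hy)))
  have hmd : MDifferentiableAt 𝓘(ℝ, Cn n) 𝓘(ℝ, W) (fun z => ∫ ζ, G ζ z (f ζ) ∂D.vol) z := by
    have h1 := key.differentiableAt.mdifferentiableAt.comp z
      ((chart_mdiff z).mdifferentiableAt hzs)
    refine h1.congr_of_eventuallyEq ?_
    filter_upwards [e.open_source.mem_nhds hzs] with y hy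
    simp only [Function.comp_apply]
    rw [e.left_inv hy]
  have hGm : ∀ ζ, MDifferentiableAt 𝓘(ℝ, Cn n) 𝓘(ℝ, V →L[ℂ] W) (G ζ) z := fun ζ => by
    by_cases hζ : ζ ∈ Q
    · have h1 : ContMDiffAt 𝓘(ℝ, Cn n) 𝓘(ℝ, V →L[ℂ] W) ∞ (G ζ) z :=
        ContMDiffAt.comp z (g := fun p : M × M => G p.1 p.2) (f := fun y => (ζ, y))
          (hG.contMDiffAt ((D.isOpen_reg.prod D.isOpen_reg).mem_nhds (mk_mem_prod (hQr hζ) hz)))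
          (contMDiffAt_const.prodMk contMDiffAt_id)
      exact h1.mdifferentiableAt (by simp)
    · have h1 : G ζ = fun _ => 0 := by ext1 y; exact hG0 ζ hζ y
      rw [h1]
      exact mdifferentiableAt_const
  have hdG : ∀ v : Tan n z, (fun ζ => dirDeriv (G ζ) z v (f ζ)) =
      fun ζ => P' (e z) ζ (chartD z z v) := fun v => by
    ext ζ
    rw [dirDeriv_eq_fderiv hzs (hGm ζ)]
    rfl
  refine ⟨hmd, fun v => ?_⟩
  rw [hdG v, dirDeriv_eq_fderiv hzs hmd]
  refine ⟨hPi.apply_continuousLinearMap _, ?_⟩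
  rw [← ContinuousLinearMap.integral_apply hPi]
  have h1 : (fun z => ∫ ζ, G ζ z (f ζ) ∂D.vol) ∘ e.symm =
      fun y => ∫ ζ, G ζ (e.symm y) (f ζ) ∂D.vol := rfl
  rw [← he, h1, key.fderiv]

end Regular


/-! ### The commutator identity for regular kernels and the boundedness of `X̃(γ f)` -/

section Commutator

variable {n : ℕ} {M : Type*} [TopologicalSpace M] [ChartedSpace (Cn n) M]
  [IsManifold 𝓘(ℂ, Cn n) ω M] [T2Space M] [SecondCountableTopology M]
  [MeasurableSpace M] [BorelSpace M] {D : LeviDomain n M} {N : ℕ}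
  {V W : Type*} [NormedAddCommGroup V] [NormedSpace ℂ V] [NormedAddCommGroup W] [NormedSpace ℂ W]

theorem LeviDomain.gamma_smul_contMDiffOn (D : LeviDomain n M) {f : M → V}
    (hf : ContMDiffOn 𝓘(ℝ, Cn n) 𝓘(ℝ, V) 1 f D.reg) :
    ContMDiffOn 𝓘(ℝ, Cn n) 𝓘(ℝ, V) 1 (fun x => (D.gamma x : ℂ) • f x) D.reg := by
  have h := (D.gamma_smoothOn.of_le (m := 1) (by simp)).smul hf
  exact h.congr fun x _ => (Complex.coe_smul _ _)

theorem tangDeriv_eq_zero_of_notMem {g : Fin N → M → ℂ} {Z : Fin N → SmoothField n M} {Q : Set M}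
    (hQ : IsClosed Q) {G : M → M → V →L[ℂ] W} (hG0 : ∀ ζ ∉ Q, ∀ z, G ζ z = 0) {ζ : M} (hζ : ζ ∉ Q)
    (z : M) : tangDeriv g Z (fun p : M × M => G p.1 p.2) (ζ, z) = 0 := by
  have h1 := tangDeriv_congr (g := g) (Z := Z) (u := fun p : M × M => G p.1 p.2)
    (v := fun _ => 0) (hQ.isOpen_compl.prod isOpen_univ) (fun p hp => hG0 p.1 hp.1 p.2)
    (mk_mem_prod hζ (mem_univ z))
  rw [h1]
  simp [tangDeriv, lieD_const]

/-- The commutator identity for a regular kernel. -/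
theorem LeviDomain.gamma_apply_regular (D : LeviDomain n M) {Q : Set M} (hQ : IsCompact Q)
    (hQr : Q ⊆ D.reg) {G : M → M → V →L[ℂ] W}
    (hG : ContMDiffOn (𝓘(ℝ, Cn n).prod 𝓘(ℝ, Cn n)) 𝓘(ℝ, V →L[ℂ] W) ∞
      (fun p : M × M => G p.1 p.2) (D.reg ×ˢ D.reg)) (hG0 : ∀ ζ ∉ Q, ∀ z, G ζ z = 0)
    {f : M → V} (hf : ContMDiffOn 𝓘(ℝ, Cn n) 𝓘(ℝ, V) 1 f D.reg) {X : ComplexField n M}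
    (hre : FieldOn (I := 𝓘(ℝ, Cn n)) ∞ X.re D.reg)
    (him : FieldOn (I := 𝓘(ℝ, Cn n)) ∞ X.im D.reg) {φ : Fin N → M → ℝ}
    {Z : Fin N → SmoothField n M} (hZ : IsFrameOn (closure D.carrier) φ Z) {z : M}
    (hz : z ∈ D.reg) :
    Integrable (fun ζ => tangDeriv (D.tang X φ) Z (fun p => G p.1 p.2) (ζ, z) (f ζ)) D.vol ∧
    Integrable (fun ζ => G ζ z (D.adjoint X (fun x => (D.gamma x : ℂ) • f x) ζ)) D.vol ∧
    (D.gamma z : ℂ) • X.apply (fun z => ∫ ζ, G ζ z (f ζ) ∂D.vol) z =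
      ∫ ζ, tangDeriv (D.tang X φ) Z (fun p => G p.1 p.2) (ζ, z) (f ζ) ∂D.vol -
      ∫ ζ, G ζ z (D.adjoint X (fun x => (D.gamma x : ℂ) • f x) ζ) ∂D.vol := by
  have hT : ContMDiffOn 𝓘(ℝ, Cn n) 𝓘(ℝ, V →L[ℂ] W) ∞ (fun ζ => G ζ z) D.reg :=
    ContMDiffOn.comp (g := fun p : M × M => G p.1 p.2) (f := fun ζ => (ζ, z)) hG
      (contMDiff_id.prodMk contMDiff_const).contMDiffOn fun ζ hζ => mk_mem_prod hζ hz
  obtain ⟨a1, a2, a3⟩ := D.integral_apply_eval hQ hQr hT (fun x hx => hG0 x hx z)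
    (D.gamma_smul_contMDiffOn hf) hre him
  obtain ⟨-, b⟩ := D.mdifferentiableAt_regular hQ hQr hG hG0 hf.continuousOn hz
  obtain ⟨b1, b2⟩ := b (X.re z)
  obtain ⟨b3, b4⟩ := b (X.im z)
  -- Pointwise `(T G) f = (X^ζ G)(γ f) + γ* (X^z G) f`. The first term is integrated by parts, the
  -- second is the derivative of the operator; for `ζ` outside `Q` everything vanishes.
  have hc : ∀ ζ, tangDeriv (D.tang X φ) Z (fun p => G p.1 p.2) (ζ, z) (f ζ) =
      X.apply (fun ζ => G ζ z) ζ ((D.gamma ζ : ℂ) • f ζ) +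
        (D.gamma z : ℂ) • (dirDeriv (G ζ) z (X.re z) (f ζ) +
          Complex.I • dirDeriv (G ζ) z (X.im z) (f ζ)) := fun ζ => by
    by_cases hζ : ζ ∈ Q
    · rw [hZ.tangDeriv_eq X (D.reg_subset_closure (hQr hζ)) (D.reg_subset_closure hz)
        (hG.mdiffAt' (D.isOpen_reg.prod D.isOpen_reg) (mk_mem_prod (hQr hζ) hz))]
      simp [ComplexField.apply]
      exact smul_comm _ _ _
    · have h3 : ∀ v : Tan n z, dirDeriv (G ζ) z v = 0 := fun v => by
        have : G ζ = fun _ => 0 := by ext1 y; exact hG0 ζ hζ y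
        rw [this]
        exact dirDeriv_eq_zero_of_notMem_tsupport (by simp [tsupport]) v
      have h4 : ∀ v : Tan n ζ, dirDeriv (fun ζ => G ζ z) ζ v = 0 := fun v =>
        dirDeriv_eq_zero_of_notMem_tsupport (fun h => hζ (closure_minimal (fun x hx => by
          by_contra h'
          exact hx (hG0 x h' z)) hQ.isClosed h)) v
      rw [tangDeriv_eq_zero_of_notMem hQ.isClosed hG0 hζ, h3, h3, ComplexField.apply, h4, h4]
      simp
  have hb : Integrable (fun ζ => (D.gamma z : ℂ) • (dirDeriv (G ζ) z (X.re z) (f ζ) +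
      Complex.I • dirDeriv (G ζ) z (X.im z) (f ζ))) D.vol :=
    (b1.add (b3.smul Complex.I)).smul _
  have hb3 : Integrable (fun ζ => Complex.I • dirDeriv (G ζ) z (X.im z) (f ζ)) D.vol :=
    b3.smul Complex.I
  simp only [hc]
  refine ⟨a1.add hb, a2, ?_⟩
  rw [integral_add a1 hb, a3, add_sub_cancel_left, integral_smul, integral_add b1 hb3,
    integral_smul, ComplexField.apply, b2, b4]

/-- In the frame `div X = ∑ ((Xφⱼ) div Zⱼ + Zⱼ(Xφⱼ))`; one derivative of a function of class `ξ₀` is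
`O(γ⁻¹)`. -/
theorem LeviDomain.exists_divergence_le (D : LeviDomain n M) {X : ∀ x : M, Tan n x}
    (hX : ∀ φ : M → ℝ, ContMDiff 𝓘(ℝ, Cn n) 𝓘(ℝ, ℝ) ∞ φ →
      D.XiOn D.reg (fun _ => 1) (fun x => dirDeriv φ x (X x))) :
    ∃ C : ℝ, ∀ x ∈ D.reg, D.gamma x * |D.divergence X x| ≤ C := by
  obtain ⟨N, φ, Z, hZ⟩ := exists_frame (n := n) D.isCompact_closure
  obtain ⟨Γ, hΓ1, hΓ⟩ := D.exists_gamma_le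
  choose a ha using fun j => (hX _ (hZ.smooth j)).2 []
  choose b hb using fun j => (hX _ (hZ.smooth j)).2 [Z j]
  have hdc : ∀ j, ContinuousOn (D.divergence fun x => Z j x) (closure D.carrier) := fun j =>
    (D.divergence_continuousOn isOpen_univ (fieldOn_fld (Z j) univ)).mono (subset_univ _)
  choose d hd using fun j => D.isCompact_closure.exists_bound_of_continuousOn (hdc j)
  refine ⟨∑ j, (Γ * (|a j| * |d j|) + |b j|), fun x hx => ?_⟩
  have hxc := D.reg_subset_closure hx
  have hγ := D.gamma_nonneg x
  rw [D.divergence_sum D.isOpen_reg (c := fun j x => dirDeriv (φ j) x (X x))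
    (fun j => (hX _ (hZ.smooth j)).1) (fun y hy => hZ.eq_sum y (D.reg_subset_closure hy) _) hx]
  refine (mul_le_mul_of_nonneg_left (Finset.abs_sum_le_sum_abs _ _) hγ).trans ?_
  rw [Finset.mul_sum]
  refine Finset.sum_le_sum fun j _ => ?_
  have h1 : |dirDeriv (φ j) x (X x)| ≤ |a j| := by
    have := ha j x hx
    simp only [List.map_nil, List.prod_nil, one_mul, mul_one] at this
    exact this.trans (le_abs_self _)
  have h2 : D.gamma x * |dirDeriv (fun x => dirDeriv (φ j) x (X x)) x (Z j x)| ≤ |b j| := by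
    have h3 : D.gamma x * ‖dirDeriv (fun x => dirDeriv (φ j) x (X x)) x (Z j x)‖ ≤ b j := by
      simpa using! hb j x hx
    exact h3.trans (le_abs_self _)
  have h4 : |D.divergence (fun x => Z j x) x| ≤ |d j| := (hd j x hxc).trans (le_abs_self _)
  calc _ ≤ D.gamma x * (|dirDeriv (φ j) x (X x)| * |D.divergence (fun x => Z j x) x| +
        |dirDeriv (fun x => dirDeriv (φ j) x (X x)) x (Z j x)|) := by
        gcongr
        refine (abs_add_le _ _).trans (le_of_eq ?_)
        rw [abs_mul]
    _ = D.gamma x * (|dirDeriv (φ j) x (X x)| * |D.divergence (fun x => Z j x) x|) +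
        D.gamma x * |dirDeriv (fun x => dirDeriv (φ j) x (X x)) x (Z j x)| := by ring
    _ ≤ _ := by
        have := hΓ x hxc
        gcongr

/-- Three bounded contributions: `(Xγ) f`, as `γ` has bounded first derivatives, `γ X f`, and `γ
(div X) f`, where `γ` absorbs the growth of the divergence at the critical points. -/
theorem LeviDomain.IsAdmissible.exists_adjoint_le {X : ComplexField n M} (hX : D.IsAdmissible X)
    {f : M → V} (hf : D.IsBoundedC1 f) :
    ∃ C : ℝ, ∀ x ∈ D.reg, ‖D.adjoint X (fun x => (D.gamma x : ℂ) • f x) x‖ ≤ C := by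
  obtain ⟨N, φ, Z, hZ⟩ := exists_frame (n := n) D.isCompact_closure
  obtain ⟨Γ, hΓ1, hΓ⟩ := D.exists_gamma_le
  obtain ⟨hf1, B, hB⟩ := hf
  have hre : ∀ φ : M → ℝ, ContMDiff 𝓘(ℝ, Cn n) 𝓘(ℝ, ℝ) ∞ φ → ∀ x,
      Complex.reCLM (X.apply (fun y => (φ y : ℂ)) x) = dirDeriv φ x (X.re x) ∧
      Complex.imCLM (X.apply (fun y => (φ y : ℂ)) x) = dirDeriv φ x (X.im x) := fun φ hφ x => by
    rw [X.apply_ofReal (hφ.mdifferentiableAt (by simp))]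
    simp
  have hXi : ∀ (L : ℂ →L[ℝ] ℝ) (φ : M → ℝ), ContMDiff 𝓘(ℝ, Cn n) 𝓘(ℝ, ℝ) ∞ φ →
      D.XiOn D.reg (fun _ => 1) (fun x => L (X.apply (fun y => (φ y : ℂ)) x)) := fun L φ hφ =>
    Symb.clm L D.isOpen_reg (fun Z => fieldOn_fld Z D.reg) (fun _ => fun x hx => D.gamma_pos hx)
      (hX.coeff φ hφ)
  obtain ⟨d₁, hd₁⟩ := D.exists_divergence_le (X := X.re) fun φ hφ =>
    (hXi Complex.reCLM φ hφ).congr D.isOpen_reg fun x _ => ((hre φ hφ x).1).symm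
  obtain ⟨d₂, hd₂⟩ := D.exists_divergence_le (X := X.im) fun φ hφ =>
    (hXi Complex.imCLM φ hφ).congr D.isOpen_reg fun x _ => ((hre φ hφ x).2).symm
  choose a ha using fun j => (hX.coeff _ (hZ.smooth j)).2 []
  choose b hb using fun j => D.xiOn_gamma.2 [Z j]
  have hZc : ∀ j, Continuous fun x => √(D.metric.inner x (Z j x) (Z j x)) := fun j =>
    (contMDiffOn_univ.1 (D.metric_contMDiffOn (k := ∞) le_rfl (fieldOn_fld (Z j) univ)
      (fieldOn_fld (Z j) univ))).continuous.sqrt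
  choose s hs using fun j => D.isCompact_closure.exists_bound_of_continuousOn (hZc j).continuousOn
  refine ⟨(∑ j, |a j| * (|b j| * |B| + Γ * (|B| * |s j|))) + (d₁ + d₂) * |B|, fun x hx => ?_⟩
  have hxc := D.reg_subset_closure hx
  have hxD := D.reg_subset_carrier hx
  have hγ := D.gamma_pos hx
  have hfx : ‖f x‖ ≤ |B| := ((hB x hxD).1).trans (le_abs_self _)
  have hgd : MDifferentiableAt 𝓘(ℝ, Cn n) 𝓘(ℝ, ℝ) D.gamma x :=
    D.gamma_smoothOn.mdiffAt' D.isOpen_reg hx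
  have hgd' : MDifferentiableAt 𝓘(ℝ, Cn n) 𝓘(ℝ, ℂ) (fun y => (D.gamma y : ℂ)) x :=
    (D.xiOn_gamma.ofReal D.isOpen_reg subset_rfl).1.mdiffAt' D.isOpen_reg hx
  have hfd : MDifferentiableAt 𝓘(ℝ, Cn n) 𝓘(ℝ, V) f x :=
    (hf1.contMDiffAt (D.isOpen_carrier.mem_nhds hxD)).mdifferentiableAt (by simp)
  have h1 : ‖X.apply (fun x => (D.gamma x : ℂ) • f x) x‖ ≤
      ∑ j, |a j| * (|b j| * |B| + Γ * (|B| * |s j|)) := by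
    rw [← hZ.sum_apply hxc X]
    refine (norm_sum_le _ _).trans (Finset.sum_le_sum fun j _ => ?_)
    rw [norm_smul]
    have h2 : ‖X.apply (fun y => (φ j y : ℂ)) x‖ ≤ |a j| := by
      have := ha j x hx
      simp only [List.map_nil, List.prod_nil, one_mul, mul_one] at this
      exact this.trans (le_abs_self _)
    have h3 : dirDeriv (fun x => (D.gamma x : ℂ) • f x) x (Z j x) =
        dirDeriv (fun y => (D.gamma y : ℂ)) x (Z j x) • f x +
          (D.gamma x : ℂ) • dirDeriv f x (Z j x) := dirDeriv_bilin (smulB V) hgd' hfd _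
    have h4 : ‖dirDeriv (fun y => (D.gamma y : ℂ)) x (Z j x)‖ ≤ |b j| := by
      have h5 : dirDeriv (fun y => (D.gamma y : ℂ)) x (Z j x) =
        ((dirDeriv D.gamma x (Z j x) : ℝ) : ℂ) := dirDeriv_clm Complex.ofRealCLM hgd _
      have h6 : D.gamma x * ‖dirDeriv D.gamma x (Z j x)‖ ≤ b j * D.gamma x := by
        simpa using! hb j x hx
      rw [h5, Complex.norm_real]
      have h7 : ‖dirDeriv D.gamma x (Z j x)‖ ≤ b j := by
        rw [mul_comm] at h6
        exact le_of_mul_le_mul_right h6 hγ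
      exact h7.trans (le_abs_self _)
    have h8 : ‖dirDeriv f x (Z j x)‖ ≤ |B| * |s j| := by
      refine ((hB x hxD).2 _).trans ?_
      have h9 := hs j x hxc
      rw [Real.norm_of_nonneg (Real.sqrt_nonneg _)] at h9
      exact mul_le_mul (le_abs_self _) (h9.trans (le_abs_self _)) (Real.sqrt_nonneg _)
        (abs_nonneg _)
    have h10 := hΓ x hxc
    have h11 : ‖(D.gamma x : ℂ)‖ = D.gamma x := by
      rw [Complex.norm_real, Real.norm_of_nonneg hγ.le]
    rw [h3]
    gcongr
    refine (norm_add_le _ _).trans ?_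
    rw [norm_smul, norm_smul, h11]
    gcongr
  rw [LeviDomain.adjoint]
  refine (norm_sub_le _ _).trans (add_le_add ((norm_neg _).trans_le h1) ?_)
  rw [smul_smul, norm_smul, norm_mul, Complex.norm_real, Real.norm_of_nonneg hγ.le]
  have h12 : ‖(D.divergence X.re x : ℂ) + Complex.I * (D.divergence X.im x : ℂ)‖ ≤
      |D.divergence X.re x| + |D.divergence X.im x| := by
    refine (norm_add_le _ _).trans (le_of_eq ?_)
    rw [norm_mul, Complex.norm_I, one_mul, Complex.norm_real, Complex.norm_real,
      Real.norm_eq_abs, Real.norm_eq_abs]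
  have h13 : ‖(D.divergence X.re x : ℂ) + Complex.I * (D.divergence X.im x : ℂ)‖ * D.gamma x ≤
      d₁ + d₂ := by
    calc _ ≤ (|D.divergence X.re x| + |D.divergence X.im x|) * D.gamma x := by gcongr
      _ = D.gamma x * |D.divergence X.re x| + D.gamma x * |D.divergence X.im x| := by ring
      _ ≤ _ := add_le_add (hd₁ x hx) (hd₂ x hx)
  have h14 : 0 ≤ d₁ + d₂ := le_trans (by positivity) h13
  gcongr

end Commutator


/-! ### Convergence of operators -/

section Convergence

variable {n : ℕ} {M : Type*} [TopologicalSpace M] [ChartedSpace (Cn n) M]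
  [IsManifold 𝓘(ℂ, Cn n) ω M] [T2Space M] [SecondCountableTopology M]

theorem _root_.TendstoUniformlyOnFilter.finset_sum {ι κ α E : Type*} [SeminormedAddCommGroup E]
    {p : Filter ι} {p' : Filter α} (t : Finset κ) {u : κ → ι → α → E} {v : κ → α → E}
    (h : ∀ i ∈ t, TendstoUniformlyOnFilter (u i) (v i) p p') :
    TendstoUniformlyOnFilter (fun j x => ∑ i ∈ t, u i j x) (fun x => ∑ i ∈ t, v i x) p p' := by
  classical
  induction t using Finset.induction_on with
  | empty =>
    simp only [Finset.sum_empty]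
    exact Metric.tendstoUniformlyOnFilter_iff.2 fun ε hε => by simp [hε]
  | insert a t ha ih =>
    simp only [Finset.sum_insert ha]
    exact (h a (by simp)).add (ih fun i hi => h i (by simp [hi]))

/-- The theorem on limits of derivatives, in a chart: uniform convergence near the point of finitely
many directional derivatives, along a coordinate basis, is uniform convergence of the differentials.
-/
theorem mdifferentiableAt_of_tendsto {W : Type*} [NormedAddCommGroup W] [NormedSpace ℝ W] {z₀ : M}
    {e : ℕ → M → W} {e' : M → W} {κ : Type*} [Fintype κ] (b : OrthonormalBasis κ ℝ (Cn n))
    {Ψ : κ → ℕ → M → W} {Ψ' : κ → M → W}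
    (he : ∀ᶠ z in 𝓝 z₀, ∀ j, MDifferentiableAt 𝓘(ℝ, Cn n) 𝓘(ℝ, W) (e j) z)
    (hΨ : ∀ᶠ z in 𝓝 z₀, ∀ j i, dirDeriv (e j) z (chartDinv z₀ z (b i)) = Ψ i j z)
    (hu : ∀ i, TendstoUniformlyOnFilter (Ψ i) (Ψ' i) Filter.atTop (𝓝 z₀))
    (ht : ∀ᶠ z in 𝓝 z₀, Filter.Tendsto (fun j => e j z) Filter.atTop (𝓝 (e' z))) :
    MDifferentiableAt 𝓘(ℝ, Cn n) 𝓘(ℝ, W) e' z₀ ∧ ∀ v : Tan n z₀,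
      Filter.Tendsto (fun j => dirDeriv (e j) z₀ v) Filter.atTop (𝓝 (dirDeriv e' z₀ v)) := by
  set c := chartAt (Cn n) z₀ with hc
  have hz : z₀ ∈ c.source := mem_chart_source _ z₀
  have hy : c z₀ ∈ c.target := c.map_source hz
  have hs : Filter.Tendsto c.symm (𝓝 (c z₀)) (𝓝 z₀) := by
    have := c.symm.continuousAt (x := c z₀) hy
    rwa [ContinuousAt, c.left_inv hz] at this
  set f' : ℕ → Cn n → Cn n →L[ℝ] W := fun j y =>
    ∑ i, (innerSL ℝ (b i)).smulRight (Ψ i j (c.symm y))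
  set g' : Cn n → Cn n →L[ℝ] W := fun y => ∑ i, (innerSL ℝ (b i)).smulRight (Ψ' i (c.symm y))
  have hf' : TendstoUniformlyOnFilter f' g' Filter.atTop (𝓝 (c z₀)) := by
    refine TendstoUniformlyOnFilter.finset_sum _ fun i _ => ?_
    have h1 := ((hu i).comp c.symm).mono_right hs.le_comap
    exact (ContinuousLinearMap.smulRightL ℝ (Cn n) W (innerSL ℝ (b i))).uniformContinuous.comp_tendstoUniformlyOnFilter h1
  have hder : ∀ᶠ y in 𝓝 (c z₀), ∀ j, HasFDerivAt (fun y => e j (c.symm y)) (f' j y) y := by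
    filter_upwards [hs.eventually he, hs.eventually hΨ, c.open_target.mem_nhds hy] with y h1 h2 h3 j
    have hys : c.symm y ∈ c.source := c.map_target h3
    have h4 : MDifferentiableAt 𝓘(ℝ, Cn n) 𝓘(ℝ, W) (e j ∘ c.symm) y :=
      (h1 j).comp y ((chart_mdiff z₀).mdifferentiableAt_symm h3)
    have h5 := h4.differentiableAt.hasFDerivAt
    convert! h5 using 1
    ext w
    have h6 : ∀ i, fderiv ℝ (e j ∘ c.symm) y (b i) = Ψ i j (c.symm y) := fun i => by
      rw [← h2 j i, dirDeriv_chartDinv hys (h1 j), ← hc, c.right_inv h3]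
    conv_rhs => rw [← b.sum_repr' w, map_sum]
    simp only [f', _root_.sum_apply, ContinuousLinearMap.smulRight_apply,
      innerSL_apply_apply, map_smul, h6]
  have key := hasFDerivAt_of_tendstoUniformlyOnFilter (𝕜 := ℝ) (l := Filter.atTop)
    (f := fun j y => e j (c.symm y)) (g := fun y => e' (c.symm y)) hf'
    ((Filter.Eventually.prod_inr hder Filter.atTop).mono fun p hp => hp p.1)
    (hs.eventually ht)
  have hmd : MDifferentiableAt 𝓘(ℝ, Cn n) 𝓘(ℝ, W) e' z₀ := by
    have h1 := key.differentiableAt.mdifferentiableAt.comp z₀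
      ((chart_mdiff z₀).mdifferentiableAt hz)
    refine h1.congr_of_eventuallyEq ?_
    filter_upwards [c.open_source.mem_nhds hz] with y hy
    simp only [Function.comp_apply]
    rw [c.left_inv hy]
  refine ⟨hmd, fun v => ?_⟩
  have h1 : ∀ j, dirDeriv (e j) z₀ v = f' j (c z₀) (chartD z₀ z₀ v) := fun j => by
    rw [dirDeriv_eq_fderiv hz (he.self_of_nhds j)]
    exact congrArg (fun L : Cn n →L[ℝ] W => L (chartD z₀ z₀ v)) (hder.self_of_nhds j).fderiv
  have h2 : dirDeriv e' z₀ v = g' (c z₀) (chartD z₀ z₀ v) := by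
    rw [dirDeriv_eq_fderiv hz hmd]
    exact congrArg (fun L : Cn n →L[ℝ] W => L (chartD z₀ z₀ v)) key.fderiv
  simp only [h1, h2]
  have h3 : Filter.Tendsto (fun j => f' j (c z₀)) Filter.atTop (𝓝 (g' (c z₀))) :=
    hf'.tendsto_at (by rw [Filter.principal_singleton]; exact pure_le_nhds _)
  exact ((ContinuousLinearMap.apply ℝ W (chartD z₀ z₀ v)).continuous.tendsto _).comp h3

variable [MeasurableSpace M] [BorelSpace M] {D : LeviDomain n M} {ρ : M → M → ℝ}
  {V W : Type*} [NormedAddCommGroup V] [NormedSpace ℂ V] [NormedAddCommGroup W] [NormedSpace ℂ W]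

theorem LeviDomain.restrict_carrier_eq (hn : n ≠ 0) (D : LeviDomain n M) (z : M) :
    D.vol.restrict D.carrier = D.vol.restrict (D.reg \ {z}) := by
  refine Measure.restrict_congr_set ?_
  rw [ae_eq_set]
  refine ⟨measure_mono_null (t := (D.carrier \ D.reg) ∪ {z}) (fun x hx => ?_)
    (measure_union_null (D.vol_carrier_diff_reg hn) (D.vol_singleton hn z)), ?_⟩
  · by_cases h : x ∈ D.reg
    · exact Or.inr (by_contra fun h' => hx.2 ⟨h, h'⟩)
    · exact Or.inl ⟨hx.1, h⟩
  · rw [sdiff_eq_empty.2 (sdiff_subset.trans D.reg_subset_carrier), measure_empty]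

theorem LeviDomain.ae_carrier (hn : n ≠ 0) (D : LeviDomain n M) (z : M) :
    ∀ᵐ ζ ∂D.vol.restrict D.carrier, ζ ∈ D.reg ∧ ζ ≠ z := by
  rw [D.restrict_carrier_eq hn z]
  exact ae_restrict_mem (D.isOpen_reg.measurableSet.diff (measurableSet_singleton z))

theorem LeviDomain.IsDistanceFunction.integrableOn_kernel (hρ : D.IsDistanceFunction ρ)
    (hn : n ≠ 0) {z : M} {L : M → V →L[ℂ] W} (hL : ContinuousOn L (D.reg \ {z}))
    {C : ℝ} (hb : ∀ ζ ∈ D.reg, ζ ≠ z → ‖L ζ‖ ≤ C * wt n (ρ ζ z)) {g : M → V}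
    (hg : ContinuousOn g D.reg) {B : ℝ} (hB : ∀ x ∈ D.reg, ‖g x‖ ≤ B) :
    IntegrableOn (fun ζ => L ζ (g ζ)) D.carrier D.vol := by
  have hw : IntegrableOn (fun ζ => wt n (ρ ζ z)) D.carrier D.vol := by
    have hm : Measurable fun ζ => wt n (ρ ζ z) := (wt_measurable n).comp
      (hρ.continuous.comp (continuous_id.prodMk continuous_const)).measurable
    refine ⟨hm.aestronglyMeasurable, ?_⟩
    rw [hasFiniteIntegral_iff_ofReal (Filter.Eventually.of_forall fun ζ =>
      wt_nonneg (hρ.nonneg ζ z))]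
    exact hρ.lintegral_wt_lt_top hn z
  have hO : IsOpen (D.reg \ {z}) := D.isOpen_reg.sdiff isClosed_singleton
  refine Integrable.mono' (hw.const_mul (C * B)) ?_ ?_
  · rw [D.restrict_carrier_eq hn z]
    exact (continuousOn_eval hL (hg.mono sdiff_subset)).aestronglyMeasurable hO.measurableSet
  · filter_upwards [D.ae_carrier hn z] with ζ hζ
    have h1 := hb ζ hζ.1 hζ.2
    calc _ ≤ ‖L ζ‖ * ‖g ζ‖ := ContinuousLinearMap.le_opNorm _ _
      _ ≤ (C * wt n (ρ ζ z)) * B := mul_le_mul h1 (hB ζ hζ.1) (norm_nonneg _)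
          ((norm_nonneg _).trans h1)
      _ = _ := by ring

/-- The difference of the kernels is dominated by the weight and vanishes outside the bad set `{j u
< 2}`, over which the weight has a uniformly small integral. -/
theorem LeviDomain.IsDistanceFunction.tendstoUniformlyOnFilter_integral
    (hρ : D.IsDistanceFunction ρ) (hn : n ≠ 0) {K : ℕ → M → M → V →L[ℂ] W} {L : M → M → V →L[ℂ] W}
    {C : ℝ} (h : ∀ j, ∀ p ∈ D.offDiag, ‖K j p.1 p.2 - L p.1 p.2‖ ≤ C * wt n (ρ p.1 p.2) ∧
      (2 ≤ j * D.cutArg ρ p → K j p.1 p.2 - L p.1 p.2 = 0)) {g : M → V} {B : ℝ}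
    (hB : ∀ x ∈ D.reg, ‖g x‖ ≤ B)
    (hK : ∀ j, ∀ z ∈ D.reg, IntegrableOn (fun ζ => K j ζ z (g ζ)) D.carrier D.vol)
    (hL : ∀ z ∈ D.reg, IntegrableOn (fun ζ => L ζ z (g ζ)) D.carrier D.vol) {q : M}
    (hq : q ∈ D.reg) :
    TendstoUniformlyOnFilter (fun j z => ∫ ζ in D.carrier, K j ζ z (g ζ) ∂D.vol)
      (fun z => ∫ ζ in D.carrier, L ζ z (g ζ) ∂D.vol) Filter.atTop (𝓝 q) := by
  rw [Metric.tendstoUniformlyOnFilter_iff]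
  intro ε hε
  -- The added one keeps `c` positive, so that `ε / (2c)` is defined even if the kernels or `g`
  -- vanish.
  set c := |C| * |B| + 1 with hc
  have hc0 : 0 < c := by positivity
  obtain ⟨N, hN, hbad⟩ := hρ.eventually_lintegral_bad_le hn q
    (η := ENNReal.ofReal (ε / (2 * c))) (ENNReal.ofReal_pos.2 (by positivity))
  filter_upwards [hbad.prod_mk (Filter.inter_mem hN (D.isOpen_reg.mem_nhds hq))] with p hp
  obtain ⟨hp1, hp2, hp3⟩ := hp
  set z := p.2
  set j := p.1
  have hmeas : MeasurableSet {ζ | (j : ℝ) * D.cutArg ρ (ζ, z) < 2} :=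
    (isOpen_lt (continuous_const.mul ((D.cutArg_smooth hρ).continuous.comp
      (continuous_id.prodMk continuous_const))) continuous_const).measurableSet
  rw [dist_eq_norm, norm_sub_rev, ← integral_sub (hK j z hp3) (hL z hp3)]
  have h1 : ‖∫ ζ in D.carrier, (K j ζ z (g ζ) - L ζ z (g ζ)) ∂D.vol‖ₑ ≤
      ENNReal.ofReal (ε / 2) := by
    refine (enorm_integral_le_lintegral_enorm _).trans ?_
    calc _ ≤ ∫⁻ ζ in D.carrier, {ζ | (j : ℝ) * D.cutArg ρ (ζ, z) < 2}.indicator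
          (fun ζ => ENNReal.ofReal c * ENNReal.ofReal (wt n (ρ ζ z))) ζ ∂D.vol := by
          refine lintegral_mono_ae ?_
          filter_upwards [D.ae_carrier hn z] with ζ hζ
          have hoff : (ζ, z) ∈ D.offDiag := ⟨⟨hζ.1, hp3⟩, hζ.2⟩
          obtain ⟨k1, k2⟩ := h j (ζ, z) hoff
          by_cases hb : (j : ℝ) * D.cutArg ρ (ζ, z) < 2
          · rw [indicator_of_mem (by exact hb), ← ofReal_norm,
              ← ENNReal.ofReal_mul hc0.le]
            refine ENNReal.ofReal_le_ofReal ?_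
            have hw := wt_nonneg (n := n) (hρ.nonneg ζ z)
            rw [← _root_.sub_apply]
            calc _ ≤ ‖K j ζ z - L ζ z‖ * ‖g ζ‖ := ContinuousLinearMap.le_opNorm _ _
              _ ≤ (|C| * wt n (ρ ζ z)) * |B| := by
                  gcongr
                  · exact k1.trans (mul_le_mul_of_nonneg_right (le_abs_self _) hw)
                  · exact (hB ζ hζ.1).trans (le_abs_self _)
              _ ≤ _ := by rw [hc]; nlinarith
          · have := k2 (not_lt.1 hb)
            rw [← _root_.sub_apply]
            simp only at this
            rw [this]
            simp
      _ = ENNReal.ofReal c * ∫⁻ ζ in D.carrier ∩ {ζ | (j : ℝ) * D.cutArg ρ (ζ, z) < 2},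
          ENNReal.ofReal (wt n (ρ ζ z)) ∂D.vol := by
          rw [lintegral_indicator hmeas, Measure.restrict_restrict hmeas, inter_comm,
            lintegral_const_mul _ (hρ.measurable_wt z)]
      _ ≤ ENNReal.ofReal c * ENNReal.ofReal (ε / (2 * c)) := by gcongr; exact hp1 z hp2
      _ = ENNReal.ofReal (ε / 2) := by
          rw [← ENNReal.ofReal_mul hc0.le]
          congr 1
          field_simp
  rw [← ofReal_norm, ENNReal.ofReal_le_ofReal_iff (by positivity)] at h1
  linarith

end Convergence


/-! ### The commutator identity for isotropic operators -/

section Isotropic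

variable {n : ℕ} {M : Type*} [TopologicalSpace M] [ChartedSpace (Cn n) M]
  [IsManifold 𝓘(ℂ, Cn n) ω M] [T2Space M] [SecondCountableTopology M]
  [MeasurableSpace M] [BorelSpace M] {D : LeviDomain n M} {ρ : M → M → ℝ} {N : ℕ}
  {V W : Type*} [NormedAddCommGroup V] [NormedSpace ℂ V] [NormedAddCommGroup W] [NormedSpace ℂ W]

theorem LeviDomain.IsDistanceFunction.quotient_contMDiffOn (hρ : D.IsDistanceFunction ρ)
    {F : Type*} [NormedAddCommGroup F] [NormedSpace ℝ F] {m : ℕ} {A : M → M → F}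
    (hA : D.IsE ρ m 0 A) (k : ℕ) :
    ContMDiffOn (𝓘(ℝ, Cn n).prod 𝓘(ℝ, Cn n)) 𝓘(ℝ, F) ∞
      (fun p : M × M => (ρ p.1 p.2 ^ (2 * k))⁻¹ • A p.1 p.2) D.offDiag := by
  have h1 : ContMDiffOn (𝓘(ℝ, Cn n).prod 𝓘(ℝ, Cn n)) 𝓘(ℝ, ℝ) ∞
      (fun p : M × M => ((ρ p.1 p.2 ^ 2) ^ k)⁻¹) D.offDiag :=
    ((hρ.smooth.pow k).contMDiffOn).inv₀ fun p hp =>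
      pow_ne_zero _ (pow_ne_zero _ (hρ.pos _ _ hp.2).ne')
  simp only [pow_mul]
  exact h1.smul (hA.1.mono D.offDiag_subset)

theorem LeviDomain.IsIsotropicKernel.opConverges {K : M → M → V →L[ℂ] W}
    (hK : D.IsIsotropicKernel ρ 1 K) (hρ : D.IsDistanceFunction ρ) (hn : n ≠ 0) {g : M → V}
    (hg : ContinuousOn g D.reg) {B : ℝ} (hB : ∀ x ∈ D.reg, ‖g x‖ ≤ B) {z : M} (hz : z ∈ D.reg) :
    D.OpConverges K g z := by
  obtain ⟨C, -, hC⟩ := hρ.exists_kernel_le hK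
  obtain ⟨m, k, A, -, hA, hKA⟩ := hK
  refine hρ.integrableOn_kernel hn (L := fun ζ => K ζ z) (C := C) ?_
    (fun ζ hζ hne => hC ζ hζ z hz hne) hg hB
  have h1 : ContinuousOn (fun ζ => (ρ ζ z ^ (2 * k))⁻¹ • A ζ z) (D.reg \ {z}) :=
    (hρ.quotient_contMDiffOn hA k).continuousOn.comp (f := fun ζ => (ζ, z))
      (continuous_id.prodMk continuous_const).continuousOn fun ζ hζ => ⟨⟨hζ.1, hz⟩, hζ.2⟩
  exact h1.congr fun ζ hζ => hKA ζ hζ.1 z hz hζ.2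

theorem LeviDomain.op_congr (hn : n ≠ 0) (D : LeviDomain n M) {K L : M → M → V →L[ℂ] W} {z : M}
    (h : ∀ ζ ∈ D.reg, ζ ≠ z → K ζ z = L ζ z) (f : M → V) : D.op K f z = D.op L f z := by
  refine integral_congr_ae ?_
  filter_upwards [D.ae_carrier hn z] with ζ hζ
  rw [h ζ hζ.1 hζ.2]

/-- Near a point of `D'`, division by `γ` is smooth. The field `γ⁻¹ ∂_w`, cut off near the point,
turns convergence of `γ Y` applied to the cut operators into convergence of an ordinary partial
derivative. -/
theorem LeviDomain.exists_scaled_field (D : LeviDomain n M) {z₀ : M} (hz : z₀ ∈ D.reg)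
    (w : Cn n) : ∃ Y : ComplexField n M, D.IsAdmissible Y ∧ ∀ᶠ z in 𝓝 z₀, ∀ u : M → W,
      (D.gamma z : ℂ) • Y.apply u z = dirDeriv u z (chartDinv z₀ z w) := by
  set O := D.reg ∩ (chartAt (Cn n) z₀).source
  have hO : IsOpen O := D.isOpen_reg.inter (chartAt (Cn n) z₀).open_source
  have hzO : z₀ ∈ O := ⟨hz, mem_chart_source _ _⟩
  obtain ⟨b, hb, hbc, hbO, hb1, -⟩ := exists_cutoff (n := n) (isCompact_singleton (x := z₀)) hO
    (singleton_subset_iff.2 hzO)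
  have h1 : FieldOn (I := 𝓘(ℝ, Cn n)) ∞
      (fun x => (D.gamma x)⁻¹ • (chartDinv z₀ x w : Tan n x)) O :=
    fieldOn_smul_section (by simp) (fieldOn_chartDinv inter_subset_right contMDiffOn_const (by simp))
      (D.xiOn_gamma_inv.1.mono inter_subset_left)
  set Z : SmoothField n M := ⟨_, contMDiffOn_univ.1 (fieldOn_smul_of_tsupport hO h1 hb hbO)⟩
  have hZ : ∀ x, Z x = b x • ((D.gamma x)⁻¹ • (chartDinv z₀ x w : Tan n x)) := fun x => rfl
  refine ⟨_, D.isAdmissible_of_compact_support Z hbc.isCompact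
    (hbO.trans inter_subset_left) fun x hx => ?_, ?_⟩
  · have : b x = 0 := image_eq_zero_of_notMem_tsupport hx
    rw [hZ, this, zero_smul]
  · rw [nhdsSet_singleton] at hb1
    filter_upwards [hb1, D.isOpen_reg.mem_nhds hz] with z hz1 hzr u
    have hγ : (D.gamma z : ℝ) ≠ 0 := hzr.2
    have h2 : (Z z : Tan n z) = (D.gamma z)⁻¹ • (chartDinv z₀ z w : Tan n z) := by
      rw [hZ, hz1, one_smul]
    have h3 : dirDeriv u z (Z z) = (D.gamma z)⁻¹ • dirDeriv u z (chartDinv z₀ z w) := by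
      rw [h2]
      exact map_smul (mfderiv 𝓘(ℝ, Cn n) 𝓘(ℝ, W) u z) _ _
    have h4 : dirDeriv u z (0 : Tan n z) = 0 := map_zero (mfderiv 𝓘(ℝ, Cn n) 𝓘(ℝ, W) u z)
    rw [ComplexField.apply, h3, h4, smul_zero, add_zero, Complex.coe_smul, smul_smul,
      mul_inv_cancel₀ hγ, one_smul]

/-- The kernel of `γ^ζ X^ζ + γ^z X^z` applied to `A / ρ^{2k}`. -/
def LeviDomain.commKernel (D : LeviDomain n M) (ρ : M → M → ℝ) (φ : Fin N → M → ℝ)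
    (Z : Fin N → SmoothField n M) (X : ComplexField n M) (k : ℕ) (A : M → M → V →L[ℂ] W)
    (ζ z : M) : V →L[ℂ] W :=
  (ρ ζ z ^ (2 * (k + 1)))⁻¹ • tangKernel ρ (D.tang X φ) Z k A ζ z

variable {φ : Fin N → M → ℝ} {Z : Fin N → SmoothField n M} {X : ComplexField n M} {m k : ℕ}
  {A : M → M → V →L[ℂ] W} {f : M → V}

theorem LeviDomain.IsAdmissible.isIsotropicKernel_comm (hX : D.IsAdmissible X)
    (hρ : D.IsDistanceFunction ρ) (hn : n ≠ 0) (hZ : IsFrameOn (closure D.carrier) φ Z)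
    (hmk : (1 : ℤ) - 2 * n ≤ (m : ℤ) - 2 * k) (hA : D.IsE ρ m 0 A) :
    D.IsIsotropicKernel ρ 1 (D.commKernel ρ φ Z X k A) :=
  ⟨m + 2, k + 1, _, by push_cast; linarith,
    hρ.isE_tangKernel hn hA Z (hX.xiOn_tang hZ.smooth) k, fun _ _ _ _ _ => rfl⟩

theorem LeviDomain.IsBoundedC1.contMDiffOn_reg (hf : D.IsBoundedC1 f) :
    ContMDiffOn 𝓘(ℝ, Cn n) 𝓘(ℝ, V) 1 f D.reg := hf.1.mono D.reg_subset_carrier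

theorem LeviDomain.IsAdmissible.continuousOn_adjoint (hX : D.IsAdmissible X)
    (hf : D.IsBoundedC1 f) :
    ContinuousOn (D.adjoint X fun x => (D.gamma x : ℂ) • f x) D.reg :=
  D.continuousOn_adjoint D.isOpen_reg (D.gamma_smul_contMDiffOn hf.contMDiffOn_reg)
    (hX.re_smooth.mono D.reg_subset_carrier) (hX.im_smooth.mono D.reg_subset_carrier)

theorem LeviDomain.tendstoUniformly_cut (hρ : D.IsDistanceFunction ρ) (hn : n ≠ 0)
    (hmk : (1 : ℤ) - 2 * n ≤ (m : ℤ) - 2 * k) (hA : D.IsE ρ m 0 A) {g : M → V}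
    (hg : ContinuousOn g D.reg) {B : ℝ} (hB : ∀ x ∈ D.reg, ‖g x‖ ≤ B) {q : M} (hq : q ∈ D.reg) :
    TendstoUniformlyOnFilter
      (fun j => D.op (D.cut ρ (fun ζ z => (ρ ζ z ^ (2 * k))⁻¹ • A ζ z) j) g)
      (D.op (fun ζ z => (ρ ζ z ^ (2 * k))⁻¹ • A ζ z) g) Filter.atTop (𝓝 q) := by
  have hH : D.IsIsotropicKernel ρ 1 (fun ζ z => (ρ ζ z ^ (2 * k))⁻¹ • A ζ z) :=
    ⟨m, k, A, hmk, hA, fun _ _ _ _ _ => rfl⟩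
  obtain ⟨C, -, hC⟩ := hρ.exists_kernel_le hH
  refine hρ.tendstoUniformlyOnFilter_integral hn (C := C) (fun j p hp => ?_) hB (fun j z hz => ?_)
    (fun z hz => hH.opConverges hρ hn hg hB hz) hq
  · obtain ⟨h1, h2⟩ := D.norm_cut_sub_le (ρ := ρ) (fun ζ z => (ρ ζ z ^ (2 * k))⁻¹ • A ζ z) j
      hp.1.1 hp.1.2
    exact ⟨h1.trans (hC _ hp.1.1 _ hp.1.2 hp.2), h2⟩
  · obtain ⟨Q, hQ, hQr, hQ0⟩ := D.exists_compact_cut_eq_zero hρ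
      (fun ζ z => (ρ ζ z ^ (2 * k))⁻¹ • A ζ z) j
    have hsm := D.cut_contMDiffOn hρ (H := fun ζ z => (ρ ζ z ^ (2 * k))⁻¹ • A ζ z)
      (hρ.quotient_contMDiffOn hA k) j
    exact (D.integrable_of_compact hQ hQr (continuousOn_eval (hsm.continuousOn.comp
      (f := fun ζ => (ζ, z)) (continuous_id.prodMk continuous_const).continuousOn
      fun ζ hζ => mk_mem_prod hζ hz) hg) fun ζ hζ => by simp [hQ0 ζ hζ]).integrableOn

theorem LeviDomain.op_cut_eq (hρ : D.IsDistanceFunction ρ) (H : M → M → V →L[ℂ] W) (j : ℕ)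
    (g : M → V) : D.op (D.cut ρ H j) g = fun z => ∫ ζ, D.cut ρ H j ζ z (g ζ) ∂D.vol := by
  obtain ⟨Q, hQ, hQr, hQ0⟩ := D.exists_compact_cut_eq_zero hρ H j
  ext z
  refine setIntegral_eq_integral_of_forall_compl_eq_zero fun ζ hζ => ?_
  rw [hQ0 ζ fun h => hζ (D.reg_subset_carrier (hQr h))]
  simp

/-- For each `j` the commutator identity expresses the left side by two integrals with cut kernels.
Both converge uniformly near `q`: the first because `T` of the cut kernel differs from `T K` only on
the bad set, the second because `X̃(γ f)` is bounded. -/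
theorem LeviDomain.IsAdmissible.tendstoUniformly_apply_cut (hX : D.IsAdmissible X)
    (hρ : D.IsDistanceFunction ρ) (hn : n ≠ 0) (hZ : IsFrameOn (closure D.carrier) φ Z)
    (hmk : (1 : ℤ) - 2 * n ≤ (m : ℤ) - 2 * k) (hA : D.IsE ρ m 0 A) (hf : D.IsBoundedC1 f) {q : M}
    (hq : q ∈ D.reg) :
    TendstoUniformlyOnFilter
      (fun j z => (D.gamma z : ℂ) •
        X.apply (D.op (D.cut ρ (fun ζ z => (ρ ζ z ^ (2 * k))⁻¹ • A ζ z) j) f) z)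
      (fun z => D.op (D.commKernel ρ φ Z X k A) f z -
        D.op (fun ζ z => (ρ ζ z ^ (2 * k))⁻¹ • A ζ z)
          (D.adjoint X fun x => (D.gamma x : ℂ) • f x) z) Filter.atTop (𝓝 q) := by
  set H : M → M → V →L[ℂ] W := fun ζ z => (ρ ζ z ^ (2 * k))⁻¹ • A ζ z with hHdef
  have hHs := hρ.quotient_contMDiffOn hA k
  have hH : D.IsIsotropicKernel ρ 1 H := ⟨m, k, A, hmk, hA, fun _ _ _ _ _ => rfl⟩
  have hR := hX.isIsotropicKernel_comm hρ hn hZ hmk hA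
  obtain ⟨B, hB⟩ := hf.2
  have hB' : ∀ x ∈ D.reg, ‖f x‖ ≤ B := fun x hx => (hB x (D.reg_subset_carrier hx)).1
  obtain ⟨B₂, hB₂⟩ := hX.exists_adjoint_le hf
  obtain ⟨C₁, -, h1⟩ := hρ.exists_kernel_le hH
  obtain ⟨C₂, -, h2⟩ := hρ.exists_kernel_le hR
  obtain ⟨C, hC, h3⟩ := hX.exists_tangDeriv_cut_sub_le hρ hZ (H := H) hHs
  have hreg : ∀ j, ∀ z ∈ D.reg, Integrable (fun ζ =>
        tangDeriv (D.tang X φ) Z (fun p => D.cut ρ H j p.1 p.2) (ζ, z) (f ζ)) D.vol ∧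
      (D.gamma z : ℂ) • X.apply (D.op (D.cut ρ H j) f) z =
        ∫ ζ in D.carrier, tangDeriv (D.tang X φ) Z (fun p => D.cut ρ H j p.1 p.2) (ζ, z) (f ζ)
          ∂D.vol - D.op (D.cut ρ H j) (D.adjoint X fun x => (D.gamma x : ℂ) • f x) z := by
    intro j z hz
    obtain ⟨Q, hQ, hQr, hQ0⟩ := D.exists_compact_cut_eq_zero hρ H j
    obtain ⟨a1, -, a3⟩ := D.gamma_apply_regular hQ hQr (D.cut_contMDiffOn hρ (H := H) hHs j) hQ0
      hf.contMDiffOn_reg (hX.re_smooth.mono D.reg_subset_carrier)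
      (hX.im_smooth.mono D.reg_subset_carrier) hZ hz
    refine ⟨a1, ?_⟩
    rw [D.op_cut_eq hρ, D.op_cut_eq hρ, a3]
    congr 1
    refine (setIntegral_eq_integral_of_forall_compl_eq_zero fun ζ hζ => ?_).symm
    rw [tangDeriv_eq_zero_of_notMem hQ.isClosed hQ0 fun h => hζ (D.reg_subset_carrier (hQr h))]
    simp
  have hlim := (hρ.tendstoUniformlyOnFilter_integral hn
    (K := fun j ζ z => tangDeriv (D.tang X φ) Z (fun p => D.cut ρ H j p.1 p.2) (ζ, z))
    (L := D.commKernel ρ φ Z X k A) (C := C * C₁ + C₂) (fun j p hp => by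
      have e := hρ.tangDeriv_quotient hA (D.tang X φ) Z k hp
      obtain ⟨c1, c2⟩ := h3 j p hp
      rw [e] at c1 c2
      refine ⟨c1.trans ?_, c2⟩
      rw [add_mul, mul_assoc]
      exact add_le_add (mul_le_mul_of_nonneg_left (h1 _ hp.1.1 _ hp.1.2 hp.2) hC)
        (h2 _ hp.1.1 _ hp.1.2 hp.2)) hB' (fun j z hz => (hreg j z hz).1.integrableOn)
    (fun z hz => hR.opConverges hρ hn hf.contMDiffOn_reg.continuousOn hB' hz) hq).sub
    (D.tendstoUniformly_cut hρ hn hmk hA (hX.continuousOn_adjoint hf) hB₂ hq)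
  refine hlim.congr ?_
  filter_upwards [Filter.Eventually.prod_inr (D.isOpen_reg.mem_nhds hq) Filter.atTop] with p hp
  exact ((hreg p.1 p.2 hp).2).symm

/-- Differentiation of an isotropic operator in an admissible direction. -/
theorem LeviDomain.IsAdmissible.gamma_apply_op (hX : D.IsAdmissible X)
    (hρ : D.IsDistanceFunction ρ) (hn : n ≠ 0) (hZ : IsFrameOn (closure D.carrier) φ Z)
    (hmk : (1 : ℤ) - 2 * n ≤ (m : ℤ) - 2 * k) (hA : D.IsE ρ m 0 A) (hf : D.IsBoundedC1 f) {q : M}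
    (hq : q ∈ D.reg) :
    MDifferentiableAt 𝓘(ℝ, Cn n) 𝓘(ℝ, W)
      (D.op (fun ζ z => (ρ ζ z ^ (2 * k))⁻¹ • A ζ z) f) q ∧
    (D.gamma q : ℂ) • X.apply (D.op (fun ζ z => (ρ ζ z ^ (2 * k))⁻¹ • A ζ z) f) q =
      D.op (D.commKernel ρ φ Z X k A) f q -
        D.op (fun ζ z => (ρ ζ z ^ (2 * k))⁻¹ • A ζ z)
          (D.adjoint X fun x => (D.gamma x : ℂ) • f x) q := by
  set H : M → M → V →L[ℂ] W := fun ζ z => (ρ ζ z ^ (2 * k))⁻¹ • A ζ z with hHdef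
  set b := stdOrthonormalBasis ℝ (Cn n)
  obtain ⟨B, hB⟩ := hf.2
  have hB' : ∀ x ∈ D.reg, ‖f x‖ ≤ B := fun x hx => (hB x (D.reg_subset_carrier hx)).1
  -- Differentiability in every direction is needed, not only along `X`; the auxiliary fields `Y i`
  -- provide it. The identity for `X` then follows by comparing two limits of the same sequence.
  choose Y hY hYe using fun i => D.exists_scaled_field (W := W) hq (b i)
  have hmd : ∀ z ∈ D.reg, ∀ j, MDifferentiableAt 𝓘(ℝ, Cn n) 𝓘(ℝ, W) (D.op (D.cut ρ H j) f) z := by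
    intro z hz j
    obtain ⟨Q, hQ, hQr, hQ0⟩ := D.exists_compact_cut_eq_zero hρ H j
    rw [D.op_cut_eq hρ]
    exact (D.mdifferentiableAt_regular hQ hQr
      (D.cut_contMDiffOn hρ (H := H) (hρ.quotient_contMDiffOn hA k) j) hQ0
      hf.contMDiffOn_reg.continuousOn hz).1
  have hu := fun i => (hY i).tendstoUniformly_apply_cut hρ hn hZ hmk hA hf hq
  obtain ⟨h1, h2⟩ := mdifferentiableAt_of_tendsto (z₀ := q) (e := fun j => D.op (D.cut ρ H j) f)
    (e' := D.op H f) b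
    (Ψ := fun i j z => (D.gamma z : ℂ) • (Y i).apply (D.op (D.cut ρ H j) f) z)
    (Ψ' := fun i z => D.op (D.commKernel ρ φ Z (Y i) k A) f z -
      D.op H (D.adjoint (Y i) fun x => (D.gamma x : ℂ) • f x) z)
    (by filter_upwards [D.isOpen_reg.mem_nhds hq] with z hz using hmd z hz)
    (by filter_upwards [Filter.eventually_all.2 hYe] with z hz j i using (hz i _).symm)
    hu
    (by
      filter_upwards [D.isOpen_reg.mem_nhds hq] with z hz
      exact (D.tendstoUniformly_cut hρ hn hmk hA hf.contMDiffOn_reg.continuousOn hB'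
        hz).tendsto_at (by rw [Filter.principal_singleton]; exact pure_le_nhds _))
  refine ⟨h1, tendsto_nhds_unique ?_ ((hX.tendstoUniformly_apply_cut hρ hn hZ hmk hA hf
    hq).tendsto_at (by rw [Filter.principal_singleton]; exact pure_le_nhds _))⟩
  exact ((h2 _).add ((h2 _).const_smul Complex.I)).const_smul _

/-- Tangent spaces are trivial, so `γ = 0` everywhere. This disposes of the case in which the
diagonal is not nowhere dense and the exponent `2n - 1` is truncated. -/
theorem LeviDomain.reg_eq_empty (hn : n = 0) (D : LeviDomain n M) : D.reg = ∅ := by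
  subst hn
  refine eq_empty_of_forall_notMem fun x hx => ?_
  have h := D.gammaSq_pos hx
  have h0 : D.grad D.r x = (0 : Tan 0 x) :=
    Subsingleton.elim (α := EuclideanSpace ℂ (Fin 0)) _ _
  have h1 : dirDeriv D.r x (0 : Tan 0 x) = 0 := map_zero (mfderiv 𝓘(ℝ, Cn 0) 𝓘(ℝ, ℝ) D.r x)
  rw [LeviDomain.gammaSq, h0, h1] at h
  simp at h

end Isotropic

end HL

end

/-! ### The theorem for an arbitrary isotropic kernel -/

theorem mainTheorem7 (n : ℕ) (M : Type*) [TopologicalSpace M] [T2Space M]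
    [SecondCountableTopology M] [ChartedSpace (HL.Cn n) M] [IsManifold 𝓘(ℂ, HL.Cn n) ω M]
    [MeasurableSpace M] [BorelSpace M]
    (D : HL.LeviDomain n M) (ρ : M → M → ℝ) (hρ : D.IsDistanceFunction ρ)
    (V W : Type*) [NormedAddCommGroup V] [NormedSpace ℂ V] [FiniteDimensional ℂ V]
    [NormedAddCommGroup W] [NormedSpace ℂ W] [FiniteDimensional ℂ W]
    (X : HL.ComplexField n M) (hX : D.IsSmoothTangential X)
    (K : M → M → V →L[ℂ] W) (hK : D.IsIsotropicKernel ρ 1 K) :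
    ∃ (l : ℕ) (K₀ : M → M → V →L[ℂ] W) (K' : Fin l → M → M → V →L[ℂ] W),
      D.IsIsotropicKernel ρ 1 K₀ ∧ (∀ ν, D.IsIsotropicKernel ρ 1 (K' ν)) ∧
      ∀ f : M → V, D.IsBoundedC1 f → ∀ z ∈ D.reg,
        D.OpConverges K f z ∧
        D.OpConverges K (D.adjoint X fun ζ => (D.gamma ζ : ℂ) • f ζ) z ∧
        D.OpConverges K₀ f z ∧ (∀ ν, D.OpConverges (K' ν) f z) ∧
        MDifferentiableAt 𝓘(ℝ, HL.Cn n) 𝓘(ℝ, W) (D.op K f) z ∧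
        (D.gamma z : ℂ) • X.apply (D.op K f) z =
          -D.op K (D.adjoint X fun ζ => (D.gamma ζ : ℂ) • f ζ) z + D.op K₀ f z +
            ∑ ν, D.op (K' ν) f z := by
  rcases eq_or_ne n 0 with hn | hn
  · refine ⟨0, K, fun _ => K, hK, fun ν => ν.elim0, fun f _ z hz => ?_⟩
    rw [D.reg_eq_empty hn] at hz
    exact hz.elim
  obtain ⟨m, k, A, hmk, hA, hKA⟩ := id hK
  have hmk' : (1 : ℤ) - 2 * n ≤ (m : ℤ) - 2 * k := by exact_mod_cast hmk
  obtain ⟨N, φ, Z, hZ⟩ := HL.exists_frame (n := n) D.isCompact_closure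
  have hXa := hX.isAdmissible
  have hR := hXa.isIsotropicKernel_comm hρ hn hZ hmk' hA
  -- The single commutator kernel accounts for all remainder terms, so the additional family is
  -- empty. The frame was fixed beforehand, which makes this kernel independent of `f` and `z`.
  refine ⟨0, D.commKernel ρ φ Z X k A, fun _ => K, hR, fun ν => ν.elim0, fun f hf z hz => ?_⟩
  obtain ⟨B, hB⟩ := hf.2
  have hB' : ∀ x ∈ D.reg, ‖f x‖ ≤ B := fun x hx => (hB x (D.reg_subset_carrier hx)).1
  obtain ⟨B₂, hB₂⟩ := hXa.exists_adjoint_le hf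
  have hfc := hf.contMDiffOn_reg.continuousOn
  have hop : ∀ w ∈ D.reg, ∀ g : M → V, D.op K g w =
      D.op (fun ζ z => (ρ ζ z ^ (2 * k))⁻¹ • A ζ z) g w := fun w hw g =>
    D.op_congr hn (fun ζ hζ hne => hKA ζ hζ w hw hne) g
  -- The kernel `K` is prescribed only off the diagonal and on `D'`. The diagonal and `D ∖ D'` are
  -- negligible for the integral, and `D'` is open, so the two operators agree near `z` and have the
  -- same derivatives there.
  have hev : D.op K f =ᶠ[𝓝 z] D.op (fun ζ z => (ρ ζ z ^ (2 * k))⁻¹ • A ζ z) f := by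
    filter_upwards [D.isOpen_reg.mem_nhds hz] with w hw using hop w hw f
  obtain ⟨h1, h2⟩ := hXa.gamma_apply_op hρ hn hZ hmk' hA hf hz
  refine ⟨hK.opConverges hρ hn hfc hB' hz, hK.opConverges hρ hn (hXa.continuousOn_adjoint hf) hB₂ hz,
    hR.opConverges hρ hn hfc hB' hz, fun ν => ν.elim0, h1.congr_of_eventuallyEq hev, ?_⟩
  have h3 : X.apply (D.op K f) z =
      X.apply (D.op (fun ζ z => (ρ ζ z ^ (2 * k))⁻¹ • A ζ z) f) z := by
    simp only [HL.ComplexField.apply, HL.dirDeriv, hev.mfderiv_eq]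
    rfl
  rw [h3, h2, hop z hz, Finset.univ_eq_empty, Finset.sum_empty, add_zero]
  abel
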